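/- Let $\epsilon\in\mathbb R$, $q_0>0$, $q_-\in\mathbb C$ with $|q_-|=q_0$, $N\ge 0$, and let $z_1,\dots,z_N$ be distinct complex numbers with $|z_n|>q_0$ and $\operatorname{Im} z_n<0$. Consider the ifoNLS equation in the form $$iq_t+2(|q|^2-q_0^2)q-i\epsilon q_{xxxxx}-10i\epsilon|q|^2q_{xxx}-20i\epsilon q_xq^*q_{xx}-30i\epsilon|q|^4q_x-10i\epsilon(|q_x|^2q)_x+q_{xx}-iq_x=0\qquad(*)$$ (so that $u=qe^{2iq_0^2t}$ solves the same equation with $2|u|^2u$ in place of $2(|q|^2-q_0^2)q$). A classical solution $q$ is of class $C^5$ on $\mathbb R^2$. The boundary conditions are: $q\to q_\pm$ as $x\to\pm\infty$ with $|q_\pm|=q_0$ and $\partial_x^jq\to0$ for $1\le j\le4$, locally uniformly in $t$, and $(1+x^2)|q(x,t)-q_\pm|$ is integrable near $x=\pm\infty$ for each $t$. Scattering data. Put $k=\frac12(z-q_0^2/z)$, $\lambda=\frac12(z+q_0^2/z)$, $\theta(x,t;z)=\lambda[x+(16k^4\epsilon-8k^2q_0^2\epsilon+2k+6q_0^4\epsilon+1)t]$,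 $\gamma=1+q_0^2/z^2$, $D^\pm=\{z:\pm(|z|^2-q_0^2)\operatorname{Im}z>0\}$, and $\Sigma_1=(\mathbb R\cup\{|z|=q_0\})\setminus\{0,\pm iq_0\}$. For each $t$ the Jost solutions $\phi_\pm=(\phi_{\pm,1},\phi_{\pm,2})$ are the solutions of $$\phi_x=\begin{pmatrix}-ik&q\\-q^*&ik\end{pmatrix}\phi,\qquad \phi_\pm e^{i\theta\sigma_3}\to E_\pm=\begin{pmatrix}1&-iq_\pm/z\\-iq_\pm^*/z&1\end{pmatrix}\quad (x\to\pm\infty),$$ column by column, with $\phi_{-,1},\phi_{+,2}$ taken for $z\in D^+\cup\Sigma_1$ and $\phi_{-,2},\phi_{+,1}$ for $z\in D^-\cup\Sigma_1$. The scattering coefficients are given by $\gamma s_{11}=\mathrm{Wr}(\phi_{+,1},\phi_{-,2})$, $\gamma s_{22}=\mathrm{Wr}(\phi_{-,1},\phi_{+,2})$, $\gamma s_{12}=\mathrm{Wr}(\phi_{+,2},\phi_{-,2})$, $\gamma s_{21}=\mathrm{Wr}(\phi_{-,1},\phi_{+,1})$. Put $\eta_n=z_n$, $\eta_{N+n}=-q_0^2/z_n^*$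 $(1\le n\le N)$ and $\hat\eta_n=-q_0^2/\eta_n$ $(1\le n\le 2N)$. We say that $q$ has at time $t$ the reflectionless data $(z_n;C_+)$ if $s_{12}=s_{21}=0$ on $\Sigma_1$, the zeros of $s_{11}$ in $D^-$ are exactly the $\eta_n$ and those of $s_{22}$ in $D^+$ exactly the $\hat\eta_n$, all of them simple, and for every $n\le 2N$ there is a constant $b_+(\hat\eta_n)$ with $\phi_{+,2}(x,t;\hat\eta_n)=b_+(\hat\eta_n)\phi_{-,1}(x,t;\hat\eta_n)$ for all $x$ and $C_+[\hat\eta_n]=b_+(\hat\eta_n)/s_{22}'(\hat\eta_n)$. For constants $C_+[\hat\eta_n]$ $(1\le n\le2N)$ let $$w_j=C_+[\hat\eta_j]e^{-2i\theta(x,t;\hat\eta_j)},\quad v_j=\frac{iq_-}{\eta_j},\quad G=\Bigl(\frac{w_j}{\eta_s-\hat\eta_j}+v_s\delta_{sj}\Bigr)_{s,j=1}^{2N},\quad \varpi=(w_j),\quad \varrho=(v_j),$$ $$q(x,t)=q_--i\,\frac{\det\begin{pmatrix}G&\varrho\\ \varpi^T&0\end{pmatrix}}{\det G}.\qquad(**)$$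 **Theorem 1.1.** (a) If a classical solution of $(*)$ satisfying the boundary conditions for some $q_+$ with $|q_+|=q_0$ has the reflectionless data $(z_n;C_+)$ at $t=0$, then $\det G\ne0$ and the solution is given by $(**)$ for all $x,t\in\mathbb R$. (b) Conversely, if all $C_+[\hat\eta_n]$ are nonzero and $C_+[-q_0^2/z_n]=-\dfrac{q_-^2}{z_n^2}\,\bigl(C_+[z_n^*]\bigr)^*$ for $1\le n\le N$, then $\det G\neq0$ everywhere, $(**)$ is a classical solution of $(*)$ (and $qe^{2iq_0^2t}$ solves the ifoNLS equation in its original form), it satisfies the boundary conditions for some $q_+$ with $|q_+|=q_0$, and it has the reflectionless data $(z_n;C_+)$ at every time $t$. -/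

import Mathlib

open Filter Topology MeasureTheory ComplexConjugate

noncomputable section

namespace IfoNLS

/-! ## The equation -/

/-- The `j`-th derivative of `q` in the space variable. -/
def dx (j : ℕ) (q : ℝ → ℝ → ℂ) (x t : ℝ) : ℂ := iteratedDeriv j (fun y => q y t) x

/-- `q` is a classical solution on `ℝ × ℝ` of
`i q_t + 2(|q|² - c) q - iε q_xxxxx - 10iε|q|² q_xxx - 20iε q_x q* q_xx - 30iε|q|⁴ q_x
  - 10iε(|q_x|² q)_x + q_xx - i q_x = 0`.
For `c = 0` this is the inhomogeneous fifth-order NLS equation; for `c = q₀²` it is the equation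
satisfied by `q` when `u = q e^{2i q₀² t}` solves the former. -/
def IsSolution (ε c : ℝ) (q : ℝ → ℝ → ℂ) : Prop :=
  ContDiff ℝ 5 (Function.uncurry q) ∧
  ∀ x t : ℝ,
    Complex.I * deriv (fun s => q x s) t
      + 2 * ((‖q x t‖ : ℂ) ^ 2 - c) * q x t
      - Complex.I * ε * dx 5 q x t
      - 10 * Complex.I * ε * (‖q x t‖ : ℂ) ^ 2 * dx 3 q x t
      - 20 * Complex.I * ε * dx 1 q x t * conj (q x t) * dx 2 q x t
      - 30 * Complex.I * ε * (‖q x t‖ : ℂ) ^ 4 * dx 1 q x t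
      - 10 * Complex.I * ε * deriv (fun y => (‖dx 1 q y t‖ : ℂ) ^ 2 * q y t) x
      + dx 2 q x t - Complex.I * dx 1 q x t = 0

/-- Nonzero boundary conditions: `q → q_±` as `x → ±∞`, the `x`-derivatives of order `1, …, 4`
tend to `0` (both locally uniformly in `t`), and at each time `q - q_±` is integrable with a
second moment near `±∞`. -/
structure BoundaryConditions (qm qp : ℂ) (q : ℝ → ℝ → ℂ) : Prop where
  lim_left : ∀ t₀ : ℝ, Tendsto (fun w : ℝ × ℝ => q w.1 w.2) (atBot ×ˢ 𝓝 t₀) (𝓝 qm)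
  lim_right : ∀ t₀ : ℝ, Tendsto (fun w : ℝ × ℝ => q w.1 w.2) (atTop ×ˢ 𝓝 t₀) (𝓝 qp)
  deriv_left : ∀ j ∈ Finset.Icc 1 4, ∀ t₀ : ℝ,
    Tendsto (fun w : ℝ × ℝ => dx j q w.1 w.2) (atBot ×ˢ 𝓝 t₀) (𝓝 0)
  deriv_right : ∀ j ∈ Finset.Icc 1 4, ∀ t₀ : ℝ,
    Tendsto (fun w : ℝ × ℝ => dx j q w.1 w.2) (atTop ×ˢ 𝓝 t₀) (𝓝 0)
  moment_left : ∀ t : ℝ,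
    IntegrableOn (fun x : ℝ => (1 + x ^ 2) * ‖q x t - qm‖) (Set.Iic 0)
  moment_right : ∀ t : ℝ,
    IntegrableOn (fun x : ℝ => (1 + x ^ 2) * ‖q x t - qp‖) (Set.Ici 0)

/-! ## The uniformizing variable -/

def kOf (q₀ : ℝ) (z : ℂ) : ℂ := (z - (q₀ : ℂ) ^ 2 / z) / 2

def lamOf (q₀ : ℝ) (z : ℂ) : ℂ := (z + (q₀ : ℂ) ^ 2 / z) / 2

/-- The phase `θ(x,t;z) = λ [x + (16 k⁴ ε - 8 k² q₀² ε + 2k + 6 q₀⁴ ε + 1) t]`. -/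
def theta (ε q₀ : ℝ) (x t : ℝ) (z : ℂ) : ℂ :=
  lamOf q₀ z * (x + (16 * kOf q₀ z ^ 4 * ε - 8 * kOf q₀ z ^ 2 * (q₀ : ℂ) ^ 2 * ε
    + 2 * kOf q₀ z + 6 * (q₀ : ℂ) ^ 4 * ε + 1) * t)

/-- `D⁺`, where `Im λ > 0`. -/
def Dplus (q₀ : ℝ) : Set ℂ := {z | 0 < (‖z‖ ^ 2 - q₀ ^ 2) * z.im}

/-- `D⁻`, where `Im λ < 0`. -/
def Dminus (q₀ : ℝ) : Set ℂ := {z | (‖z‖ ^ 2 - q₀ ^ 2) * z.im < 0}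

/-- The continuous spectrum `ℝ ∪ {|z| = q₀}`, without the point `0` (which corresponds to
`k = ∞`) and the branch points `± i q₀`. -/
def Sigma₁ (q₀ : ℝ) : Set ℂ :=
  {z | (z.im = 0 ∨ ‖z‖ = q₀) ∧ z ≠ 0 ∧ z ≠ Complex.I * q₀ ∧ z ≠ -(Complex.I * q₀)}

/-! ## Jost solutions and scattering coefficients -/

/-- The matrix `-ik σ₃ + U₀` of the scattering problem `φ_x = (-ik σ₃ + U₀) φ`, `a` being the value
of the potential. -/
def laxU (k a : ℂ) : Matrix (Fin 2) (Fin 2) ℂ :=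
  !![-(Complex.I * k), a; -conj a, Complex.I * k]

/-- The matrix `E_±(z)`, `a` being the boundary value `q_±`. -/
def E (a z : ℂ) : Matrix (Fin 2) (Fin 2) ℂ :=
  !![1, -(Complex.I * a / z); -(Complex.I * conj a / z), 1]

/-- The determinant `γ(z) = 1 + q₀² / z²` of `E_±(z)`. -/
def gam (q₀ : ℝ) (z : ℂ) : ℂ := 1 + (q₀ : ℂ) ^ 2 / z ^ 2

/-- `φ` is the `j`-th column (`j = 0, 1`) at time `t` of the Jost solution normalized along `l`
(`atBot` or `atTop`) by the boundary value `a`: it solves the scattering problem, and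
`φ e^{iθ}` for `j = 0`, `φ e^{-iθ}` for `j = 1`, tends along `l` to the `j`-th column of `E`. -/
def IsJost (ε q₀ : ℝ) (q : ℝ → ℝ → ℂ) (a : ℂ) (l : Filter ℝ) (j : Fin 2) (t : ℝ) (z : ℂ)
    (φ : ℝ → Fin 2 → ℂ) : Prop :=
  (∀ x : ℝ, HasDerivAt φ ((laxU (kOf q₀ z) (q x t)).mulVec (φ x)) x) ∧
  Tendsto (fun x : ℝ =>
      Complex.exp ((![1, -1] : Fin 2 → ℂ) j * (Complex.I * theta ε q₀ x t z)) • φ x)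
    l (𝓝 fun i => E a z i j)

open Classical in
/-- The column singled out by `IsJost`. It is used only for those `z` for which it is unique:
`z ∈ D⁺ ∪ Σ₁` for `φ_{-,1}` and `φ_{+,2}`, and `z ∈ D⁻ ∪ Σ₁` for `φ_{-,2}` and `φ_{+,1}`. -/
def jost (ε q₀ : ℝ) (q : ℝ → ℝ → ℂ) (a : ℂ) (l : Filter ℝ) (j : Fin 2) (t : ℝ) (z : ℂ) :
    ℝ → Fin 2 → ℂ :=
  if h : ∃ φ, IsJost ε q₀ q a l j t z φ then h.choose else 0

/-- The column `φ_{-,j}`, normalized at `x → -∞`. -/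
def jostM (ε q₀ : ℝ) (qm : ℂ) (q : ℝ → ℝ → ℂ) (j : Fin 2) (t : ℝ) (z : ℂ) : ℝ → Fin 2 → ℂ :=
  jost ε q₀ q qm atBot j t z

/-- The column `φ_{+,j}`, normalized at `x → +∞`. -/
def jostP (ε q₀ : ℝ) (qp : ℂ) (q : ℝ → ℝ → ℂ) (j : Fin 2) (t : ℝ) (z : ℂ) : ℝ → Fin 2 → ℂ :=
  jost ε q₀ q qp atTop j t z

/-- The Wronskian. For two solutions of the scattering problem it does not depend on `x`; below it
is evaluated at `x = 0`. -/
def wr (u v : Fin 2 → ℂ) : ℂ := u 0 * v 1 - u 1 * v 0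

/-! The entries of the scattering matrix `S(z)`, `φ_+ = φ_- S`, at time `t`. -/

/-- `s₁₁ γ = Wr(φ_{+,1}, φ_{-,2})`, on `D⁻ ∪ Σ₁`. -/
def s11 (ε q₀ : ℝ) (qm qp : ℂ) (q : ℝ → ℝ → ℂ) (t : ℝ) (z : ℂ) : ℂ :=
  wr (jostP ε q₀ qp q 0 t z 0) (jostM ε q₀ qm q 1 t z 0) / gam q₀ z

/-- `s₂₂ γ = Wr(φ_{-,1}, φ_{+,2})`, on `D⁺ ∪ Σ₁`. -/
def s22 (ε q₀ : ℝ) (qm qp : ℂ) (q : ℝ → ℝ → ℂ) (t : ℝ) (z : ℂ) : ℂ :=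
  wr (jostM ε q₀ qm q 0 t z 0) (jostP ε q₀ qp q 1 t z 0) / gam q₀ z

/-- `s₁₂ γ = Wr(φ_{+,2}, φ_{-,2})`, on `Σ₁`. -/
def s12 (ε q₀ : ℝ) (qm qp : ℂ) (q : ℝ → ℝ → ℂ) (t : ℝ) (z : ℂ) : ℂ :=
  wr (jostP ε q₀ qp q 1 t z 0) (jostM ε q₀ qm q 1 t z 0) / gam q₀ z

/-- `s₂₁ γ = Wr(φ_{-,1}, φ_{+,1})`, on `Σ₁`. -/
def s21 (ε q₀ : ℝ) (qm qp : ℂ) (q : ℝ → ℝ → ℂ) (t : ℝ) (z : ℂ) : ℂ :=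
  wr (jostM ε q₀ qm q 0 t z 0) (jostP ε q₀ qp q 0 t z 0) / gam q₀ z

/-! ## The discrete spectrum -/

/-- The eigenvalues `η_n`, `n = 1, …, 2N`, in `D⁻`: the `z_n`, followed by the `-q₀² / z_n*`. -/
def eta (q₀ : ℝ) {N : ℕ} (z : Fin N → ℂ) : Fin N ⊕ Fin N → ℂ :=
  Sum.elim z (fun n => -(q₀ : ℂ) ^ 2 / conj (z n))

/-- The eigenvalues `η̂_n = -q₀² / η_n` in `D⁺`. -/
def etaHat (q₀ : ℝ) {N : ℕ} (z : Fin N → ℂ) (n : Fin N ⊕ Fin N) : ℂ :=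
  -(q₀ : ℂ) ^ 2 / eta q₀ z n

/-- At time `t` the potential `q` is reflectionless, the zeros of `s₁₁` in `D⁻` and of `s₂₂` in `D⁺`
are exactly the `η_n` and the `η̂_n` and are simple, and the norming constants
`C_+[η̂_n] = b_+(η̂_n) / s₂₂'(η̂_n)`, where `φ_{+,2}(η̂_n) = b_+(η̂_n) φ_{-,1}(η̂_n)`,
are the `C n`. -/
structure ReflectionlessSimple (ε q₀ : ℝ) (qm qp : ℂ) {N : ℕ} (z : Fin N → ℂ)
    (C : Fin N ⊕ Fin N → ℂ) (q : ℝ → ℝ → ℂ) (t : ℝ) : Prop where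
  s12_eq_zero : ∀ ζ ∈ Sigma₁ q₀, s12 ε q₀ qm qp q t ζ = 0
  s21_eq_zero : ∀ ζ ∈ Sigma₁ q₀, s21 ε q₀ qm qp q t ζ = 0
  s11_zeros : ∀ ζ ∈ Dminus q₀, s11 ε q₀ qm qp q t ζ = 0 ↔ ∃ n, ζ = eta q₀ z n
  s22_zeros : ∀ ζ ∈ Dplus q₀, s22 ε q₀ qm qp q t ζ = 0 ↔ ∃ n, ζ = etaHat q₀ z n
  s11_simple : ∀ n, deriv (s11 ε q₀ qm qp q t) (eta q₀ z n) ≠ 0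
  s22_simple : ∀ n, deriv (s22 ε q₀ qm qp q t) (etaHat q₀ z n) ≠ 0
  norming : ∀ n, ∃ b : ℂ,
    (∀ x : ℝ, jostP ε q₀ qp q 1 t (etaHat q₀ z n) x
        = b • jostM ε q₀ qm q 0 t (etaHat q₀ z n) x) ∧
      C n = b / deriv (s22 ε q₀ qm qp q t) (etaHat q₀ z n)

/-- The symmetry `C_+[-q₀² / z_n] = -(q_-² / z_n²) C_+[z_n*]*` of the norming constants. -/
def NormingSymmetry (qm : ℂ) {N : ℕ} (z : Fin N → ℂ) (C : Fin N ⊕ Fin N → ℂ) : Prop :=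
  ∀ n : Fin N, C (Sum.inl n) = -(qm ^ 2 / z n ^ 2) * conj (C (Sum.inr n))

/-! ## The determinantal formula -/

/-- `w_j = C_+[η̂_j] e^{-2iθ(η̂_j)}`. -/
def wVec (ε q₀ : ℝ) {N : ℕ} (z : Fin N → ℂ) (C : Fin N ⊕ Fin N → ℂ) (x t : ℝ)
    (j : Fin N ⊕ Fin N) : ℂ :=
  C j * Complex.exp (-2 * Complex.I * theta ε q₀ x t (etaHat q₀ z j))

/-- `v_j = i q_- / η_j`. -/
def vVec (q₀ : ℝ) (qm : ℂ) {N : ℕ} (z : Fin N → ℂ) (j : Fin N ⊕ Fin N) : ℂ :=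
  Complex.I * qm / eta q₀ z j

/-- `g_{sj} = w_j / (η_s - η̂_j) + v_s δ_{sj}`. -/
def gMat (ε q₀ : ℝ) (qm : ℂ) {N : ℕ} (z : Fin N → ℂ) (C : Fin N ⊕ Fin N → ℂ) (x t : ℝ) :
    Matrix (Fin N ⊕ Fin N) (Fin N ⊕ Fin N) ℂ :=
  Matrix.of fun s j =>
    wVec ε q₀ z C x t j / (eta q₀ z s - etaHat q₀ z j) + if s = j then vVec q₀ qm z s else 0

/-- The bordered matrix with blocks `G`, `v`, `wᵀ`, `0`. -/
def gBordered (ε q₀ : ℝ) (qm : ℂ) {N : ℕ} (z : Fin N → ℂ) (C : Fin N ⊕ Fin N → ℂ) (x t : ℝ) :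
    Matrix ((Fin N ⊕ Fin N) ⊕ Unit) ((Fin N ⊕ Fin N) ⊕ Unit) ℂ :=
  Matrix.fromBlocks (gMat ε q₀ qm z C x t) (Matrix.replicateCol Unit (vVec q₀ qm z))
    (Matrix.replicateRow Unit (wVec ε q₀ z C x t)) 0

/-- `q_- - i det [[G, v], [wᵀ, 0]] / det G`. -/
def soliton (ε q₀ : ℝ) (qm : ℂ) {N : ℕ} (z : Fin N → ℂ) (C : Fin N ⊕ Fin N → ℂ) (x t : ℝ) : ℂ :=
  qm - Complex.I * ((gBordered ε q₀ qm z C x t).det / (gMat ε q₀ qm z C x t).det)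

end IfoNLS

end

/-!
The equation is the compatibility condition of the spatial scattering problem with a second linear
equation `φ_t = V φ`, `V` polynomial in `k`. Both parts identify the columns `φ_{-,2} e^{-iθ}` in
`D⁻` and `φ_{+,2} e^{-iθ} / s₂₂` in `D⁺` with a single rational function of `z` having simple poles
at the points `η̂_j`. Its values at the points `η_s` solve the linear system with the matrix `G`,
and its expansion at `z = ∞` contains the potential; by Cramer's rule this is the quotient of
determinants (`potential_eq_det`).

*The formula gives a solution.* A vector in the kernel of `G` defines a rational function which,
together with its reflection under `z ↦ -q₀² / z*`, yields an expression `f f* + g g*` without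
poles; so it vanishes, on the real line `f` is zero, and the vector is zero. Hence `det G ≠ 0`
(`det_cmat_ne_zero`). Differentiating the linear system, with `∂ w_j` a multiple of `w_j`, and
using the duality between `G` and its transpose (`sum_dual`), one finds that `x`- and
`t`-derivatives of the potential are combinations of the moments `∑ λ k^i w X₁²` of the squared
eigenfunctions. These moments satisfy the recursion that defines the differential polynomials of
the hierarchy and vanish at `-∞`, so that they are these polynomials (`eq_pol_of_recursion`); the
formula for the `t`-derivative is then the equation (`equation_eq_flow`, `isSolution_sol`). The
limit at `+∞` is that of the linear system as all `w_j → ∞` (`qPlus`). The Jost solutions are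
rational functions times exponentials, and the scattering data are read off from them
(`reflectionlessSimple_sol`).

*A solution with these data is given by the formula.* The factor `(1 + x²)` in the boundary
conditions makes the Volterra equation of the Jost solutions, in a weighted space of bounded
functions, differentiable in `z` up to the boundary `Im λ = 0` of the domain, branch points
`± i q₀` included (`DecaysLeft.exists_differentiableOn`). The zero-curvature representation gives
matrices of determinant one which carry the Jost solutions at one time to those at another
(`exists_transport`). Since the phase `θ` in the normalization contains `t`, the data, norming
constants included, are the same at all times (`ReflectionlessSimple.at_time`). It remains to
recover a potential from its data at one fixed time. As `s₁₂ = s₂₁ = 0`, the two columns above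
agree on `Σ₁`. The glued function is differentiable across `Σ₁` because it is so within the closed
region on either side, and the two derivatives agree, being determined by the difference quotients
along `Σ₁` (`differentiableAt_of_differentiableWithinAt`). At `± i q₀` nothing singular happens,
for `γ s₂₂` vanishes there at most to first order (`isBigO_of_branch`). An energy estimate bounds
the Jost solutions uniformly in `z`, and after a change of variables absorbing the oscillating
terms it gives their limits as `z → ∞` (`exists_normalized_near`). By Liouville's theorem the
column is rational (`rhCol_eq`), whence the linear system for its values (`cmat_mulVec_boundVec`)
and the potential (`eq_add_sum_boundVec`). The symmetry of the Jost solutions under `z ↦ -q₀² / z*`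
imposes on the norming constants the symmetry of the first half of the argument (`norming_eq`), so
`det G ≠ 0` and the potential is the one given by the formula (`eq_soliton`).
-/

open Filter Topology MeasureTheory ComplexConjugate

noncomputable section

namespace IfoNLS


/-! ### Partial fractions with simple poles -/

section PartialFractions

open Polynomial

variable {ι : Type*} [Fintype ι]

/-- A rational function `c + ∑ a_j / (z - p_j)` with as many zeros `r_s` as poles is
`c ∏ (z - r_j) / (z - p_j)`. -/
theorem const_add_sum_div_eq_prod [DecidableEq ι] {p r : ι → ℂ} (hr : Function.Injective r)
    (hpr : ∀ s j, r s ≠ p j) (c : ℂ) (a : ι → ℂ) (h : ∀ s, c + ∑ j, a j / (r s - p j) = 0)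
    {z : ℂ} (hz : ∀ j, z ≠ p j) :
    c + ∑ j, a j / (z - p j) = c * ∏ j, ((z - r j) / (z - p j)) := by
  have key : ∀ y : ℂ, (∀ j, y ≠ p j) →
      (c + ∑ j, a j / (y - p j)) * ∏ j, (y - p j) =
        c * ∏ j, (y - p j) + ∑ j, a j * ∏ i ∈ Finset.univ.erase j, (y - p i) := by
    intro y hy
    rw [add_mul, Finset.sum_mul]
    congr 1
    refine Finset.sum_congr rfl fun j _ => ?_
    rw [← Finset.mul_prod_erase Finset.univ (fun i => y - p i) (Finset.mem_univ j)]
    have := sub_ne_zero.2 (hy j)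
    field_simp
  set P : ℂ[X] := C c * (∏ j, (X - C (p j)) - ∏ j, (X - C (r j)))
    + ∑ j, C (a j) * ∏ i ∈ Finset.univ.erase j, (X - C (p i)) with hP
  have hdeg : P.degree < (Finset.univ : Finset ι).card := by
    refine lt_of_le_of_lt (degree_add_le _ _) (max_lt ?_ ?_)
    · rcases eq_or_ne c 0 with rfl | hc
      · simp
      rw [degree_C_mul hc]
      have h1 : (∏ j, (X - C (p j))).Monic := monic_prod_of_monic _ _ fun j _ => monic_X_sub_C _
      have h2 : (∏ j, (X - C (r j))).Monic := monic_prod_of_monic _ _ fun j _ => monic_X_sub_C _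
      have d1 : (∏ j, (X - C (p j))).degree = ((Finset.univ : Finset ι).card : WithBot ℕ) := by
        simp [degree_prod]
      have d2 : (∏ j, (X - C (r j))).degree = ((Finset.univ : Finset ι).card : WithBot ℕ) := by
        simp [degree_prod]
      rw [← d1]
      exact degree_sub_lt_left (d1.trans d2.symm) h1.ne_zero (h1.leadingCoeff.trans h2.leadingCoeff.symm)
    · refine lt_of_le_of_lt (degree_sum_le _ _) ?_
      rw [Finset.sup_lt_iff (by exact WithBot.bot_lt_coe _)]
      intro j _
      refine lt_of_le_of_lt (degree_mul_le _ _) ?_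
      refine lt_of_le_of_lt (add_le_add_left degree_C_le _) ?_
      rw [zero_add, degree_prod]
      simp only [degree_X_sub_C, Finset.sum_const, nsmul_eq_mul, mul_one]
      exact_mod_cast Finset.card_erase_lt_of_mem (Finset.mem_univ j)
  have hzero : P = 0 := by
    refine eq_zero_of_degree_lt_of_eval_index_eq_zero (v := r) (s := Finset.univ) hr.injOn hdeg ?_
    intro s _
    have h0 := key (r s) (hpr s)
    rw [h s, zero_mul] at h0
    simp only [hP, eval_add, eval_mul, eval_C, eval_sub, eval_prod, eval_X, eval_finsetSum]
    rw [Finset.prod_eq_zero (f := fun j => r s - r j) (Finset.mem_univ s) (sub_self (r s)), sub_zero]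
    exact h0.symm
  have hev : P.eval z = 0 := by rw [hzero, eval_zero]
  have hne : ∏ j, (z - p j) ≠ 0 := Finset.prod_ne_zero_iff.2 fun j _ => sub_ne_zero.2 (hz j)
  refine mul_right_cancel₀ hne ?_
  rw [key z hz, Finset.prod_div_distrib]
  simp only [hP, eval_add, eval_mul, eval_C, eval_sub, eval_prod, eval_X, eval_finsetSum] at hev
  field_simp
  linear_combination hev

/-- The Cauchy matrix `1 / (r_s - p_j)` is nonsingular. -/
theorem eq_zero_of_cauchy [DecidableEq ι] {p r : ι → ℂ} (hp : Function.Injective p) (hr : Function.Injective r)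
    (hpr : ∀ s j, r s ≠ p j) (a : ι → ℂ) (h : ∀ s, ∑ j, a j / (r s - p j) = 0) : a = 0 := by
  have h0 : ∀ z, (∀ j, z ≠ p j) → ∑ j, a j / (z - p j) = 0 := fun z hz => by
    simpa using const_add_sum_div_eq_prod hr hpr 0 a (by simpa using h) hz
  funext j
  -- the residue of the vanishing sum at `p j`
  have hl : Tendsto (fun z => ∑ i, a i * ((z - p j) / (z - p i))) (𝓝[≠] p j)
      (𝓝 (∑ i, a i * if i = j then 1 else 0)) := by
    refine tendsto_finsetSum _ fun i _ => Tendsto.const_mul _ ?_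
    by_cases hij : i = j
    · subst hij
      rw [if_pos rfl]
      refine tendsto_const_nhds.congr' ?_
      filter_upwards [self_mem_nhdsWithin] with z hz
      rw [div_self (sub_ne_zero.2 hz)]
    · rw [if_neg hij]
      have : ContinuousAt (fun z => (z - p j) / (z - p i)) (p j) := by
        refine ContinuousAt.div (by fun_prop) (by fun_prop) ?_
        exact sub_ne_zero.2 fun h => hij (hp h.symm)
      have h2 := this.tendsto.mono_left (nhdsWithin_le_nhds (s := {p j}ᶜ))
      simpa using h2
  have hev : ∀ᶠ z in 𝓝[≠] p j, ∀ i, z ≠ p i := by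
    rw [Filter.eventually_all]
    intro i
    by_cases hij : i = j
    · subst hij; exact self_mem_nhdsWithin
    · exact nhdsWithin_le_nhds (isOpen_ne.mem_nhds fun h => hij (hp h.symm))
  have hl0 : Tendsto (fun z => ∑ i, a i * ((z - p j) / (z - p i))) (𝓝[≠] p j) (𝓝 0) := by
    refine tendsto_const_nhds.congr' ?_
    filter_upwards [hev] with z hz
    have := h0 z hz
    calc (0 : ℂ) = (z - p j) * ∑ i, a i / (z - p i) := by rw [this, mul_zero]
      _ = _ := by
        rw [Finset.mul_sum]
        exact Finset.sum_congr rfl fun i _ => by ring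
  simpa using tendsto_nhds_unique hl hl0

/-- The partial fraction expansion of a product of two sums of simple poles. -/
theorem sum_div_mul_sum_div (p r a b : ι → ℂ) (hpr : ∀ j m, p j ≠ r m) {z : ℂ}
    (hp : ∀ j, z ≠ p j) (hr : ∀ j, z ≠ r j) :
    (∑ j, a j / (z - p j)) * ∑ m, b m / (z - r m) =
      ∑ j, (a j * ∑ m, b m / (p j - r m)) / (z - p j)
        + ∑ m, (b m * ∑ j, a j / (r m - p j)) / (z - r m) := by
  rw [Finset.sum_mul_sum]
  simp only [Finset.mul_sum, Finset.sum_div]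
  rw [Finset.sum_comm (s := Finset.univ) (t := Finset.univ)
    (f := fun m j => b m * (a j / (r m - p j)) / (z - r m)), ← Finset.sum_add_distrib]
  refine Finset.sum_congr rfl fun j _ => ?_
  rw [← Finset.sum_add_distrib]
  refine Finset.sum_congr rfl fun m _ => ?_
  have h1 := sub_ne_zero.2 (hp j)
  have h2 := sub_ne_zero.2 (hr m)
  have h3 := sub_ne_zero.2 (hpr j m)
  have h4 := sub_ne_zero.2 (hpr j m).symm
  field_simp
  ring

end PartialFractions

/-! ### The linear system behind the determinantal formula -/

section LinearSystem

variable {ι : Type*}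

/-- A finite discrete spectrum: distinct points `η j` of `D⁻`, closed under `z ↦ -q₀² / z*`, which
acts on the indices by `τ`. -/
structure IsSpectrum (q₀ : ℝ) (qm : ℂ) (η : ι → ℂ) (τ : ι → ι) : Prop where
  pos : 0 < q₀
  norm_qm : ‖qm‖ = q₀
  inj : Function.Injective η
  mem : ∀ j, η j ∈ Dminus q₀
  conj_mul : ∀ j, conj (η j) * η (τ j) = -(q₀ : ℂ) ^ 2

/-- The point `-q₀² / η j` of `D⁺`. -/
def hat (q₀ : ℝ) (η : ι → ℂ) (j : ι) : ℂ := -(q₀ : ℂ) ^ 2 / η j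

namespace IsSpectrum

variable {q₀ : ℝ} {qm : ℂ} {η : ι → ℂ} {τ : ι → ι}

theorem q₀_ne (h : IsSpectrum q₀ qm η τ) : (q₀ : ℂ) ≠ 0 := by
  exact_mod_cast h.pos.ne'

theorem qm_ne (h : IsSpectrum q₀ qm η τ) : qm ≠ 0 := by
  rw [← norm_pos_iff, h.norm_qm]; exact h.pos

theorem qm_mul_conj (h : IsSpectrum q₀ qm η τ) : qm * conj qm = (q₀ : ℂ) ^ 2 := by
  rw [Complex.mul_conj']; simp [h.norm_qm]

theorem eta_ne (h : IsSpectrum q₀ qm η τ) (j : ι) : η j ≠ 0 := fun h0 => by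
  have := h.mem j
  simp [Dminus, h0] at this

theorem tau_tau (h : IsSpectrum q₀ qm η τ) (j : ι) : τ (τ j) = j := by
  apply h.inj
  have h1 := h.conj_mul j
  have h2 := congrArg conj (h.conj_mul (τ j))
  simp only [map_mul, Complex.conj_conj, map_neg, map_pow, Complex.conj_ofReal] at h2
  have h3 := congrArg conj h1
  simp only [map_mul, Complex.conj_conj, map_neg, map_pow, Complex.conj_ofReal] at h3
  have h4 : conj (η (τ j)) ≠ 0 := by simpa using h.eta_ne (τ j)
  have h5 := congrArg conj h2
  simp only [map_mul, Complex.conj_conj, map_neg, map_pow, Complex.conj_ofReal] at h5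
  refine mul_left_cancel₀ h4 ?_
  rw [h5, ← h3, mul_comm]

theorem tau_bijective (h : IsSpectrum q₀ qm η τ) : Function.Bijective τ :=
  Function.Involutive.bijective h.tau_tau

theorem hat_ne (h : IsSpectrum q₀ qm η τ) (j : ι) : hat q₀ η j ≠ 0 :=
  div_ne_zero (neg_ne_zero.2 (pow_ne_zero 2 h.q₀_ne)) (h.eta_ne j)

theorem hat_mul_eta (h : IsSpectrum q₀ qm η τ) (j : ι) : hat q₀ η j * η j = -(q₀ : ℂ) ^ 2 :=
  div_mul_cancel₀ _ (h.eta_ne j)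

theorem conj_eta (h : IsSpectrum q₀ qm η τ) (j : ι) : conj (η j) = hat q₀ η (τ j) :=
  eq_div_of_mul_eq (h.eta_ne _) (h.conj_mul j)

theorem conj_hat (h : IsSpectrum q₀ qm η τ) (j : ι) : conj (hat q₀ η j) = η (τ j) := by
  have := h.conj_eta (τ j)
  rw [h.tau_tau] at this
  rw [← this, Complex.conj_conj]

theorem hat_inj (h : IsSpectrum q₀ qm η τ) : Function.Injective (hat q₀ η) := by
  intro i j hij
  apply h.inj
  have h1 := h.hat_mul_eta i
  rw [hij, ← h.hat_mul_eta j] at h1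
  exact mul_left_cancel₀ (h.hat_ne j) h1

theorem hat_mem (h : IsSpectrum q₀ qm η τ) (j : ι) : hat q₀ η j ∈ Dplus q₀ := by
  have := h.mem (τ j)
  rw [← h.conj_hat] at this
  simp only [Dminus, Set.mem_ofPred_eq, RCLike.norm_conj, Complex.conj_im] at this
  simp only [Dplus, Set.mem_ofPred_eq]
  linarith

theorem eta_ne_hat (h : IsSpectrum q₀ qm η τ) (i j : ι) : η i ≠ hat q₀ η j := fun hij => by
  have h1 := h.mem i
  have h2 := h.hat_mem j
  rw [← hij] at h2
  simp only [Dplus, Dminus, Set.mem_ofPred_eq] at h1 h2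
  linarith

theorem conj_v (h : IsSpectrum q₀ qm η τ) (j : ι) :
    conj (Complex.I * qm / η (τ j)) = Complex.I * η j / qm := by
  rw [map_div₀, map_mul, Complex.conj_I, h.conj_eta, h.tau_tau,
    div_eq_div_iff (h.hat_ne j) h.qm_ne]
  linear_combination -Complex.I * h.qm_mul_conj - Complex.I * h.hat_mul_eta j

end IsSpectrum

/-- The matrix `G`, as a function of the vector `w`. -/
def cmat [DecidableEq ι] (q₀ : ℝ) (qm : ℂ) (η w : ι → ℂ) : Matrix ι ι ℂ :=
  Matrix.of fun s j => w j / (η s - hat q₀ η j) + if s = j then Complex.I * qm / η s else 0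

/-- Norming constants which are nonzero and compatible with the symmetries of the spectrum. -/
structure Admissible (qm : ℂ) (η : ι → ℂ) (τ : ι → ι) (w : ι → ℂ) : Prop where
  ne_zero : ∀ j, w j ≠ 0
  conj_eq : ∀ j, conj (w j) = -(η (τ j) ^ 2 / qm ^ 2) * w (τ j)

theorem IsSpectrum.conj_w {q₀ : ℝ} {qm : ℂ} {η : ι → ℂ} {τ : ι → ι} (h : IsSpectrum q₀ qm η τ) {w : ι → ℂ} (hw : Admissible qm η τ w) (j : ι) :
    conj (w (τ j)) = -(η j ^ 2 / qm ^ 2) * w j := by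
  rw [hw.conj_eq, h.tau_tau]

variable [Fintype ι] [DecidableEq ι]

/-- The first components of the values at `η̂` of the first column of the solution of the
Riemann-Hilbert problem. -/
def sol₁ (q₀ : ℝ) (qm : ℂ) (η w : ι → ℂ) : ι → ℂ :=
  (cmat q₀ qm η w)⁻¹.mulVec fun j => Complex.I * qm / η j

/-- The second components of these values. -/
def sol₂ (q₀ : ℝ) (qm : ℂ) (η w : ι → ℂ) : ι → ℂ :=
  (cmat q₀ qm η w)⁻¹.mulVec fun _ => -1

/-- The potential belonging to the vector `w`. -/
def potential (q₀ : ℝ) (qm : ℂ) (η w : ι → ℂ) : ℂ :=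
  qm + Complex.I * ∑ j, w j * sol₁ q₀ qm η w j

theorem cmat_mulVec (q₀ : ℝ) (qm : ℂ) (η w Y : ι → ℂ) (s : ι) :
    (cmat q₀ qm η w).mulVec Y s =
      ∑ j, w j * Y j / (η s - hat q₀ η j) + Complex.I * qm / η s * Y s := by
  simp only [cmat, Matrix.mulVec, dotProduct, Matrix.of_apply, add_mul, Finset.sum_add_distrib,
    ite_mul, zero_mul, Finset.sum_ite_eq, Finset.mem_univ, if_true]
  congr 1
  exact Finset.sum_congr rfl fun j _ => by ring

namespace IsSpectrum

variable {q₀ : ℝ} {qm : ℂ} {η : ι → ℂ} {τ : ι → ι}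

/-- For `G Y = 0` the function `f = ∑ w_j Y_j / (z - η̂_j)` and its reflection `g` are such that
`f f* + g g*` has no poles, hence vanishes on the real line, and `f = 0`. -/
theorem eq_zero_of_mulVec_eq_zero (h : IsSpectrum q₀ qm η τ) {w : ι → ℂ}
    (hw : Admissible qm η τ w) {Y : ι → ℂ} (hY : (cmat q₀ qm η w).mulVec Y = 0) : Y = 0 := by
  have hq := h.qm_ne
  have hqq := h.qm_mul_conj
  set a : ι → ℂ := fun j => w j * Y j with ha
  set b : ι → ℂ := fun j => Complex.I * conj qm * a j / hat q₀ η j with hb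
  have hf : ∀ s, ∑ j, a j / (η s - hat q₀ η j) = -(Complex.I * qm / η s * Y s) := fun s => by
    have := congrFun hY s
    rw [cmat_mulVec] at this
    exact eq_neg_of_add_eq_zero_left this
  have hg : ∀ s, ∑ j, b j / (hat q₀ η s - η j) = Y s := fun s => by
    have e : ∑ j, b j / (hat q₀ η s - η j)
        = Complex.I * η s / qm * ∑ j, a j / (η s - hat q₀ η j) := by
      rw [Finset.mul_sum]
      refine Finset.sum_congr rfl fun j _ => ?_
      have h1 := sub_ne_zero.2 (h.eta_ne_hat s j)
      have h2 := sub_ne_zero.2 (h.eta_ne_hat j s).symm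
      have h3 := h.hat_ne j
      have h4 := h.hat_mul_eta j
      have h5 := h.hat_mul_eta s
      simp only [hb]
      rw [div_div, div_mul_div_comm, div_eq_div_iff (mul_ne_zero h3 h2) (mul_ne_zero hq h1)]
      linear_combination (Complex.I * a j * (η s - hat q₀ η j)) * hqq
        + (-Complex.I * a j * hat q₀ η j) * h5 + Complex.I * a j * η s * h4
    rw [e, hf]
    have := h.eta_ne s
    field_simp
    rw [Complex.I_sq]; ring
  -- the values of the conjugate functions
  have hf' : ∀ s, ∑ j, conj (a (τ j)) / (hat q₀ η s - η j)
      = -(conj (Complex.I * qm / η (τ s) * Y (τ s))) := fun s => by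
    rw [← map_neg, ← hf, map_sum, ← h.tau_bijective.sum_comp]
    refine Finset.sum_congr rfl fun j _ => ?_
    rw [map_div₀, map_sub, h.conj_hat, h.conj_eta, h.tau_tau, h.tau_tau]
  have hg' : ∀ s, ∑ j, conj (b (τ j)) / (η s - hat q₀ η j) = conj (Y (τ s)) := fun s => by
    rw [← hg, map_sum, ← h.tau_bijective.sum_comp]
    refine Finset.sum_congr rfl fun j _ => ?_
    rw [h.tau_tau, map_div₀ _ (b j), map_sub, h.conj_hat, h.conj_eta, h.tau_tau]
  have hwc : ∀ j, conj (w (τ j)) = -(η j ^ 2 / qm ^ 2) * w j := fun j => by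
    rw [hw.conj_eq, h.tau_tau]
  have hvc : ∀ j, conj (Complex.I * qm / η (τ j)) = Complex.I * η j / qm := fun j => by
    rw [map_div₀, map_mul, Complex.conj_I, h.conj_eta, h.tau_tau]
    have := h.hat_ne j
    have h4 := h.hat_mul_eta j
    rw [div_eq_div_iff this hq]
    linear_combination -Complex.I * hqq - Complex.I * h4
  have hbc : ∀ j, conj (b (τ j)) = Complex.I * η j / qm * w j * conj (Y (τ j)) := fun j => by
    simp only [hb, ha]
    rw [map_div₀, h.conj_hat, h.tau_tau]
    simp only [map_mul, Complex.conj_I, Complex.conj_conj, hwc]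
    have := h.eta_ne j
    field_simp
  -- on the real line `f f* + g g* = 0`
  have hreal : ∀ x : ℝ, ∑ j, a j / ((x : ℂ) - hat q₀ η j) = 0 := by
    intro x
    have hx1 : ∀ j, (x : ℂ) ≠ hat q₀ η j := fun j hj => by
      have := h.hat_mem j
      rw [← hj] at this
      simp [Dplus] at this
    have hx2 : ∀ j, (x : ℂ) ≠ η j := fun j hj => by
      have := h.mem j
      rw [← hj] at this
      simp [Dminus] at this
    set f := ∑ j, a j / ((x : ℂ) - hat q₀ η j) with hfdef
    set g := ∑ j, b j / ((x : ℂ) - η j) with hgdef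
    have c1 : ∑ j, conj (a (τ j)) / ((x : ℂ) - η j) = conj f := by
      rw [hfdef, map_sum, ← h.tau_bijective.sum_comp]
      refine Finset.sum_congr rfl fun j _ => ?_
      rw [map_div₀, map_sub, h.conj_hat, Complex.conj_ofReal, h.tau_tau]
    have c2 : ∑ j, conj (b (τ j)) / ((x : ℂ) - hat q₀ η j) = conj g := by
      rw [hgdef, map_sum, ← h.tau_bijective.sum_comp]
      refine Finset.sum_congr rfl fun j _ => ?_
      rw [h.tau_tau, map_div₀ _ (b j), map_sub, h.conj_eta, Complex.conj_ofReal]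
    have e1 := sum_div_mul_sum_div (hat q₀ η) η a (fun j => conj (a (τ j)))
      (fun j m => (h.eta_ne_hat m j).symm) hx1 hx2
    have e2 := sum_div_mul_sum_div η (hat q₀ η) b (fun j => conj (b (τ j)))
      (fun j m => h.eta_ne_hat j m) hx2 hx1
    rw [c1] at e1
    rw [c2] at e2
    have e3 : f * conj f + g * conj g = 0 := by
      rw [e1, e2]
      simp only [hf, hg, hf', hg']
      have comm4 : ∀ A B C D : ℂ, A + B + (C + D) = (A + D) + (B + C) := fun A B C D => by ring
      rw [comm4, ← Finset.sum_add_distrib, ← Finset.sum_add_distrib]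
      rw [Finset.sum_eq_zero, Finset.sum_eq_zero, add_zero]
      · intro j _
        rw [← add_div, div_eq_zero_iff]
        left
        have h3 : conj qm / hat q₀ η j = -(η j / qm) := by
          rw [← neg_div, div_eq_div_iff (h.hat_ne j) hq]
          linear_combination hqq + h.hat_mul_eta j
        have h4 : b j = Complex.I * a j * (conj qm / hat q₀ η j) := by simp only [hb]; ring
        rw [h4, h3]
        simp only [ha, map_mul, hwc]
        have h1 := h.eta_ne j
        field_simp
        ring
      · intro j _
        rw [← add_div, div_eq_zero_iff]
        left
        rw [map_mul, hvc, hbc]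
        simp only [ha]
        ring
    rw [Complex.mul_conj', Complex.mul_conj'] at e3
    have e4 : ‖f‖ ^ 2 + ‖g‖ ^ 2 = 0 := by exact_mod_cast e3
    have : ‖f‖ ^ 2 = 0 := by nlinarith [sq_nonneg ‖f‖, sq_nonneg ‖g‖]
    simpa using this
  obtain ⟨r, hr⟩ : ∃ r : ι → ℝ, Function.Injective r := by
    obtain ⟨e⟩ := Fintype.truncEquivFin ι |>.nonempty
    exact ⟨fun i => ((e i : ℕ) : ℝ), fun i j hij => e.injective (Fin.ext (Nat.cast_injective hij))⟩
  have := eq_zero_of_cauchy h.hat_inj (r := fun i => (r i : ℂ))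
    (fun i j hij => hr (Complex.ofReal_injective hij)) (fun s j hj => by
      have := h.hat_mem j
      rw [← hj] at this
      simp [Dplus] at this) a (fun s => hreal (r s))
  funext j
  have := congrFun this j
  simpa [ha, hw.ne_zero j] using this

end IsSpectrum
end LinearSystem

section LinearSystem

variable {ι : Type*} [Fintype ι] [DecidableEq ι]

namespace IsSpectrum

variable {q₀ : ℝ} {qm : ℂ} {η : ι → ℂ} {τ : ι → ι}

theorem det_cmat_ne_zero (h : IsSpectrum q₀ qm η τ) {w : ι → ℂ} (hw : Admissible qm η τ w) :
    (cmat q₀ qm η w).det ≠ 0 := fun h0 => by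
  obtain ⟨Y, hY, h1⟩ := Matrix.exists_mulVec_eq_zero_iff.2 h0
  exact hY (h.eq_zero_of_mulVec_eq_zero hw h1)

theorem eq_of_mulVec_eq (h : IsSpectrum q₀ qm η τ) {w : ι → ℂ} (hw : Admissible qm η τ w)
    {Y Z : ι → ℂ} (hYZ : (cmat q₀ qm η w).mulVec Y = (cmat q₀ qm η w).mulVec Z) : Y = Z := by
  rw [← sub_eq_zero] at hYZ ⊢
  rw [← Matrix.mulVec_sub] at hYZ
  exact h.eq_zero_of_mulVec_eq_zero hw hYZ

theorem sum_sol₁ (h : IsSpectrum q₀ qm η τ) {w : ι → ℂ} (hw : Admissible qm η τ w) (s : ι) :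
    ∑ j, w j * sol₁ q₀ qm η w j / (η s - hat q₀ η j)
      = Complex.I * qm / η s * (1 - sol₁ q₀ qm η w s) := by
  have h1 : (cmat q₀ qm η w).mulVec (sol₁ q₀ qm η w) s = Complex.I * qm / η s := by
    rw [sol₁, Matrix.mulVec_mulVec,
      Matrix.mul_nonsing_inv _ (isUnit_iff_ne_zero.2 (h.det_cmat_ne_zero hw)), Matrix.one_mulVec]
  rw [cmat_mulVec] at h1
  linear_combination h1

theorem sum_sol₂ (h : IsSpectrum q₀ qm η τ) {w : ι → ℂ} (hw : Admissible qm η τ w) (s : ι) :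
    ∑ j, w j * sol₂ q₀ qm η w j / (η s - hat q₀ η j)
      = -1 - Complex.I * qm / η s * sol₂ q₀ qm η w s := by
  have h1 : (cmat q₀ qm η w).mulVec (sol₂ q₀ qm η w) s = -1 := by
    rw [sol₂, Matrix.mulVec_mulVec,
      Matrix.mul_nonsing_inv _ (isUnit_iff_ne_zero.2 (h.det_cmat_ne_zero hw)), Matrix.one_mulVec]
  rw [cmat_mulVec] at h1
  linear_combination h1

/-- The symmetry of the second components with the first ones. -/
theorem sol₂_eq (h : IsSpectrum q₀ qm η τ) {w : ι → ℂ} (hw : Admissible qm η τ w) (s : ι) :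
    sol₂ q₀ qm η w s = Complex.I * η s / qm * conj (sol₁ q₀ qm η w (τ s)) := by
  suffices sol₂ q₀ qm η w = fun s => Complex.I * η s / qm * conj (sol₁ q₀ qm η w (τ s)) from
    congrFun this s
  have hq := h.qm_ne
  apply h.eq_of_mulVec_eq hw
  funext s
  rw [cmat_mulVec, cmat_mulVec, h.sum_sol₂ hw]
  have h1 := congrArg conj (h.sum_sol₁ hw (τ s))
  rw [map_mul, h.conj_v, map_sub, map_one, map_sum, ← h.tau_bijective.sum_comp] at h1
  have h2 : ∑ j, conj (w (τ j) * sol₁ q₀ qm η w (τ j) / (η (τ s) - hat q₀ η (τ j))) =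
      Complex.I * η s / qm *
        -∑ j, w j * (Complex.I * η j / qm * conj (sol₁ q₀ qm η w (τ j))) / (η s - hat q₀ η j) := by
    rw [← Finset.sum_neg_distrib, Finset.mul_sum]
    refine Finset.sum_congr rfl fun j _ => ?_
    rw [map_div₀, map_mul, map_sub, h.conj_w hw, h.conj_eta, h.conj_hat, h.tau_tau, h.tau_tau]
    have e1 := sub_ne_zero.2 (h.eta_ne_hat s j)
    have e2 := sub_ne_zero.2 (h.eta_ne_hat j s).symm
    have e3 : η j / (hat q₀ η s - η j) = -(η s / (η s - hat q₀ η j)) := by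
      rw [← neg_div, div_eq_div_iff e2 e1]
      linear_combination h.hat_mul_eta s - h.hat_mul_eta j
    have e4 : -(η j ^ 2 / qm ^ 2) * w j * conj (sol₁ q₀ qm η w (τ j)) / (hat q₀ η s - η j)
      = -(η j / qm ^ 2) * w j * conj (sol₁ q₀ qm η w (τ j)) * (η j / (hat q₀ η s - η j)) := by ring
    rw [e4, e3]
    field_simp
    rw [Complex.I_sq]
    ring
  rw [h2] at h1
  have h3 : Complex.I * η s / qm ≠ 0 :=
    div_ne_zero (mul_ne_zero Complex.I_ne_zero (h.eta_ne s)) hq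
  have h4 := mul_left_cancel₀ h3 h1
  have h5 : Complex.I * qm / η s * (Complex.I * η s / qm * conj (sol₁ q₀ qm η w (τ s)))
      = - conj (sol₁ q₀ qm η w (τ s)) := by
    have := h.eta_ne s
    field_simp
    rw [Complex.I_sq]; ring
  rw [h5]
  linear_combination h4

theorem conj_sol₁ (h : IsSpectrum q₀ qm η τ) {w : ι → ℂ} (hw : Admissible qm η τ w) (s : ι) :
    conj (sol₁ q₀ qm η w (τ s)) = -(Complex.I * qm / η s) * sol₂ q₀ qm η w s := by
  rw [h.sol₂_eq hw]
  have := h.eta_ne s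
  have := h.qm_ne
  field_simp
  rw [Complex.I_sq]; ring

theorem conj_potential (h : IsSpectrum q₀ qm η τ) {w : ι → ℂ} (hw : Admissible qm η τ w) :
    conj (potential q₀ qm η w)
      = conj qm * (1 - ∑ j, w j * sol₂ q₀ qm η w j / hat q₀ η j) := by
  rw [potential, map_add, map_mul, map_sum, Complex.conj_I, ← h.tau_bijective.sum_comp]
  have : ∑ j, conj (w (τ j) * sol₁ q₀ qm η w (τ j))
      = -(Complex.I * conj qm) * ∑ j, w j * sol₂ q₀ qm η w j / hat q₀ η j := by
    rw [Finset.mul_sum]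
    refine Finset.sum_congr rfl fun j _ => ?_
    rw [map_mul, h.conj_w hw, h.conj_sol₁ hw]
    have h1 := h.eta_ne j
    have h2 := h.qm_ne
    have h3 := h.hat_ne j
    have h4 := h.hat_mul_eta j
    have h5 := h.qm_mul_conj
    field_simp
    linear_combination (w j * sol₂ q₀ qm η w j) * (h4 + h5)
  rw [this]
  linear_combination (conj qm * ∑ j, w j * sol₂ q₀ qm η w j / hat q₀ η j) * Complex.I_sq

/-- The determinantal formula, by the Schur complement. -/
theorem _root_.IfoNLS.potential_eq_det {w : ι → ℂ} (hw : (cmat q₀ qm η w).det ≠ 0) :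
    potential q₀ qm η w = qm - Complex.I * ((Matrix.fromBlocks (cmat q₀ qm η w)
      (Matrix.replicateCol Unit fun j => Complex.I * qm / η j) (Matrix.replicateRow Unit w)
      0).det / (cmat q₀ qm η w).det) := by
  have hu := isUnit_iff_ne_zero.2 hw
  let _ := Matrix.invertibleOfIsUnitDet _ hu
  rw [Matrix.det_fromBlocks₁₁, mul_div_cancel_left₀ _ hw, Matrix.det_unique, potential, sol₁,
    Matrix.invOf_eq_nonsing_inv]
  have : (0 - Matrix.replicateRow Unit w * (cmat q₀ qm η w)⁻¹ *
      Matrix.replicateCol Unit (fun j => Complex.I * qm / η j) : Matrix Unit Unit ℂ) default default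
      = -∑ j, w j * (cmat q₀ qm η w)⁻¹.mulVec (fun j => Complex.I * qm / η j) j := by
    rw [Matrix.mul_assoc, ← Matrix.replicateCol_mulVec]
    simp [Matrix.mul_apply]
  rw [this]
  ring

/-! ### Differentiation of the linear system -/

end IsSpectrum

theorem contDiffAt_det {E : Type*} [NormedAddCommGroup E] [NormedSpace ℝ E] {n : WithTop ℕ∞}
    {M : E → Matrix ι ι ℂ} {x : E} (hM : ∀ i j, ContDiffAt ℝ n (fun y => M y i j) x) :
    ContDiffAt ℝ n (fun y => (M y).det) x := by
  simp only [Matrix.det_apply']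
  refine ContDiffAt.sum fun σ _ => ContDiffAt.mul contDiffAt_const ?_
  exact contDiffAt_prod fun i _ => hM _ _

theorem contDiffAt_cmat {ι : Type*} [DecidableEq ι] {E : Type*} [NormedAddCommGroup E] [NormedSpace ℝ E] {n : WithTop ℕ∞}
    (q₀ : ℝ) (qm : ℂ) (η : ι → ℂ) {w : E → ι → ℂ} {x : E}
    (hw : ∀ j, ContDiffAt ℝ n (fun y => w y j) x) (s j : ι) :
    ContDiffAt ℝ n (fun y => cmat q₀ qm η (w y) s j) x := by
  simp only [cmat, Matrix.of_apply]
  exact ((hw j).div_const _).add contDiffAt_const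

theorem contDiffAt_inv_mulVec {E : Type*} [NormedAddCommGroup E] [NormedSpace ℝ E]
    {n : WithTop ℕ∞} {M : E → Matrix ι ι ℂ} {x : E} (b : ι → ℂ)
    (hM : ∀ i j, ContDiffAt ℝ n (fun y => M y i j) x) (hdet : (M x).det ≠ 0) (j : ι) :
    ContDiffAt ℝ n (fun y => (M y)⁻¹.mulVec b j) x := by
  have : (fun y => (M y)⁻¹.mulVec b j) = fun y => ((M y).det)⁻¹ * ((M y).updateCol j b).det := by
    funext y
    rw [Matrix.inv_def, Matrix.smul_mulVec, ← Matrix.cramer_eq_adjugate_mulVec,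
      Pi.smul_apply, Matrix.cramer_apply, Ring.inverse_eq_inv', smul_eq_mul]
  rw [this]
  refine ((contDiffAt_det hM).inv hdet).mul (contDiffAt_det fun i k => ?_)
  simp only [Matrix.updateCol_apply]
  split_ifs
  · exact contDiffAt_const
  · exact hM i k

namespace IsSpectrum
variable {q₀ : ℝ} {qm : ℂ} {η : ι → ℂ} {τ : ι → ι}

theorem contDiffAt_sol₁ (h : IsSpectrum q₀ qm η τ) {E : Type*} [NormedAddCommGroup E]
    [NormedSpace ℝ E] {n : WithTop ℕ∞} {w : E → ι → ℂ} {x : E}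
    (hw : ∀ j, ContDiffAt ℝ n (fun y => w y j) x) (ha : Admissible qm η τ (w x)) (j : ι) :
    ContDiffAt ℝ n (fun y => sol₁ q₀ qm η (w y) j) x :=
  contDiffAt_inv_mulVec _ (contDiffAt_cmat q₀ qm η hw) (h.det_cmat_ne_zero ha) j

theorem contDiffAt_sol₂ (h : IsSpectrum q₀ qm η τ) {E : Type*} [NormedAddCommGroup E]
    [NormedSpace ℝ E] {n : WithTop ℕ∞} {w : E → ι → ℂ} {x : E}
    (hw : ∀ j, ContDiffAt ℝ n (fun y => w y j) x) (ha : Admissible qm η τ (w x)) (j : ι) :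
    ContDiffAt ℝ n (fun y => sol₂ q₀ qm η (w y) j) x :=
  contDiffAt_inv_mulVec _ (contDiffAt_cmat q₀ qm η hw) (h.det_cmat_ne_zero ha) j

theorem contDiffAt_potential (h : IsSpectrum q₀ qm η τ) {E : Type*} [NormedAddCommGroup E]
    [NormedSpace ℝ E] {n : WithTop ℕ∞} {w : E → ι → ℂ} {x : E}
    (hw : ∀ j, ContDiffAt ℝ n (fun y => w y j) x) (ha : Admissible qm η τ (w x)) :
    ContDiffAt ℝ n (fun y => potential q₀ qm η (w y)) x :=
  contDiffAt_const.add (contDiffAt_const.mul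
    (ContDiffAt.sum fun j _ => (hw j).mul (h.contDiffAt_sol₁ hw ha j)))

variable {w : ℝ → ι → ℂ} {d : ι → ℂ} {x : ℝ}

/-- The row vector `y` with `y G = w` is `y_s = w_s η_s X_s / (i q_-)`. -/
theorem sum_dual (h : IsSpectrum q₀ qm η τ) {w : ι → ℂ} (hw : Admissible qm η τ w) (j : ι) :
    ∑ s, w s * η s * sol₁ q₀ qm η w s / (Complex.I * qm) / (η s - hat q₀ η j)
      = 1 - sol₁ q₀ qm η w j := by
  have h0 : Complex.I * qm ≠ 0 := mul_ne_zero Complex.I_ne_zero h.qm_ne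
  have hj := h.eta_ne j
  have h1 : ∑ s, w s * η s * sol₁ q₀ qm η w s / (Complex.I * qm) / (η s - hat q₀ η j)
      = η j / (Complex.I * qm) * ∑ s, w s * sol₁ q₀ qm η w s / (η j - hat q₀ η s) := by
    rw [Finset.mul_sum]
    refine Finset.sum_congr rfl fun s _ => ?_
    have e1 := sub_ne_zero.2 (h.eta_ne_hat s j)
    have e2 := sub_ne_zero.2 (h.eta_ne_hat j s)
    have e3 : η s / (η s - hat q₀ η j) = η j / (η j - hat q₀ η s) := by
      rw [div_eq_div_iff e1 e2]
      linear_combination h.hat_mul_eta j - h.hat_mul_eta s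
    calc _ = w s * sol₁ q₀ qm η w s / (Complex.I * qm) * (η s / (η s - hat q₀ η j)) := by ring
      _ = _ := by rw [e3]; ring
  rw [h1, h.sum_sol₁ hw, ← mul_assoc, div_mul_div_cancel₀ h0, div_self hj, one_mul]

/-- The derivative of the solution of the linear system when `w_j' = d_j w_j`. -/
theorem _root_.IfoNLS.mulVec_deriv {w : ℝ → ι → ℂ} {d : ι → ℂ} {x : ℝ}
    (hd : ∀ j, HasDerivAt (fun y => w y j) (d j * w x j) x) {X : ℝ → ι → ℂ} {Y b : ι → ℂ}
    (hX : ∀ j, HasDerivAt (fun y => X y j) (Y j) x)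
    (hG : ∀ y, (cmat q₀ qm η (w y)).mulVec (X y) = b) (s : ι) :
    (cmat q₀ qm η (w x)).mulVec Y s = -∑ j, d j * w x j * X x j / (η s - hat q₀ η j) := by
  have h1 : HasDerivAt (fun y => (cmat q₀ qm η (w y)).mulVec (X y) s)
      (∑ j, (d j * w x j * X x j + w x j * Y j) / (η s - hat q₀ η j)
        + Complex.I * qm / η s * Y s) x := by
    simp only [cmat_mulVec]
    exact (HasDerivAt.fun_sum fun j _ => ((hd j).mul (hX j)).div_const _).add ((hX s).const_mul _)
  have h2 : (fun y => (cmat q₀ qm η (w y)).mulVec (X y) s) = fun _ => b s := by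
    funext y; rw [hG]
  rw [h2] at h1
  have h3 := h1.unique (hasDerivAt_const x (b s))
  rw [cmat_mulVec]
  simp only [add_div, Finset.sum_add_distrib] at h3
  linear_combination h3

theorem mulVec_sol₁ (h : IsSpectrum q₀ qm η τ) {w : ι → ℂ} (hw : Admissible qm η τ w) :
    (cmat q₀ qm η w).mulVec (sol₁ q₀ qm η w) = fun s => Complex.I * qm / η s := by
  funext s
  rw [cmat_mulVec, h.sum_sol₁ hw]; ring

theorem mulVec_sol₂ (h : IsSpectrum q₀ qm η τ) {w : ι → ℂ} (hw : Admissible qm η τ w) :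
    (cmat q₀ qm η w).mulVec (sol₂ q₀ qm η w) = fun _ => -1 := by
  funext s
  rw [cmat_mulVec, h.sum_sol₂ hw]; ring

theorem sum_dual_mulVec (h : IsSpectrum q₀ qm η τ) {w : ι → ℂ} (hw : Admissible qm η τ w)
    (Y : ι → ℂ) :
    ∑ s, w s * η s * sol₁ q₀ qm η w s / (Complex.I * qm) * (cmat q₀ qm η w).mulVec Y s
      = ∑ j, w j * Y j := by
  have hq := h.qm_ne
  have hI := Complex.I_ne_zero
  simp only [cmat_mulVec, mul_add, Finset.mul_sum, Finset.sum_add_distrib]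
  rw [Finset.sum_comm, ← Finset.sum_add_distrib]
  refine Finset.sum_congr rfl fun j _ => ?_
  have h1 : ∑ s, w s * η s * sol₁ q₀ qm η w s / (Complex.I * qm)
      * (w j * Y j / (η s - hat q₀ η j)) = w j * Y j * (1 - sol₁ q₀ qm η w j) := by
    rw [← h.sum_dual hw, Finset.mul_sum]
    exact Finset.sum_congr rfl fun s _ => by ring
  have h2 : w j * η j * sol₁ q₀ qm η w j / (Complex.I * qm) * (Complex.I * qm / η j * Y j)
      = w j * Y j * sol₁ q₀ qm η w j := by
    have := h.eta_ne j
    field_simp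
  rw [h1, h2]
  ring

/-- The derivative of the potential is a sum of squared eigenfunctions. -/
theorem hasDerivAt_potential (h : IsSpectrum q₀ qm η τ) (hw : ∀ y, Admissible qm η τ (w y))
    (hw1 : ∀ j, ContDiffAt ℝ 1 (fun y => w y j) x)
    (hd : ∀ j, HasDerivAt (fun y => w y j) (d j * w x j) x) :
    HasDerivAt (fun y => potential q₀ qm η (w y))
      (Complex.I * ∑ j, d j * w x j * sol₁ q₀ qm η (w x) j ^ 2) x := by
  obtain ⟨Y, hX'⟩ : ∃ Y : ι → ℂ, ∀ j, HasDerivAt (fun y => sol₁ q₀ qm η (w y) j) (Y j) x :=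
    ⟨_, fun j => ((h.contDiffAt_sol₁ (n := 1) (E := ℝ) (x := x) (w := w) hw1 (hw x) j
      ).differentiableAt one_ne_zero).hasDerivAt⟩
  have hG : ∀ s, (cmat q₀ qm η (w x)).mulVec Y s
      = -∑ j, d j * w x j * sol₁ q₀ qm η (w x) j / (η s - hat q₀ η j) :=
    fun s => mulVec_deriv (X := fun y => sol₁ q₀ qm η (w y)) (Y := Y)
      (b := fun s => Complex.I * qm / η s) hd hX' (fun y => h.mulVec_sol₁ (hw y)) s
  have e1 := h.sum_dual_mulVec (hw x) Y
  simp only [hG, mul_neg, Finset.sum_neg_distrib, Finset.mul_sum] at e1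
  rw [Finset.sum_comm] at e1
  have e2 : ∀ j, ∑ s, w x s * η s * sol₁ q₀ qm η (w x) s / (Complex.I * qm)
      * (d j * w x j * sol₁ q₀ qm η (w x) j / (η s - hat q₀ η j))
      = d j * w x j * sol₁ q₀ qm η (w x) j * (1 - sol₁ q₀ qm η (w x) j) := fun j => by
    rw [← h.sum_dual (hw x), Finset.mul_sum]
    exact Finset.sum_congr rfl fun s _ => by ring
  simp only [e2] at e1
  have h1 : HasDerivAt (fun y => ∑ j, w y j * sol₁ q₀ qm η (w y) j)
      (∑ j, (d j * w x j * sol₁ q₀ qm η (w x) j + w x j * Y j)) x :=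
    HasDerivAt.fun_sum fun j _ => (hd j).mul (hX' j)
  have h2 : ∑ j, (d j * w x j * sol₁ q₀ qm η (w x) j + w x j * Y j)
      = ∑ j, d j * w x j * sol₁ q₀ qm η (w x) j ^ 2 := by
    rw [Finset.sum_add_distrib, ← e1, ← sub_eq_add_neg, ← Finset.sum_sub_distrib]
    exact Finset.sum_congr rfl fun j _ => by ring
  rw [h2] at h1
  exact (h1.const_mul Complex.I).const_add qm

/-- The first component of the eigenfunctions. -/
theorem hasDerivAt_sol₁ (h : IsSpectrum q₀ qm η τ) (hw : ∀ y, Admissible qm η τ (w y))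
    (hw1 : ∀ j, ContDiffAt ℝ 1 (fun y => w y j) x)
    (hd : ∀ j, HasDerivAt (fun y => w y j) (-Complex.I * (hat q₀ η j - η j) * w x j) x) (s : ι) :
    HasDerivAt (fun y => sol₁ q₀ qm η (w y) s)
      (-Complex.I * η s * sol₁ q₀ qm η (w x) s
        + potential q₀ qm η (w x) * sol₂ q₀ qm η (w x) s) x := by
  have hX := fun j => ((h.contDiffAt_sol₁ (n := 1) (E := ℝ) (x := x) (w := w)
    (fun j => hw1 j) (hw x) j).differentiableAt one_ne_zero).hasDerivAt
  have hG := mulVec_deriv hd hX fun y => h.mulVec_sol₁ (hw y)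
  suffices (fun j => deriv (fun y => sol₁ q₀ qm η (w y) j) x) = fun s =>
      -Complex.I * η s * sol₁ q₀ qm η (w x) s
        + potential q₀ qm η (w x) * sol₂ q₀ qm η (w x) s from
    (hX s).congr_deriv (congrFun this s)
  apply h.eq_of_mulVec_eq (hw x)
  funext s
  rw [hG, cmat_mulVec]
  have h2 := h.sum_sol₂ (hw x) s
  have h1 := h.sum_sol₁ (hw x) s
  set X := sol₁ q₀ qm η (w x)
  set X' := sol₂ q₀ qm η (w x)
  set q := potential q₀ qm η (w x) with hq
  have e : ∑ j, w x j * (-Complex.I * η j * X j + q * X' j) / (η s - hat q₀ η j) =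
      (-∑ j, -Complex.I * (hat q₀ η j - η j) * w x j * X j / (η s - hat q₀ η j))
        + q * (∑ j, w x j * X' j / (η s - hat q₀ η j))
        - Complex.I * η s * ∑ j, w x j * X j / (η s - hat q₀ η j)
        + Complex.I * ∑ j, w x j * X j := by
    simp only [Finset.mul_sum, ← Finset.sum_neg_distrib]
    rw [← Finset.sum_add_distrib, ← Finset.sum_sub_distrib, ← Finset.sum_add_distrib]
    refine Finset.sum_congr rfl fun j _ => ?_
    have := sub_ne_zero.2 (h.eta_ne_hat s j)
    field_simp
    ring
  rw [e, h1, h2]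
  have h3 : q = qm + Complex.I * ∑ j, w x j * X j := rfl
  have h4 := h.eta_ne s
  field_simp
  linear_combination η s * h3 + η s * qm * Complex.I_sq

/-- The second component of the eigenfunctions. -/
theorem hasDerivAt_sol₂ (h : IsSpectrum q₀ qm η τ) (hw : ∀ y, Admissible qm η τ (w y))
    (hw1 : ∀ j, ContDiffAt ℝ 1 (fun y => w y j) x)
    (hd : ∀ j, HasDerivAt (fun y => w y j) (-Complex.I * (hat q₀ η j - η j) * w x j) x) (s : ι) :
    HasDerivAt (fun y => sol₂ q₀ qm η (w y) s)
      (Complex.I * hat q₀ η s * sol₂ q₀ qm η (w x) s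
        - conj (potential q₀ qm η (w x)) * sol₁ q₀ qm η (w x) s) x := by
  have hX := fun j => ((h.contDiffAt_sol₂ (n := 1) (E := ℝ) (x := x) (w := w)
    (fun j => hw1 j) (hw x) j).differentiableAt one_ne_zero).hasDerivAt
  have hG := mulVec_deriv hd hX fun y => h.mulVec_sol₂ (hw y)
  suffices (fun j => deriv (fun y => sol₂ q₀ qm η (w y) j) x) = fun s =>
      Complex.I * hat q₀ η s * sol₂ q₀ qm η (w x) s
        - conj (potential q₀ qm η (w x)) * sol₁ q₀ qm η (w x) s from
    (hX s).congr_deriv (congrFun this s)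
  apply h.eq_of_mulVec_eq (hw x)
  funext s
  rw [hG, cmat_mulVec]
  have h2 := h.sum_sol₂ (hw x) s
  have h1 := h.sum_sol₁ (hw x) s
  have h3 := h.conj_potential (hw x)
  set X := sol₁ q₀ qm η (w x)
  set X' := sol₂ q₀ qm η (w x)
  set r := conj (potential q₀ qm η (w x))
  have h4 := h.eta_ne s
  have e : ∑ j, w x j * (Complex.I * hat q₀ η j * X' j - r * X j) / (η s - hat q₀ η j) =
      (-∑ j, -Complex.I * (hat q₀ η j - η j) * w x j * X' j / (η s - hat q₀ η j))
        - r * (∑ j, w x j * X j / (η s - hat q₀ η j))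
        + Complex.I * (hat q₀ η s) * ((∑ j, w x j * X' j / (η s - hat q₀ η j))
          + ∑ j, w x j * X' j / hat q₀ η j) := by
    simp only [Finset.mul_sum, ← Finset.sum_neg_distrib, ← Finset.sum_add_distrib]
    rw [← Finset.sum_sub_distrib, ← Finset.sum_add_distrib]
    refine Finset.sum_congr rfl fun j _ => ?_
    have h5 := sub_ne_zero.2 (h.eta_ne_hat s j)
    have h6 := h.hat_ne j
    have h7 := h.hat_mul_eta s
    have h8 := h.hat_mul_eta j
    field_simp
    linear_combination (Complex.I * w x j * X' j) * (h8 - h7)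
  rw [e, h1, h2, h3]
  set S := ∑ j, w x j * X' j / hat q₀ η j
  have h7 := h.hat_mul_eta s
  have h8 := h.qm_mul_conj
  field_simp
  linear_combination (Complex.I * (1 - S)) * (h7 + h8)

end IsSpectrum
end LinearSystem

/-! ### The differential polynomials of the hierarchy -/

section Hierarchy

/-! `J j` stands for `∂_x^j q`. The polynomials `A_j`, `B_j` are defined by
`B_j' = -2i B_{j+1} + 2 q A_j` and `A_j' = -(q B_j* + q* B_j)`, starting with `B_0 = q_x`, where the
constants of integration in the `A_j` make them vanish at `q = const`, `|q|² = c`. -/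

def polA0 (c : ℝ) (J : ℕ → ℂ) : ℂ := c - J 0 * conj (J 0)

def polB1 (c : ℝ) (J : ℕ → ℂ) : ℂ :=
  Complex.I / 2 * (J 2 + 2 * J 0 ^ 2 * conj (J 0) - 2 * c * J 0)

def polA1 (J : ℕ → ℂ) : ℂ := Complex.I / 2 * (J 0 * conj (J 1) - conj (J 0) * J 1)

def polB2 (c : ℝ) (J : ℕ → ℂ) : ℂ :=
  -1 / 4 * J 3 - 3 / 2 * (J 0 * conj (J 0) * J 1) + c / 2 * J 1

def polA2 (c : ℝ) (J : ℕ → ℂ) : ℂ :=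
  1 / 4 * (conj (J 0) * J 2 - J 1 * conj (J 1) + J 0 * conj (J 2))
    + 3 / 4 * (J 0 ^ 2 * conj (J 0) ^ 2) - c / 2 * (J 0 * conj (J 0)) - c ^ 2 / 4

def polB3 (c : ℝ) (J : ℕ → ℂ) : ℂ :=
  Complex.I * (-1 / 8 * J 4 - 3 / 4 * (conj (J 0) * J 1 ^ 2) - J 0 * conj (J 0) * J 2
    - 1 / 2 * (J 0 * J 1 * conj (J 1)) - 1 / 4 * (J 0 ^ 2 * conj (J 2))
    - 3 / 4 * (J 0 ^ 3 * conj (J 0) ^ 2) + c / 4 * J 2 + c / 2 * (J 0 ^ 2 * conj (J 0))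
    + c ^ 2 / 4 * J 0)

def polA3 (c : ℝ) (J : ℕ → ℂ) : ℂ :=
  Complex.I * (1 / 8 * (conj (J 0) * J 3 - conj (J 1) * J 2 + J 1 * conj (J 2) - J 0 * conj (J 3))
    + 3 / 4 * (J 0 * conj (J 0) ^ 2 * J 1 - J 0 ^ 2 * conj (J 0) * conj (J 1))
    - c / 4 * (conj (J 0) * J 1 - J 0 * conj (J 1)))

def polB4 (c : ℝ) (J : ℕ → ℂ) : ℂ :=
  1 / 16 * J 5 + 5 / 4 * (conj (J 0) * J 1 * J 2) + 5 / 8 * (J 1 ^ 2 * conj (J 1)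
    + J 0 * conj (J 0) * J 3 + J 0 * conj (J 1) * J 2 + J 0 * J 1 * conj (J 2))
    + 15 / 8 * (J 0 ^ 2 * conj (J 0) ^ 2 * J 1) - c / 8 * J 3
    - 3 / 4 * c * (J 0 * conj (J 0) * J 1) - c ^ 2 / 8 * J 1

/-- The right-hand side of the evolution equation `q_t = …`. -/
def flow (ε : ℝ) (c : ℝ) (J : ℕ → ℂ) : ℂ :=
  16 * ε * polB4 c J - 8 * c * ε * polB2 c J + 2 * polB1 c J + (6 * c ^ 2 * ε + 1) * J 1

variable {J : ℝ → ℕ → ℂ} {x : ℝ}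

theorem hasDerivAt_conj {f : ℝ → ℂ} {f' : ℂ} {x : ℝ} (h : HasDerivAt f f' x) :
    HasDerivAt (fun y => conj (f y)) (conj f') x := by
  simpa using h.star

variable {c : ℝ}

set_option linter.unusedSimpArgs false

theorem hasDerivAt_polA0 (hJ : ∀ j ≤ 4, HasDerivAt (fun y => J y j) (J x (j + 1)) x) :
    HasDerivAt (fun y => polA0 c (J y)) (-(J x 0 * conj (J x 1) + conj (J x 0) * J x 1)) x := by
  have h0 := hJ 0 (by norm_num)
  have g0 := hasDerivAt_conj h0
  refine ((h0.mul g0).const_sub (c : ℂ)).congr_deriv ?_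
  ring

theorem hasDerivAt_polB0 (hJ : ∀ j ≤ 4, HasDerivAt (fun y => J y j) (J x (j + 1)) x) :
    HasDerivAt (fun y => J y 1) (-2 * Complex.I * polB1 c (J x) + 2 * J x 0 * polA0 c (J x)) x := by
  have h0 := hJ 0 (by norm_num)
  have h1 := hJ 1 (by norm_num)
  refine (h1).congr_deriv ?_
  simp only [polA0, polA1, polA2, polA3, polB1, polB2, polB3, polB4, map_mul, map_div₀, map_sub,
    map_add, map_pow, map_neg, map_one, map_ofNat, Complex.conj_I, Complex.conj_conj,
    Complex.conj_ofReal, Pi.mul_apply, Pi.pow_apply]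
  ring_nf
  simp only [Complex.I_sq]
  ring

theorem hasDerivAt_polA1 (hJ : ∀ j ≤ 4, HasDerivAt (fun y => J y j) (J x (j + 1)) x) :
    HasDerivAt (fun y => polA1 (J y)) (-(J x 0 * conj (polB1 c (J x)) + conj (J x 0) * polB1 c (J x))) x := by
  have h0 := hJ 0 (by norm_num)
  have h1 := hJ 1 (by norm_num)
  have g0 := hasDerivAt_conj h0
  have g1 := hasDerivAt_conj h1
  refine (((h0.mul g1).sub (g0.mul h1)).const_mul (Complex.I / 2)).congr_deriv ?_
  simp only [polA0, polA1, polA2, polA3, polB1, polB2, polB3, polB4, map_mul, map_div₀, map_sub,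
    map_add, map_pow, map_neg, map_one, map_ofNat, Complex.conj_I, Complex.conj_conj,
    Complex.conj_ofReal, Pi.mul_apply, Pi.pow_apply]
  ring

theorem hasDerivAt_polB1 (hJ : ∀ j ≤ 4, HasDerivAt (fun y => J y j) (J x (j + 1)) x) :
    HasDerivAt (fun y => polB1 c (J y)) (-2 * Complex.I * polB2 c (J x) + 2 * J x 0 * polA1 (J x)) x := by
  have h0 := hJ 0 (by norm_num)
  have h1 := hJ 1 (by norm_num)
  have h2 := hJ 2 (by norm_num)
  have g0 := hasDerivAt_conj h0
  refine (((h2.add (((h0.pow 2).const_mul 2).mul g0)).sub (h0.const_mul (2 * (c : ℂ)))).const_mul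
    (Complex.I / 2)).congr_deriv ?_
  simp only [polA0, polA1, polA2, polA3, polB1, polB2, polB3, polB4, map_mul, map_div₀, map_sub,
    map_add, map_pow, map_neg, map_one, map_ofNat, Complex.conj_I, Complex.conj_conj,
    Complex.conj_ofReal, Pi.mul_apply, Pi.pow_apply]
  ring

theorem hasDerivAt_polA2 (hJ : ∀ j ≤ 4, HasDerivAt (fun y => J y j) (J x (j + 1)) x) :
    HasDerivAt (fun y => polA2 c (J y)) (-(J x 0 * conj (polB2 c (J x)) + conj (J x 0) * polB2 c (J x))) x := by
  have h0 := hJ 0 (by norm_num)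
  have h1 := hJ 1 (by norm_num)
  have h2 := hJ 2 (by norm_num)
  have h3 := hJ 3 (by norm_num)
  have g0 := hasDerivAt_conj h0
  have g1 := hasDerivAt_conj h1
  have g2 := hasDerivAt_conj h2
  have g3 := hasDerivAt_conj h3
  refine (((((((g0.mul h2).sub (h1.mul g1)).add (h0.mul g2)).const_mul (1 / 4)).add
    (((h0.pow 2).mul (g0.pow 2)).const_mul (3 / 4))).sub ((h0.mul g0).const_mul ((c : ℂ) / 2))).sub_const
    ((c : ℂ) ^ 2 / 4)).congr_deriv ?_
  simp only [polA0, polA1, polA2, polA3, polB1, polB2, polB3, polB4, map_mul, map_div₀, map_sub,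
    map_add, map_pow, map_neg, map_one, map_ofNat, Complex.conj_I, Complex.conj_conj,
    Complex.conj_ofReal, Pi.mul_apply, Pi.pow_apply]
  ring

theorem hasDerivAt_polB2 (hJ : ∀ j ≤ 4, HasDerivAt (fun y => J y j) (J x (j + 1)) x) :
    HasDerivAt (fun y => polB2 c (J y)) (-2 * Complex.I * polB3 c (J x) + 2 * J x 0 * polA2 c (J x)) x := by
  have h0 := hJ 0 (by norm_num)
  have h1 := hJ 1 (by norm_num)
  have h2 := hJ 2 (by norm_num)
  have h3 := hJ 3 (by norm_num)
  have g0 := hasDerivAt_conj h0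
  refine (((h3.const_mul (-1 / 4)).sub (((h0.mul g0).mul h1).const_mul (3 / 2))).add
    (h1.const_mul ((c : ℂ) / 2))).congr_deriv ?_
  simp only [polA0, polA1, polA2, polA3, polB1, polB2, polB3, polB4, map_mul, map_div₀, map_sub,
    map_add, map_pow, map_neg, map_one, map_ofNat, Complex.conj_I, Complex.conj_conj,
    Complex.conj_ofReal, Pi.mul_apply, Pi.pow_apply]
  ring_nf
  simp only [Complex.I_sq]
  ring

theorem hasDerivAt_polA3 (hJ : ∀ j ≤ 4, HasDerivAt (fun y => J y j) (J x (j + 1)) x) :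
    HasDerivAt (fun y => polA3 c (J y)) (-(J x 0 * conj (polB3 c (J x)) + conj (J x 0) * polB3 c (J x))) x := by
  have h0 := hJ 0 (by norm_num)
  have h1 := hJ 1 (by norm_num)
  have h2 := hJ 2 (by norm_num)
  have h3 := hJ 3 (by norm_num)
  have g0 := hasDerivAt_conj h0
  have g1 := hasDerivAt_conj h1
  have g2 := hasDerivAt_conj h2
  have g3 := hasDerivAt_conj h3
  refine ((((((((g0.mul h3).sub (g1.mul h2)).add (h1.mul g2)).sub (h0.mul g3)).const_mul (1 / 8)).add
    ((((h0.mul (g0.pow 2)).mul h1).sub (((h0.pow 2).mul g0).mul g1)).const_mul (3 / 4))).sub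
    (((g0.mul h1).sub (h0.mul g1)).const_mul ((c : ℂ) / 4))).const_mul Complex.I).congr_deriv ?_
  simp only [polA0, polA1, polA2, polA3, polB1, polB2, polB3, polB4, map_mul, map_div₀, map_sub,
    map_add, map_pow, map_neg, map_one, map_ofNat, Complex.conj_I, Complex.conj_conj,
    Complex.conj_ofReal, Pi.mul_apply, Pi.pow_apply]
  ring

theorem hasDerivAt_polB3 (hJ : ∀ j ≤ 4, HasDerivAt (fun y => J y j) (J x (j + 1)) x) :
    HasDerivAt (fun y => polB3 c (J y)) (-2 * Complex.I * polB4 c (J x) + 2 * J x 0 * polA3 c (J x)) x := by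
  have h0 := hJ 0 (by norm_num)
  have h1 := hJ 1 (by norm_num)
  have h2 := hJ 2 (by norm_num)
  have h3 := hJ 3 (by norm_num)
  have h4 := hJ 4 (by norm_num)
  have g0 := hasDerivAt_conj h0
  have g1 := hasDerivAt_conj h1
  have g2 := hasDerivAt_conj h2
  refine ((((((((((h4.const_mul (-1 / 8)).sub ((g0.mul (h1.pow 2)).const_mul (3 / 4))).sub
    ((h0.mul g0).mul h2)).sub (((h0.mul h1).mul g1).const_mul (1 / 2))).sub
    (((h0.pow 2).mul g2).const_mul (1 / 4))).sub (((h0.pow 3).mul (g0.pow 2)).const_mul (3 / 4))).add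
    (h2.const_mul ((c : ℂ) / 4))).add (((h0.pow 2).mul g0).const_mul ((c : ℂ) / 2))).add
    (h0.const_mul ((c : ℂ) ^ 2 / 4))).const_mul Complex.I).congr_deriv ?_
  simp only [polA0, polA1, polA2, polA3, polB1, polB2, polB3, polB4, map_mul, map_div₀, map_sub,
    map_add, map_pow, map_neg, map_one, map_ofNat, Complex.conj_I, Complex.conj_conj,
    Complex.conj_ofReal, Pi.mul_apply, Pi.pow_apply]
  ring_nf

/-- Two functions with the same derivative and the same limit at `-∞` are equal. -/
theorem eq_of_hasDerivAt_of_tendsto {f g f' : ℝ → ℂ} {a : ℂ} (hf : ∀ x, HasDerivAt f (f' x) x)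
    (hg : ∀ x, HasDerivAt g (f' x) x) (hf0 : Tendsto f atBot (𝓝 a)) (hg0 : Tendsto g atBot (𝓝 a))
    (x : ℝ) : f x = g x := by
  have h1 : ∀ y, HasDerivAt (fun y => f y - g y) 0 y := fun y => by
    have := (hf y).fun_sub (hg y)
    rwa [sub_self] at this
  have h2 : ∀ y, f y - g y = f x - g x := fun y =>
    is_const_of_deriv_eq_zero (fun y => (h1 y).differentiableAt) (fun y => (h1 y).deriv) y x
  have h3 : Tendsto (fun y => f y - g y) atBot (𝓝 (a - a)) := hf0.sub hg0
  have h4 := tendsto_nhds_unique (h3.congr h2) tendsto_const_nhds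
  rw [sub_self] at h4
  exact sub_eq_zero.1 h4.symm

section Limits

variable {α : Type*} {l : Filter α} {K : α → ℕ → ℂ} {a : ℂ}

theorem tendsto_conj {f : α → ℂ} {b : ℂ} (h : Tendsto f l (𝓝 b)) :
    Tendsto (fun y => conj (f y)) l (𝓝 (conj b)) :=
  (Complex.continuous_conj.tendsto b).comp h

theorem tendsto_jet_two (h0 : Tendsto (fun y => K y 0) l (𝓝 a)) (ha : a * conj a = c)
    (hB : Tendsto (fun y => polB1 c (K y)) l (𝓝 0)) : Tendsto (fun y => K y 2) l (𝓝 0) := by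
  have e : (fun y => K y 2) = fun y => -2 * Complex.I * polB1 c (K y)
      - 2 * K y 0 * (K y 0 * conj (K y 0) - c) := by
    funext y
    simp only [polB1]
    linear_combination (K y 2 + 2 * K y 0 ^ 2 * conj (K y 0) - 2 * c * K y 0) * Complex.I_sq
  have h := (hB.const_mul (-2 * Complex.I)).sub
    ((h0.const_mul 2).mul ((h0.mul (tendsto_conj h0)).sub_const (c : ℂ)))
  rw [e]
  simpa [ha] using h

theorem tendsto_jet_three (h0 : Tendsto (fun y => K y 0) l (𝓝 a))
    (h1 : Tendsto (fun y => K y 1) l (𝓝 0))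
    (hB : Tendsto (fun y => polB2 c (K y)) l (𝓝 0)) : Tendsto (fun y => K y 3) l (𝓝 0) := by
  have e : (fun y => K y 3) = fun y => -4 * polB2 c (K y)
      - 6 * (K y 0 * conj (K y 0) * K y 1) + 2 * c * K y 1 := by
    funext y
    simp only [polB2]
    ring
  have h := ((hB.const_mul (-4)).sub
    (((h0.mul (tendsto_conj h0)).mul h1).const_mul 6)).add (h1.const_mul (2 * (c : ℂ)))
  rw [e]
  simpa using h

theorem tendsto_jet_four (h0 : Tendsto (fun y => K y 0) l (𝓝 a)) (ha : a * conj a = c)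
    (h1 : Tendsto (fun y => K y 1) l (𝓝 0)) (h2 : Tendsto (fun y => K y 2) l (𝓝 0))
    (hB : Tendsto (fun y => polB3 c (K y)) l (𝓝 0)) : Tendsto (fun y => K y 4) l (𝓝 0) := by
  have e : (fun y => K y 4) = fun y => 8 * Complex.I * polB3 c (K y)
      - 6 * (conj (K y 0) * K y 1 ^ 2) - 8 * (K y 0 * conj (K y 0) * K y 2)
      - 4 * (K y 0 * K y 1 * conj (K y 1)) - 2 * (K y 0 ^ 2 * conj (K y 2)) + 2 * c * K y 2
      - 2 * K y 0 * (3 * (K y 0 * conj (K y 0)) + c) * (K y 0 * conj (K y 0) - c) := by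
    funext y
    simp only [polB3]
    ring_nf
    simp only [Complex.I_sq]
    ring
  have r0 := tendsto_conj h0
  have h := (((((((hB.const_mul (8 * Complex.I)).sub ((r0.mul (h1.pow 2)).const_mul 6)).sub
    (((h0.mul r0).mul h2).const_mul 8)).sub (((h0.mul h1).mul (tendsto_conj h1)).const_mul 4)).sub
    (((h0.pow 2).mul (tendsto_conj h2)).const_mul 2)).add (h2.const_mul (2 * (c : ℂ))))).sub
    (((h0.const_mul 2).mul (((h0.mul r0).const_mul 3).add_const (c : ℂ))).mul
      ((h0.mul r0).sub_const (c : ℂ)))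
  rw [e]
  simpa [ha] using h

theorem tendsto_polA0 (h0 : Tendsto (fun y => K y 0) l (𝓝 a)) (ha : a * conj a = c) :
    Tendsto (fun y => polA0 c (K y)) l (𝓝 0) := by
  simpa [polA0, ha] using (h0.mul (tendsto_conj h0)).const_sub (c : ℂ)

theorem tendsto_polA1 (h0 : Tendsto (fun y => K y 0) l (𝓝 a))
    (h1 : Tendsto (fun y => K y 1) l (𝓝 0)) : Tendsto (fun y => polA1 (K y)) l (𝓝 0) := by
  simpa [polA1] using ((h0.mul (tendsto_conj h1)).sub ((tendsto_conj h0).mul h1)).const_mul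
    (Complex.I / 2)

theorem tendsto_polA2 (h0 : Tendsto (fun y => K y 0) l (𝓝 a)) (ha : a * conj a = c)
    (h1 : Tendsto (fun y => K y 1) l (𝓝 0)) (h2 : Tendsto (fun y => K y 2) l (𝓝 0)) :
    Tendsto (fun y => polA2 c (K y)) l (𝓝 0) := by
  have r0 := tendsto_conj h0
  have e : 3 / 4 * (a ^ 2 * conj a ^ 2) - c / 2 * (a * conj a) - (c : ℂ) ^ 2 / 4 = 0 := by
    rw [← mul_pow, ha]; ring
  have h := (((((r0.mul h2).sub (h1.mul (tendsto_conj h1))).add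
    (h0.mul (tendsto_conj h2))).const_mul (1 / 4)).add
    (((h0.pow 2).mul (r0.pow 2)).const_mul (3 / 4))).sub ((h0.mul r0).const_mul ((c : ℂ) / 2))
    |>.sub_const ((c : ℂ) ^ 2 / 4)
  simp only [polA2]
  refine h.trans_eq ?_
  congr 1
  rw [map_zero]
  linear_combination e

theorem tendsto_polA3 (h0 : Tendsto (fun y => K y 0) l (𝓝 a))
    (h1 : Tendsto (fun y => K y 1) l (𝓝 0)) (h2 : Tendsto (fun y => K y 2) l (𝓝 0))
    (h3 : Tendsto (fun y => K y 3) l (𝓝 0)) :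
    Tendsto (fun y => polA3 c (K y)) l (𝓝 0) := by
  have r0 := tendsto_conj h0
  have r1 := tendsto_conj h1
  have h := ((((((r0.mul h3).sub (r1.mul h2)).add (h1.mul (tendsto_conj h2))).sub
    (h0.mul (tendsto_conj h3))).const_mul (1 / 8)).add
    ((((h0.mul (r0.pow 2)).mul h1).sub (((h0.pow 2).mul r0).mul r1)).const_mul (3 / 4))).sub
    (((r0.mul h1).sub (h0.mul r1)).const_mul ((c : ℂ) / 4)) |>.const_mul Complex.I
  simpa [polA3] using h

end Limits

/-- Sequences `A`, `B` subject to the recursion of the hierarchy, vanishing at `-∞`, are given by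
the differential polynomials. -/
theorem eq_pol_of_recursion {A B : ℕ → ℝ → ℂ} {a : ℂ} (ha : a * conj a = c)
    (hJ : ∀ x, ∀ j ≤ 4, HasDerivAt (fun y => J y j) (J x (j + 1)) x)
    (hJ0 : Tendsto (fun y => J y 0) atBot (𝓝 a)) (hB0 : ∀ x, B 0 x = J x 1)
    (hB : ∀ j x, HasDerivAt (B j) (-2 * Complex.I * B (j + 1) x + 2 * J x 0 * A j x) x)
    (hA : ∀ j x, HasDerivAt (A j) (-(J x 0 * conj (B j x) + conj (J x 0) * B j x)) x)
    (hBl : ∀ j, Tendsto (B j) atBot (𝓝 0)) (hAl : ∀ j, Tendsto (A j) atBot (𝓝 0)) :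
    ∀ x, A 0 x = polA0 c (J x) ∧ B 1 x = polB1 c (J x) ∧ B 2 x = polB2 c (J x)
      ∧ B 3 x = polB3 c (J x) ∧ B 4 x = polB4 c (J x) := by
  have hI : (-2 * Complex.I : ℂ) ≠ 0 := by simp
  -- each step of the recursion
  have stepA : ∀ (j : ℕ) (P Q : (ℕ → ℂ) → ℂ), (∀ x, B j x = P (J x)) →
      (∀ x, HasDerivAt (fun y => Q (J y)) (-(J x 0 * conj (P (J x)) + conj (J x 0) * P (J x))) x) →
      Tendsto (fun y => Q (J y)) atBot (𝓝 0) → ∀ x, A j x = Q (J x) := by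
    intro j P Q h1 h2 h3
    refine eq_of_hasDerivAt_of_tendsto (hA j) (fun x => ?_) (hAl j) h3
    rw [h1]; exact h2 x
  have stepB : ∀ (j : ℕ) (P Q R : (ℕ → ℂ) → ℂ), (∀ x, B j x = P (J x)) → (∀ x, A j x = Q (J x)) →
      (∀ x, HasDerivAt (fun y => P (J y)) (-2 * Complex.I * R (J x) + 2 * J x 0 * Q (J x)) x) →
      ∀ x, B (j + 1) x = R (J x) := by
    intro j P Q R h1 h2 h3 x
    have e : B j = fun y => P (J y) := funext h1
    have h4 := hB j x
    rw [e] at h4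
    have h5 := h4.unique (h3 x)
    rw [h2, add_left_inj] at h5
    exact mul_left_cancel₀ hI h5
  have l1 : Tendsto (fun y => J y 1) atBot (𝓝 0) := (hBl 0).congr hB0
  have a0 := stepA 0 (fun J => J 1) (polA0 c) hB0 (fun x => hasDerivAt_polA0 (hJ x))
    (tendsto_polA0 hJ0 ha)
  have b1 := stepB 0 (fun J => J 1) (polA0 c) (polB1 c) hB0 a0 fun x => hasDerivAt_polB0 (hJ x)
  have l2 := tendsto_jet_two hJ0 ha ((hBl 1).congr b1)
  have a1 := stepA 1 (polB1 c) polA1 b1 (fun x => hasDerivAt_polA1 (hJ x)) (tendsto_polA1 hJ0 l1)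
  have b2 := stepB 1 (polB1 c) polA1 (polB2 c) b1 a1 fun x => hasDerivAt_polB1 (hJ x)
  have l3 := tendsto_jet_three hJ0 l1 ((hBl 2).congr b2)
  have a2 := stepA 2 (polB2 c) (polA2 c) b2 (fun x => hasDerivAt_polA2 (hJ x))
    (tendsto_polA2 hJ0 ha l1 l2)
  have b3 := stepB 2 (polB2 c) (polA2 c) (polB3 c) b2 a2 fun x => hasDerivAt_polB2 (hJ x)
  have a3 := stepA 3 (polB3 c) (polA3 c) b3 (fun x => hasDerivAt_polA3 (hJ x))
    (tendsto_polA3 hJ0 l1 l2 l3)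
  have b4 := stepB 3 (polB3 c) (polA3 c) (polB4 c) b3 a3 fun x => hasDerivAt_polB3 (hJ x)
  exact fun x => ⟨a0 x, b1 x, b2 x, b3 x, b4 x⟩

/-! ### The equation as an evolution equation -/

theorem hasDerivAt_dx {q : ℝ → ℝ → ℂ} {t : ℝ} (hq : ContDiff ℝ 5 (fun y => q y t)) (x : ℝ) :
    ∀ j ≤ 4, HasDerivAt (fun y => dx j q y t) (dx (j + 1) q x t) x := by
  intro j hj
  have h1 : Differentiable ℝ (iteratedDeriv j fun y => q y t) :=
    hq.differentiable_iteratedDeriv j (by exact_mod_cast Nat.lt_of_le_of_lt hj (by norm_num))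
  have h2 := (h1 x).hasDerivAt
  rwa [← iteratedDeriv_succ] at h2

/-- The left-hand side of the equation in terms of `flow`. -/
theorem equation_eq_flow {ε c : ℝ} {q : ℝ → ℝ → ℂ} {t : ℝ}
    (hq : ContDiff ℝ 5 (fun y => q y t)) (x : ℝ) (qt : ℂ) :
    Complex.I * qt + 2 * ((‖q x t‖ : ℂ) ^ 2 - c) * q x t
      - Complex.I * ε * dx 5 q x t
      - 10 * Complex.I * ε * (‖q x t‖ : ℂ) ^ 2 * dx 3 q x t
      - 20 * Complex.I * ε * dx 1 q x t * conj (q x t) * dx 2 q x t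
      - 30 * Complex.I * ε * (‖q x t‖ : ℂ) ^ 4 * dx 1 q x t
      - 10 * Complex.I * ε * deriv (fun y => (‖dx 1 q y t‖ : ℂ) ^ 2 * q y t) x
      + dx 2 q x t - Complex.I * dx 1 q x t
      = Complex.I * (qt - flow ε c fun j => dx j q x t) := by
  have e0 : ∀ y, dx 0 q y t = q y t := fun y => by simp [dx]
  have h0 : HasDerivAt (fun y => q y t) (dx 1 q x t) x := by
    have := hasDerivAt_dx hq x 0 (by norm_num)
    simpa only [e0] using this
  have h1 := hasDerivAt_dx hq x 1 (by norm_num)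
  have h2 : deriv (fun y => (‖dx 1 q y t‖ : ℂ) ^ 2 * q y t) x
      = (dx 2 q x t * conj (dx 1 q x t) + dx 1 q x t * conj (dx 2 q x t)) * q x t
        + dx 1 q x t * conj (dx 1 q x t) * dx 1 q x t := by
    simp only [← Complex.mul_conj']
    exact ((h1.mul (hasDerivAt_conj h1)).mul h0).deriv
  have h3 : (‖q x t‖ : ℂ) ^ 4 = (q x t * conj (q x t)) ^ 2 := by
    rw [Complex.mul_conj']; ring
  rw [h2, h3, ← Complex.mul_conj']
  simp only [flow, polB1, polB2, polB4, e0]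
  ring_nf
  simp only [Complex.I_sq]
  ring

end Hierarchy

/-! ### Symmetries of the phase -/

theorem kOf_neg_div {q₀ : ℝ} (hq : (q₀ : ℂ) ≠ 0) {z : ℂ} (hz : z ≠ 0) :
    kOf q₀ (-(q₀ : ℂ) ^ 2 / z) = kOf q₀ z := by
  simp only [kOf]; field_simp; ring

theorem lamOf_neg_div {q₀ : ℝ} (hq : (q₀ : ℂ) ≠ 0) {z : ℂ} (hz : z ≠ 0) :
    lamOf q₀ (-(q₀ : ℂ) ^ 2 / z) = -lamOf q₀ z := by
  simp only [lamOf]; field_simp; ring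

theorem theta_neg_div {q₀ : ℝ} (hq : (q₀ : ℂ) ≠ 0) (ε x t : ℝ) {z : ℂ} (hz : z ≠ 0) :
    theta ε q₀ x t (-(q₀ : ℂ) ^ 2 / z) = -theta ε q₀ x t z := by
  simp only [theta, kOf_neg_div hq hz, lamOf_neg_div hq hz]; ring

theorem kOf_conj (q₀ : ℝ) (z : ℂ) : kOf q₀ (conj z) = conj (kOf q₀ z) := by
  simp [kOf, map_ofNat]

theorem lamOf_conj (q₀ : ℝ) (z : ℂ) : lamOf q₀ (conj z) = conj (lamOf q₀ z) := by
  simp [lamOf, map_ofNat]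

theorem theta_conj (ε q₀ x t : ℝ) (z : ℂ) : theta ε q₀ x t (conj z) = conj (theta ε q₀ x t z) := by
  simp [theta, kOf_conj, lamOf_conj, map_ofNat]

/-- The velocity `∂_t θ / λ`. -/
def velocity (ε q₀ : ℝ) (z : ℂ) : ℂ :=
  16 * kOf q₀ z ^ 4 * ε - 8 * kOf q₀ z ^ 2 * (q₀ : ℂ) ^ 2 * ε
    + 2 * kOf q₀ z + 6 * (q₀ : ℂ) ^ 4 * ε + 1

theorem hasDerivAt_theta_x (ε q₀ x t : ℝ) (z : ℂ) :
    HasDerivAt (fun y => theta ε q₀ y t z) (lamOf q₀ z) x := by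
  have := ((Complex.ofRealCLM.hasDerivAt (x := x)).add_const
    ((16 * kOf q₀ z ^ 4 * ε - 8 * kOf q₀ z ^ 2 * (q₀ : ℂ) ^ 2 * ε
    + 2 * kOf q₀ z + 6 * (q₀ : ℂ) ^ 4 * ε + 1) * t)).const_mul (lamOf q₀ z)
  simpa [theta] using this

theorem hasDerivAt_theta_t (ε q₀ x t : ℝ) (z : ℂ) :
    HasDerivAt (fun s => theta ε q₀ x s z) (lamOf q₀ z * velocity ε q₀ z) t := by
  have := (((Complex.ofRealCLM.hasDerivAt (x := t)).const_mul (velocity ε q₀ z)).const_add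
    (x : ℂ)).const_mul (lamOf q₀ z)
  simpa [theta, velocity] using this

theorem im_lamOf (q₀ : ℝ) {z : ℂ} (hz : z ≠ 0) :
    (lamOf q₀ z).im = (‖z‖ ^ 2 - q₀ ^ 2) * z.im / (2 * ‖z‖ ^ 2) := by
  have h1 : ‖z‖ ^ 2 ≠ 0 := pow_ne_zero 2 (norm_ne_zero_iff.2 hz)
  have h2 : ((q₀ : ℂ) ^ 2 / z).im = -(q₀ ^ 2 * z.im / ‖z‖ ^ 2) := by
    rw [← Complex.normSq_eq_norm_sq]
    rw [show ((q₀ : ℂ) ^ 2 / z) = ((q₀ ^ 2 : ℝ) : ℂ) * z⁻¹ by push_cast; rfl, Complex.im_ofReal_mul,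
      Complex.inv_im]
    ring
  rw [lamOf, show ((z + (q₀ : ℂ) ^ 2 / z) / 2) = ((1 / 2 : ℝ) : ℂ) * (z + (q₀ : ℂ) ^ 2 / z) by
    push_cast; ring, Complex.im_ofReal_mul, Complex.add_im, h2]
  field_simp
  ring

theorem im_lamOf_pos {q₀ : ℝ} {z : ℂ} (hz : z ∈ Dplus q₀) : 0 < (lamOf q₀ z).im := by
  have h0 : z ≠ 0 := by rintro rfl; simp [Dplus] at hz
  rw [im_lamOf q₀ h0]
  exact div_pos hz (by positivity)

section Soliton

variable {ι : Type*} {q₀ : ℝ} {qm : ℂ} {η : ι → ℂ} {τ : ι → ι} {ε : ℝ} {C : ι → ℂ}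

/-- `w_j = C_j e^{-2iθ(η̂_j)}`. -/
def expVec (ε q₀ : ℝ) (η C : ι → ℂ) (x t : ℝ) (j : ι) : ℂ :=
  C j * Complex.exp (-2 * Complex.I * theta ε q₀ x t (hat q₀ η j))

namespace IsSpectrum

theorem lamOf_hat (h : IsSpectrum q₀ qm η τ) (j : ι) :
    lamOf q₀ (hat q₀ η j) = (hat q₀ η j - η j) / 2 := by
  have : (q₀ : ℂ) ^ 2 / hat q₀ η j = -η j := by
    rw [div_eq_iff (h.hat_ne j)]; linear_combination h.hat_mul_eta j
  rw [lamOf, this]; ring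

theorem kOf_hat (h : IsSpectrum q₀ qm η τ) (j : ι) :
    kOf q₀ (hat q₀ η j) = (hat q₀ η j + η j) / 2 := by
  have : (q₀ : ℂ) ^ 2 / hat q₀ η j = -η j := by
    rw [div_eq_iff (h.hat_ne j)]; linear_combination h.hat_mul_eta j
  rw [kOf, this]; ring

theorem conj_lamOf_hat (h : IsSpectrum q₀ qm η τ) (j : ι) :
    conj (lamOf q₀ (hat q₀ η (τ j))) = -lamOf q₀ (hat q₀ η j) := by
  rw [← lamOf_conj, h.conj_hat, h.tau_tau]
  rw [hat, lamOf_neg_div h.q₀_ne (h.eta_ne j), neg_neg]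

theorem conj_kOf_hat (h : IsSpectrum q₀ qm η τ) (j : ι) :
    conj (kOf q₀ (hat q₀ η (τ j))) = kOf q₀ (hat q₀ η j) := by
  rw [← kOf_conj, h.conj_hat, h.tau_tau]
  rw [hat, kOf_neg_div h.q₀_ne (h.eta_ne j)]

theorem admissible_expVec (h : IsSpectrum q₀ qm η τ) (hC : Admissible qm η τ C) (x t : ℝ) :
    Admissible qm η τ (expVec ε q₀ η C x t) where
  ne_zero j := mul_ne_zero (hC.ne_zero j) (Complex.exp_ne_zero _)
  conj_eq j := by
    have h1 : conj (theta ε q₀ x t (hat q₀ η j)) = -theta ε q₀ x t (hat q₀ η (τ j)) := by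
      rw [← theta_conj, h.conj_hat]
      conv_rhs => rw [hat, theta_neg_div h.q₀_ne _ _ _ (h.eta_ne _), neg_neg]
    simp only [expVec, map_mul, hC.conj_eq, ← Complex.exp_conj, h1, map_neg, Complex.conj_I,
      map_ofNat]
    ring_nf

theorem norm_expVec (x t : ℝ) (j : ι) :
    ‖expVec ε q₀ η C x t j‖ = ‖C j‖ * Real.exp (2 * (theta ε q₀ x t (hat q₀ η j)).im) := by
  rw [expVec, norm_mul, Complex.norm_exp]
  congr 2
  simp [mul_assoc]

theorem im_theta (x t : ℝ) (z : ℂ) : (theta ε q₀ x t z).im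
    = (lamOf q₀ z).im * x + (lamOf q₀ z * velocity ε q₀ z).im * t := by
  have : theta ε q₀ x t z = (x : ℂ) * lamOf q₀ z + (t : ℂ) * (lamOf q₀ z * velocity ε q₀ z) := by
    simp only [theta, velocity]; ring
  rw [this, Complex.add_im, Complex.im_ofReal_mul, Complex.im_ofReal_mul]; ring

theorem hasDerivAt_expVec_x (h : IsSpectrum q₀ qm η τ) (x t : ℝ) (j : ι) :
    HasDerivAt (fun y => expVec ε q₀ η C y t j)
      (-Complex.I * (hat q₀ η j - η j) * expVec ε q₀ η C x t j) x := by
  refine ((((hasDerivAt_theta_x ε q₀ x t (hat q₀ η j)).const_mul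
    (-2 * Complex.I)).cexp).const_mul (C j)).congr_deriv ?_
  rw [h.lamOf_hat, expVec]; ring

theorem hasDerivAt_expVec_t (x t : ℝ) (j : ι) :
    HasDerivAt (fun s => expVec ε q₀ η C x s j)
      (-2 * Complex.I * lamOf q₀ (hat q₀ η j) * velocity ε q₀ (hat q₀ η j)
        * expVec ε q₀ η C x t j) t := by
  refine ((((hasDerivAt_theta_t ε q₀ x t (hat q₀ η j)).const_mul
    (-2 * Complex.I)).cexp).const_mul (C j)).congr_deriv ?_
  rw [expVec]; ring

theorem contDiff_expVec {n : WithTop ℕ∞} (j : ι) :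
    ContDiff ℝ n (fun p : ℝ × ℝ => expVec ε q₀ η C p.1 p.2 j) := by
  have h1 : ContDiff ℝ n (fun p : ℝ × ℝ => ((p.1 : ℝ) : ℂ)) :=
    Complex.ofRealCLM.contDiff.comp contDiff_fst
  have h2 : ContDiff ℝ n (fun p : ℝ × ℝ => ((p.2 : ℝ) : ℂ)) :=
    Complex.ofRealCLM.contDiff.comp contDiff_snd
  simp only [expVec, theta]
  exact contDiff_const.mul (contDiff_const.mul (contDiff_const.mul
    (h1.add (contDiff_const.mul h2)))).cexp

variable [Fintype ι] [DecidableEq ι]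

/-- The moments `2 ∑ λ k^i w X₁²` of the squared eigenfunctions. -/
def _root_.IfoNLS.momentB (q₀ : ℝ) (qm : ℂ) (η w : ι → ℂ) (i : ℕ) : ℂ :=
  ∑ j, 2 * lamOf q₀ (hat q₀ η j) * kOf q₀ (hat q₀ η j) ^ i * (w j * sol₁ q₀ qm η w j ^ 2)

/-- The moments `2 ∑ λ k^i w X₁ X₂` of the squared eigenfunctions. -/
def _root_.IfoNLS.momentA (q₀ : ℝ) (qm : ℂ) (η w : ι → ℂ) (i : ℕ) : ℂ :=
  ∑ j, 2 * lamOf q₀ (hat q₀ η j) * kOf q₀ (hat q₀ η j) ^ i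
    * (w j * (sol₁ q₀ qm η w j * sol₂ q₀ qm η w j))

theorem conj_momentB (h : IsSpectrum q₀ qm η τ) {w : ι → ℂ} (hw : Admissible qm η τ w) (i : ℕ) :
    conj (momentB q₀ qm η w i) = -∑ j, 2 * lamOf q₀ (hat q₀ η j) * kOf q₀ (hat q₀ η j) ^ i
      * (w j * sol₂ q₀ qm η w j ^ 2) := by
  rw [momentB, map_sum, ← h.tau_bijective.sum_comp, ← Finset.sum_neg_distrib]
  refine Finset.sum_congr rfl fun j _ => ?_
  simp only [map_mul, map_pow, map_ofNat, h.conj_lamOf_hat, h.conj_kOf_hat, h.conj_w hw,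
    h.conj_sol₁ hw]
  have h1 := h.eta_ne j
  have h2 := h.qm_ne
  field_simp
  rw [Complex.I_sq]; ring

section
variable {x t : ℝ}

theorem hasDerivAt_sq (h : IsSpectrum q₀ qm η τ) (hC : Admissible qm η τ C) (j : ι) :
    HasDerivAt (fun y => expVec ε q₀ η C y t j * sol₁ q₀ qm η (expVec ε q₀ η C y t) j ^ 2)
      (-2 * Complex.I * kOf q₀ (hat q₀ η j)
        * (expVec ε q₀ η C x t j * sol₁ q₀ qm η (expVec ε q₀ η C x t) j ^ 2)
        + 2 * potential q₀ qm η (expVec ε q₀ η C x t) * (expVec ε q₀ η C x t j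
          * (sol₁ q₀ qm η (expVec ε q₀ η C x t) j * sol₂ q₀ qm η (expVec ε q₀ η C x t) j))) x := by
  have hw := fun y => h.admissible_expVec (ε := ε) hC y t
  have hw1 : ∀ j, ContDiffAt ℝ 1 (fun y => expVec ε q₀ η C y t j) x := fun j =>
    ((contDiff_expVec j).comp (contDiff_id.prodMk contDiff_const)).contDiffAt
  have hd := fun j => h.hasDerivAt_expVec_x (ε := ε) (C := C) x t j
  refine ((hd j).mul ((h.hasDerivAt_sol₁ hw hw1 hd j).pow 2)).congr_deriv ?_
  rw [h.kOf_hat]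
  simp only [Pi.pow_apply]
  ring

theorem hasDerivAt_prod (h : IsSpectrum q₀ qm η τ) (hC : Admissible qm η τ C) (j : ι) :
    HasDerivAt (fun y => expVec ε q₀ η C y t j * (sol₁ q₀ qm η (expVec ε q₀ η C y t) j
        * sol₂ q₀ qm η (expVec ε q₀ η C y t) j))
      (potential q₀ qm η (expVec ε q₀ η C x t) * (expVec ε q₀ η C x t j
          * sol₂ q₀ qm η (expVec ε q₀ η C x t) j ^ 2)
        - conj (potential q₀ qm η (expVec ε q₀ η C x t)) * (expVec ε q₀ η C x t j
          * sol₁ q₀ qm η (expVec ε q₀ η C x t) j ^ 2)) x := by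
  have hw := fun y => h.admissible_expVec (ε := ε) hC y t
  have hw1 : ∀ j, ContDiffAt ℝ 1 (fun y => expVec ε q₀ η C y t j) x := fun j =>
    ((contDiff_expVec j).comp (contDiff_id.prodMk contDiff_const)).contDiffAt
  have hd := fun j => h.hasDerivAt_expVec_x (ε := ε) (C := C) x t j
  refine ((hd j).mul ((h.hasDerivAt_sol₁ hw hw1 hd j).mul
    (h.hasDerivAt_sol₂ hw hw1 hd j))).congr_deriv ?_
  simp only [Pi.mul_apply]
  ring

theorem hasDerivAt_momentB (h : IsSpectrum q₀ qm η τ) (hC : Admissible qm η τ C) (i : ℕ) :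
    HasDerivAt (fun y => momentB q₀ qm η (expVec ε q₀ η C y t) i)
      (-2 * Complex.I * momentB q₀ qm η (expVec ε q₀ η C x t) (i + 1)
        + 2 * potential q₀ qm η (expVec ε q₀ η C x t)
          * momentA q₀ qm η (expVec ε q₀ η C x t) i) x := by
  simp only [momentB]
  refine (HasDerivAt.fun_sum fun j _ => (h.hasDerivAt_sq hC j).const_mul _).congr_deriv ?_
  rw [momentA, Finset.mul_sum, Finset.mul_sum, ← Finset.sum_add_distrib]
  exact Finset.sum_congr rfl fun j _ => by ring

theorem hasDerivAt_momentA (h : IsSpectrum q₀ qm η τ) (hC : Admissible qm η τ C) (i : ℕ) :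
    HasDerivAt (fun y => momentA q₀ qm η (expVec ε q₀ η C y t) i)
      (-(potential q₀ qm η (expVec ε q₀ η C x t)
          * conj (momentB q₀ qm η (expVec ε q₀ η C x t) i)
        + conj (potential q₀ qm η (expVec ε q₀ η C x t))
          * momentB q₀ qm η (expVec ε q₀ η C x t) i)) x := by
  rw [h.conj_momentB (h.admissible_expVec hC x t)]
  simp only [momentA]
  refine (HasDerivAt.fun_sum fun j _ => (h.hasDerivAt_prod hC j).const_mul _).congr_deriv ?_
  rw [momentB, mul_neg, Finset.mul_sum, Finset.mul_sum, neg_add, neg_neg, ← sub_eq_add_neg,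
    ← Finset.sum_sub_distrib]
  exact Finset.sum_congr rfl fun j _ => by ring

theorem hasDerivAt_potential_x (h : IsSpectrum q₀ qm η τ) (hC : Admissible qm η τ C) :
    HasDerivAt (fun y => potential q₀ qm η (expVec ε q₀ η C y t))
      (momentB q₀ qm η (expVec ε q₀ η C x t) 0) x := by
  refine (h.hasDerivAt_potential (fun y => h.admissible_expVec (ε := ε) hC y t) (fun j =>
    ((contDiff_expVec j).comp (contDiff_id.prodMk contDiff_const)).contDiffAt)
    (fun j => h.hasDerivAt_expVec_x x t j)).congr_deriv ?_
  rw [momentB, Finset.mul_sum]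
  refine Finset.sum_congr rfl fun j _ => ?_
  rw [h.lamOf_hat]
  linear_combination (-(hat q₀ η j - η j) * (expVec ε q₀ η C x t j
    * sol₁ q₀ qm η (expVec ε q₀ η C x t) j ^ 2)) * Complex.I_sq

theorem hasDerivAt_potential_t (h : IsSpectrum q₀ qm η τ) (hC : Admissible qm η τ C) :
    HasDerivAt (fun s => potential q₀ qm η (expVec ε q₀ η C x s))
      (16 * ε * momentB q₀ qm η (expVec ε q₀ η C x t) 4
        - 8 * (q₀ : ℂ) ^ 2 * ε * momentB q₀ qm η (expVec ε q₀ η C x t) 2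
        + 2 * momentB q₀ qm η (expVec ε q₀ η C x t) 1
        + (6 * (q₀ : ℂ) ^ 4 * ε + 1) * momentB q₀ qm η (expVec ε q₀ η C x t) 0) t := by
  refine (h.hasDerivAt_potential (fun y => h.admissible_expVec (ε := ε) hC x y) (fun j =>
    ((contDiff_expVec j).comp (contDiff_const.prodMk contDiff_id)).contDiffAt)
    (fun j => hasDerivAt_expVec_t x t j)).congr_deriv ?_
  simp only [momentB, Finset.mul_sum]
  rw [← Finset.sum_sub_distrib, ← Finset.sum_add_distrib, ← Finset.sum_add_distrib]
  refine Finset.sum_congr rfl fun j _ => ?_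
  have hv : velocity ε q₀ (hat q₀ η j) = 16 * kOf q₀ (hat q₀ η j) ^ 4 * ε
    - 8 * kOf q₀ (hat q₀ η j) ^ 2 * (q₀ : ℂ) ^ 2 * ε + 2 * kOf q₀ (hat q₀ η j)
    + 6 * (q₀ : ℂ) ^ 4 * ε + 1 := rfl
  linear_combination (2 * lamOf q₀ (hat q₀ η j)
    * (expVec ε q₀ η C x t j * sol₁ q₀ qm η (expVec ε q₀ η C x t) j ^ 2)) * hv + (-2 * lamOf q₀ (hat q₀ η j) * velocity ε q₀ (hat q₀ η j)
    * (expVec ε q₀ η C x t j * sol₁ q₀ qm η (expVec ε q₀ η C x t) j ^ 2)) * Complex.I_sq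
end

end IsSpectrum
end Soliton

/-! ### Asymptotics of the potential -/

section Asymptotics

theorem integrableOn_moment_Iic {f : ℝ → ℂ} (hf : Continuous f) {a : ℝ} (ha : 0 < a)
    (hO : f =O[atBot] fun x => Real.exp (a * x)) :
    IntegrableOn (fun x : ℝ => (1 + x ^ 2) * ‖f x‖) (Set.Iic 0) := by
  have hc : Continuous fun x : ℝ => (1 + x ^ 2) * ‖f x‖ := by fun_prop
  refine (hc.locallyIntegrable.locallyIntegrableOn _).integrableOn_of_isBigO_atBot
    (g := fun x : ℝ => (1 + x ^ 2)⁻¹) ?_ (integrable_inv_one_add_sq.integrableAtFilter _)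
  have h1 : (fun x : ℝ => Real.exp (a * x)) =O[atBot] fun x : ℝ => ((1 + x ^ 2) ^ 2)⁻¹ := by
    have h2 : (fun x : ℝ => (1 + x ^ 2) ^ 2) =O[atTop] fun x => Real.exp (a * x) := by
      have h3 := isLittleO_pow_exp_pos_mul_atTop 0 ha
      have h4 := isLittleO_pow_exp_pos_mul_atTop 2 ha
      have h5 := isLittleO_pow_exp_pos_mul_atTop 4 ha
      have h6 := ((h3.add (h4.const_mul_left 2)).add h5).isBigO
      refine h6.congr_left fun x => ?_
      ring
    have h7 := h2.inv_rev (Eventually.of_forall fun x h0 => absurd h0 (by positivity))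
    have h8 := h7.comp_tendsto tendsto_neg_atBot_atTop
    refine h8.congr (fun x => ?_) (fun x => ?_)
    · simp [← Real.exp_neg]
    · simp
  have h9 := (Asymptotics.isBigO_refl (fun x : ℝ => 1 + x ^ 2) atBot).mul (hO.norm_left.trans h1)
  refine h9.congr_right fun x => ?_
  have : (1 + x ^ 2 : ℝ) ≠ 0 := by positivity
  field_simp

theorem integrableOn_moment_Ici {f : ℝ → ℂ} (hf : Continuous f) {a : ℝ} (ha : 0 < a)
    (hO : f =O[atTop] fun x => Real.exp (-(a * x))) :
    IntegrableOn (fun x : ℝ => (1 + x ^ 2) * ‖f x‖) (Set.Ici 0) := by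
  have h1 := integrableOn_moment_Iic (f := fun x => f (-x)) (by fun_prop) ha
    ((hO.comp_tendsto tendsto_neg_atBot_atTop).congr_right fun x => by simp)
  have h2 := h1.comp_neg
  simpa using h2

variable {ι : Type*} [Fintype ι] [DecidableEq ι] {q₀ : ℝ} {qm : ℂ} {η : ι → ℂ} {τ : ι → ι}

/-- The matrix `G` with the factor `w_j` removed from the `j`-th column, in terms of
`ω_j = 1 / w_j`. At `ω = 0` it is the Cauchy matrix. -/
def cmatInv (q₀ : ℝ) (qm : ℂ) (η ω : ι → ℂ) : Matrix ι ι ℂ :=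
  Matrix.of fun s j => 1 / (η s - hat q₀ η j) + if s = j then Complex.I * qm / η s * ω s else 0

theorem cmatInv_mulVec (q₀ : ℝ) (qm : ℂ) (η ω Y : ι → ℂ) (s : ι) :
    (cmatInv q₀ qm η ω).mulVec Y s =
      ∑ j, Y j / (η s - hat q₀ η j) + Complex.I * qm / η s * ω s * Y s := by
  simp only [cmatInv, Matrix.mulVec, dotProduct, Matrix.of_apply, add_mul, Finset.sum_add_distrib,
    ite_mul, zero_mul, Finset.sum_ite_eq, Finset.mem_univ, if_true]
  congr 1
  exact Finset.sum_congr rfl fun j _ => by ring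

theorem cmatInv_mul_diagonal {w : ι → ℂ} (hw : ∀ j, w j ≠ 0) :
    cmatInv q₀ qm η (fun j => (w j)⁻¹) * Matrix.diagonal w = cmat q₀ qm η w := by
  ext s j
  rw [Matrix.mul_diagonal, cmatInv, cmat, Matrix.of_apply, Matrix.of_apply]
  split_ifs with hsj
  · subst hsj
    have := hw s
    field_simp
  · ring

theorem mul_inv_mulVec {w b : ι → ℂ} (hw : ∀ j, w j ≠ 0) (j : ι) :
    w j * (cmat q₀ qm η w)⁻¹.mulVec b j
      = (cmatInv q₀ qm η fun j => (w j)⁻¹)⁻¹.mulVec b j := by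
  have hd : IsUnit (Matrix.diagonal w).det := by
    rw [Matrix.det_diagonal, isUnit_iff_ne_zero]
    exact Finset.prod_ne_zero_iff.2 fun j _ => hw j
  have h1 : (cmatInv q₀ qm η fun j => (w j)⁻¹)⁻¹
      = Matrix.diagonal w * (cmat q₀ qm η w)⁻¹ := by
    rw [← cmatInv_mul_diagonal hw, Matrix.mul_inv_rev, ← Matrix.mul_assoc,
      Matrix.mul_nonsing_inv _ hd, Matrix.one_mul]
  rw [h1, ← Matrix.mulVec_mulVec, Matrix.mulVec_diagonal]

namespace IsSpectrum

theorem cmat_zero_det (h : IsSpectrum q₀ qm η τ) : (cmat q₀ qm η 0).det ≠ 0 := fun h0 => by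
  obtain ⟨Y, hY, h1⟩ := Matrix.exists_mulVec_eq_zero_iff.2 h0
  apply hY
  funext s
  have := congrFun h1 s
  rw [cmat_mulVec] at this
  have h2 := h.eta_ne s
  have h3 := h.qm_ne
  simpa [h2, h3] using this

theorem cmatInv_zero_det (h : IsSpectrum q₀ qm η τ) : (cmatInv q₀ qm η 0).det ≠ 0 := fun h0 => by
  obtain ⟨Y, hY, h1⟩ := Matrix.exists_mulVec_eq_zero_iff.2 h0
  apply hY
  refine eq_zero_of_cauchy h.hat_inj h.inj (fun s j => h.eta_ne_hat s j) Y fun s => ?_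
  have := congrFun h1 s
  rw [cmatInv_mulVec] at this
  simpa using this

theorem contDiffAt_left (h : IsSpectrum q₀ qm η τ) (b : ι → ℂ) (j : ι) :
    ContDiffAt ℝ 1 (fun w : ι → ℂ => (cmat q₀ qm η w)⁻¹.mulVec b j) 0 :=
  contDiffAt_inv_mulVec b (contDiffAt_cmat q₀ qm η fun j => (contDiff_apply ℝ ℂ j).contDiffAt)
    h.cmat_zero_det j

theorem contDiffAt_right (h : IsSpectrum q₀ qm η τ) (b : ι → ℂ) (j : ι) :
    ContDiffAt ℝ 1 (fun ω : ι → ℂ => (cmatInv q₀ qm η ω)⁻¹.mulVec b j) 0 := by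
  refine contDiffAt_inv_mulVec b (fun s i => ?_) h.cmatInv_zero_det j
  simp only [cmatInv, Matrix.of_apply]
  refine contDiffAt_const.add ?_
  split_ifs
  · exact contDiffAt_const.mul (contDiff_apply ℝ ℂ s).contDiffAt
  · exact contDiffAt_const

theorem sol₁_zero (h : IsSpectrum q₀ qm η τ) (j : ι) : sol₁ q₀ qm η 0 j = 1 := by
  have h1 : (cmat q₀ qm η 0).mulVec (sol₁ q₀ qm η 0) j = Complex.I * qm / η j := by
    rw [sol₁, Matrix.mulVec_mulVec,
      Matrix.mul_nonsing_inv _ (isUnit_iff_ne_zero.2 h.cmat_zero_det), Matrix.one_mulVec]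
  rw [cmat_mulVec] at h1
  have h2 : Complex.I * qm / η j ≠ 0 :=
    div_ne_zero (mul_ne_zero Complex.I_ne_zero h.qm_ne) (h.eta_ne j)
  simpa [h2] using h1

/-- The limit of `w_j X_j` as all `w_j` tend to infinity. -/
def _root_.IfoNLS.limVec (q₀ : ℝ) (η : ι → ℂ) (qm : ℂ) (b : ι → ℂ) : ι → ℂ :=
  (cmatInv q₀ qm η 0)⁻¹.mulVec b

/-- The boundary value `q_+`. -/
def _root_.IfoNLS.qPlus (q₀ : ℝ) (qm : ℂ) (η : ι → ℂ) : ℂ :=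
  qm + Complex.I * ∑ j, limVec q₀ η qm (fun j => Complex.I * qm / η j) j

section
variable {α : Type*} {l : Filter α} {w : α → ι → ℂ}

theorem tendsto_sol₁_left (h : IsSpectrum q₀ qm η τ) (hw : Tendsto w l (𝓝 0)) (j : ι) :
    Tendsto (fun y => sol₁ q₀ qm η (w y) j) l (𝓝 1) := by
  have := (h.contDiffAt_left (fun j => Complex.I * qm / η j) j).continuousAt.tendsto.comp hw
  rwa [show (cmat q₀ qm η 0)⁻¹.mulVec (fun j => Complex.I * qm / η j) j = 1 from
    h.sol₁_zero j] at this

theorem tendsto_sol₂_left (h : IsSpectrum q₀ qm η τ) (hw : Tendsto w l (𝓝 0)) (j : ι) :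
    Tendsto (fun y => sol₂ q₀ qm η (w y) j) l (𝓝 (sol₂ q₀ qm η 0 j)) :=
  (h.contDiffAt_left (fun _ => -1) j).continuousAt.tendsto.comp hw

theorem tendsto_potential_left (h : IsSpectrum q₀ qm η τ) (hw : Tendsto w l (𝓝 0)) :
    Tendsto (fun y => potential q₀ qm η (w y)) l (𝓝 qm) := by
  have h1 := tendsto_finsetSum Finset.univ fun j _ =>
    ((tendsto_pi_nhds.1 hw j).mul (h.tendsto_sol₁_left hw j))
  simpa [potential] using (h1.const_mul Complex.I).const_add qm

theorem tendsto_momentB_left (h : IsSpectrum q₀ qm η τ) (hw : Tendsto w l (𝓝 0)) (i : ℕ) :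
    Tendsto (fun y => momentB q₀ qm η (w y) i) l (𝓝 0) := by
  have h1 := tendsto_finsetSum Finset.univ fun j _ => (((tendsto_pi_nhds.1 hw j).mul
    ((h.tendsto_sol₁_left hw j).pow 2)).const_mul
      (2 * lamOf q₀ (hat q₀ η j) * kOf q₀ (hat q₀ η j) ^ i))
  simpa [momentB] using h1

theorem tendsto_momentA_left (h : IsSpectrum q₀ qm η τ) (hw : Tendsto w l (𝓝 0)) (i : ℕ) :
    Tendsto (fun y => momentA q₀ qm η (w y) i) l (𝓝 0) := by
  have h1 := tendsto_finsetSum Finset.univ fun j _ => (((tendsto_pi_nhds.1 hw j).mul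
    ((h.tendsto_sol₁_left hw j).mul (h.tendsto_sol₂_left hw j))).const_mul
      (2 * lamOf q₀ (hat q₀ η j) * kOf q₀ (hat q₀ η j) ^ i))
  simpa [momentA] using h1

variable (hne : ∀ y j, w y j ≠ 0)

theorem tendsto_mul_right (h : IsSpectrum q₀ qm η τ) (hne : ∀ y j, w y j ≠ 0)
    (hw : Tendsto (fun y j => (w y j)⁻¹) l (𝓝 0)) (b : ι → ℂ) (j : ι) :
    Tendsto (fun y => w y j * (cmat q₀ qm η (w y))⁻¹.mulVec b j) l (𝓝 (limVec q₀ η qm b j)) := by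
  simp only [fun y => mul_inv_mulVec (q₀ := q₀) (qm := qm) (η := η) (b := b) (hne y) j]
  exact (h.contDiffAt_right b j).continuousAt.tendsto.comp hw

theorem tendsto_potential_right (h : IsSpectrum q₀ qm η τ) (hne : ∀ y j, w y j ≠ 0)
    (hw : Tendsto (fun y j => (w y j)⁻¹) l (𝓝 0)) :
    Tendsto (fun y => potential q₀ qm η (w y)) l (𝓝 (qPlus q₀ qm η)) :=
  ((tendsto_finsetSum Finset.univ fun j _ =>
    h.tendsto_mul_right hne hw _ j).const_mul Complex.I).const_add qm

theorem tendsto_quadratic_right (h : IsSpectrum q₀ qm η τ) (hne : ∀ y j, w y j ≠ 0)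
    (hw : Tendsto (fun y j => (w y j)⁻¹) l (𝓝 0)) (b b' : ι → ℂ) (j : ι) :
    Tendsto (fun y => w y j * ((cmat q₀ qm η (w y))⁻¹.mulVec b j
      * (cmat q₀ qm η (w y))⁻¹.mulVec b' j)) l (𝓝 0) := by
  have h1 := (tendsto_pi_nhds.1 hw j).mul
    ((h.tendsto_mul_right hne hw b j).mul (h.tendsto_mul_right hne hw b' j))
  rw [Pi.zero_apply, zero_mul] at h1
  refine h1.congr fun y => ?_
  have := hne y j
  field_simp

theorem tendsto_momentB_right (h : IsSpectrum q₀ qm η τ) (hne : ∀ y j, w y j ≠ 0)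
    (hw : Tendsto (fun y j => (w y j)⁻¹) l (𝓝 0)) (i : ℕ) :
    Tendsto (fun y => momentB q₀ qm η (w y) i) l (𝓝 0) := by
  have h1 := tendsto_finsetSum Finset.univ fun j _ => ((h.tendsto_quadratic_right hne hw
    (fun j => Complex.I * qm / η j) (fun j => Complex.I * qm / η j) j).const_mul
      (2 * lamOf q₀ (hat q₀ η j) * kOf q₀ (hat q₀ η j) ^ i))
  simp only [mul_zero, Finset.sum_const_zero] at h1
  simpa only [momentB, sol₁, sq] using h1

theorem tendsto_momentA_right (h : IsSpectrum q₀ qm η τ) (hne : ∀ y j, w y j ≠ 0)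
    (hw : Tendsto (fun y j => (w y j)⁻¹) l (𝓝 0)) (i : ℕ) :
    Tendsto (fun y => momentA q₀ qm η (w y) i) l (𝓝 0) := by
  have h1 := tendsto_finsetSum Finset.univ fun j _ => ((h.tendsto_quadratic_right hne hw
    (fun j => Complex.I * qm / η j) (fun _ => -1) j).const_mul
      (2 * lamOf q₀ (hat q₀ η j) * kOf q₀ (hat q₀ η j) ^ i))
  simp only [mul_zero, Finset.sum_const_zero] at h1
  simpa only [momentA, sol₁, sol₂] using h1

end

variable {ε : ℝ} {C : ι → ℂ}

theorem tendsto_expVec (h : IsSpectrum q₀ qm η τ) (t₀ : ℝ) :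
    Tendsto (fun p : ℝ × ℝ => expVec ε q₀ η C p.1 p.2) (atBot ×ˢ 𝓝 t₀) (𝓝 0) := by
  rw [tendsto_pi_nhds]
  intro j
  rw [Pi.zero_apply, tendsto_zero_iff_norm_tendsto_zero]
  simp only [norm_expVec, im_theta]
  have h1 : Tendsto (fun p : ℝ × ℝ => 2 * ((lamOf q₀ (hat q₀ η j)).im * p.1
      + (lamOf q₀ (hat q₀ η j) * velocity ε q₀ (hat q₀ η j)).im * p.2)) (atBot ×ˢ 𝓝 t₀) atBot := by
    refine Tendsto.const_mul_atBot two_pos (Tendsto.atBot_add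
      (tendsto_fst.const_mul_atBot (im_lamOf_pos (h.hat_mem j))) (tendsto_snd.const_mul _))
  simpa using (Real.tendsto_exp_atBot.comp h1).const_mul ‖C j‖

theorem tendsto_inv_expVec (h : IsSpectrum q₀ qm η τ) (t₀ : ℝ) :
    Tendsto (fun (p : ℝ × ℝ) j => (expVec ε q₀ η C p.1 p.2 j)⁻¹) (atTop ×ˢ 𝓝 t₀) (𝓝 0) := by
  rw [tendsto_pi_nhds]
  intro j
  rw [Pi.zero_apply, tendsto_zero_iff_norm_tendsto_zero]
  simp only [norm_inv, norm_expVec, im_theta, mul_inv, ← Real.exp_neg]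
  have h1 : Tendsto (fun p : ℝ × ℝ => 2 * ((lamOf q₀ (hat q₀ η j)).im * p.1
      + (lamOf q₀ (hat q₀ η j) * velocity ε q₀ (hat q₀ η j)).im * p.2)) (atTop ×ˢ 𝓝 t₀) atTop := by
    refine Tendsto.const_mul_atTop two_pos (Tendsto.atTop_add
      (tendsto_fst.const_mul_atTop (im_lamOf_pos (h.hat_mem j))) (tendsto_snd.const_mul _))
  simpa using (Real.tendsto_exp_neg_atTop_nhds_zero.comp h1).const_mul ‖C j‖⁻¹

/-- The soliton potential. -/
def _root_.IfoNLS.sol (ε q₀ : ℝ) (qm : ℂ) (η C : ι → ℂ) (x t : ℝ) : ℂ :=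
  potential q₀ qm η (expVec ε q₀ η C x t)

theorem contDiff_sol (h : IsSpectrum q₀ qm η τ) (hC : Admissible qm η τ C) {n : WithTop ℕ∞} :
    ContDiff ℝ n (Function.uncurry (sol ε q₀ qm η C)) := by
  rw [contDiff_iff_contDiffAt]
  intro p
  exact h.contDiffAt_potential (fun j => (contDiff_expVec j).contDiffAt)
    (h.admissible_expVec hC p.1 p.2)

theorem contDiff_sol_x (h : IsSpectrum q₀ qm η τ) (hC : Admissible qm η τ C) {n : WithTop ℕ∞}
    (t : ℝ) : ContDiff ℝ n (fun x => sol ε q₀ qm η C x t) :=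
  (h.contDiff_sol (ε := ε) hC (n := n)).comp
    (g := Function.uncurry (sol ε q₀ qm η C)) (f := fun x : ℝ => (x, t))
    (contDiff_id.prodMk contDiff_const)

theorem tendsto_prod_mk {l : Filter ℝ} (t : ℝ) : Tendsto (fun x : ℝ => (x, t)) l (l ×ˢ 𝓝 t) :=
  tendsto_id.prodMk tendsto_const_nhds

theorem dx_one_sol (h : IsSpectrum q₀ qm η τ) (hC : Admissible qm η τ C) (x t : ℝ) :
    dx 1 (sol ε q₀ qm η C) x t = momentB q₀ qm η (expVec ε q₀ η C x t) 0 := by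
  rw [dx, iteratedDeriv_one]
  exact (h.hasDerivAt_potential_x hC).deriv

theorem moments_eq (h : IsSpectrum q₀ qm η τ) (hC : Admissible qm η τ C) (x t : ℝ) :
    momentA q₀ qm η (expVec ε q₀ η C x t) 0
        = polA0 (q₀ ^ 2) (fun j => dx j (sol ε q₀ qm η C) x t) ∧
      momentB q₀ qm η (expVec ε q₀ η C x t) 1
        = polB1 (q₀ ^ 2) (fun j => dx j (sol ε q₀ qm η C) x t) ∧
      momentB q₀ qm η (expVec ε q₀ η C x t) 2
        = polB2 (q₀ ^ 2) (fun j => dx j (sol ε q₀ qm η C) x t) ∧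
      momentB q₀ qm η (expVec ε q₀ η C x t) 3
        = polB3 (q₀ ^ 2) (fun j => dx j (sol ε q₀ qm η C) x t) ∧
      momentB q₀ qm η (expVec ε q₀ η C x t) 4
        = polB4 (q₀ ^ 2) (fun j => dx j (sol ε q₀ qm η C) x t) := by
  have e0 : ∀ y, dx 0 (sol ε q₀ qm η C) y t = potential q₀ qm η (expVec ε q₀ η C y t) :=
    fun y => by simp [dx, sol]
  have hw := (h.tendsto_expVec (ε := ε) (C := C) t).comp (tendsto_prod_mk t)
  refine eq_pol_of_recursion (J := fun y j => dx j (sol ε q₀ qm η C) y t) (a := qm)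
    (A := fun i y => momentA q₀ qm η (expVec ε q₀ η C y t) i)
    (B := fun i y => momentB q₀ qm η (expVec ε q₀ η C y t) i)
    (by rw [h.qm_mul_conj]; push_cast; rfl) (fun y => hasDerivAt_dx (h.contDiff_sol_x hC t) y)
    ?_ (fun y => (h.dx_one_sol hC y t).symm) (fun i y => ?_) (fun i y => ?_)
    (fun i => h.tendsto_momentB_left hw i) (fun i => h.tendsto_momentA_left hw i) x
  · simp only [e0]
    exact h.tendsto_potential_left hw
  · simp only [e0]
    exact h.hasDerivAt_momentB hC i
  · simp only [e0]
    exact h.hasDerivAt_momentA hC i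

theorem isSolution_sol (h : IsSpectrum q₀ qm η τ) (hC : Admissible qm η τ C) :
    IsSolution ε (q₀ ^ 2) (sol ε q₀ qm η C) := by
  refine ⟨h.contDiff_sol hC, fun x t => ?_⟩
  have h1 := h.hasDerivAt_potential_t (ε := ε) (x := x) (t := t) hC
  have h2 : deriv (fun s => sol ε q₀ qm η C x s) t
      = flow ε (q₀ ^ 2 : ℝ) (fun j => dx j (sol ε q₀ qm η C) x t) := by
    obtain ⟨-, e1, e2, -, e4⟩ := h.moments_eq (ε := ε) hC x t
    rw [show (fun s => sol ε q₀ qm η C x s) = fun s => potential q₀ qm η (expVec ε q₀ η C x s) from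
      rfl, h1.deriv, e1, e2, e4, ← h.dx_one_sol hC, flow]
    push_cast
    ring
  have h3 := equation_eq_flow (ε := ε) (c := q₀ ^ 2) (h.contDiff_sol_x (ε := ε) hC t) x
    (deriv (fun s => sol ε q₀ qm η C x s) t)
  rw [h2] at h3 ⊢
  rw [h3, sub_self, mul_zero]

theorem qPlus_mul_conj (h : IsSpectrum q₀ qm η τ) (hC : Admissible qm η τ C) :
    qPlus q₀ qm η * conj (qPlus q₀ qm η) = (q₀ : ℂ) ^ 2 := by
  have hw := (h.tendsto_inv_expVec (ε := 0) (C := C) 0).comp (tendsto_prod_mk 0)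
  have hne : ∀ (x : ℝ) j, expVec 0 q₀ η C x 0 j ≠ 0 := fun x j =>
    (h.admissible_expVec hC x 0).ne_zero j
  have h1 := h.tendsto_momentA_right hne hw 0
  have h2 := h.tendsto_potential_right hne hw
  have h3 := (h2.mul (tendsto_conj h2)).const_sub ((q₀ : ℂ) ^ 2)
  have h4 := tendsto_nhds_unique (h3.congr fun x => ?_) h1
  · linear_combination -h4
  · rw [(h.moments_eq (ε := 0) hC x 0).1, polA0]
    simp [dx, sol]

theorem norm_qPlus (h : IsSpectrum q₀ qm η τ) (hC : Admissible qm η τ C) :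
    ‖qPlus q₀ qm η‖ = q₀ := by
  have h1 := h.qPlus_mul_conj hC
  rw [Complex.mul_conj'] at h1
  have h2 : ‖qPlus q₀ qm η‖ ^ 2 = q₀ ^ 2 := by exact_mod_cast h1
  exact (pow_left_inj₀ (norm_nonneg _) h.pos.le two_ne_zero).1 h2

theorem exists_rate (h : IsSpectrum q₀ qm η τ) :
    ∃ a : ℝ, 0 < a ∧ ∀ j, a ≤ 2 * (lamOf q₀ (hat q₀ η j)).im := by
  rcases isEmpty_or_nonempty ι with hι | hι
  · exact ⟨1, one_pos, fun j => isEmptyElim j⟩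
  · obtain ⟨j₀, hj⟩ := Finite.exists_min fun j => 2 * (lamOf q₀ (hat q₀ η j)).im
    exact ⟨_, mul_pos two_pos (im_lamOf_pos (h.hat_mem j₀)), hj⟩

theorem differentiableAt_potential_zero (h : IsSpectrum q₀ qm η τ) :
    DifferentiableAt ℝ (fun w : ι → ℂ => potential q₀ qm η w) 0 := by
  have h1 : ∀ j ∈ Finset.univ, DifferentiableAt ℝ
      (fun w : ι → ℂ => w j * sol₁ q₀ qm η w j) 0 := fun j _ =>
    (differentiableAt_apply j 0).mul
      ((h.contDiffAt_left (fun j => Complex.I * qm / η j) j).differentiableAt one_ne_zero)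
  exact ((DifferentiableAt.fun_sum h1).const_mul Complex.I).const_add qm

/-- The potential as a function of `ω_j = 1 / w_j`. -/
def _root_.IfoNLS.potentialInv (q₀ : ℝ) (qm : ℂ) (η ω : ι → ℂ) : ℂ :=
  qm + Complex.I * ∑ j, (cmatInv q₀ qm η ω)⁻¹.mulVec (fun j => Complex.I * qm / η j) j

theorem differentiableAt_potentialInv_zero (h : IsSpectrum q₀ qm η τ) :
    DifferentiableAt ℝ (fun ω : ι → ℂ => potentialInv q₀ qm η ω) 0 := by
  have h1 : ∀ j ∈ Finset.univ, DifferentiableAt ℝ (fun ω : ι → ℂ =>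
      (cmatInv q₀ qm η ω)⁻¹.mulVec (fun j => Complex.I * qm / η j) j) 0 := fun j _ =>
    (h.contDiffAt_right _ j).differentiableAt one_ne_zero
  exact ((DifferentiableAt.fun_sum h1).const_mul Complex.I).const_add qm

theorem _root_.IfoNLS.potential_eq_potentialInv {w : ι → ℂ} (hw : ∀ j, w j ≠ 0) :
    potential q₀ qm η w = potentialInv q₀ qm η fun j => (w j)⁻¹ := by
  rw [potential, potentialInv]
  congr 2
  exact Finset.sum_congr rfl fun j _ => mul_inv_mulVec hw j

theorem isBigO_expVec {a : ℝ} (haj : ∀ j, a ≤ 2 * (lamOf q₀ (hat q₀ η j)).im) (t : ℝ) :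
    (fun x => expVec ε q₀ η C x t) =O[atBot] fun x => Real.exp (a * x) := by
  refine Asymptotics.isBigO_pi.2 fun j => ?_
  refine Asymptotics.IsBigO.of_bound (‖C j‖ * Real.exp (2 *
    ((lamOf q₀ (hat q₀ η j) * velocity ε q₀ (hat q₀ η j)).im * t))) ?_
  filter_upwards [eventually_le_atBot 0] with x hx
  rw [norm_expVec, im_theta, Real.norm_eq_abs, Real.abs_exp, mul_add, add_comm, Real.exp_add,
    ← mul_assoc]
  refine mul_le_mul_of_nonneg_left (Real.exp_le_exp.2 ?_) (by positivity)
  nlinarith [haj j]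

theorem isBigO_inv_expVec {a : ℝ} (haj : ∀ j, a ≤ 2 * (lamOf q₀ (hat q₀ η j)).im) (t : ℝ) :
    (fun x j => (expVec ε q₀ η C x t j)⁻¹) =O[atTop] fun x => Real.exp (-(a * x)) := by
  refine Asymptotics.isBigO_pi.2 fun j => ?_
  refine Asymptotics.IsBigO.of_bound (‖C j‖⁻¹ * Real.exp (-(2 *
    ((lamOf q₀ (hat q₀ η j) * velocity ε q₀ (hat q₀ η j)).im * t)))) ?_
  filter_upwards [eventually_ge_atTop 0] with x hx
  rw [norm_inv, norm_expVec, im_theta, Real.norm_eq_abs, Real.abs_exp, mul_inv, ← Real.exp_neg,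
    mul_add, neg_add, add_comm, Real.exp_add, ← mul_assoc]
  refine mul_le_mul_of_nonneg_left (Real.exp_le_exp.2 ?_) (by positivity)
  nlinarith [haj j]

theorem tendsto_dx_sol (h : IsSpectrum q₀ qm η τ) (hC : Admissible qm η τ C)
    {l : Filter (ℝ × ℝ)} {a : ℂ} (ha : a * conj a = ((q₀ ^ 2 : ℝ) : ℂ))
    (h0 : Tendsto (fun p : ℝ × ℝ => potential q₀ qm η (expVec ε q₀ η C p.1 p.2)) l (𝓝 a))
    (hB : ∀ i, Tendsto (fun p : ℝ × ℝ => momentB q₀ qm η (expVec ε q₀ η C p.1 p.2) i) l (𝓝 0))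
    {j : ℕ} (hj : j ∈ Finset.Icc 1 4) :
    Tendsto (fun p : ℝ × ℝ => dx j (sol ε q₀ qm η C) p.1 p.2) l (𝓝 0) := by
  have j0 : Tendsto (fun p : ℝ × ℝ => dx 0 (sol ε q₀ qm η C) p.1 p.2) l (𝓝 a) :=
    h0.congr fun p => by rw [dx, iteratedDeriv_zero, sol]
  have m := fun p : ℝ × ℝ => h.moments_eq (ε := ε) hC p.1 p.2
  have d := fun p : ℝ × ℝ => h.dx_one_sol (ε := ε) hC p.1 p.2
  generalize hK : (fun (p : ℝ × ℝ) (j : ℕ) => dx j (sol ε q₀ qm η C) p.1 p.2) = K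
  have hK' : ∀ p j, dx j (sol ε q₀ qm η C) p.1 p.2 = K p j := fun p j =>
    congrFun (congrFun hK p) j
  simp only [hK'] at m d j0 ⊢
  have j1 := (hB 0).congr fun p => (d p).symm
  have b1 := (hB 1).congr fun p => (m p).2.1
  have b2 := (hB 2).congr fun p => (m p).2.2.1
  have b3 := (hB 3).congr fun p => (m p).2.2.2.1
  have j2 := tendsto_jet_two (K := K) j0 ha b1
  have j3 := tendsto_jet_three (K := K) j0 j1 b2
  have j4 := tendsto_jet_four (K := K) j0 ha j1 j2 b3
  obtain ⟨hj1, hj2⟩ := Finset.mem_Icc.1 hj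
  have h4 : j = 1 ∨ j = 2 ∨ j = 3 ∨ j = 4 := by omega
  rcases h4 with rfl | rfl | rfl | rfl
  exacts [j1, j2, j3, j4]

theorem boundaryConditions_sol (h : IsSpectrum q₀ qm η τ) (hC : Admissible qm η τ C) :
    BoundaryConditions qm (qPlus q₀ qm η) (sol ε q₀ qm η C) := by
  have hqm : qm * conj qm = ((q₀ ^ 2 : ℝ) : ℂ) := by rw [h.qm_mul_conj]; push_cast; rfl
  have hqp : qPlus q₀ qm η * conj (qPlus q₀ qm η) = ((q₀ ^ 2 : ℝ) : ℂ) := by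
    rw [h.qPlus_mul_conj hC]; push_cast; rfl
  have hne : ∀ (p : ℝ × ℝ) j, expVec ε q₀ η C p.1 p.2 j ≠ 0 := fun p j =>
    (h.admissible_expVec hC p.1 p.2).ne_zero j
  obtain ⟨a, ha, haj⟩ := h.exists_rate
  refine ⟨fun t₀ => h.tendsto_potential_left (h.tendsto_expVec t₀),
    fun t₀ => h.tendsto_potential_right hne (h.tendsto_inv_expVec t₀),
    fun j hj t₀ => h.tendsto_dx_sol hC hqm (h.tendsto_potential_left (h.tendsto_expVec t₀))
      (h.tendsto_momentB_left (h.tendsto_expVec t₀)) hj,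
    fun j hj t₀ => h.tendsto_dx_sol hC hqp (h.tendsto_potential_right hne (h.tendsto_inv_expVec t₀))
      (h.tendsto_momentB_right hne (h.tendsto_inv_expVec t₀)) hj, fun t => ?_, fun t => ?_⟩
  · have hc : Continuous fun x => sol ε q₀ qm η C x t - qm :=
      (h.contDiff_sol_x (n := 0) hC t).continuous.sub continuous_const
    refine integrableOn_moment_Iic hc ha (Asymptotics.IsBigO.trans ?_
      (isBigO_expVec (ε := ε) (C := C) haj t))
    have h2 : potential q₀ qm η 0 = qm := by simp [potential]
    have h1 := h.differentiableAt_potential_zero.isBigO_sub.comp_tendsto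
      ((h.tendsto_expVec (ε := ε) (C := C) t).comp (tendsto_prod_mk t))
    rw [h2] at h1
    simpa only [Function.comp_def, sub_zero, sol] using h1
  · have hc : Continuous fun x => sol ε q₀ qm η C x t - qPlus q₀ qm η :=
      (h.contDiff_sol_x (n := 0) hC t).continuous.sub continuous_const
    refine integrableOn_moment_Ici hc ha (Asymptotics.IsBigO.trans ?_
      (isBigO_inv_expVec (ε := ε) (C := C) haj t))
    have h1 := h.differentiableAt_potentialInv_zero.isBigO_sub.comp_tendsto
      ((h.tendsto_inv_expVec (ε := ε) (C := C) t).comp (tendsto_prod_mk t))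
    have h3 : ∀ x, sol ε q₀ qm η C x t
        = potentialInv q₀ qm η fun j => (expVec ε q₀ η C x t j)⁻¹ := fun x =>
      potential_eq_potentialInv (hne (x, t))
    have h4 : qPlus q₀ qm η = potentialInv q₀ qm η 0 := rfl
    simp only [h3, h4]
    simpa only [Function.comp_def, sub_zero] using h1

end IsSpectrum
end Asymptotics

/-! ### Solutions of the scattering problem -/

section Lax

/-- On a bounded interval a continuous matrix function is bounded as an operator. -/
theorem exists_norm_mulVec_le {A : ℝ → Matrix (Fin 2) (Fin 2) ℂ}
    (hA : ∀ i j, Continuous fun x => A x i j) (R : ℝ) :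
    ∃ K : ℝ, 0 ≤ K ∧ ∀ y ∈ Set.Icc (-R) R, ∀ u : Fin 2 → ℂ, ‖(A y).mulVec u‖ ≤ K * ‖u‖ := by
  have hc : Continuous fun x => ‖A x 0 0‖ + ‖A x 0 1‖ + ‖A x 1 0‖ + ‖A x 1 1‖ := by
    have h1 := hA 0 0
    have h2 := hA 0 1
    have h3 := hA 1 0
    have h4 := hA 1 1
    fun_prop
  obtain ⟨K, hK⟩ := (isCompact_Icc (a := -R) (b := R)).exists_bound_of_continuousOn hc.continuousOn
  refine ⟨max K 0, le_max_right _ _, fun y hy u => ?_⟩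
  have h1 := (hK y hy).trans (le_max_left K 0)
  rw [Real.norm_of_nonneg (by positivity)] at h1
  have hK0 : 0 ≤ max K 0 := le_max_right _ _
  have a0 := norm_le_pi_norm u 0
  have a1 := norm_le_pi_norm u 1
  refine (pi_norm_le_iff_of_nonneg (by positivity)).2 fun i => ?_
  have e : (A y).mulVec u i = A y i 0 * u 0 + A y i 1 * u 1 := by
    simp [Matrix.mulVec, dotProduct, Fin.sum_univ_two]
  rw [e]
  refine (norm_add_le _ _).trans ?_
  rw [norm_mul, norm_mul]
  have n00 := norm_nonneg (A y 0 0)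
  have n01 := norm_nonneg (A y 0 1)
  have n10 := norm_nonneg (A y 1 0)
  have n11 := norm_nonneg (A y 1 1)
  have nu := norm_nonneg u
  have b0 := mul_le_mul_of_nonneg_left a0 (norm_nonneg (A y i 0))
  have b1 := mul_le_mul_of_nonneg_left a1 (norm_nonneg (A y i 1))
  fin_cases i <;> simp only [Fin.zero_eta, Fin.mk_one, Fin.isValue] at b0 b1 ⊢ <;> nlinarith

theorem lipschitz_mulVec {M : Matrix (Fin 2) (Fin 2) ℂ} {K : ℝ}
    (hK : ∀ u : Fin 2 → ℂ, ‖M.mulVec u‖ ≤ K * ‖u‖) :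
    LipschitzOnWith K.toNNReal (fun u : Fin 2 → ℂ => M.mulVec u) Set.univ := by
  refine LipschitzOnWith.of_dist_le_mul fun u _ v _ => ?_
  rw [dist_eq_norm, dist_eq_norm, ← Matrix.mulVec_sub]
  refine (hK _).trans ?_
  gcongr
  exact Real.le_coe_toNNReal K

/-- Two solutions on an open interval of a linear system `φ' = A φ` with continuous coefficients
agree if they have a value in common. -/
theorem eqOn_of_hasDerivAt_mulVec {A : ℝ → Matrix (Fin 2) (Fin 2) ℂ}
    (hA : ∀ i j, Continuous fun x => A x i j) {φ ψ : ℝ → Fin 2 → ℂ} {a b x₀ : ℝ}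
    (hφ : ∀ x ∈ Set.Ioo a b, HasDerivAt φ ((A x).mulVec (φ x)) x)
    (hψ : ∀ x ∈ Set.Ioo a b, HasDerivAt ψ ((A x).mulVec (ψ x)) x)
    (hx₀ : x₀ ∈ Set.Ioo a b) (h0 : φ x₀ = ψ x₀) : Set.EqOn φ ψ (Set.Ioo a b) := by
  obtain ⟨K, -, hK⟩ := exists_norm_mulVec_le hA (max |a| |b|)
  refine ODE_solution_unique_of_mem_Ioo (v := fun x u => (A x).mulVec u) (K := K.toNNReal)
    (s := fun _ => Set.univ) (fun y hy => lipschitz_mulVec (hK y ?_)) hx₀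
    (fun y hy => ⟨hφ y hy, Set.mem_univ _⟩) (fun y hy => ⟨hψ y hy, Set.mem_univ _⟩) h0
  constructor
  · have := neg_abs_le a
    have := le_max_left |a| |b|
    linarith [hy.1]
  · have := le_abs_self b
    have := le_max_right |a| |b|
    linarith [hy.2]

/-- A linear system `φ' = A φ` with continuous coefficients has at most one solution with a given
value at a given point. -/
theorem eq_zero_of_hasDerivAt_mulVec {A : ℝ → Matrix (Fin 2) (Fin 2) ℂ}
    (hA : ∀ i j, Continuous fun x => A x i j) {φ : ℝ → Fin 2 → ℂ}
    (hφ : ∀ x, HasDerivAt φ ((A x).mulVec (φ x)) x) {x₀ : ℝ} (h0 : φ x₀ = 0) (x : ℝ) :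
    φ x = 0 := by
  refine eqOn_of_hasDerivAt_mulVec hA (ψ := fun _ => 0) (a := -(|x| + |x₀| + 1))
    (b := |x| + |x₀| + 1) (x₀ := x₀) (fun y _ => hφ y)
    (fun y _ => by simpa using hasDerivAt_const y (0 : Fin 2 → ℂ)) ?_ h0 ?_
  · exact abs_lt.1 (by linarith [abs_nonneg x])
  · exact abs_lt.1 (by linarith [abs_nonneg x₀])

/-- `φ` solves the scattering problem with spectral parameter `k` and potential `u`. -/
def IsLax (k : ℂ) (u : ℝ → ℂ) (φ : ℝ → Fin 2 → ℂ) : Prop :=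
  ∀ x, HasDerivAt φ ((laxU k (u x)).mulVec (φ x)) x

theorem laxU_mulVec (k a : ℂ) (v : Fin 2 → ℂ) : (laxU k a).mulVec v =
    ![-(Complex.I * k) * v 0 + a * v 1, -conj a * v 0 + Complex.I * k * v 1] := by
  funext i
  fin_cases i <;> simp [laxU, Matrix.mulVec, dotProduct, Fin.sum_univ_two]

variable {k : ℂ} {u : ℝ → ℂ} {φ ψ : ℝ → Fin 2 → ℂ}

theorem isLax_iff : IsLax k u φ ↔ ∀ x,
    HasDerivAt (fun y => φ y 0) (-(Complex.I * k) * φ x 0 + u x * φ x 1) x ∧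
    HasDerivAt (fun y => φ y 1) (-conj (u x) * φ x 0 + Complex.I * k * φ x 1) x := by
  refine forall_congr' fun x => ?_
  rw [hasDerivAt_pi, Fin.forall_fin_two, laxU_mulVec]
  simp

theorem IsLax.smul (h : IsLax k u φ) (c : ℂ) : IsLax k u (fun x => c • φ x) := fun x => by
  rw [Matrix.mulVec_smul]
  exact (h x).const_smul c

theorem IsLax.sub (h : IsLax k u φ) (h' : IsLax k u ψ) : IsLax k u (fun x => φ x - ψ x) :=
  fun x => by
    rw [Matrix.mulVec_sub]
    exact (h x).sub (h' x)

theorem IsLax.eq_zero (hu : Continuous u) (h : IsLax k u φ) {x₀ : ℝ} (h0 : φ x₀ = 0) (x : ℝ) :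
    φ x = 0 := by
  refine eq_zero_of_hasDerivAt_mulVec (A := fun x => laxU k (u x)) (fun i j => ?_) h h0 x
  fin_cases i <;> fin_cases j <;> simp only [laxU] <;> simp <;> fun_prop

theorem wr_smul_left (c : ℂ) (a b : Fin 2 → ℂ) : wr (c • a) b = c * wr a b := by
  simp only [wr, Pi.smul_apply, smul_eq_mul]; ring

theorem wr_smul_right (c : ℂ) (a b : Fin 2 → ℂ) : wr a (c • b) = c * wr a b := by
  simp only [wr, Pi.smul_apply, smul_eq_mul]; ring

theorem wr_self (a : Fin 2 → ℂ) : wr a a = 0 := by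
  simp only [wr]; ring

theorem wr_swap (a b : Fin 2 → ℂ) : wr a b = -wr b a := by
  simp only [wr]; ring

theorem IsLax.wr_eq (h : IsLax k u φ) (h' : IsLax k u ψ) (x y : ℝ) :
    wr (φ x) (ψ x) = wr (φ y) (ψ y) := by
  rw [isLax_iff] at h h'
  have hd : ∀ x, HasDerivAt (fun x => wr (φ x) (ψ x)) 0 x := fun x => by
    refine (((h x).1.mul (h' x).2).sub ((h x).2.mul (h' x).1)).congr_deriv ?_
    ring
  exact is_const_of_deriv_eq_zero (fun x => (hd x).differentiableAt) (fun x => (hd x).deriv) x y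

/-- Two solutions whose Wronskian vanishes are proportional. -/
theorem IsLax.exists_eq_smul (hu : Continuous u) (h : IsLax k u φ) (h' : IsLax k u ψ) {x₀ : ℝ}
    (h0 : φ x₀ ≠ 0) (hw : wr (φ x₀) (ψ x₀) = 0) : ∃ c : ℂ, ∀ x, ψ x = c • φ x := by
  obtain ⟨c, hc⟩ : ∃ c : ℂ, ψ x₀ = c • φ x₀ := by
    rw [wr] at hw
    by_cases h1 : φ x₀ 0 = 0
    · have h2 : φ x₀ 1 ≠ 0 := fun h2 => h0 (by funext i; fin_cases i <;> simp [h1, h2])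
      refine ⟨ψ x₀ 1 / φ x₀ 1, funext fun i => ?_⟩
      fin_cases i
      · simp only [h1, zero_mul, zero_sub, neg_eq_zero, mul_eq_zero, h2, false_or] at hw
        simp [h1, hw]
      · simp [h2]
    · refine ⟨ψ x₀ 0 / φ x₀ 0, funext fun i => ?_⟩
      fin_cases i
      · simp [h1]
      · simp only [Fin.mk_one, Pi.smul_apply, smul_eq_mul]
        field_simp
        linear_combination hw
  refine ⟨c, fun x => sub_eq_zero.1 ?_⟩
  exact (h'.sub (h.smul c)).eq_zero hu (x₀ := x₀) (by simp [hc]) x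

end Lax

/-! ### Jost solutions -/

section Jost

variable {ε q₀ : ℝ} {q : ℝ → ℝ → ℂ} {a : ℂ} {l : Filter ℝ} {j : Fin 2} {t : ℝ} {z : ℂ}
  {φ ψ : ℝ → Fin 2 → ℂ}

theorem IsJost.isLax (h : IsJost ε q₀ q a l j t z φ) : IsLax (kOf q₀ z) (fun x => q x t) φ := h.1

/-- The factor `e^{iθ}` or `e^{-iθ}` normalizing the `j`-th column. -/
def normFactor (ε q₀ : ℝ) (j : Fin 2) (t : ℝ) (z : ℂ) (x : ℝ) : ℂ :=
  Complex.exp ((![1, -1] : Fin 2 → ℂ) j * (Complex.I * theta ε q₀ x t z))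

theorem IsJost.tendsto (h : IsJost ε q₀ q a l j t z φ) :
    Tendsto (fun x => normFactor ε q₀ j t z x • φ x) l (𝓝 fun i => E a z i j) := h.2

theorem E_col_ne_zero (a z : ℂ) (j : Fin 2) : (fun i => E a z i j) ≠ 0 := fun h => by
  have := congrFun h j
  fin_cases j <;> simp [E] at this

/-- A Jost solution is determined by its normalization if the normalizing factor stays away
from `0`: the Wronskian of two of them vanishes, being constant and tending to `0`. -/
theorem IsJost.unique [l.NeBot] (hq : Continuous fun x => q x t)
    (hl : ∃ c > 0, ∀ᶠ x in l, c ≤ ‖normFactor ε q₀ j t z x‖)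
    (h : IsJost ε q₀ q a l j t z φ) (h' : IsJost ε q₀ q a l j t z ψ) : ψ = φ := by
  obtain ⟨c, hc, hl⟩ := hl
  have hd := h'.isLax.sub h.isLax
  have hdt : Tendsto (fun x => normFactor ε q₀ j t z x • (ψ x - φ x)) l (𝓝 0) := by
    simpa [smul_sub] using h'.tendsto.sub h.tendsto
  -- some value of `φ` is not `0`
  obtain ⟨x₀, hx₀⟩ : ∃ x₀, φ x₀ ≠ 0 := by
    by_contra! h0
    have h1 := h.tendsto
    simp only [h0, smul_zero] at h1
    exact E_col_ne_zero a z j (tendsto_nhds_unique h1 tendsto_const_nhds)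
  have hw : wr (φ x₀) (ψ x₀ - φ x₀) = 0 := by
    have h1 : Tendsto (fun x => wr (normFactor ε q₀ j t z x • φ x)
        (normFactor ε q₀ j t z x • (ψ x - φ x))) l (𝓝 0) := by
      have a := tendsto_pi_nhds.1 h.tendsto
      have b := tendsto_pi_nhds.1 hdt
      simpa [wr] using ((a 0).mul (b 1)).sub ((a 1).mul (b 0))
    simp only [wr_smul_left, wr_smul_right,
      fun x => h.isLax.wr_eq hd x x₀] at h1
    by_contra hne
    have h2 : ∀ᶠ x in l, c * (c * ‖wr (φ x₀) (ψ x₀ - φ x₀)‖)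
        ≤ ‖normFactor ε q₀ j t z x * (normFactor ε q₀ j t z x * wr (φ x₀) (ψ x₀ - φ x₀))‖ := by
      filter_upwards [hl] with x hx
      rw [norm_mul, norm_mul]
      gcongr
    have h3 := ge_of_tendsto h1.norm h2
    rw [norm_zero] at h3
    have := norm_pos_iff.2 hne
    exact absurd h3 (not_le.2 (by positivity))
  obtain ⟨b, hb⟩ := h.isLax.exists_eq_smul hq hd hx₀ hw
  have h2 : (b • fun i => E a z i j) = 0 := by
    have h3 := h.tendsto.const_smul b
    refine tendsto_nhds_unique (h3.congr fun x => ?_) hdt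
    rw [hb, smul_comm]
  have h4 : b = 0 := (smul_eq_zero.1 h2).resolve_right (E_col_ne_zero a z j)
  funext x
  have := hb x
  rw [h4, zero_smul] at this
  exact sub_eq_zero.1 this

theorem norm_normFactor (x : ℝ) : ‖normFactor ε q₀ j t z x‖
    = Real.exp ((![-1, 1] : Fin 2 → ℝ) j * (theta ε q₀ x t z).im) := by
  rw [normFactor, Complex.norm_exp]
  fin_cases j <;> simp

theorem im_theta_eq (x : ℝ) : (theta ε q₀ x t z).im
    = (lamOf q₀ z).im * x + (lamOf q₀ z * velocity ε q₀ z).im * t :=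
  IsSpectrum.im_theta x t z

/-- The closed region in which the `j`-th column, normalized along `l`, is uniquely determined. -/
def JostRange (q₀ : ℝ) (l : Filter ℝ) (j : Fin 2) (z : ℂ) : Prop :=
  ∀ᶠ x : ℝ in l, 0 ≤ (![-1, 1] : Fin 2 → ℝ) j * ((lamOf q₀ z).im * x)

theorem JostRange.exists_le (h : JostRange q₀ l j z) (ε t : ℝ) :
    ∃ c > 0, ∀ᶠ x in l, c ≤ ‖normFactor ε q₀ j t z x‖ := by
  refine ⟨Real.exp ((![-1, 1] : Fin 2 → ℝ) j * ((lamOf q₀ z * velocity ε q₀ z).im * t)),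
    Real.exp_pos _, ?_⟩
  filter_upwards [h] with x hx
  rw [norm_normFactor, im_theta_eq]
  exact Real.exp_le_exp.2 (by linarith)

theorem IsJost.jost_eq [l.NeBot] (hq : Continuous fun x => q x t) (hz : JostRange q₀ l j z)
    (h : IsJost ε q₀ q a l j t z φ) : jost ε q₀ q a l j t z = φ := by
  have h1 : ∃ φ, IsJost ε q₀ q a l j t z φ := ⟨φ, h⟩
  rw [jost, dif_pos h1]
  exact h.unique hq (hz.exists_le ε t) h1.choose_spec

theorem jostRange_atBot_zero (h : 0 ≤ (lamOf q₀ z).im) : JostRange q₀ atBot 0 z := by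
  filter_upwards [eventually_le_atBot 0] with x hx
  simpa using mul_nonpos_of_nonneg_of_nonpos h hx

theorem jostRange_atTop_one (h : 0 ≤ (lamOf q₀ z).im) : JostRange q₀ atTop 1 z := by
  filter_upwards [eventually_ge_atTop 0] with x hx
  simpa using mul_nonneg h hx

theorem jostRange_atBot_one (h : (lamOf q₀ z).im ≤ 0) : JostRange q₀ atBot 1 z := by
  filter_upwards [eventually_le_atBot 0] with x hx
  simpa using mul_nonneg_of_nonpos_of_nonpos h hx

theorem jostRange_atTop_zero (h : (lamOf q₀ z).im ≤ 0) : JostRange q₀ atTop 0 z := by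
  filter_upwards [eventually_ge_atTop 0] with x hx
  simpa using mul_nonpos_of_nonpos_of_nonneg h hx

theorem normFactor_neg_div (hq : (q₀ : ℂ) ≠ 0) (hz : z ≠ 0) (j : Fin 2) (x : ℝ) :
    normFactor ε q₀ j t (-(q₀ : ℂ) ^ 2 / z) x = normFactor ε q₀ (1 - j) t z x := by
  rw [normFactor, normFactor, theta_neg_div hq _ _ _ hz]
  congr 1
  fin_cases j <;> simp

/-- The symmetry `z ↦ -q₀² / z`: the first column from the second one. -/
theorem IsJost.col_zero (h : IsJost ε q₀ q a l 1 t (-(q₀ : ℂ) ^ 2 / z) φ) (hq : (q₀ : ℂ) ≠ 0)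
    (hz : z ≠ 0) (ha : a * conj a = (q₀ : ℂ) ^ 2) :
    IsJost ε q₀ q a l 0 t z (fun x => (-(Complex.I * conj a / z)) • φ x) := by
  have h1 := h.isLax
  rw [kOf_neg_div hq hz] at h1
  refine ⟨h1.smul _, ?_⟩
  have h2 := h.tendsto.const_smul (-(Complex.I * conj a / z))
  have h3 : ((-(Complex.I * conj a / z)) • fun i => E a (-(q₀ : ℂ) ^ 2 / z) i 1)
      = fun i => E a z i 0 := by
    funext i
    fin_cases i
    · simp [E]
      field_simp
      rw [Complex.I_sq]
      linear_combination ha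
    · simp [E]
  rw [h3] at h2
  refine h2.congr fun x => ?_
  rw [normFactor_neg_div hq hz, smul_comm]
  rfl

/-- The symmetry `z ↦ -q₀² / z`: the second column from the first one. -/
theorem IsJost.col_one (h : IsJost ε q₀ q a l 0 t (-(q₀ : ℂ) ^ 2 / z) φ) (hq : (q₀ : ℂ) ≠ 0)
    (hz : z ≠ 0) (ha : a * conj a = (q₀ : ℂ) ^ 2) :
    IsJost ε q₀ q a l 1 t z (fun x => (-(Complex.I * a / z)) • φ x) := by
  have h1 := h.isLax
  rw [kOf_neg_div hq hz] at h1
  refine ⟨h1.smul _, ?_⟩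
  have h2 := h.tendsto.const_smul (-(Complex.I * a / z))
  have h3 : ((-(Complex.I * a / z)) • fun i => E a (-(q₀ : ℂ) ^ 2 / z) i 0)
      = fun i => E a z i 1 := by
    funext i
    fin_cases i
    · simp [E]
    · simp [E]
      field_simp
      rw [Complex.I_sq]
      linear_combination ha
  rw [h3] at h2
  refine h2.congr fun x => ?_
  rw [normFactor_neg_div hq hz, smul_comm]
  rfl

theorem conj_normFactor (j : Fin 2) (x : ℝ) :
    conj (normFactor ε q₀ j t (conj z) x) = normFactor ε q₀ (1 - j) t z x := by
  rw [normFactor, normFactor, theta_conj, ← Complex.exp_conj]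
  congr 1
  fin_cases j <;> simp

/-- The symmetry `z ↦ z*`: the second column from the first one. -/
theorem IsJost.conj_zero (h : IsJost ε q₀ q a l 0 t (conj z) φ) :
    IsJost ε q₀ q a l 1 t z (fun x => ![-conj (φ x 1), conj (φ x 0)]) := by
  constructor
  · change IsLax _ (fun x => q x t) _
    have h1 := isLax_iff.1 h.isLax
    refine isLax_iff.2 fun x => ⟨?_, ?_⟩
    · refine (hasDerivAt_conj (h1 x).2).neg.congr_deriv ?_
      simp [kOf_conj]
    · refine (hasDerivAt_conj (h1 x).1).congr_deriv ?_
      simp [kOf_conj]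
      ring
  · have h2 := tendsto_pi_nhds.1 h.tendsto
    refine tendsto_pi_nhds.2 fun i => ?_
    change Tendsto (fun x => normFactor ε q₀ 1 t z x * _) l _
    have e : ∀ x, normFactor ε q₀ 1 t z x = conj (normFactor ε q₀ 0 t (conj z) x) := fun x => by
      rw [conj_normFactor]; rfl
    simp only [e]
    fin_cases i
    · refine (tendsto_conj (h2 1)).neg.congr' ?_ |>.trans ?_
      · exact Eventually.of_forall fun x => by simp
      · simp [E, neg_div]
    · refine (tendsto_conj (h2 0)).congr' ?_ |>.trans ?_
      · exact Eventually.of_forall fun x => by simp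
      · simp [E]

end Jost

/-! ### The Jost solutions of the soliton potential -/

section SolitonJost

variable {ι : Type*} [Fintype ι] [DecidableEq ι] {ε q₀ : ℝ} {qm : ℂ} {η C : ι → ℂ} {τ : ι → ι}
  {t : ℝ} {z : ℂ}

/-- The second column of the solution of the Riemann-Hilbert problem. -/
def colTwo (q₀ : ℝ) (qm : ℂ) (η w : ι → ℂ) (z : ℂ) : Fin 2 → ℂ :=
  ![-(Complex.I * qm / z) + ∑ j, w j * sol₁ q₀ qm η w j / (z - hat q₀ η j),
    1 + ∑ j, w j * sol₂ q₀ qm η w j / (z - hat q₀ η j)]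

/-- The coefficient `s₂₂` of the soliton potential. -/
def blaschke (q₀ : ℝ) (η : ι → ℂ) (z : ℂ) : ℂ := ∏ j, ((z - hat q₀ η j) / (z - η j))

namespace IsSpectrum

theorem ne_eta_of_mem (h : IsSpectrum q₀ qm η τ) (hz : 0 ≤ (lamOf q₀ z).im) (j : ι) :
    z ≠ η j := fun e => by
  have h1 := im_lamOf_pos (h.hat_mem j)
  rw [hat, lamOf_neg_div h.q₀_ne (h.eta_ne j), ← e, Complex.neg_im] at h1
  linarith

theorem ne_hat_of_mem (h : IsSpectrum q₀ qm η τ) (hz : (lamOf q₀ z).im ≤ 0) (j : ι) :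
    z ≠ hat q₀ η j := fun e => by
  have h1 := im_lamOf_pos (h.hat_mem j)
  rw [← e] at h1
  linarith

theorem tendsto_expVec_x (h : IsSpectrum q₀ qm η τ) (t : ℝ) :
    Tendsto (fun x => expVec ε q₀ η C x t) atBot (𝓝 0) := by
  have h1 := (h.tendsto_expVec (ε := ε) (C := C) t).comp (tendsto_prod_mk t)
  simpa only [Function.comp_def] using h1

theorem tendsto_inv_expVec_x (h : IsSpectrum q₀ qm η τ) (t : ℝ) :
    Tendsto (fun x j => (expVec ε q₀ η C x t j)⁻¹) atTop (𝓝 0) := by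
  have h1 := (h.tendsto_inv_expVec (ε := ε) (C := C) t).comp (tendsto_prod_mk t)
  simpa only [Function.comp_def] using h1

theorem tendsto_colTwo_left (h : IsSpectrum q₀ qm η τ) {α : Type*} {l : Filter α}
    {w : α → ι → ℂ} (hw : Tendsto w l (𝓝 0)) (z : ℂ) :
    Tendsto (fun x => colTwo q₀ qm η (w x) z) l (𝓝 fun i => E qm z i 1) := by
  have hw' := tendsto_pi_nhds.1 hw
  have t1 : ∀ j ∈ Finset.univ, Tendsto (fun x => w x j * sol₁ q₀ qm η (w x) j / (z - hat q₀ η j))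
      l (𝓝 (0 * 1 / (z - hat q₀ η j))) := fun j _ =>
    ((hw' j).mul (h.tendsto_sol₁_left hw j)).div_const _
  have t2 : ∀ j ∈ Finset.univ, Tendsto (fun x => w x j * sol₂ q₀ qm η (w x) j / (z - hat q₀ η j))
      l (𝓝 (0 * sol₂ q₀ qm η 0 j / (z - hat q₀ η j))) := fun j _ =>
    ((hw' j).mul (h.tendsto_sol₂_left hw j)).div_const _
  have l1 := (tendsto_finsetSum Finset.univ t1).const_add (-(Complex.I * qm / z))
  have l2 := (tendsto_finsetSum Finset.univ t2).const_add 1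
  simp only [zero_mul, zero_div, Finset.sum_const_zero, add_zero] at l1 l2
  refine tendsto_pi_nhds.2 fun i => ?_
  fin_cases i
  · simpa [E, colTwo] using l1
  · simpa [E, colTwo] using l2

theorem isJost_colTwo (h : IsSpectrum q₀ qm η τ) (hC : Admissible qm η τ C) (t : ℝ)
    (hz0 : z ≠ 0) (hz : ∀ j, z ≠ hat q₀ η j) :
    IsJost ε q₀ (sol ε q₀ qm η C) qm atBot 1 t z fun x =>
      Complex.exp (Complex.I * theta ε q₀ x t z) • colTwo q₀ qm η (expVec ε q₀ η C x t) z := by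
  have hq := h.qm_ne
  have hz' : ∀ j, z - hat q₀ η j ≠ 0 := fun j => sub_ne_zero.2 (hz j)
  constructor
  · change IsLax _ (fun x => sol ε q₀ qm η C x t) _
    refine isLax_iff.2 fun x => ?_
    set w := expVec ε q₀ η C x t with hw
    have ha := h.admissible_expVec (ε := ε) hC x t
    rw [← hw] at ha
    have e : HasDerivAt (fun y => Complex.exp (Complex.I * theta ε q₀ y t z))
        (Complex.exp (Complex.I * theta ε q₀ x t z) * (Complex.I * lamOf q₀ z)) x :=
      ((hasDerivAt_theta_x ε q₀ x t z).const_mul Complex.I).cexp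
    have hd := fun j => h.hasDerivAt_expVec_x (ε := ε) (C := C) x t j
    have hc : ∀ j, ContDiffAt ℝ 1 (fun y => expVec ε q₀ η C y t j) x := fun j =>
      ((contDiff_expVec (n := 1) j).comp
        (contDiff_id.prodMk contDiff_const : ContDiff ℝ 1 fun y : ℝ => (y, t))).contDiffAt
    have d1 := h.hasDerivAt_sol₁ (fun y => h.admissible_expVec (ε := ε) hC y t) hc hd
    have d2 := h.hasDerivAt_sol₂ (fun y => h.admissible_expVec (ε := ε) hC y t) hc hd
    have s1 := HasDerivAt.fun_sum (u := Finset.univ) fun j _ =>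
      ((hd j).fun_mul (d1 j)).div_const (z - hat q₀ η j)
    have s2 := HasDerivAt.fun_sum (u := Finset.univ) fun j _ =>
      ((hd j).fun_mul (d2 j)).div_const (z - hat q₀ η j)
    rw [← hw] at s1 s2
    have hpot : sol ε q₀ qm η C x t = potential q₀ qm η w := rfl
    have hconj := h.conj_potential ha
    have hk : kOf q₀ z + lamOf q₀ z = z := by simp only [kOf, lamOf]; ring
    have hkl : kOf q₀ z - lamOf q₀ z = -(q₀ : ℂ) ^ 2 / z := by simp only [kOf, lamOf]; ring
    constructor
    · refine (e.fun_mul (s1.const_add (-(Complex.I * qm / z)))).congr_deriv ?_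
      simp only [colTwo, Pi.smul_apply, smul_eq_mul, Matrix.cons_val_zero, Matrix.cons_val_one,
        hpot, ← hw]
      have e1 : ∑ j, (-Complex.I * (hat q₀ η j - η j) * w j * sol₁ q₀ qm η w j
          + w j * (-Complex.I * η j * sol₁ q₀ qm η w j
            + potential q₀ qm η w * sol₂ q₀ qm η w j)) / (z - hat q₀ η j)
          = -Complex.I * z * ∑ j, w j * sol₁ q₀ qm η w j / (z - hat q₀ η j)
            + Complex.I * ∑ j, w j * sol₁ q₀ qm η w j
            + potential q₀ qm η w * ∑ j, w j * sol₂ q₀ qm η w j / (z - hat q₀ η j) := by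
        simp only [Finset.mul_sum, ← Finset.sum_add_distrib]
        refine Finset.sum_congr rfl fun j _ => ?_
        have := hz' j
        field_simp
        ring
      have e2 : Complex.I * ∑ j, w j * sol₁ q₀ qm η w j = potential q₀ qm η w - qm := by
        rw [potential]; ring
      rw [e1, e2]
      have e3 : lamOf q₀ z = z - kOf q₀ z := by linear_combination hk
      rw [e3]
      field_simp
      linear_combination (-z * qm) * Complex.I_sq
    · refine (e.fun_mul (s2.const_add 1)).congr_deriv ?_
      simp only [colTwo, Pi.smul_apply, smul_eq_mul, Matrix.cons_val_zero, Matrix.cons_val_one,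
        hpot, ← hw]
      have e1 : ∑ j, (-Complex.I * (hat q₀ η j - η j) * w j * sol₂ q₀ qm η w j
          + w j * (Complex.I * hat q₀ η j * sol₂ q₀ qm η w j
            - conj (potential q₀ qm η w) * sol₁ q₀ qm η w j)) / (z - hat q₀ η j)
          = -(Complex.I * (q₀ : ℂ) ^ 2 / z) * (∑ j, w j * sol₂ q₀ qm η w j / hat q₀ η j
              + ∑ j, w j * sol₂ q₀ qm η w j / (z - hat q₀ η j))
            - conj (potential q₀ qm η w) * ∑ j, w j * sol₁ q₀ qm η w j / (z - hat q₀ η j) := by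
        simp only [Finset.mul_sum, ← Finset.sum_add_distrib, ← Finset.sum_sub_distrib]
        refine Finset.sum_congr rfl fun j _ => ?_
        have h1 := hz' j
        have h2 := h.hat_ne j
        have h3 : η j = -(q₀ : ℂ) ^ 2 / hat q₀ η j :=
          eq_div_of_mul_eq h2 (by rw [mul_comm]; exact h.hat_mul_eta j)
        rw [h3]
        field_simp
        ring
      have e2 : ∑ j, w j * sol₂ q₀ qm η w j / hat q₀ η j
          = 1 - conj (potential q₀ qm η w) * qm / (q₀ : ℂ) ^ 2 := by
        rw [hconj, ← h.qm_mul_conj]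
        have : conj qm ≠ 0 := by simpa using hq
        field_simp
        ring
      rw [e1, e2]
      have e3 : lamOf q₀ z = kOf q₀ z + (q₀ : ℂ) ^ 2 / z := by
        linear_combination -hkl
      rw [e3]
      have := h.q₀_ne
      field_simp
      ring
  · have hw := h.tendsto_expVec_x (ε := ε) (C := C) t
    have hexp : ∀ x, Complex.exp ((![1, -1] : Fin 2 → ℂ) 1 * (Complex.I * theta ε q₀ x t z))
        * Complex.exp (Complex.I * theta ε q₀ x t z) = 1 := fun x => by
      rw [← Complex.exp_add]; simp
    simp only [smul_smul, hexp, one_smul]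
    exact h.tendsto_colTwo_left hw z

theorem colTwo_eta (h : IsSpectrum q₀ qm η τ) {w : ι → ℂ} (hw : Admissible qm η τ w) (n : ι) :
    colTwo q₀ qm η w (η n)
      = (-(Complex.I * qm / η n)) • ![sol₁ q₀ qm η w n, sol₂ q₀ qm η w n] := by
  rw [colTwo, h.sum_sol₁ hw, h.sum_sol₂ hw]
  funext i
  fin_cases i <;> simp <;> ring

theorem differentiableAt_blaschke (hz : ∀ j, z ≠ η j) :
    DifferentiableAt ℂ (blaschke q₀ η) z := by
  unfold blaschke
  refine DifferentiableAt.fun_finsetProd fun j _ => ?_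
  exact (differentiableAt_id.sub_const _).div (differentiableAt_id.sub_const _)
    (sub_ne_zero.2 (hz j))

theorem blaschke_eq_zero (hz : ∀ j, z ≠ η j) :
    blaschke q₀ η z = 0 ↔ ∃ j, z = hat q₀ η j := by
  rw [blaschke, Finset.prod_eq_zero_iff]
  simp [div_eq_zero_iff, sub_eq_zero, hz]

section
variable (h : IsSpectrum q₀ qm η τ)

theorem cmatInv_mulVec_limVec (h : IsSpectrum q₀ qm η τ) (b : ι → ℂ) (s : ι) :
    ∑ j, limVec q₀ η qm b j / (η s - hat q₀ η j) = b s := by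
  have h1 : (cmatInv q₀ qm η 0).mulVec (limVec q₀ η qm b) = b := by
    rw [limVec, Matrix.mulVec_mulVec,
      Matrix.mul_nonsing_inv _ (isUnit_iff_ne_zero.2 h.cmatInv_zero_det), Matrix.one_mulVec]
  have h2 := congrFun h1 s
  rw [cmatInv_mulVec] at h2
  simpa using h2

theorem prod_mul_blaschke (hz : ∀ j, z ≠ hat q₀ η j) (hz' : ∀ j, z ≠ η j) :
    (∏ j, ((z - η j) / (z - hat q₀ η j))) * blaschke q₀ η z = 1 := by
  rw [blaschke, ← Finset.prod_mul_distrib]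
  refine Finset.prod_eq_one fun j _ => ?_
  have h1 := sub_ne_zero.2 (hz j)
  have h2 := sub_ne_zero.2 (hz' j)
  field_simp

theorem blaschke_mul_two (h : IsSpectrum q₀ qm η τ) (hz : ∀ j, z ≠ hat q₀ η j)
    (hz' : ∀ j, z ≠ η j) :
    blaschke q₀ η z * (1 + ∑ j, limVec q₀ η qm (fun _ => -1) j / (z - hat q₀ η j)) = 1 := by
  rw [const_add_sum_div_eq_prod h.inj (fun s j => h.eta_ne_hat s j) 1 _
    (fun s => by rw [h.cmatInv_mulVec_limVec]; ring) hz, one_mul, mul_comm]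
  exact prod_mul_blaschke hz hz'

theorem blaschke_mul_one (h : IsSpectrum q₀ qm η τ) (hz0 : z ≠ 0) (hz : ∀ j, z ≠ hat q₀ η j)
    (hz' : ∀ j, z ≠ η j) :
    blaschke q₀ η z * (-(Complex.I * qm / z)
      + ∑ j, limVec q₀ η qm (fun j => Complex.I * qm / η j) j / (z - hat q₀ η j))
      = -(Complex.I * qPlus q₀ qm η / z) := by
  set u := limVec q₀ η qm (fun j => Complex.I * qm / η j) with hu
  have key : ∀ y : ℂ, y ≠ 0 → (∀ j, y ≠ hat q₀ η j) →
      -(Complex.I * qPlus q₀ qm η) + ∑ j, hat q₀ η j * u j / (y - hat q₀ η j)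
        = y * (-(Complex.I * qm / y) + ∑ j, u j / (y - hat q₀ η j)) := by
    intro y hy0 hy
    have e : y * ∑ j, u j / (y - hat q₀ η j)
        = ∑ j, u j + ∑ j, hat q₀ η j * u j / (y - hat q₀ η j) := by
      rw [Finset.mul_sum, ← Finset.sum_add_distrib]
      refine Finset.sum_congr rfl fun j _ => ?_
      have := sub_ne_zero.2 (hy j)
      field_simp
      ring
    rw [mul_add, e, qPlus, ← hu]
    field_simp
    linear_combination (-∑ j, u j) * Complex.I_sq
  have h1 := const_add_sum_div_eq_prod h.inj (fun s j => h.eta_ne_hat s j)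
    (-(Complex.I * qPlus q₀ qm η)) (fun j => hat q₀ η j * u j) (fun s => by
      rw [key _ (h.eta_ne s) (fun j => h.eta_ne_hat s j), hu, h.cmatInv_mulVec_limVec]
      ring) hz
  rw [key z hz0 hz] at h1
  have h2 := prod_mul_blaschke (q₀ := q₀) hz hz'
  rw [eq_neg_iff_add_eq_zero, ← mul_right_inj' hz0, mul_zero, mul_add,
    mul_div_cancel₀ _ hz0, mul_left_comm, h1]
  linear_combination (-(Complex.I * qPlus q₀ qm η)) * h2

end

theorem prod_erase_ne_zero (h : IsSpectrum q₀ qm η τ) (n : ι) :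
    deriv (blaschke q₀ η) (hat q₀ η n) * limVec q₀ η qm (fun _ => -1) n = 1 ∧
    deriv (blaschke q₀ η) (hat q₀ η n) * limVec q₀ η qm (fun j => Complex.I * qm / η j) n
      = -(Complex.I * qPlus q₀ qm η / hat q₀ η n) := by
  set p := hat q₀ η n with hp
  have hpη : ∀ j, p ≠ η j := fun j => (h.eta_ne_hat j n).symm
  have hd := (differentiableAt_blaschke (q₀ := q₀) hpη).hasDerivAt
  have h0 : blaschke q₀ η p = 0 := (blaschke_eq_zero hpη).2 ⟨n, rfl⟩
  have hslope : Tendsto (fun z => blaschke q₀ η z / (z - p)) (𝓝[≠] p)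
      (𝓝 (deriv (blaschke q₀ η) p)) := by
    refine (hasDerivAt_iff_tendsto_slope.1 hd).congr fun z => ?_
    rw [slope_def_field, h0, sub_zero]
  -- near `p` the point `z` avoids all poles
  have hne : ∀ᶠ z in 𝓝[≠] p, z ≠ 0 ∧ (∀ j, z ≠ hat q₀ η j) ∧ ∀ j, z ≠ η j := by
    refine Filter.Eventually.and ?_ (Filter.Eventually.and ?_ ?_)
    · exact nhdsWithin_le_nhds (eventually_ne_nhds (h.hat_ne n))
    · refine eventually_all.2 fun j => ?_
      by_cases hj : j = n
      · subst hj
        exact eventually_mem_nhdsWithin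
      · exact nhdsWithin_le_nhds (eventually_ne_nhds fun e => hj (h.hat_inj e).symm)
    · exact nhdsWithin_le_nhds (eventually_all.2 fun j => eventually_ne_nhds (hpη j))
  have hsum : ∀ a : ι → ℂ, Tendsto (fun z => (z - p) * ∑ j, a j / (z - hat q₀ η j)) (𝓝[≠] p)
      (𝓝 (a n)) := by
    intro a
    have h1 : Tendsto (fun z => ∑ j, a j * ((z - p) / (z - hat q₀ η j))) (𝓝[≠] p)
        (𝓝 (∑ j, a j * if j = n then 1 else 0)) := by
      refine tendsto_finsetSum _ fun j _ => Tendsto.const_mul _ ?_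
      by_cases hj : j = n
      · subst hj
        rw [if_pos rfl]
        refine tendsto_const_nhds.congr' ?_
        filter_upwards [eventually_mem_nhdsWithin] with z hz
        exact (div_self (sub_ne_zero.2 hz)).symm
      · rw [if_neg hj]
        have hpj : p - hat q₀ η j ≠ 0 := sub_ne_zero.2 fun e => hj (h.hat_inj e).symm
        have h2 : Tendsto (fun z => (z - p) / (z - hat q₀ η j)) (𝓝 p)
            (𝓝 ((p - p) / (p - hat q₀ η j))) :=
          (tendsto_id.sub_const p).div (tendsto_id.sub_const _) hpj
        rw [sub_self, zero_div] at h2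
        exact h2.mono_left nhdsWithin_le_nhds
    simp only [mul_ite, mul_one, mul_zero, Finset.sum_ite_eq', Finset.mem_univ, if_true] at h1
    refine h1.congr fun z => ?_
    rw [Finset.mul_sum]
    exact Finset.sum_congr rfl fun j _ => by ring
  have hsub : Tendsto (fun z => z - p) (𝓝[≠] p) (𝓝 0) := by
    have : Tendsto (fun z => z - p) (𝓝 p) (𝓝 (p - p)) := tendsto_id.sub_const p
    rw [sub_self] at this
    exact this.mono_left nhdsWithin_le_nhds
  constructor
  · have h1 := hslope.mul (hsub.add (hsum (limVec q₀ η qm fun _ => -1)))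
    rw [zero_add] at h1
    refine tendsto_nhds_unique (h1.congr' ?_) tendsto_const_nhds
    filter_upwards [hne, eventually_mem_nhdsWithin] with z hz hzp
    have hzp' : z - p ≠ 0 := sub_ne_zero.2 hzp
    refine Eq.trans ?_ (h.blaschke_mul_two hz.2.1 hz.2.2)
    field_simp
  · have hinv : Tendsto (fun z : ℂ => (z - p) * -(Complex.I * qm / z)) (𝓝[≠] p) (𝓝 0) := by
      have h2 : Tendsto (fun z : ℂ => -(Complex.I * qm / z)) (𝓝 p)
          (𝓝 (-(Complex.I * qm / p))) := (tendsto_const_nhds.div tendsto_id (h.hat_ne n)).neg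
      simpa using hsub.mul (h2.mono_left nhdsWithin_le_nhds)
    have h1 := hslope.mul (hinv.add (hsum (limVec q₀ η qm fun j => Complex.I * qm / η j)))
    rw [zero_add] at h1
    have h3 : Tendsto (fun z : ℂ => -(Complex.I * qPlus q₀ qm η / z)) (𝓝[≠] p)
        (𝓝 (-(Complex.I * qPlus q₀ qm η / p))) :=
      (tendsto_const_nhds.div tendsto_id (h.hat_ne n)).neg.mono_left nhdsWithin_le_nhds
    refine tendsto_nhds_unique (h1.congr' ?_) h3
    filter_upwards [hne, eventually_mem_nhdsWithin] with z hz hzp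
    have hzp' : z - p ≠ 0 := sub_ne_zero.2 hzp
    rw [← h.blaschke_mul_one hz.1 hz.2.1 hz.2.2, ← mul_add]
    field_simp

theorem tendsto_mul_expVec_right (h : IsSpectrum q₀ qm η τ) (hC : Admissible qm η τ C) (t : ℝ)
    (b : ι → ℂ) (j : ι) :
    Tendsto (fun x => expVec ε q₀ η C x t j
        * (cmat q₀ qm η (expVec ε q₀ η C x t))⁻¹.mulVec b j) atTop
      (𝓝 (limVec q₀ η qm b j)) :=
  h.tendsto_mul_right (fun x => (h.admissible_expVec (ε := ε) hC x t).ne_zero)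
    (h.tendsto_inv_expVec_x t) b j

/-- Off the zeros of `s₂₂` the Jost solutions `φ_{+,2}` and `s₂₂ φ_{-,2}` agree. -/
theorem isJost_colTwo_right (h : IsSpectrum q₀ qm η τ) (hC : Admissible qm η τ C) (t : ℝ)
    (hz0 : z ≠ 0) (hz : ∀ j, z ≠ hat q₀ η j) (hz' : ∀ j, z ≠ η j) :
    IsJost ε q₀ (sol ε q₀ qm η C) (qPlus q₀ qm η) atTop 1 t z fun x =>
      blaschke q₀ η z • Complex.exp (Complex.I * theta ε q₀ x t z)
        • colTwo q₀ qm η (expVec ε q₀ η C x t) z := by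
  refine ⟨(h.isJost_colTwo hC t hz0 hz).isLax.smul _, ?_⟩
  have hexp : ∀ x, Complex.exp ((![1, -1] : Fin 2 → ℂ) 1 * (Complex.I * theta ε q₀ x t z))
      * Complex.exp (Complex.I * theta ε q₀ x t z) = 1 := fun x => by
    rw [← Complex.exp_add]; simp
  have e : ∀ x, Complex.exp ((![1, -1] : Fin 2 → ℂ) 1 * (Complex.I * theta ε q₀ x t z))
      • blaschke q₀ η z • Complex.exp (Complex.I * theta ε q₀ x t z)
        • colTwo q₀ qm η (expVec ε q₀ η C x t) z
      = blaschke q₀ η z • colTwo q₀ qm η (expVec ε q₀ η C x t) z := fun x => by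
    rw [smul_comm, smul_smul _ _ (colTwo _ _ _ _ _), hexp, one_smul]
  simp only [e]
  have t1 : ∀ j ∈ Finset.univ, Tendsto (fun x => expVec ε q₀ η C x t j
      * sol₁ q₀ qm η (expVec ε q₀ η C x t) j / (z - hat q₀ η j)) atTop
      (𝓝 (limVec q₀ η qm (fun j => Complex.I * qm / η j) j / (z - hat q₀ η j))) := fun j _ =>
    (h.tendsto_mul_expVec_right hC t _ j).div_const _
  have t2 : ∀ j ∈ Finset.univ, Tendsto (fun x => expVec ε q₀ η C x t j
      * sol₂ q₀ qm η (expVec ε q₀ η C x t) j / (z - hat q₀ η j)) atTop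
      (𝓝 (limVec q₀ η qm (fun _ => -1) j / (z - hat q₀ η j))) := fun j _ =>
    (h.tendsto_mul_expVec_right hC t _ j).div_const _
  have l1 := ((tendsto_finsetSum Finset.univ t1).const_add (-(Complex.I * qm / z))).const_mul
    (blaschke q₀ η z)
  have l2 := ((tendsto_finsetSum Finset.univ t2).const_add 1).const_mul (blaschke q₀ η z)
  rw [h.blaschke_mul_one hz0 hz hz'] at l1
  rw [h.blaschke_mul_two hz hz'] at l2
  refine tendsto_pi_nhds.2 fun i => ?_
  fin_cases i
  · simpa [E, colTwo] using l1
  · simpa [E, colTwo] using l2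

/-- The Jost solution `φ_{-,1}`. -/
def _root_.IfoNLS.solJost (ε q₀ : ℝ) (qm : ℂ) (η C : ι → ℂ) (t : ℝ) (z : ℂ) (x : ℝ) :
    Fin 2 → ℂ :=
  (-(Complex.I * conj qm / z)) • Complex.exp (Complex.I * theta ε q₀ x t (-(q₀ : ℂ) ^ 2 / z))
    • colTwo q₀ qm η (expVec ε q₀ η C x t) (-(q₀ : ℂ) ^ 2 / z)

theorem neg_div_ne_hat (h : IsSpectrum q₀ qm η τ) {j : ι} (hz : z ≠ η j) :
    -(q₀ : ℂ) ^ 2 / z ≠ hat q₀ η j := fun e => by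
  apply hz
  have h1 := congrArg (fun y => -(q₀ : ℂ) ^ 2 / y) e
  have h2 : -(q₀ : ℂ) ^ 2 ≠ 0 := neg_ne_zero.2 (pow_ne_zero 2 h.q₀_ne)
  simpa only [hat, div_div_cancel₀ h2] using h1

theorem isJost_solJost (h : IsSpectrum q₀ qm η τ) (hC : Admissible qm η τ C) (t : ℝ)
    (hz0 : z ≠ 0) (hz : ∀ j, z ≠ η j) :
    IsJost ε q₀ (sol ε q₀ qm η C) qm atBot 0 t z (solJost ε q₀ qm η C t z) :=
  (h.isJost_colTwo hC t (div_ne_zero (neg_ne_zero.2 (pow_ne_zero 2 h.q₀_ne)) hz0)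
    (fun j => h.neg_div_ne_hat (hz j))).col_zero h.q₀_ne hz0 h.qm_mul_conj

theorem solJost_hat (h : IsSpectrum q₀ qm η τ) (hC : Admissible qm η τ C) (t : ℝ) (n : ι)
    (x : ℝ) : solJost ε q₀ qm η C t (hat q₀ η n) x
      = Complex.exp (-(Complex.I * theta ε q₀ x t (hat q₀ η n)))
        • ![sol₁ q₀ qm η (expVec ε q₀ η C x t) n, sol₂ q₀ qm η (expVec ε q₀ η C x t) n] := by
  have e1 : -(q₀ : ℂ) ^ 2 / hat q₀ η n = η n := by
    rw [← h.hat_mul_eta n, mul_div_cancel_left₀ _ (h.hat_ne n)]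
  have e2 : theta ε q₀ x t (η n) = -theta ε q₀ x t (hat q₀ η n) := by
    rw [hat, theta_neg_div h.q₀_ne _ _ _ (h.eta_ne n), neg_neg]
  have e3 : -(Complex.I * conj qm / hat q₀ η n) * -(Complex.I * qm / η n) = 1 := by
    have h1 := h.hat_ne n
    have h2 := h.eta_ne n
    have h3 := h.hat_mul_eta n
    have h4 := h.qm_mul_conj
    field_simp
    linear_combination (conj qm * qm) * Complex.I_sq - h4 - h3
  rw [solJost, e1, e2, h.colTwo_eta (h.admissible_expVec hC x t), smul_comm (Complex.exp _),
    smul_smul, e3, one_smul, mul_neg]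

/-- At a zero of `s₂₂` the two Jost solutions are proportional. -/
theorem isJost_right_hat (h : IsSpectrum q₀ qm η τ) (hC : Admissible qm η τ C) (t : ℝ) (n : ι) :
    IsJost ε q₀ (sol ε q₀ qm η C) (qPlus q₀ qm η) atTop 1 t (hat q₀ η n) fun x =>
      (deriv (blaschke q₀ η) (hat q₀ η n) * C n) • solJost ε q₀ qm η C t (hat q₀ η n) x := by
  refine ⟨(h.isJost_solJost hC t (h.hat_ne n) fun j => (h.eta_ne_hat j n).symm).isLax.smul _, ?_⟩
  have e : ∀ x, Complex.exp ((![1, -1] : Fin 2 → ℂ) 1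
        * (Complex.I * theta ε q₀ x t (hat q₀ η n)))
      • (deriv (blaschke q₀ η) (hat q₀ η n) * C n) • solJost ε q₀ qm η C t (hat q₀ η n) x
      = deriv (blaschke q₀ η) (hat q₀ η n) • expVec ε q₀ η C x t n
        • ![sol₁ q₀ qm η (expVec ε q₀ η C x t) n, sol₂ q₀ qm η (expVec ε q₀ η C x t) n] := by
    intro x
    have e2 : Complex.exp ((![1, -1] : Fin 2 → ℂ) 1 * (Complex.I * theta ε q₀ x t (hat q₀ η n)))
        * Complex.exp (-(Complex.I * theta ε q₀ x t (hat q₀ η n)))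
        = Complex.exp (-2 * Complex.I * theta ε q₀ x t (hat q₀ η n)) := by
      rw [← Complex.exp_add]
      congr 1
      simp
      ring
    rw [h.solJost_hat hC, smul_smul, smul_smul, smul_smul, expVec, ← e2]
    congr 1
    ring
  simp only [e]
  obtain ⟨h2, h1⟩ := h.prod_erase_ne_zero n
  have l1 := (h.tendsto_mul_expVec_right (ε := ε) hC t (fun j => Complex.I * qm / η j) n).const_mul
    (deriv (blaschke q₀ η) (hat q₀ η n))
  have l2 := (h.tendsto_mul_expVec_right (ε := ε) hC t (fun _ => -1) n).const_mul
    (deriv (blaschke q₀ η) (hat q₀ η n))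
  rw [h1] at l1
  rw [h2] at l2
  refine tendsto_pi_nhds.2 fun i => ?_
  fin_cases i
  · simpa [E, sol₁] using l1
  · simpa [E, sol₂] using l2

end IsSpectrum
end SolitonJost

/-! ### The scattering data of the soliton potential -/

section Regions

variable {q₀ : ℝ} {z : ℂ}

theorem ne_zero_of_mem_Dplus (hz : z ∈ Dplus q₀) : z ≠ 0 := fun h => by
  simp [Dplus, h] at hz

theorem ne_zero_of_mem_Dminus (hz : z ∈ Dminus q₀) : z ≠ 0 := fun h => by
  simp [Dminus, h] at hz

theorem mem_Dplus_iff (hz : z ≠ 0) : z ∈ Dplus q₀ ↔ 0 < (lamOf q₀ z).im := by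
  have h1 : 0 < 2 * ‖z‖ ^ 2 := by have := norm_pos_iff.2 hz; positivity
  rw [im_lamOf q₀ hz, div_pos_iff_of_pos_right h1]
  rfl

theorem mem_Dminus_iff (hz : z ≠ 0) : z ∈ Dminus q₀ ↔ (lamOf q₀ z).im < 0 := by
  have h1 : 0 < 2 * ‖z‖ ^ 2 := by have := norm_pos_iff.2 hz; positivity
  rw [im_lamOf q₀ hz, div_neg_iff]
  simp only [h1, not_lt.2 h1.le, and_false, and_true, false_or]
  rfl

theorem neg_div_ne_zero (hq : (q₀ : ℂ) ≠ 0) (hz : z ≠ 0) : -(q₀ : ℂ) ^ 2 / z ≠ 0 :=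
  div_ne_zero (neg_ne_zero.2 (pow_ne_zero 2 hq)) hz

theorem neg_div_mem_Dplus (hq : (q₀ : ℂ) ≠ 0) (hz : z ∈ Dminus q₀) :
    -(q₀ : ℂ) ^ 2 / z ∈ Dplus q₀ := by
  have h0 := ne_zero_of_mem_Dminus hz
  rw [mem_Dminus_iff h0] at hz
  rw [mem_Dplus_iff (neg_div_ne_zero hq h0), lamOf_neg_div hq h0, Complex.neg_im]
  linarith

theorem im_lamOf_of_mem_Sigma (hz : z ∈ Sigma₁ q₀) : (lamOf q₀ z).im = 0 := by
  rw [im_lamOf q₀ hz.2.1]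
  rcases hz.1 with h | h <;> simp [h]

theorem gam_ne_zero_of_ne (hz : z ≠ 0) (h1 : z ≠ Complex.I * q₀) (h2 : z ≠ -(Complex.I * q₀)) :
    gam q₀ z ≠ 0 := fun h => by
  rw [gam, add_div' _ _ _ (pow_ne_zero 2 hz), div_eq_zero_iff, or_iff_left (pow_ne_zero 2 hz)] at h
  have h3 : (z - Complex.I * q₀) * (z + Complex.I * q₀) = 0 := by
    linear_combination h - (q₀ : ℂ) ^ 2 * Complex.I_sq
  rcases mul_eq_zero.1 h3 with h4 | h4
  · exact h1 (sub_eq_zero.1 h4)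
  · exact h2 (eq_neg_of_add_eq_zero_left h4)

theorem gam_ne_zero_of_im_ne (hq : 0 < q₀) (hz : z ≠ 0) (h : (lamOf q₀ z).im ≠ 0) :
    gam q₀ z ≠ 0 := by
  have h0 : (‖z‖ ^ 2 - q₀ ^ 2) ≠ 0 := fun h0 => h (by rw [im_lamOf q₀ hz, h0]; simp)
  refine gam_ne_zero_of_ne hz (fun e => h0 ?_) (fun e => h0 ?_) <;> simp [e, abs_of_pos hq]

theorem gam_neg_div (hq : (q₀ : ℂ) ≠ 0) (hz : z ≠ 0) :
    gam q₀ (-(q₀ : ℂ) ^ 2 / z) = z ^ 2 / (q₀ : ℂ) ^ 2 * gam q₀ z := by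
  simp only [gam]
  field_simp
  ring

theorem isOpen_Dplus : IsOpen (Dplus q₀) :=
  isOpen_lt continuous_const (by fun_prop)

theorem isOpen_Dminus : IsOpen (Dminus q₀) :=
  isOpen_lt (by fun_prop) continuous_const

end Regions

section Spec

variable {ε q₀ : ℝ} {q : ℝ → ℝ → ℂ} {a b : ℂ} {l : Filter ℝ} {j : Fin 2} {t : ℝ} {z : ℂ}
  {φ ψ : ℝ → Fin 2 → ℂ}

theorem isJost_jost (h : ∃ φ, IsJost ε q₀ q a l j t z φ) :
    IsJost ε q₀ q a l j t z (jost ε q₀ q a l j t z) := by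
  rw [jost, dif_pos h]
  exact h.choose_spec

/-- The Wronskian of the two columns normalized at the same end is `γ`. -/
theorem wr_jost_jost [l.NeBot] (ha : a * conj a = (q₀ : ℂ) ^ 2) (hz : z ≠ 0)
    (h : IsJost ε q₀ q a l 0 t z φ) (h' : IsJost ε q₀ q a l 1 t z ψ) (x : ℝ) :
    wr (φ x) (ψ x) = gam q₀ z := by
  have a0 := tendsto_pi_nhds.1 h.tendsto
  have a1 := tendsto_pi_nhds.1 h'.tendsto
  have h1 := ((a0 0).mul (a1 1)).sub ((a0 1).mul (a1 0))
  have e : ∀ y, (normFactor ε q₀ 0 t z y • φ y) 0 * (normFactor ε q₀ 1 t z y • ψ y) 1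
      - (normFactor ε q₀ 0 t z y • φ y) 1 * (normFactor ε q₀ 1 t z y • ψ y) 0
      = wr (φ x) (ψ x) := by
    intro y
    have h2 : normFactor ε q₀ 0 t z y * normFactor ε q₀ 1 t z y = 1 := by
      rw [normFactor, normFactor, ← Complex.exp_add]
      simp
    rw [h.isLax.wr_eq h'.isLax x y, wr]
    simp only [Pi.smul_apply, smul_eq_mul]
    linear_combination (φ y 0 * ψ y 1 - φ y 1 * ψ y 0) * h2
  have h3 := tendsto_nhds_unique (h1.congr e) tendsto_const_nhds
  rw [← h3]
  simp only [E, gam]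
  simp
  field_simp
  linear_combination ha - a * conj a * Complex.I_sq

end Spec

section SolitonData

variable {ι : Type*} [Fintype ι] [DecidableEq ι] {ε q₀ : ℝ} {qm : ℂ} {η C : ι → ℂ} {τ : ι → ι}
  {t : ℝ} {z : ℂ}

namespace IsSpectrum

theorem continuous_sol (h : IsSpectrum q₀ qm η τ) (hC : Admissible qm η τ C) (t : ℝ) :
    Continuous fun x => sol ε q₀ qm η C x t :=
  (h.contDiff_sol_x (n := 0) hC t).continuous

theorem jostM_sol (h : IsSpectrum q₀ qm η τ) (hC : Admissible qm η τ C) (t : ℝ) (hz0 : z ≠ 0)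
    (hz : 0 ≤ (lamOf q₀ z).im) :
    jostM ε q₀ qm (sol ε q₀ qm η C) 0 t z = solJost ε q₀ qm η C t z :=
  (h.isJost_solJost hC t hz0 (h.ne_eta_of_mem hz)).jost_eq (h.continuous_sol hC t)
    (jostRange_atBot_zero hz)

theorem jostP_sol (h : IsSpectrum q₀ qm η τ) (hC : Admissible qm η τ C) (t : ℝ) (hz0 : z ≠ 0)
    (hz : 0 ≤ (lamOf q₀ z).im) (hz' : ∀ j, z ≠ hat q₀ η j) :
    jostP ε q₀ (qPlus q₀ qm η) (sol ε q₀ qm η C) 1 t z = fun x =>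
      blaschke q₀ η z • Complex.exp (Complex.I * theta ε q₀ x t z)
        • colTwo q₀ qm η (expVec ε q₀ η C x t) z :=
  (h.isJost_colTwo_right hC t hz0 hz' (h.ne_eta_of_mem hz)).jost_eq (h.continuous_sol hC t)
    (jostRange_atTop_one hz)

theorem jostP_sol_hat (h : IsSpectrum q₀ qm η τ) (hC : Admissible qm η τ C) (t : ℝ) (n : ι) :
    jostP ε q₀ (qPlus q₀ qm η) (sol ε q₀ qm η C) 1 t (hat q₀ η n) = fun x =>
      (deriv (blaschke q₀ η) (hat q₀ η n) * C n) • solJost ε q₀ qm η C t (hat q₀ η n) x :=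
  (h.isJost_right_hat hC t n).jost_eq (h.continuous_sol hC t)
    (jostRange_atTop_one (im_lamOf_pos (h.hat_mem n)).le)

theorem exists_isJost_right (h : IsSpectrum q₀ qm η τ) (hC : Admissible qm η τ C) (t : ℝ)
    (hz0 : z ≠ 0) (hz : 0 ≤ (lamOf q₀ z).im) :
    IsJost ε q₀ (sol ε q₀ qm η C) (qPlus q₀ qm η) atTop 1 t z
      (jostP ε q₀ (qPlus q₀ qm η) (sol ε q₀ qm η C) 1 t z) := by
  refine isJost_jost ?_
  by_cases hz' : ∃ j, z = hat q₀ η j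
  · obtain ⟨n, rfl⟩ := hz'
    exact ⟨_, h.isJost_right_hat hC t n⟩
  · exact ⟨_, h.isJost_colTwo_right hC t hz0 (not_exists.1 hz') (h.ne_eta_of_mem hz)⟩

theorem s22_sol (h : IsSpectrum q₀ qm η τ) (hC : Admissible qm η τ C) (t : ℝ)
    (hz : z ∈ Dplus q₀) :
    s22 ε q₀ qm (qPlus q₀ qm η) (sol ε q₀ qm η C) t z = blaschke q₀ η z := by
  have hz0 := ne_zero_of_mem_Dplus hz
  have him := im_lamOf_pos hz
  rw [s22, h.jostM_sol hC t hz0 him.le, div_eq_iff (gam_ne_zero_of_im_ne h.pos hz0 him.ne')]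
  by_cases hz' : ∃ j, z = hat q₀ η j
  · obtain ⟨n, rfl⟩ := hz'
    rw [h.jostP_sol_hat hC t n, wr_smul_right, wr_self, (blaschke_eq_zero fun j =>
      (h.eta_ne_hat j n).symm).2 ⟨n, rfl⟩]
    ring
  · rw [not_exists] at hz'
    rw [h.jostP_sol hC t hz0 him.le hz', wr_smul_right,
      wr_jost_jost h.qm_mul_conj hz0 (h.isJost_solJost hC t hz0 (h.ne_eta_of_mem him.le))
        (h.isJost_colTwo hC t hz0 hz')]

theorem jostP_zero_sol (h : IsSpectrum q₀ qm η τ) (hC : Admissible qm η τ C) (t : ℝ) (hz0 : z ≠ 0)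
    (hz : (lamOf q₀ z).im ≤ 0) :
    jostP ε q₀ (qPlus q₀ qm η) (sol ε q₀ qm η C) 0 t z = fun x =>
      (-(Complex.I * conj (qPlus q₀ qm η) / z)) •
        jostP ε q₀ (qPlus q₀ qm η) (sol ε q₀ qm η C) 1 t (-(q₀ : ℂ) ^ 2 / z) x := by
  have hz' : 0 ≤ (lamOf q₀ (-(q₀ : ℂ) ^ 2 / z)).im := by
    rw [lamOf_neg_div h.q₀_ne hz0, Complex.neg_im]; linarith
  exact ((h.exists_isJost_right hC t (neg_div_ne_zero h.q₀_ne hz0) hz').col_zero h.q₀_ne hz0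
    (h.qPlus_mul_conj hC)).jost_eq (h.continuous_sol hC t) (jostRange_atTop_zero hz)

theorem jostM_one_sol (h : IsSpectrum q₀ qm η τ) (hC : Admissible qm η τ C) (t : ℝ) (hz0 : z ≠ 0)
    (hz : (lamOf q₀ z).im ≤ 0) :
    jostM ε q₀ qm (sol ε q₀ qm η C) 1 t z = fun x =>
      (-(Complex.I * qm / z)) • jostM ε q₀ qm (sol ε q₀ qm η C) 0 t (-(q₀ : ℂ) ^ 2 / z) x := by
  have hz' : 0 ≤ (lamOf q₀ (-(q₀ : ℂ) ^ 2 / z)).im := by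
    rw [lamOf_neg_div h.q₀_ne hz0, Complex.neg_im]; linarith
  have h1 := neg_div_ne_zero h.q₀_ne hz0
  rw [h.jostM_sol hC t h1 hz']
  exact ((h.isJost_solJost hC t h1 (h.ne_eta_of_mem hz')).col_one h.q₀_ne hz0
    h.qm_mul_conj).jost_eq (h.continuous_sol hC t) (jostRange_atBot_one hz)

theorem s11_sol (h : IsSpectrum q₀ qm η τ) (hC : Admissible qm η τ C) (t : ℝ)
    (hz : z ∈ Dminus q₀) :
    s11 ε q₀ qm (qPlus q₀ qm η) (sol ε q₀ qm η C) t z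
      = conj (qPlus q₀ qm η) * qm / (q₀ : ℂ) ^ 2 * blaschke q₀ η (-(q₀ : ℂ) ^ 2 / z) := by
  have hz0 := ne_zero_of_mem_Dminus hz
  have him := (mem_Dminus_iff hz0).1 hz
  have hq := h.q₀_ne
  have hg := gam_ne_zero_of_im_ne h.pos hz0 him.ne
  rw [← h.s22_sol (ε := ε) hC t (neg_div_mem_Dplus h.q₀_ne hz), s11, s22,
    h.jostP_zero_sol hC t hz0 him.le, h.jostM_one_sol hC t hz0 him.le, gam_neg_div hq hz0,
    wr_smul_left, wr_smul_right, wr_swap (jostP _ _ _ _ _ _ _ _)]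
  generalize wr (jostM _ _ _ _ _ _ _ _) _ = W
  field_simp
  linear_combination (-(conj (qPlus q₀ qm η) * qm * W)) * Complex.I_sq

theorem deriv_blaschke_ne_zero (h : IsSpectrum q₀ qm η τ) (n : ι) :
    deriv (blaschke q₀ η) (hat q₀ η n) ≠ 0 := fun h0 => by
  have := (h.prod_erase_ne_zero n).1
  rw [h0, zero_mul] at this
  exact zero_ne_one this

theorem deriv_s22_sol (h : IsSpectrum q₀ qm η τ) (hC : Admissible qm η τ C) (t : ℝ) (n : ι) :
    deriv (s22 ε q₀ qm (qPlus q₀ qm η) (sol ε q₀ qm η C) t) (hat q₀ η n)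
      = deriv (blaschke q₀ η) (hat q₀ η n) := by
  refine EventuallyEq.deriv_eq ?_
  filter_upwards [isOpen_Dplus.mem_nhds (h.hat_mem n)] with z hz
  exact h.s22_sol hC t hz

theorem deriv_s11_sol_ne_zero (h : IsSpectrum q₀ qm η τ) (hC : Admissible qm η τ C) (t : ℝ)
    (n : ι) : deriv (s11 ε q₀ qm (qPlus q₀ qm η) (sol ε q₀ qm η C) t) (η n) ≠ 0 := by
  have e : s11 ε q₀ qm (qPlus q₀ qm η) (sol ε q₀ qm η C) t =ᶠ[𝓝 (η n)]
      fun z => conj (qPlus q₀ qm η) * qm / (q₀ : ℂ) ^ 2 * blaschke q₀ η (-(q₀ : ℂ) ^ 2 / z) := by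
    filter_upwards [isOpen_Dminus.mem_nhds (h.mem n)] with z hz
    exact h.s11_sol hC t hz
  have hη := h.eta_ne n
  have hq := h.q₀_ne
  have d1 : HasDerivAt (fun z : ℂ => -(q₀ : ℂ) ^ 2 / z) ((q₀ : ℂ) ^ 2 / η n ^ 2) (η n) := by
    refine ((hasDerivAt_inv hη).const_mul (-(q₀ : ℂ) ^ 2)).congr_deriv ?_
    ring
  have d2 : HasDerivAt (blaschke q₀ η) (deriv (blaschke q₀ η) (hat q₀ η n))
      (-(q₀ : ℂ) ^ 2 / η n) :=
    (differentiableAt_blaschke fun j => (h.eta_ne_hat j n).symm).hasDerivAt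
  have d3 := (d2.comp (η n) d1).const_mul (conj (qPlus q₀ qm η) * qm / (q₀ : ℂ) ^ 2)
  rw [e.deriv_eq]
  refine ne_of_eq_of_ne d3.deriv ?_
  have hp : conj (qPlus q₀ qm η) ≠ 0 := fun h0 => by
    have := h.qPlus_mul_conj hC
    rw [h0, mul_zero] at this
    exact pow_ne_zero 2 hq this.symm
  exact mul_ne_zero (div_ne_zero (mul_ne_zero hp h.qm_ne) (pow_ne_zero 2 hq))
    (mul_ne_zero (h.deriv_blaschke_ne_zero n) (div_ne_zero (pow_ne_zero 2 hq)
      (pow_ne_zero 2 hη)))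

theorem s12_sol (h : IsSpectrum q₀ qm η τ) (hC : Admissible qm η τ C) (t : ℝ)
    (hz : z ∈ Sigma₁ q₀) : s12 ε q₀ qm (qPlus q₀ qm η) (sol ε q₀ qm η C) t z = 0 := by
  have hz0 := hz.2.1
  have him := im_lamOf_of_mem_Sigma hz
  have hh := h.ne_hat_of_mem him.le
  have e : jostM ε q₀ qm (sol ε q₀ qm η C) 1 t z = fun x =>
      Complex.exp (Complex.I * theta ε q₀ x t z) • colTwo q₀ qm η (expVec ε q₀ η C x t) z :=
    (h.isJost_colTwo hC t hz0 hh).jost_eq (h.continuous_sol hC t) (jostRange_atBot_one him.le)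
  rw [s12, h.jostP_sol hC t hz0 him.ge hh, e, wr_smul_left, wr_self, mul_zero, zero_div]

theorem s21_sol (h : IsSpectrum q₀ qm η τ) (hC : Admissible qm η τ C) (t : ℝ)
    (hz : z ∈ Sigma₁ q₀) : s21 ε q₀ qm (qPlus q₀ qm η) (sol ε q₀ qm η C) t z = 0 := by
  have hz0 := hz.2.1
  have him := im_lamOf_of_mem_Sigma hz
  have him' : (lamOf q₀ (-(q₀ : ℂ) ^ 2 / z)).im = 0 := by
    rw [lamOf_neg_div h.q₀_ne hz0, Complex.neg_im, him, neg_zero]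
  rw [s21, h.jostP_zero_sol hC t hz0 him.le, h.jostM_sol hC t hz0 him.ge,
    h.jostP_sol hC t (neg_div_ne_zero h.q₀_ne hz0) him'.ge (h.ne_hat_of_mem him'.le), solJost,
    wr_smul_left, wr_smul_right, wr_smul_right, wr_self]
  simp

end IsSpectrum

variable {N : ℕ} {y : Fin N → ℂ} {D : Fin N ⊕ Fin N → ℂ}

theorem isSpectrum_eta (hq₀ : 0 < q₀) (hqm : ‖qm‖ = q₀) (hy : Function.Injective y)
    (hy_out : ∀ n, q₀ < ‖y n‖) (hy_im : ∀ n, (y n).im < 0) :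
    IsSpectrum q₀ qm (eta q₀ y) Sum.swap := by
  have hq : (q₀ : ℂ) ≠ 0 := by exact_mod_cast hq₀.ne'
  have h0 : ∀ n, y n ≠ 0 := fun n e => by
    have := hy_im n
    simp [e] at this
  have h0' : ∀ n, conj (y n) ≠ 0 := fun n => by simpa using h0 n
  have hq2 : -(q₀ : ℂ) ^ 2 ≠ 0 := neg_ne_zero.2 (pow_ne_zero 2 hq)
  -- the two halves of the spectrum lie outside and inside the circle
  have hin : ∀ n, ‖-(q₀ : ℂ) ^ 2 / conj (y n)‖ < q₀ := fun n => by
    rw [norm_div, norm_neg, norm_pow, RCLike.norm_conj, Complex.norm_real, Real.norm_of_nonneg hq₀.le,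
      div_lt_iff₀ (hq₀.trans (hy_out n)), sq]
    exact mul_lt_mul_of_pos_left (hy_out n) hq₀
  refine ⟨hq₀, hqm, ?_, ?_, ?_⟩
  · rintro (m | m) (n | n) hmn
    · exact congrArg Sum.inl (hy hmn)
    · have h1 := hin n
      have h2 := hy_out m
      simp only [eta, Sum.elim_inl, Sum.elim_inr] at hmn
      rw [← hmn] at h1
      exact absurd h1 (not_lt.2 h2.le)
    · have h1 := hin m
      have h2 := hy_out n
      simp only [eta, Sum.elim_inl, Sum.elim_inr] at hmn
      rw [hmn] at h1
      exact absurd h1 (not_lt.2 h2.le)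
    · simp only [eta, Sum.elim_inr] at hmn
      have h1 := congrArg (fun x => -(q₀ : ℂ) ^ 2 / x) hmn
      simp only [div_div_cancel₀ hq2] at h1
      exact congrArg Sum.inr (hy (star_injective h1))
  · have hmem : ∀ n, y n ∈ Dminus q₀ := fun n => by
      have h1 := hy_out n
      have h2 := hy_im n
      simp only [Dminus, Set.mem_ofPred_eq]
      nlinarith [mul_pos (show 0 < ‖y n‖ ^ 2 - q₀ ^ 2 by nlinarith) (neg_pos.2 h2)]
    rintro (n | n)
    · exact hmem n
    · have h1 := (mem_Dminus_iff (h0 n)).1 (hmem n)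
      simp only [eta, Sum.elim_inr]
      rw [mem_Dminus_iff (div_ne_zero hq2 (h0' n)), lamOf_neg_div hq (h0' n), lamOf_conj]
      simpa using h1
  · rintro (n | n)
    · simp only [eta, Sum.elim_inl, Sum.elim_inr, Sum.swap_inl]
      rw [mul_div_cancel₀ _ (h0' n)]
    · simp only [eta, Sum.elim_inl, Sum.elim_inr, Sum.swap_inr]
      rw [map_div₀, Complex.conj_conj]
      simp [div_mul_cancel₀ _ (h0 n)]

theorem admissible_of_symmetry (hy : ∀ n, y n ≠ 0) (hqm : qm ≠ 0) (hqq : qm * conj qm = (q₀ : ℂ) ^ 2)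
    (hD : NormingSymmetry qm y D) (hD0 : ∀ n, D n ≠ 0) :
    Admissible qm (eta q₀ y) Sum.swap D := by
  refine ⟨hD0, ?_⟩
  have hc : conj qm ≠ 0 := by simpa using hqm
  rintro (n | n)
  · have h1 := hD n
    have h2 := hy n
    have h2' : conj (y n) ≠ 0 := by simpa using h2
    simp only [Sum.swap_inl, eta, Sum.elim_inr]
    rw [h1]
    simp only [map_mul, map_neg, map_div₀, map_pow, Complex.conj_conj]
    rw [show (-(q₀ : ℂ) ^ 2) = -(qm * conj qm) by rw [hqq]]
    field_simp
  · have h1 := hD n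
    have h2 := hy n
    simp only [Sum.swap_inr, eta, Sum.elim_inl]
    rw [h1]
    field_simp

theorem soliton_eq_sol (h : IsSpectrum q₀ qm (eta q₀ y) Sum.swap)
    (hD : Admissible qm (eta q₀ y) Sum.swap D) :
    soliton ε q₀ qm y D = sol ε q₀ qm (eta q₀ y) D := by
  funext x t
  exact (potential_eq_det
    (h.det_cmat_ne_zero (h.admissible_expVec (ε := ε) hD x t))).symm

theorem reflectionlessSimple_sol (h : IsSpectrum q₀ qm (eta q₀ y) Sum.swap)
    (hD : Admissible qm (eta q₀ y) Sum.swap D) (t : ℝ) :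
    ReflectionlessSimple ε q₀ qm (qPlus q₀ qm (eta q₀ y)) y D (sol ε q₀ qm (eta q₀ y) D) t where
  s12_eq_zero ζ hζ := h.s12_sol hD t hζ
  s21_eq_zero ζ hζ := h.s21_sol hD t hζ
  s11_zeros ζ hζ := by
    have hp : conj (qPlus q₀ qm (eta q₀ y)) ≠ 0 := fun h0 => by
      have := h.qPlus_mul_conj hD
      rw [h0, mul_zero] at this
      exact pow_ne_zero 2 h.q₀_ne this.symm
    have hc : conj (qPlus q₀ qm (eta q₀ y)) * qm / (q₀ : ℂ) ^ 2 ≠ 0 :=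
      div_ne_zero (mul_ne_zero hp h.qm_ne) (pow_ne_zero 2 h.q₀_ne)
    rw [h.s11_sol hD t hζ, mul_eq_zero, or_iff_right hc, IsSpectrum.blaschke_eq_zero
      (h.ne_eta_of_mem (im_lamOf_pos (neg_div_mem_Dplus h.q₀_ne hζ)).le)]
    refine exists_congr fun n => ⟨fun e => ?_, fun e => by rw [e]; rfl⟩
    by_contra hne
    exact h.neg_div_ne_hat hne e
  s22_zeros ζ hζ := by
    rw [h.s22_sol hD t hζ, IsSpectrum.blaschke_eq_zero (h.ne_eta_of_mem (im_lamOf_pos hζ).le)]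
    rfl
  s11_simple n := h.deriv_s11_sol_ne_zero hD t n
  s22_simple n := by
    change deriv _ (hat q₀ (eta q₀ y) n) ≠ 0
    rw [h.deriv_s22_sol hD t n]
    exact h.deriv_blaschke_ne_zero n
  norming n := by
    refine ⟨deriv (blaschke q₀ (eta q₀ y)) (hat q₀ (eta q₀ y) n) * D n, fun x => ?_, ?_⟩
    · change jostP _ _ _ _ _ _ (hat q₀ (eta q₀ y) n) x = _ • jostM _ _ _ _ _ _ (hat q₀ (eta q₀ y) n) x
      rw [h.jostP_sol_hat hD t n, h.jostM_sol hD t (h.hat_ne n) (im_lamOf_pos (h.hat_mem n)).le]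
    · change _ = _ / deriv _ (hat q₀ (eta q₀ y) n)
      rw [h.deriv_s22_sol hD t n, mul_div_cancel_left₀ _ (h.deriv_blaschke_ne_zero n)]

end SolitonData

section Phase

variable {ε c : ℝ} {q : ℝ → ℝ → ℂ}

/-- Multiplication by `e^{2ict}` removes the term `-2cq` from the equation. -/
theorem IsSolution.mul_exp (h : IsSolution ε c q) :
    IsSolution ε 0 (fun x t => q x t * Complex.exp (2 * Complex.I * (c : ℂ) * t)) := by
  obtain ⟨hq, h⟩ := h
  have he : ContDiff ℝ 5 fun p : ℝ × ℝ => Complex.exp (2 * Complex.I * (c : ℂ) * (p.2 : ℝ)) := by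
    have : ContDiff ℝ 5 fun p : ℝ × ℝ => ((p.2 : ℝ) : ℂ) :=
      Complex.ofRealCLM.contDiff.comp contDiff_snd
    exact (contDiff_const.mul this).cexp
  refine ⟨hq.mul he, fun x t => ?_⟩
  have hqx : ContDiff ℝ 5 fun y => q y t :=
    hq.comp (contDiff_id.prodMk contDiff_const : ContDiff ℝ 5 fun y : ℝ => (y, t))
  have hqt : ContDiff ℝ 5 fun s => q x s :=
    hq.comp (contDiff_const.prodMk contDiff_id : ContDiff ℝ 5 fun s : ℝ => (x, s))
  set e := Complex.exp (2 * Complex.I * (c : ℂ) * t) with he'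
  have hnorm : ‖e‖ = 1 := by
    rw [he', show 2 * Complex.I * (c : ℂ) * t = ((2 * c * t : ℝ) : ℂ) * Complex.I by
      push_cast; ring]
    exact Complex.norm_exp_ofReal_mul_I _
  have hee : e * conj e = 1 := by rw [Complex.mul_conj']; simp [hnorm]
  have hdx : ∀ j ≤ 5, ∀ y, dx j (fun x t => q x t * Complex.exp (2 * Complex.I * (c : ℂ) * t)) y t
      = dx j q y t * e := fun j hj y => by
    simp only [dx]
    rw [show (fun y => q y t * Complex.exp (2 * Complex.I * (c : ℂ) * t)) = fun y => e * q y t from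
      funext fun y => mul_comm _ _, mul_comm]
    exact iteratedDeriv_const_mul_field e fun y => q y t
  have hdt : deriv (fun s => q x s * Complex.exp (2 * Complex.I * (c : ℂ) * (s : ℝ))) t
      = (deriv (fun s => q x s) t + 2 * Complex.I * c * q x t) * e := by
    have d1 : HasDerivAt (fun s : ℝ => 2 * Complex.I * (c : ℂ) * (s : ℂ)) (2 * Complex.I * c) t := by
      simpa using (Complex.ofRealCLM.hasDerivAt (x := t)).const_mul (2 * Complex.I * (c : ℂ))
    have d2 := ((hqt.differentiable (by simp)) t).hasDerivAt
    refine (d2.fun_mul d1.cexp).deriv.trans ?_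
    rw [← he']
    ring
  have hlast : deriv (fun y => (‖dx 1 q y t * e‖ : ℂ) ^ 2 * (q y t * e)) x
      = deriv (fun y => (‖dx 1 q y t‖ : ℂ) ^ 2 * q y t) x * e := by
    rw [← deriv_mul_const_field]
    congr 1
    funext y
    rw [norm_mul, hnorm, mul_one, mul_assoc]
  have h1 := h x t
  rw [hdt, hdx 5 le_rfl, hdx 3 (by norm_num), hdx 1 (by norm_num), hdx 2 (by norm_num)]
  simp only [fun y => hdx 1 (by norm_num) y]
  rw [hlast, norm_mul, hnorm, mul_one, map_mul]
  push_cast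
  linear_combination e * h1 + (-20 * Complex.I * ε * dx 1 q x t * conj (q x t) * dx 2 q x t * e) * hee
    + (2 * c * q x t * e) * Complex.I_sq

end Phase

/-! ### Volterra operators on a half-line -/

section Volterra

open BoundedContinuousFunction

variable {V : Type*} [NormedAddCommGroup V] [NormedSpace ℂ V] [CompleteSpace V]

/-- A continuous kernel `a x y`, used for `y ≤ x ≤ X`, which is dominated by an integrable function
of `y`. -/
structure VolKernel (X : ℝ) (a : ℝ → ℝ → ℂ) (p : ℝ → ℝ) : Prop where
  cont : Continuous (Function.uncurry a)
  bound : ∀ x ≤ X, ∀ y ≤ x, ‖a x y‖ ≤ p y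
  int : IntegrableOn p (Set.Iic X)

namespace VolKernel

variable {X : ℝ} {a b : ℝ → ℝ → ℂ} {p r : ℝ → ℝ}

theorem cont_right (h : VolKernel X a p) (x : ℝ) : Continuous (a x) :=
  h.cont.comp (continuous_const.prodMk continuous_id)

theorem integrableOn_norm (h : VolKernel X a p) {x : ℝ} (hx : x ≤ X) :
    IntegrableOn (fun y => ‖a x y‖) (Set.Iic x) := by
  refine Integrable.mono' (h.int.mono_set (Set.Iic_subset_Iic.2 hx))
    (h.cont_right x).norm.aestronglyMeasurable ?_
  filter_upwards [ae_restrict_mem measurableSet_Iic] with y hy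
  rw [norm_norm]
  exact h.bound x hx y hy

theorem integrableOn_smul (h : VolKernel X a p) {x : ℝ} (hx : x ≤ X) (m : ℝ →ᵇ V) :
    IntegrableOn (fun y => a x y • m y) (Set.Iic x) := by
  refine Integrable.mono' ((h.integrableOn_norm hx).mul_const ‖m‖)
    ((h.cont_right x).smul m.continuous).aestronglyMeasurable ?_
  refine Eventually.of_forall fun y => ?_
  rw [norm_smul]
  gcongr
  exact m.norm_coe_le_norm y

theorem norm_integral_le (h : VolKernel X a p) {x : ℝ} (hx : x ≤ X) (m : ℝ →ᵇ V) :
    ‖∫ y in Set.Iic x, a x y • m y‖ ≤ (∫ y in Set.Iic x, ‖a x y‖) * ‖m‖ := by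
  refine (norm_integral_le_integral_norm _).trans ?_
  rw [← integral_mul_const]
  refine integral_mono_of_nonneg (Eventually.of_forall fun y => norm_nonneg _)
    ((h.integrableOn_norm hx).mul_const _) (Eventually.of_forall fun y => ?_)
  simp only [norm_smul]
  gcongr
  exact m.norm_coe_le_norm y

theorem integral_norm_le (h : VolKernel X a p) {x : ℝ} (hx : x ≤ X) :
    ∫ y in Set.Iic x, ‖a x y‖ ≤ ∫ y in Set.Iic X, ‖p y‖ := by
  calc ∫ y in Set.Iic x, ‖a x y‖ ≤ ∫ y in Set.Iic x, ‖p y‖ := by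
        refine integral_mono_ae (h.integrableOn_norm hx)
          (h.int.mono_set (Set.Iic_subset_Iic.2 hx)).norm ?_
        filter_upwards [ae_restrict_mem measurableSet_Iic] with y hy
        exact (h.bound x hx y hy).trans (le_abs_self _)
    _ ≤ _ := setIntegral_mono_set h.int.norm (Eventually.of_forall fun y => norm_nonneg _)
        (Set.Iic_subset_Iic.2 hx).eventuallyLE

theorem continuous_integral (h : VolKernel X a p) (m : ℝ →ᵇ V) :
    Continuous fun x => ∫ y in Set.Iic (min x X), a (min x X) y • m y := by
  simp only [← integral_indicator measurableSet_Iic]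
  refine continuous_iff_continuousAt.2 fun x₀ => ?_
  refine continuousAt_of_dominated (bound := fun y => (Set.Iic X).indicator p y * ‖m‖) ?_ ?_ ?_ ?_
  · refine Eventually.of_forall fun x => ?_
    exact ((h.cont_right _).smul m.continuous).aestronglyMeasurable.indicator measurableSet_Iic
  · refine Eventually.of_forall fun x => Eventually.of_forall fun y => ?_
    by_cases hy : y ≤ min x X
    · rw [Set.indicator_of_mem (Set.mem_Iic.2 hy), norm_smul,
        Set.indicator_of_mem (Set.mem_Iic.2 (hy.trans (min_le_right _ _)))]
      gcongr
      · exact (norm_nonneg _).trans (h.bound _ (min_le_right _ _) y hy)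
      · exact h.bound _ (min_le_right _ _) y hy
      · exact m.norm_coe_le_norm y
    · rw [Set.indicator_of_notMem (by simpa using hy), norm_zero]
      refine mul_nonneg (Set.indicator_nonneg (fun y hy => ?_) y) (norm_nonneg m)
      exact (norm_nonneg _).trans (h.bound y hy y le_rfl)
  · exact (h.int.integrable_indicator measurableSet_Iic).mul_const _
  · have h0 : ∀ᵐ y, y ≠ min x₀ X := Measure.ae_ne volume _
    filter_upwards [h0] with y hy
    have hc : Continuous fun x : ℝ => min x X := by fun_prop
    rcases lt_or_gt_of_ne hy with hlt | hgt
    · have h1 : ∀ᶠ x in 𝓝 x₀, y < min x X := hc.continuousAt.eventually (lt_mem_nhds hlt)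
      have h2 : Continuous fun x => a (min x X) y • m y :=
        (h.cont.comp (hc.prodMk continuous_const)).smul continuous_const
      refine h2.continuousAt.congr ?_
      filter_upwards [h1] with x hx
      rw [Set.indicator_of_mem (Set.mem_Iic.2 hx.le)]
    · have h1 : ∀ᶠ x in 𝓝 x₀, min x X < y := hc.continuousAt.eventually (gt_mem_nhds hgt)
      refine (continuousAt_const (y := (0 : V))).congr ?_
      filter_upwards [h1] with x hx
      rw [Set.indicator_of_notMem fun h' => absurd (Set.mem_Iic.1 h') (not_le.2 hx)]

/-- The Volterra operator with the kernel `a`, on bounded continuous functions. The upper limit of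
integration is cut off at `X`. -/
def op (h : VolKernel X a p) : (ℝ →ᵇ V) →L[ℂ] (ℝ →ᵇ V) :=
  LinearMap.mkContinuous
    { toFun := fun m => BoundedContinuousFunction.ofNormedAddCommGroup
        (fun x => ∫ y in Set.Iic (min x X), a (min x X) y • m y) (h.continuous_integral m)
        ((∫ y in Set.Iic X, ‖p y‖) * ‖m‖) (fun x => (h.norm_integral_le (min_le_right _ _) m).trans
          (by gcongr; exact h.integral_norm_le (min_le_right _ _)))
      map_add' := fun m n => by
        ext1 x
        simp only [BoundedContinuousFunction.coe_ofNormedAddCommGroup,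
          BoundedContinuousFunction.coe_add, Pi.add_apply, smul_add]
        exact integral_add (h.integrableOn_smul (min_le_right _ _) m)
          (h.integrableOn_smul (min_le_right _ _) n)
      map_smul' := fun c m => by
        ext1 x
        simp only [BoundedContinuousFunction.coe_ofNormedAddCommGroup,
          BoundedContinuousFunction.coe_smul, RingHom.id_apply, smul_comm _ c]
        exact integral_smul c _ }
    (∫ y in Set.Iic X, ‖p y‖) (fun m => (BoundedContinuousFunction.norm_le (by positivity)).2
      fun x => (h.norm_integral_le (min_le_right _ _) m).trans
          (by gcongr; exact h.integral_norm_le (min_le_right _ _)))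

theorem op_apply (h : VolKernel X a p) (m : ℝ →ᵇ V) (x : ℝ) :
    h.op m x = ∫ y in Set.Iic (min x X), a (min x X) y • m y := rfl

theorem op_apply_of_le (h : VolKernel X a p) (m : ℝ →ᵇ V) {x : ℝ} (hx : x ≤ X) :
    h.op m x = ∫ y in Set.Iic x, a x y • m y := by
  rw [op_apply, min_eq_left hx]

theorem norm_op_le (h : VolKernel X a p) {c : ℝ}
    (hc : ∀ x ≤ X, ∫ y in Set.Iic x, ‖a x y‖ ≤ c) : ‖(h.op : (ℝ →ᵇ V) →L[ℂ] (ℝ →ᵇ V))‖ ≤ c := by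
  have hc0 : 0 ≤ c := le_trans (integral_nonneg fun y => norm_nonneg _) (hc X le_rfl)
  refine ContinuousLinearMap.opNorm_le_bound _ hc0 fun m =>
    (BoundedContinuousFunction.norm_le (by positivity)).2 fun x => ?_
  exact (h.norm_integral_le (min_le_right _ _) m).trans (by gcongr; exact hc _ (min_le_right _ _))

theorem sub (h : VolKernel X a p) (h' : VolKernel X b r) :
    VolKernel X (fun x y => a x y - b x y) (fun y => p y + r y) where
  cont := h.cont.sub h'.cont
  bound x hx y hy := (norm_sub_le _ _).trans (add_le_add (h.bound x hx y hy) (h'.bound x hx y hy))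
  int := h.int.add h'.int

theorem const_mul (h : VolKernel X a p) (c : ℂ) :
    VolKernel X (fun x y => c * a x y) (fun y => ‖c‖ * p y) where
  cont := continuous_const.mul h.cont
  bound x hx y hy := by
    rw [norm_mul]
    gcongr
    exact h.bound x hx y hy
  int := h.int.const_mul _

theorem op_sub (h : VolKernel X a p) (h' : VolKernel X b r) :
    ((h.sub h').op : (ℝ →ᵇ V) →L[ℂ] (ℝ →ᵇ V)) = h.op - h'.op := by
  ext1 m
  ext1 x
  change (h.sub h').op m x = h.op m x - h'.op m x
  simp only [op_apply, sub_smul]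
  exact integral_sub (h.integrableOn_smul (min_le_right _ _) m)
    (h'.integrableOn_smul (min_le_right _ _) m)

theorem op_const_mul (h : VolKernel X a p) (c : ℂ) :
    ((h.const_mul c).op : (ℝ →ᵇ V) →L[ℂ] (ℝ →ᵇ V)) = c • h.op := by
  ext1 m
  ext1 x
  change (h.const_mul c).op m x = c • h.op m x
  simp only [op_apply, mul_smul]
  exact integral_smul c _

end VolKernel

/-! The function `φ(w) = ∫₀¹ e^{wr} dr = (e^w - 1) / w` on the left half-plane. -/

theorem norm_exp_sub_exp_le {a b : ℂ} (ha : a.re ≤ 0) (hb : b.re ≤ 0) :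
    ‖Complex.exp b - Complex.exp a‖ ≤ ‖b - a‖ := by
  have hconv : Convex ℝ {z : ℂ | z.re ≤ 0} := convex_halfSpace_re_le 0
  have := hconv.norm_image_sub_le_of_norm_hasDerivWithin_le (f := Complex.exp) (C := 1)
    (fun x _ => (Complex.hasDerivAt_exp x).hasDerivWithinAt)
    (fun x hx => by rw [Complex.norm_exp]; exact Real.exp_le_one_iff.2 hx) ha hb
  simpa using this

theorem norm_exp_sub_exp_sub_le {a b : ℂ} (ha : a.re ≤ 0) (hb : b.re ≤ 0) :
    ‖Complex.exp b - Complex.exp a - (b - a) * Complex.exp a‖ ≤ ‖b - a‖ ^ 2 := by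
  have hconv : Convex ℝ ({z : ℂ | z.re ≤ 0} ∩ Metric.closedBall a ‖b - a‖) :=
    (convex_halfSpace_re_le 0).inter (convex_closedBall _ _)
  have := hconv.norm_image_sub_le_of_norm_hasDerivWithin_le
    (f := fun x => Complex.exp x - x * Complex.exp a) (C := ‖b - a‖)
    (f' := fun x => Complex.exp x - 1 * Complex.exp a)
    (fun x _ => ((Complex.hasDerivAt_exp x).sub
      ((hasDerivAt_id x).mul_const _)).hasDerivWithinAt)
    (fun x hx => by
      rw [one_mul]
      exact (norm_exp_sub_exp_le ha hx.1).trans (by simpa [dist_eq_norm] using hx.2))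
    (x := a) (y := b) ⟨ha, by simp⟩ ⟨hb, by simp [dist_eq_norm]⟩
  rw [sq, show Complex.exp b - Complex.exp a - (b - a) * Complex.exp a
    = Complex.exp b - b * Complex.exp a - (Complex.exp a - a * Complex.exp a) by ring]
  exact this

/-- `φ(w) = ∫₀¹ e^{wr} dr`. -/
def phi (w : ℂ) : ℂ := ∫ r in (0 : ℝ)..1, Complex.exp (w * r)

/-- The derivative `∫₀¹ r e^{wr} dr` of `phi`. -/
def phi' (w : ℂ) : ℂ := ∫ r in (0 : ℝ)..1, r * Complex.exp (w * r)

theorem continuous_phi : Continuous phi :=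
  intervalIntegral.continuous_parametric_intervalIntegral_of_continuous' (by fun_prop) 0 1

theorem continuous_phi' : Continuous phi' :=
  intervalIntegral.continuous_parametric_intervalIntegral_of_continuous' (by fun_prop) 0 1

theorem mul_phi {w : ℂ} (hw : w ≠ 0) : phi w = (Complex.exp w - 1) / w := by
  rw [phi, integral_exp_mul_complex hw]
  simp

theorem re_mul_nonpos {w : ℂ} (hw : w.re ≤ 0) {r : ℝ} (hr : 0 ≤ r) : (w * r).re ≤ 0 := by
  simpa using mul_nonpos_of_nonpos_of_nonneg hw hr

theorem norm_phi_le {w : ℂ} (hw : w.re ≤ 0) : ‖phi w‖ ≤ 1 := by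
  have := intervalIntegral.norm_integral_le_of_norm_le_const (a := (0 : ℝ)) (b := 1) (C := 1)
    (f := fun r : ℝ => Complex.exp (w * r)) fun r hr => by
      rw [Set.uIoc_of_le zero_le_one] at hr
      rw [Complex.norm_exp]
      exact Real.exp_le_one_iff.2 (re_mul_nonpos hw hr.1.le)
  simpa [phi] using this

theorem norm_phi'_le {w : ℂ} (hw : w.re ≤ 0) : ‖phi' w‖ ≤ 1 := by
  have := intervalIntegral.norm_integral_le_of_norm_le_const (a := (0 : ℝ)) (b := 1) (C := 1)
    (f := fun r : ℝ => r * Complex.exp (w * r)) fun r hr => by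
      rw [Set.uIoc_of_le zero_le_one] at hr
      rw [norm_mul, Complex.norm_exp, Complex.norm_real, Real.norm_of_nonneg hr.1.le]
      exact mul_le_one₀ hr.2 (Real.exp_pos _).le
        (Real.exp_le_one_iff.2 (re_mul_nonpos hw hr.1.le))
  simpa [phi'] using this

theorem phi_sub {w w' : ℂ} : phi w' - phi w - (w' - w) * phi' w
    = ∫ r in (0 : ℝ)..1, (Complex.exp (w' * r) - Complex.exp (w * r)
      - (w' * r - w * r) * Complex.exp (w * r)) := by
  have i : ∀ v : ℂ, IntervalIntegrable (fun r : ℝ => Complex.exp (v * r)) volume 0 1 := fun v =>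
    (by fun_prop : Continuous fun r : ℝ => Complex.exp (v * r)).intervalIntegrable _ _
  have i' : IntervalIntegrable (fun r : ℝ => (w' * r - w * r) * Complex.exp (w * r)) volume 0 1 :=
    (by fun_prop : Continuous fun r : ℝ =>
      (w' * r - w * r) * Complex.exp (w * r)).intervalIntegrable _ _
  rw [intervalIntegral.integral_sub ((i w').sub (i w)) i', intervalIntegral.integral_sub (i w') (i w),
    phi, phi, phi', ← intervalIntegral.integral_const_mul]
  congr 1
  refine intervalIntegral.integral_congr fun r _ => ?_
  ring

theorem norm_phi_sub_le {w w' : ℂ} (hw : w.re ≤ 0) (hw' : w'.re ≤ 0) :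
    ‖phi w' - phi w - (w' - w) * phi' w‖ ≤ min (2 * ‖w' - w‖) (‖w' - w‖ ^ 2) := by
  rw [phi_sub]
  refine (intervalIntegral.norm_integral_le_of_norm_le_const
    (C := min (2 * ‖w' - w‖) (‖w' - w‖ ^ 2)) fun r hr => ?_).trans (by simp)
  rw [Set.uIoc_of_le zero_le_one] at hr
  have h1 := re_mul_nonpos hw hr.1.le
  have h2 := re_mul_nonpos hw' hr.1.le
  have h3 : ‖w' * r - w * r‖ ≤ ‖w' - w‖ := by
    rw [← sub_mul, norm_mul, Complex.norm_real, Real.norm_of_nonneg hr.1.le]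
    exact mul_le_of_le_one_right (norm_nonneg _) hr.2
  refine le_min ?_ ?_
  · refine (norm_sub_le _ _).trans ?_
    have h4 := norm_exp_sub_exp_le h1 h2
    have h5 : ‖(w' * r - w * r) * Complex.exp (w * r)‖ ≤ ‖w' * r - w * r‖ := by
      rw [norm_mul, Complex.norm_exp]
      exact mul_le_of_le_one_right (norm_nonneg _) (Real.exp_le_one_iff.2 h1)
    linarith
  · exact (norm_exp_sub_exp_sub_le h1 h2).trans (by gcongr)

end Volterra

/-! ### Dependence of the Volterra operators on the spectral parameter -/

section Primitive

variable {F : Type*} [NormedAddCommGroup F] [NormedSpace ℝ F] {f : ℝ → F}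

theorem integrableOn_Iic_of_continuous (hf : Continuous f) {a : ℝ} (h : IntegrableOn f (Set.Iic a))
    (x : ℝ) : IntegrableOn f (Set.Iic x) := by
  refine (h.union (hf.integrableOn_Icc (a := a) (b := x))).mono_set fun y hy => ?_
  rcases le_or_gt y a with h1 | h1
  · exact Or.inl h1
  · exact Or.inr ⟨h1.le, hy⟩

theorem integral_Iic_eq_add [CompleteSpace F] (h : ∀ x, IntegrableOn f (Set.Iic x)) (a x : ℝ) :
    ∫ y in Set.Iic x, f y = (∫ y in Set.Iic a, f y) + ∫ y in a..x, f y := by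
  rw [← intervalIntegral.integral_Iic_sub_Iic (h a) (h x)]
  abel

theorem hasDerivAt_integral_Iic [CompleteSpace F] (hf : Continuous f)
    (h : ∀ x, IntegrableOn f (Set.Iic x)) (x : ℝ) :
    HasDerivAt (fun x => ∫ y in Set.Iic x, f y) (f x) x := by
  have h1 := (intervalIntegral.integral_hasDerivAt_right (hf.intervalIntegrable 0 x)
    (hf.stronglyMeasurableAtFilter _ _) hf.continuousAt).const_add (∫ y in Set.Iic 0, f y)
  exact h1.congr_of_eventuallyEq (Eventually.of_forall fun y => integral_Iic_eq_add h 0 y)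

theorem tendsto_integral_Iic_atBot [CompleteSpace F] (h : ∀ x, IntegrableOn f (Set.Iic x)) :
    Tendsto (fun x => ∫ y in Set.Iic x, f y) atBot (𝓝 0) := by
  have h1 := (intervalIntegral_tendsto_integral_Iic 0 (h 0) tendsto_id).const_sub
    (∫ y in Set.Iic 0, f y)
  rw [sub_self] at h1
  refine h1.congr fun x => ?_
  rw [integral_Iic_eq_add h x 0]
  simp

end Primitive

section Kernels

open BoundedContinuousFunction

variable {V : Type*} [NormedAddCommGroup V] [NormedSpace ℂ V] [CompleteSpace V]

/-- A weight and a coefficient with a second moment at `-∞`. -/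
structure IsWeighted (X : ℝ) (ρ : ℝ → ℝ) (c : ℝ → ℂ) : Prop where
  pos : ∀ x, 0 < ρ x
  mono : Monotone ρ
  cont_weight : Continuous ρ
  cont : Continuous c
  int : IntegrableOn (fun y => (1 + (X - y) ^ 2) * ‖c y‖) (Set.Iic X)

namespace IsWeighted

variable {X : ℝ} {ρ : ℝ → ℝ} {c : ℝ → ℂ} (h : IsWeighted X ρ c)

theorem norm_weight_le (h : IsWeighted X ρ c) {x y : ℝ} (hxy : y ≤ x) :
    ‖((ρ y / ρ x : ℝ) : ℂ)‖ ≤ 1 := by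
  rw [Complex.norm_real, Real.norm_of_nonneg (div_nonneg (h.pos y).le (h.pos x).le)]
  exact (div_le_one (h.pos x)).2 (h.mono hxy)

theorem cont_quot (h : IsWeighted X ρ c) :
    Continuous fun w : ℝ × ℝ => ((ρ w.2 / ρ w.1 : ℝ) : ℂ) :=
  Complex.continuous_ofReal.comp ((h.cont_weight.comp continuous_snd).div
    (h.cont_weight.comp continuous_fst) fun _ => (h.pos _).ne')

/-- Kernels of the form `(ρ(y) / ρ(x)) c(y) k(x - y)`. -/
theorem volKernel (h : IsWeighted X ρ c) {k : ℝ → ℂ} (hk : Continuous k) {B : ℝ}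
    (hB : ∀ s, 0 ≤ s → ‖k s‖ ≤ B * (1 + s ^ 2)) :
    VolKernel X (fun x y => ((ρ y / ρ x : ℝ) : ℂ) * c y * k (x - y))
      (fun y => B * ((1 + (X - y) ^ 2) * ‖c y‖)) where
  cont := (h.cont_quot.mul (h.cont.comp continuous_snd)).mul
    (hk.comp (continuous_fst.sub continuous_snd))
  bound x hx y hy := by
    have hB0 : 0 ≤ B := by simpa using (norm_nonneg _).trans (hB 0 le_rfl)
    have h1 := hB (x - y) (sub_nonneg.2 hy)
    have h2 : (x - y) ^ 2 ≤ (X - y) ^ 2 := by nlinarith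
    rw [norm_mul, norm_mul]
    calc _ ≤ 1 * ‖c y‖ * (B * (1 + (x - y) ^ 2)) := by
          gcongr
          exact h.norm_weight_le hy
      _ ≤ 1 * ‖c y‖ * (B * (1 + (X - y) ^ 2)) := by gcongr
      _ = _ := by ring
  int := h.int.const_mul B

theorem continuous_phi_mul (l : ℂ) :
    Continuous fun s : ℝ => (s : ℂ) * phi (2 * Complex.I * l * s) :=
  Complex.continuous_ofReal.mul (continuous_phi.comp (by fun_prop))

theorem re_nonpos {l : ℂ} (hl : 0 ≤ l.im) {s : ℝ} (hs : 0 ≤ s) :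
    (2 * Complex.I * l * s).re ≤ 0 := by
  have : (2 * Complex.I * l * s).re = -(2 * (l.im * s)) := by simp; ring
  rw [this]
  have := mul_nonneg hl hs
  linarith

theorem norm_phi_mul_le {l : ℂ} (hl : 0 ≤ l.im) {s : ℝ} (hs : 0 ≤ s) :
    ‖(s : ℂ) * phi (2 * Complex.I * l * s)‖ ≤ 1 * (1 + s ^ 2) := by
  rw [norm_mul, Complex.norm_real, Real.norm_of_nonneg hs, one_mul]
  have h1 := norm_phi_le (re_nonpos hl hs)
  nlinarith [norm_nonneg (phi (2 * Complex.I * l * s)), sq_nonneg (s - 1)]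

theorem norm_phi'_mul_le {l : ℂ} (hl : 0 ≤ l.im) {s : ℝ} (hs : 0 ≤ s) :
    ‖(s : ℂ) * (2 * Complex.I * s * phi' (2 * Complex.I * l * s))‖ ≤ 2 * (1 + s ^ 2) := by
  have h1 := norm_phi'_le (re_nonpos hl hs)
  simp only [norm_mul, Complex.norm_real, Real.norm_of_nonneg hs, Complex.norm_I, Complex.norm_two]
  nlinarith [norm_nonneg (phi' (2 * Complex.I * l * s)), mul_nonneg hs hs]

open Classical in
/-- The operator with the kernel `(ρ(y) / ρ(x)) c(y) g(x - y)`, `g(s) = ∫₀ˢ e^{2ilr} dr`, where `l`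
is in the closed upper half-plane. -/
def gOp (V : Type*) [NormedAddCommGroup V] [NormedSpace ℂ V] [CompleteSpace V]
    (h : IsWeighted X ρ c) (l : ℂ) : (ℝ →ᵇ V) →L[ℂ] (ℝ →ᵇ V) :=
  if hl : 0 ≤ l.im then
    (h.volKernel (continuous_phi_mul l) fun _ hs => norm_phi_mul_le hl hs).op else 0

theorem gOp_of_nonneg (h : IsWeighted X ρ c) {l : ℂ} (hl : 0 ≤ l.im) : h.gOp V l =
    (h.volKernel (continuous_phi_mul l) fun _ hs => norm_phi_mul_le hl hs).op :=
  dif_pos hl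

/-- The modulus governing the remainder in the Taylor expansion of `gOp`. -/
theorem tendsto_modulus (h : IsWeighted X ρ c) : Tendsto (fun d : ℝ =>
    ∫ y in Set.Iic X, ‖c y‖ * ((X - y) * min (4 * (X - y)) (4 * (X - y) ^ 2 * d)))
    (𝓝[≥] 0) (𝓝 0) := by
  have h1 : Tendsto (fun d : ℝ =>
      ∫ y in Set.Iic X, ‖c y‖ * ((X - y) * min (4 * (X - y)) (4 * (X - y) ^ 2 * d)))
      (𝓝[≥] 0) (𝓝 (∫ y in Set.Iic X, (0 : ℝ))) := by
    have hc := h.cont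
    refine tendsto_integral_filter_of_dominated_convergence
      (fun y => 4 * ((1 + (X - y) ^ 2) * ‖c y‖)) ?_ ?_ (h.int.const_mul 4) ?_
    · exact Eventually.of_forall fun d => (by fun_prop : Continuous fun y : ℝ =>
        ‖c y‖ * ((X - y) * min (4 * (X - y)) (4 * (X - y) ^ 2 * d))).aestronglyMeasurable
    · filter_upwards [self_mem_nhdsWithin] with d hd
      filter_upwards [ae_restrict_mem measurableSet_Iic] with y hy
      have hs : 0 ≤ X - y := sub_nonneg.2 hy
      have hd' : 0 ≤ d := hd
      have h2 : 0 ≤ min (4 * (X - y)) (4 * (X - y) ^ 2 * d) := le_min (by positivity) (by positivity)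
      have h3 := min_le_left (4 * (X - y)) (4 * (X - y) ^ 2 * d)
      rw [Real.norm_of_nonneg (by positivity)]
      have h4 : (X - y) * min (4 * (X - y)) (4 * (X - y) ^ 2 * d) ≤ 4 * (1 + (X - y) ^ 2) := by
        nlinarith
      nlinarith [mul_le_mul_of_nonneg_left h4 (norm_nonneg (c y))]
    · filter_upwards [ae_restrict_mem measurableSet_Iic] with y hy
      have hs : 0 ≤ X - y := sub_nonneg.2 hy
      have h2 : Continuous fun d : ℝ =>
          ‖c y‖ * ((X - y) * min (4 * (X - y)) (4 * (X - y) ^ 2 * d)) := by fun_prop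
      have h3 := (h2.tendsto 0).mono_left (nhdsWithin_le_nhds (s := Set.Ici 0))
      simpa [min_eq_right (by positivity : (0 : ℝ) ≤ 4 * (X - y))] using h3
  simpa using h1

/-- In the closed upper half-plane `gOp` is differentiable, one-sidedly on the boundary. -/
theorem differentiableOn_gOp (h : IsWeighted X ρ c) :
    DifferentiableOn ℂ (h.gOp V) {l | 0 ≤ l.im} := by
  intro l hl
  have hl' : 0 ≤ l.im := hl
  have hk' : Continuous fun s : ℝ => (s : ℂ) * (2 * Complex.I * s * phi' (2 * Complex.I * l * s)) :=
    Complex.continuous_ofReal.mul (Continuous.mul (by fun_prop)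
      (continuous_phi'.comp (by fun_prop)))
  have K' := h.volKernel hk' fun _ hs => norm_phi'_mul_le hl' hs
  have K := fun (v : ℂ) (hv : 0 ≤ v.im) =>
    h.volKernel (continuous_phi_mul v) fun _ hs => norm_phi_mul_le hv hs
  refine HasDerivWithinAt.differentiableWithinAt (f' := (K'.op : (ℝ →ᵇ V) →L[ℂ] (ℝ →ᵇ V))) ?_
  rw [hasDerivWithinAt_iff_tendsto]
  have hdist : Tendsto (fun v : ℂ => ‖v - l‖) (𝓝[{l | 0 ≤ l.im}] l) (𝓝[≥] 0) := by
    refine tendsto_nhdsWithin_iff.2 ⟨?_, Eventually.of_forall fun v => norm_nonneg _⟩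
    have : Continuous fun v : ℂ => ‖v - l‖ := by fun_prop
    simpa using (this.tendsto l).mono_left nhdsWithin_le_nhds
  refine squeeze_zero' (Eventually.of_forall fun v => by positivity) ?_
    (h.tendsto_modulus.comp hdist)
  filter_upwards [self_mem_nhdsWithin] with v hv
  have hv' : 0 ≤ v.im := hv
  rw [gOp_of_nonneg h hv', gOp_of_nonneg h hl', ← VolKernel.op_const_mul K', ← VolKernel.op_sub,
    ← VolKernel.op_sub]
  set M := ∫ y in Set.Iic X, ‖c y‖ * ((X - y) * min (4 * (X - y)) (4 * (X - y) ^ 2 * ‖v - l‖))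
    with hM
  have hint : IntegrableOn (fun y => ‖c y‖ * ((X - y) * min (4 * (X - y))
      (4 * (X - y) ^ 2 * ‖v - l‖))) (Set.Iic X) := by
    have hc := h.cont
    refine Integrable.mono' (h.int.const_mul 4) (by fun_prop : Continuous fun y : ℝ =>
      ‖c y‖ * ((X - y) * min (4 * (X - y)) (4 * (X - y) ^ 2 * ‖v - l‖))).aestronglyMeasurable ?_
    filter_upwards [ae_restrict_mem measurableSet_Iic] with y hy
    have hs : 0 ≤ X - y := sub_nonneg.2 hy
    have h2 : 0 ≤ min (4 * (X - y)) (4 * (X - y) ^ 2 * ‖v - l‖) :=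
      le_min (by positivity) (by positivity)
    have h3 := min_le_left (4 * (X - y)) (4 * (X - y) ^ 2 * ‖v - l‖)
    rw [Real.norm_of_nonneg (by positivity)]
    have h4 : (X - y) * min (4 * (X - y)) (4 * (X - y) ^ 2 * ‖v - l‖) ≤ 4 * (1 + (X - y) ^ 2) := by
      nlinarith
    nlinarith [mul_le_mul_of_nonneg_left h4 (norm_nonneg (c y))]
  have hle := VolKernel.norm_op_le (V := V) (c := ‖v - l‖ * M)
    (((K v hv').sub (K l hl')).sub (K'.const_mul (v - l))) fun x hx => by
    rw [hM, ← integral_const_mul]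
    calc _ ≤ ∫ y in Set.Iic x, ‖v - l‖ * (‖c y‖ * ((X - y) * min (4 * (X - y))
          (4 * (X - y) ^ 2 * ‖v - l‖))) := ?_
      _ ≤ _ := ?_
    · refine integral_mono_ae (VolKernel.integrableOn_norm
        (((K v hv').sub (K l hl')).sub (K'.const_mul (v - l))) hx)
        ((hint.mono_set (Set.Iic_subset_Iic.2 hx)).const_mul _) ?_
      filter_upwards [ae_restrict_mem measurableSet_Iic] with y hy
      have hs : 0 ≤ x - y := sub_nonneg.2 hy
      have hs' : x - y ≤ X - y := sub_le_sub_right hx y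
      have e : ((ρ y / ρ x : ℝ) : ℂ) * c y * (((x - y : ℝ) : ℂ)
            * phi (2 * Complex.I * v * ((x - y : ℝ) : ℂ)))
          - ((ρ y / ρ x : ℝ) : ℂ) * c y * (((x - y : ℝ) : ℂ)
            * phi (2 * Complex.I * l * ((x - y : ℝ) : ℂ)))
          - (v - l) * (((ρ y / ρ x : ℝ) : ℂ) * c y * (((x - y : ℝ) : ℂ)
            * (2 * Complex.I * ((x - y : ℝ) : ℂ) * phi' (2 * Complex.I * l * ((x - y : ℝ) : ℂ)))))
          = ((ρ y / ρ x : ℝ) : ℂ) * c y * ((x - y : ℝ) : ℂ)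
            * (phi (2 * Complex.I * v * ((x - y : ℝ) : ℂ))
              - phi (2 * Complex.I * l * ((x - y : ℝ) : ℂ))
              - (2 * Complex.I * v * ((x - y : ℝ) : ℂ) - 2 * Complex.I * l * ((x - y : ℝ) : ℂ))
                * phi' (2 * Complex.I * l * ((x - y : ℝ) : ℂ))) := by ring
      simp only [e]
      have h1 := norm_phi_sub_le (re_nonpos hl' hs) (re_nonpos hv' hs)
      have e2 : ‖2 * Complex.I * v * ((x - y : ℝ) : ℂ) - 2 * Complex.I * l * ((x - y : ℝ) : ℂ)‖
          = 2 * ‖v - l‖ * (x - y) := by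
        rw [← sub_mul, ← mul_sub, norm_mul, norm_mul, norm_mul, Complex.norm_real,
          Real.norm_of_nonneg hs]
        simp
      rw [e2] at h1
      have h2 := h.norm_weight_le (X := X) hy
      rw [norm_mul, norm_mul, norm_mul, Complex.norm_real (x - y), Real.norm_of_nonneg hs]
      have h3 : min (2 * (2 * ‖v - l‖ * (x - y))) ((2 * ‖v - l‖ * (x - y)) ^ 2)
          ≤ ‖v - l‖ * min (4 * (X - y)) (4 * (X - y) ^ 2 * ‖v - l‖) := by
        rw [mul_min_of_nonneg _ _ (norm_nonneg _)]
        refine min_le_min ?_ ?_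
        · nlinarith [mul_le_mul_of_nonneg_left hs' (norm_nonneg (v - l))]
        · have h5 : (x - y) ^ 2 ≤ (X - y) ^ 2 := by gcongr
          nlinarith [mul_le_mul_of_nonneg_left h5 (sq_nonneg ‖v - l‖)]
      have hX : 0 ≤ X - y := hs.trans hs'
      calc _ ≤ 1 * ‖c y‖ * (X - y)
            * (‖v - l‖ * min (4 * (X - y)) (4 * (X - y) ^ 2 * ‖v - l‖)) := by
            gcongr
            exact h1.trans h3
        _ = _ := by ring
    · refine setIntegral_mono_set (hint.const_mul _) ?_ (Set.Iic_subset_Iic.2 hx).eventuallyLE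
      filter_upwards [ae_restrict_mem measurableSet_Iic] with y hy
      have hs : 0 ≤ X - y := sub_nonneg.2 hy
      have h2 : 0 ≤ min (4 * (X - y)) (4 * (X - y) ^ 2 * ‖v - l‖) :=
        le_min (by positivity) (by positivity)
      exact mul_nonneg (norm_nonneg _) (mul_nonneg (norm_nonneg _) (mul_nonneg hs h2))
  rcases eq_or_lt_of_le (norm_nonneg (v - l)) with h0 | h0
  · rw [show ‖v - l‖⁻¹ = 0 by rw [← h0, inv_zero], zero_mul]
    refine integral_nonneg_of_ae ?_
    filter_upwards [ae_restrict_mem measurableSet_Iic] with y hy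
    have hs : 0 ≤ X - y := sub_nonneg.2 hy
    have h2 : 0 ≤ min (4 * (X - y)) (4 * (X - y) ^ 2 * ‖v - l‖) :=
      le_min (by positivity) (by positivity)
    exact mul_nonneg (norm_nonneg _) (mul_nonneg hs h2)
  · rw [inv_mul_le_iff₀ h0]
    exact hle

end IsWeighted
end Kernels

/-! ### Linear systems of differential equations -/

section LinearODE

variable {A : ℝ → Matrix (Fin 2) (Fin 2) ℂ}

/-- The bounded operator on `ℂ²` given by a matrix. -/
def matL (M : Matrix (Fin 2) (Fin 2) ℂ) : (Fin 2 → ℂ) →L[ℂ] (Fin 2 → ℂ) :=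
  LinearMap.toContinuousLinearMap (Matrix.mulVecLin M)

theorem matL_apply (M : Matrix (Fin 2) (Fin 2) ℂ) (v : Fin 2 → ℂ) : matL M v = M.mulVec v := rfl

theorem continuous_mulVec (hA : ∀ i j, Continuous fun x => A x i j) {f : ℝ → Fin 2 → ℂ}
    (hf : Continuous f) : Continuous fun x => (A x).mulVec (f x) := by
  refine continuous_pi fun i => ?_
  simp only [Matrix.mulVec, dotProduct]
  exact continuous_finsetSum _ fun j _ => (hA i j).mul ((continuous_apply j).comp hf)

/-- The Picard iterates of a linear system. -/
def picard (A : ℝ → Matrix (Fin 2) (Fin 2) ℂ) (v : Fin 2 → ℂ) : ℕ → ℝ → Fin 2 → ℂ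
  | 0 => fun _ => v
  | n + 1 => fun t => ∫ s in (0 : ℝ)..t, (A s).mulVec (picard A v n s)

theorem hasDerivAt_picard (hA : ∀ i j, Continuous fun x => A x i j) {v : Fin 2 → ℂ} {n : ℕ}
    (hc : Continuous (picard A v n)) (t : ℝ) :
    HasDerivAt (picard A v (n + 1)) ((A t).mulVec (picard A v n t)) t := by
  have h1 := continuous_mulVec hA hc
  exact intervalIntegral.integral_hasDerivAt_right (h1.intervalIntegrable 0 t)
    (h1.stronglyMeasurableAtFilter _ _) h1.continuousAt

theorem continuous_picard (hA : ∀ i j, Continuous fun x => A x i j) (v : Fin 2 → ℂ) (n : ℕ) :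
    Continuous (picard A v n) := by
  induction n with
  | zero => exact continuous_const
  | succ n ih =>
    exact continuous_iff_continuousAt.2 fun t => (hasDerivAt_picard hA ih t).continuousAt

theorem norm_picard_le (v : Fin 2 → ℂ) {R K : ℝ}
    (hK0 : 0 ≤ K) (hK : ∀ y ∈ Set.Icc (-R) R, ∀ u : Fin 2 → ℂ, ‖(A y).mulVec u‖ ≤ K * ‖u‖)
    (n : ℕ) : ∀ t ∈ Set.Icc (-R) R, ‖picard A v n t‖ ≤ ‖v‖ * ((K * |t|) ^ n / n.factorial) := by
  induction n with
  | zero => intro t _; simp [picard]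
  | succ n ih =>
    intro t ht
    have e : picard A v (n + 1) t
        = t • ∫ r in (0 : ℝ)..1, (A (t * r)).mulVec (picard A v n (t * r)) := by
      rw [intervalIntegral.smul_integral_comp_mul_left
        (fun s => (A s).mulVec (picard A v n s))]
      simp [picard]
    have hb : ‖∫ r in (0 : ℝ)..1, (A (t * r)).mulVec (picard A v n (t * r))‖
        ≤ ∫ r in (0 : ℝ)..1, K * (‖v‖ * ((K * |t|) ^ n / n.factorial)) * r ^ n := by
      refine intervalIntegral.norm_integral_le_of_norm_le zero_le_one
        (Eventually.of_forall fun r hr => ?_) (Continuous.intervalIntegrable (by fun_prop) _ _)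
      have hmem : t * r ∈ Set.Icc (-R) R := by
        refine abs_le.1 ?_
        rw [abs_mul, abs_of_pos hr.1]
        exact (mul_le_of_le_one_right (abs_nonneg t) hr.2).trans (abs_le.2 ht)
      refine (hK _ hmem _).trans ?_
      have h1 := mul_le_mul_of_nonneg_left (ih _ hmem) hK0
      refine h1.trans_eq ?_
      rw [abs_mul, abs_of_pos hr.1, ← mul_assoc K |t|, mul_pow (K * |t|)]
      ring
    rw [e, norm_smul, Real.norm_eq_abs]
    refine (mul_le_mul_of_nonneg_left hb (abs_nonneg t)).trans_eq ?_
    rw [intervalIntegral.integral_const_mul, integral_pow, Nat.factorial_succ]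
    have : (n.factorial : ℝ) ≠ 0 := by positivity
    push_cast
    field_simp
    ring

/-- A linear system with continuous coefficients is solvable on the whole line. -/
theorem exists_hasDerivAt_mulVec (hA : ∀ i j, Continuous fun x => A x i j) (v : Fin 2 → ℂ) :
    ∃ y : ℝ → Fin 2 → ℂ, y 0 = v ∧ ∀ t, HasDerivAt y ((A t).mulVec (y t)) t := by
  have hsum : ∀ t, Summable fun n => picard A v n t := fun t => by
    obtain ⟨K, hK0, hK⟩ := exists_norm_mulVec_le hA |t|
    refine Summable.of_norm_bounded (g := fun n => ‖v‖ * ((K * |t|) ^ n / n.factorial))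
      ((Real.summable_pow_div_factorial _).mul_left _) fun n => ?_
    exact norm_picard_le v hK0 hK n t (abs_le.1 le_rfl)
  have htail : ∀ t, ∑' n, picard A v n t = v + ∑' n, picard A v (n + 1) t := fun t => by
    rw [(hsum t).tsum_eq_zero_add]
    rfl
  refine ⟨fun t => v + ∑' n, picard A v (n + 1) t, ?_, fun t => ?_⟩
  · have : ∀ n, picard A v (n + 1) 0 = 0 := fun n => by simp [picard]
    simp [this]
  · obtain ⟨K, hK0, hK⟩ := exists_norm_mulVec_le hA (|t| + 1)
    have hd := hasDerivAt_tsum_of_isPreconnected (y₀ := 0) (y := t)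
      (g := fun n t => picard A v (n + 1) t)
      (g' := fun n t => (A t).mulVec (picard A v n t)) (t := Set.Ioo (-(|t| + 1)) (|t| + 1))
      (u := fun n => K * (‖v‖ * ((K * (|t| + 1)) ^ n / n.factorial)))
      (((Real.summable_pow_div_factorial _).mul_left _).mul_left _) isOpen_Ioo isPreconnected_Ioo
      (fun n y _ => hasDerivAt_picard hA (continuous_picard hA v n) y)
      (fun n y hy => by
        have hy' := Set.Ioo_subset_Icc_self hy
        refine (hK y hy' _).trans ?_
        gcongr
        refine (norm_picard_le v hK0 hK n y hy').trans ?_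
        have : |y| ≤ |t| + 1 := abs_le.2 hy'
        gcongr)
      (abs_lt.1 (by rw [abs_zero]; positivity)) ((summable_nat_add_iff 1).2 (hsum 0))
      (abs_lt.1 (by linarith))
    refine (hd.const_add v).congr_deriv ?_
    change _ = (A t).mulVec (v + ∑' n, picard A v (n + 1) t)
    rw [← htail, ← matL_apply, ContinuousLinearMap.map_tsum _ (hsum t)]
    rfl

/-- A solution on a half-line extends to the whole line. -/
theorem exists_extension_mulVec (hA : ∀ i j, Continuous fun x => A x i j) {φ : ℝ → Fin 2 → ℂ}
    {X : ℝ} (hφ : ∀ x < X, HasDerivAt φ ((A x).mulVec (φ x)) x) :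
    ∃ ψ : ℝ → Fin 2 → ℂ, (∀ x, HasDerivAt ψ ((A x).mulVec (ψ x)) x) ∧ ∀ x < X, ψ x = φ x := by
  have hA' : ∀ i j, Continuous fun x => A (x + (X - 1)) i j := fun i j =>
    (hA i j).comp (by fun_prop : Continuous fun x : ℝ => x + (X - 1))
  obtain ⟨y, hy0, hy⟩ := exists_hasDerivAt_mulVec hA' (φ (X - 1))
  have hψ : ∀ x, HasDerivAt (fun x => y (x - (X - 1))) ((A x).mulVec (y (x - (X - 1)))) x :=
    fun x => by
      have h1 := HasDerivAt.comp_sub_const x (X - 1) (hy (x - (X - 1)))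
      simpa using h1
  refine ⟨_, hψ, fun x hx => ?_⟩
  refine eqOn_of_hasDerivAt_mulVec hA (a := min x (X - 1) - 1) (b := X) (x₀ := X - 1)
    (fun y _ => hψ y) (fun y hy => hφ y hy.2) ⟨?_, by linarith⟩ (by simpa using hy0) ⟨?_, hx⟩
  · linarith [min_le_right x (X - 1)]
  · linarith [min_le_left x (X - 1)]

end LinearODE

/-! ### Variation of constants -/

section Duhamel

variable {V : Type*} [NormedAddCommGroup V] [NormedSpace ℂ V] [CompleteSpace V]

theorem mul_phi_eq {l : ℂ} (hl : l ≠ 0) (s : ℝ) : (s : ℂ) * phi (2 * Complex.I * l * s)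
    = (Complex.exp (2 * Complex.I * l * s) - 1) / (2 * Complex.I * l) := by
  have h2 : 2 * Complex.I * l ≠ 0 := by simp [hl]
  by_cases hs : s = 0
  · simp [hs]
  · have hs' : (s : ℂ) ≠ 0 := by exact_mod_cast hs
    rw [mul_phi (mul_ne_zero h2 hs')]
    field_simp

theorem integrableOn_exp_smul {l : ℂ} (hl : 0 ≤ l.im) {f : ℝ → V} (hf : Continuous f)
    (hint : ∀ x, IntegrableOn f (Set.Iic x)) (x : ℝ) :
    IntegrableOn (fun y : ℝ => Complex.exp (-(2 * Complex.I * l * ((y : ℝ) : ℂ))) • f y) (Set.Iic x) := by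
  have hc : Continuous fun y : ℝ => Complex.exp (-(2 * Complex.I * l * (y : ℂ))) := by fun_prop
  refine Integrable.mono' ((hint x).norm.const_mul (Real.exp (2 * l.im * x)))
    (hc.smul hf).aestronglyMeasurable ?_
  filter_upwards [ae_restrict_mem measurableSet_Iic] with y hy
  rw [norm_smul, Complex.norm_exp]
  gcongr
  have : (-(2 * Complex.I * l * (y : ℂ))).re = 2 * l.im * y := by simp
  rw [this]
  exact mul_le_mul_of_nonneg_left hy (by positivity)

theorem integral_phi_smul {l : ℂ} (hl : 0 ≤ l.im) (hl0 : l ≠ 0) {f : ℝ → V} (hf : Continuous f)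
    (hint : ∀ x, IntegrableOn f (Set.Iic x)) (x : ℝ) :
    ∫ y in Set.Iic x, (((x - y : ℝ) : ℂ) * phi (2 * Complex.I * l * ((x - y : ℝ) : ℂ))) • f y
      = (2 * Complex.I * l)⁻¹ • (Complex.exp (2 * Complex.I * l * x)
          • (∫ y : ℝ in Set.Iic x, Complex.exp (-(2 * Complex.I * l * ((y : ℝ) : ℂ))) • f y)
        - ∫ y in Set.Iic x, f y) := by
  have h1 : IntegrableOn (fun y : ℝ => Complex.exp (2 * Complex.I * l * x)
      • (Complex.exp (-(2 * Complex.I * l * (y : ℂ))) • f y)) (Set.Iic x) :=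
    (integrableOn_exp_smul hl hf hint x).smul (Complex.exp (2 * Complex.I * l * x))
  have e : ∀ y : ℝ, (((x - y : ℝ) : ℂ) * phi (2 * Complex.I * l * ((x - y : ℝ) : ℂ))) • f y
      = (2 * Complex.I * l)⁻¹ • ((Complex.exp (2 * Complex.I * l * x)
        • (Complex.exp (-(2 * Complex.I * l * (y : ℂ))) • f y)) - f y) := fun y => by
    have h3 : Complex.exp (2 * Complex.I * l * ((x - y : ℝ) : ℂ))
        = Complex.exp (2 * Complex.I * l * x) * Complex.exp (-(2 * Complex.I * l * (y : ℂ))) := by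
      rw [← Complex.exp_add]; push_cast; ring_nf
    rw [mul_phi_eq hl0, h3, smul_smul (Complex.exp _), div_eq_inv_mul, mul_smul, sub_smul, one_smul]
  rw [integral_congr_ae (Eventually.of_forall e), integral_smul, integral_sub h1 (hint x),
    integral_smul]

/-- The derivative of the convolution with `g(s) = ∫₀ˢ e^{2ilr} dr`. -/
theorem hasDerivAt_integral_phi_smul {l : ℂ} (hl : 0 ≤ l.im) (hl0 : l ≠ 0) {f : ℝ → V}
    (hf : Continuous f) (hint : ∀ x, IntegrableOn f (Set.Iic x)) (x : ℝ) :
    HasDerivAt (fun x => ∫ y in Set.Iic x,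
        (((x - y : ℝ) : ℂ) * phi (2 * Complex.I * l * ((x - y : ℝ) : ℂ))) • f y)
      ((∫ y in Set.Iic x, f y) + (2 * Complex.I * l) • ∫ y in Set.Iic x,
        (((x - y : ℝ) : ℂ) * phi (2 * Complex.I * l * ((x - y : ℝ) : ℂ))) • f y) x := by
  simp only [integral_phi_smul hl hl0 hf hint]
  have hc : Continuous fun y : ℝ => Complex.exp (-(2 * Complex.I * l * ((y : ℝ) : ℂ))) • f y :=
    (by fun_prop : Continuous fun y : ℝ => Complex.exp (-(2 * Complex.I * l * (y : ℂ)))).smul hf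
  have d1 := hasDerivAt_integral_Iic hc (integrableOn_exp_smul hl hf hint) x
  have d2 := hasDerivAt_integral_Iic hf hint x
  have d3 : HasDerivAt (fun x : ℝ => Complex.exp (2 * Complex.I * l * x))
      (Complex.exp (2 * Complex.I * l * x) * (2 * Complex.I * l)) x := by
    have : HasDerivAt (fun x : ℝ => 2 * Complex.I * l * (x : ℂ)) (2 * Complex.I * l) x := by
      simpa using (Complex.ofRealCLM.hasDerivAt (x := x)).const_mul (2 * Complex.I * l)
    exact this.cexp
  refine (((d3.smul d1).sub d2).const_smul (2 * Complex.I * l)⁻¹).congr_deriv ?_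
  have h2 : 2 * Complex.I * l ≠ 0 := by simp [hl0]
  have h3 : Complex.exp (2 * Complex.I * l * x) * Complex.exp (-(2 * Complex.I * l * (x : ℂ))) = 1 := by
    rw [← Complex.exp_add]; simp
  rw [smul_smul (Complex.exp _) (Complex.exp _) (f x), h3, one_smul, smul_inv_smul₀ h2,
    mul_comm (Complex.exp _) (2 * Complex.I * l), mul_smul, smul_sub, smul_add,
    inv_smul_smul₀ h2]
  abel

end Duhamel

/-! ### The Volterra equation for the Jost solutions -/

section Weight

/-- The weight `exp(κ ∫_{-∞}^x (1 + (X - y)²) |δ(y)| dy)`, with respect to which the Volterra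
operators have norm at most `1 / κ`. -/
def potWeight (X κ : ℝ) (δ : ℝ → ℂ) (x : ℝ) : ℝ :=
  Real.exp (κ * ∫ y in Set.Iic x, (1 + (X - y) ^ 2) * ‖δ y‖)

variable {X κ : ℝ} {δ c : ℝ → ℂ}

theorem integrableOn_moment (hδ : Continuous δ)
    (hint : IntegrableOn (fun y => (1 + y ^ 2) * ‖δ y‖) (Set.Iic 0)) (X x : ℝ) :
    IntegrableOn (fun y => (1 + (X - y) ^ 2) * ‖δ y‖) (Set.Iic x) := by
  refine integrableOn_Iic_of_continuous (by fun_prop) (a := 0) ?_ x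
  refine Integrable.mono' (hint.const_mul (2 + 2 * X ^ 2))
    (by fun_prop : Continuous fun y => (1 + (X - y) ^ 2) * ‖δ y‖).aestronglyMeasurable
    (Eventually.of_forall fun y => ?_)
  rw [Real.norm_of_nonneg (by positivity), ← mul_assoc]
  gcongr
  nlinarith [sq_nonneg (X + y), sq_nonneg (X * y)]

theorem hasDerivAt_potWeight (hδ : Continuous δ)
    (hint : ∀ x, IntegrableOn (fun y => (1 + (X - y) ^ 2) * ‖δ y‖) (Set.Iic x)) (x : ℝ) :
    HasDerivAt (potWeight X κ δ)
      (κ * (potWeight X κ δ x * ((1 + (X - x) ^ 2) * ‖δ x‖))) x := by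
  have h1 := ((hasDerivAt_integral_Iic (by fun_prop) hint x).const_mul κ).exp
  exact h1.congr_deriv (by rw [potWeight]; ring)

theorem one_le_potWeight (hκ : 0 ≤ κ) (x : ℝ) : 1 ≤ potWeight X κ δ x :=
  Real.one_le_exp (mul_nonneg hκ (integral_nonneg fun y => by positivity))

theorem isWeighted_potWeight (hδ : Continuous δ)
    (hint : ∀ x, IntegrableOn (fun y => (1 + (X - y) ^ 2) * ‖δ y‖) (Set.Iic x)) (hκ : 0 ≤ κ)
    (hc : Continuous c) (hcδ : ∀ y, ‖c y‖ = ‖δ y‖) : IsWeighted X (potWeight X κ δ) c where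
  pos x := Real.exp_pos _
  mono := monotone_of_hasDerivAt_nonneg (hasDerivAt_potWeight hδ hint) fun x =>
    mul_nonneg hκ (mul_nonneg (Real.exp_pos _).le (by positivity))
  cont_weight := continuous_iff_continuousAt.2 fun x => (hasDerivAt_potWeight hδ hint x).continuousAt
  cont := hc
  int := by simpa only [hcδ] using hint X

theorem norm_op_le_inv {V : Type*} [NormedAddCommGroup V] [NormedSpace ℂ V] [CompleteSpace V]
    (hδ : Continuous δ)
    (hint : ∀ x, IntegrableOn (fun y => (1 + (X - y) ^ 2) * ‖δ y‖) (Set.Iic x)) (hκ : 0 < κ)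
    (h : IsWeighted X (potWeight X κ δ) c) (hcδ : ∀ y, ‖c y‖ = ‖δ y‖) {k : ℝ → ℂ}
    (hk : Continuous k) (hB : ∀ s, 0 ≤ s → ‖k s‖ ≤ 1 * (1 + s ^ 2)) :
    ‖((h.volKernel hk hB).op : (BoundedContinuousFunction ℝ V) →L[ℂ] _)‖ ≤ κ⁻¹ := by
  refine VolKernel.norm_op_le _ fun x hx => ?_
  set ρ := potWeight X κ δ with hρ
  set p : ℝ → ℝ := fun y => (1 + (X - y) ^ 2) * ‖δ y‖ with hp
  have hd := hasDerivAt_potWeight (κ := κ) hδ hint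
  have hpi : IntegrableOn (fun y => κ * (ρ y * p y)) (Set.Iic x) := by
    have hc1 := h.cont_weight
    refine Integrable.mono' ((hint x).const_mul (κ * ρ x))
      (by fun_prop : Continuous fun y => κ * (ρ y * p y)).aestronglyMeasurable ?_
    filter_upwards [ae_restrict_mem measurableSet_Iic] with y hy
    have h1 := h.pos y
    rw [Real.norm_of_nonneg (by positivity), mul_assoc]
    gcongr
    exact h.mono hy
  have hlim : Tendsto ρ atBot (𝓝 1) := by
    have := ((tendsto_integral_Iic_atBot hint).const_mul κ).rexp
    rw [mul_zero, Real.exp_zero] at this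
    exact this
  have hI := integral_Iic_of_hasDerivAt_of_tendsto' (fun y _ => hd y) hpi hlim
  have hI' : ∫ y in Set.Iic x, ρ y * p y ≤ κ⁻¹ * ρ x := by
    rw [integral_const_mul] at hI
    rw [← inv_mul_cancel_left₀ hκ.ne' (∫ y in Set.Iic x, ρ y * p y)]
    gcongr
    exact hI.le.trans (by linarith)
  have hx0 := h.pos x
  calc ∫ y in Set.Iic x, ‖((ρ y / ρ x : ℝ) : ℂ) * c y * k (x - y)‖
      ≤ ∫ y in Set.Iic x, (κ⁻¹ * (ρ x)⁻¹) * (κ * (ρ y * p y)) := by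
        refine integral_mono_ae ((h.volKernel hk hB).integrableOn_norm hx) (hpi.const_mul _) ?_
        filter_upwards [ae_restrict_mem measurableSet_Iic] with y hy
        have h1 := h.pos y
        have h2 := hB (x - y) (sub_nonneg.2 hy)
        have h3 : (x - y) ^ 2 ≤ (X - y) ^ 2 := by
          have : 0 ≤ x - y := sub_nonneg.2 hy
          gcongr
        have e : κ⁻¹ * (ρ x)⁻¹ * (κ * (ρ y * p y)) = ρ y / ρ x * p y := by
          field_simp
        rw [e, norm_mul, norm_mul, Complex.norm_real, Real.norm_of_nonneg (by positivity), hcδ,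
          mul_assoc]
        refine mul_le_mul_of_nonneg_left ?_ (by positivity)
        rw [hp]
        simp only
        rw [mul_comm]
        gcongr
        linarith
    _ = (ρ x)⁻¹ * ∫ y in Set.Iic x, ρ y * p y := by
        rw [integral_const_mul, integral_const_mul]
        field_simp
    _ ≤ (ρ x)⁻¹ * (κ⁻¹ * ρ x) := by gcongr
    _ = κ⁻¹ := by field_simp

end Weight

section Volterra

open BoundedContinuousFunction

/-- The pointwise action of a matrix on bounded functions. -/
def liftB (M : Matrix (Fin 2) (Fin 2) ℂ) :
    (ℝ →ᵇ (Fin 2 → ℂ)) →L[ℂ] (ℝ →ᵇ (Fin 2 → ℂ)) :=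
  (matL M).compLeftContinuousBounded ℝ

variable {X q₀ : ℝ} {ρ : ℝ → ℝ} {δ : ℝ → ℂ} {a z : ℂ}

namespace IsWeighted

/-- The operator with the kernel `(ρ(y) / ρ(x)) c(y)`. -/
def sOp {c : ℝ → ℂ} (h : IsWeighted X ρ c) :
    (ℝ →ᵇ (Fin 2 → ℂ)) →L[ℂ] (ℝ →ᵇ (Fin 2 → ℂ)) :=
  (h.volKernel (k := fun _ => 1) continuous_const (B := 1)
    fun s _ => by rw [norm_one, one_mul]; linarith [sq_nonneg s]).op

/-- The matrix `N = iλ - ikσ₃ + U₀(a)`, for which `N² = 2iλN` and `N E₁ = 0`. -/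
def bgMat (q₀ : ℝ) (a z : ℂ) : Matrix (Fin 2) (Fin 2) ℂ :=
  !![Complex.I * (q₀ : ℂ) ^ 2 / z, a; -conj a, Complex.I * z]

/-- The Volterra operator `m ↦ ∫_{-∞}^x (1 + N g(x - y)) Δ(y) m(y) dy`, conjugated by the weight. -/
def jostOp (h : IsWeighted X ρ δ) (h' : IsWeighted X ρ fun x => conj (δ x)) (q₀ : ℝ) (a z : ℂ) :
    (ℝ →ᵇ (Fin 2 → ℂ)) →L[ℂ] (ℝ →ᵇ (Fin 2 → ℂ)) :=
  ((liftB !![0, 1; 0, 0]).comp h.sOp - (liftB !![0, 0; 1, 0]).comp h'.sOp) +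
  ((Complex.I * (q₀ : ℂ) ^ 2 / z) • liftB !![1, 0; 0, 0] + (Complex.I * z) • liftB !![0, 0; 0, 1]
    + liftB !![0, a; -conj a, 0]).comp
  ((liftB !![0, 1; 0, 0]).comp (h.gOp (Fin 2 → ℂ) (lamOf q₀ z))
    - (liftB !![0, 0; 1, 0]).comp (h'.gOp (Fin 2 → ℂ) (lamOf q₀ z)))

theorem differentiableAt_lamOf (hz : z ≠ 0) : DifferentiableAt ℂ (lamOf q₀) z := by
  unfold lamOf
  fun_prop (disch := assumption)

theorem differentiableWithinAt_comb {W : Type*} [NormedAddCommGroup W] [NormedSpace ℂ W] {f g : ℂ → ℂ}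
    {S : Set ℂ} (hf : DifferentiableWithinAt ℂ f S z) (hg : DifferentiableWithinAt ℂ g S z)
    (A B C : W →L[ℂ] W) {T : ℂ → W →L[ℂ] W} (hT : DifferentiableWithinAt ℂ T S z) :
    DifferentiableWithinAt ℂ (fun z => (f z • A + g z • B + C).comp (T z)) S z :=
  (((hf.smul_const A).add (hg.smul_const B)).add_const C).clm_comp hT

theorem differentiableOn_jostOp (h : IsWeighted X ρ δ) (h' : IsWeighted X ρ fun x => conj (δ x)) :
    DifferentiableOn ℂ (h.jostOp h' q₀ a) {z | z ≠ 0 ∧ 0 ≤ (lamOf q₀ z).im} := by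
  intro z hz
  have hl : DifferentiableWithinAt ℂ (lamOf q₀) {z | z ≠ 0 ∧ 0 ≤ (lamOf q₀ z).im} z :=
    (differentiableAt_lamOf hz.1).differentiableWithinAt
  have hm : Set.MapsTo (lamOf q₀) {z | z ≠ 0 ∧ 0 ≤ (lamOf q₀ z).im} {l | 0 ≤ l.im} :=
    fun z hz => hz.2
  have g1 := (h.differentiableOn_gOp (V := Fin 2 → ℂ) (lamOf q₀ z) hz.2).comp z hl hm
  have g2 := (h'.differentiableOn_gOp (V := Fin 2 → ℂ) (lamOf q₀ z) hz.2).comp z hl hm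
  have s1 : DifferentiableWithinAt ℂ (fun z : ℂ => Complex.I * (q₀ : ℂ) ^ 2 / z)
      {z | z ≠ 0 ∧ 0 ≤ (lamOf q₀ z).im} z :=
    ((differentiableAt_const _).div differentiableAt_id hz.1).differentiableWithinAt
  have s2 : DifferentiableWithinAt ℂ (fun z : ℂ => Complex.I * z)
      {z | z ≠ 0 ∧ 0 ≤ (lamOf q₀ z).im} z := by fun_prop
  have c1 := (differentiableWithinAt_const (c := liftB !![0, 1; 0, 0])).clm_comp g1
  have c2 := (differentiableWithinAt_const (c := liftB !![0, 0; 1, 0])).clm_comp g2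
  exact (differentiableWithinAt_comb s1 s2 (liftB !![1, 0; 0, 0]) (liftB !![0, 0; 0, 1])
    (liftB !![0, a; -conj a, 0]) (c1.sub c2)).const_add _

end IsWeighted
end Volterra

section VolterraSolution

open BoundedContinuousFunction

variable {X q₀ : ℝ} {ρ : ℝ → ℝ} {δ : ℝ → ℂ} {a z : ℂ}

/-- The off-diagonal part of the Lax matrix in excess of its background value, applied to `m`. -/
def excess (δ : ℝ → ℂ) (m : ℝ → Fin 2 → ℂ) (y : ℝ) : Fin 2 → ℂ := ![δ y * m y 1, -conj (δ y) * m y 0]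

theorem continuous_excess (hδ : Continuous δ) {m : ℝ → Fin 2 → ℂ} (hm : Continuous m) :
    Continuous (excess δ m) := by
  have h0 := (continuous_apply 0).comp hm
  have h1 := (continuous_apply 1).comp hm
  refine continuous_pi fun i => ?_
  fin_cases i
  · exact hδ.mul h1
  · exact ((Complex.continuous_conj.comp hδ).neg).mul h0

theorem norm_excess_le (δ : ℝ → ℂ) (m : ℝ → Fin 2 → ℂ) (y : ℝ) :
    ‖excess δ m y‖ ≤ ‖δ y‖ * ‖m y‖ := by
  refine (pi_norm_le_iff_of_nonneg (by positivity)).2 fun i => ?_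
  fin_cases i
  · change ‖δ y * m y 1‖ ≤ _
    rw [norm_mul]
    gcongr
    exact norm_le_pi_norm (m y) 1
  · change ‖-conj (δ y) * m y 0‖ ≤ _
    rw [norm_mul, norm_neg, RCLike.norm_conj]
    gcongr
    exact norm_le_pi_norm (m y) 0

namespace IsWeighted

theorem liftB_op_apply (h : IsWeighted X ρ δ) (h' : IsWeighted X ρ fun x => conj (δ x)) {k : ℝ → ℂ}
    (hk : Continuous k) {B : ℝ} (hB : ∀ s, 0 ≤ s → ‖k s‖ ≤ B * (1 + s ^ 2))
    (n : ℝ →ᵇ (Fin 2 → ℂ)) {x : ℝ} (hx : x ≤ X) :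
    (liftB !![0, 1; 0, 0]).comp (h.volKernel hk hB).op n x
      - (liftB !![0, 0; 1, 0]).comp (h'.volKernel hk hB).op n x
      = ((ρ x : ℂ))⁻¹ • ∫ y in Set.Iic x, k (x - y) • excess δ (fun y => (ρ y : ℂ) • n y) y := by
  change (matL _ ((h.volKernel hk hB).op n x)) - (matL _ ((h'.volKernel hk hB).op n x)) = _
  have i1 := (h.volKernel hk hB).integrableOn_smul hx n
  have i2 := (h'.volKernel hk hB).integrableOn_smul hx n
  rw [VolKernel.op_apply_of_le _ _ hx, VolKernel.op_apply_of_le _ _ hx,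
    ← ContinuousLinearMap.integral_comp_comm _ i1, ← ContinuousLinearMap.integral_comp_comm _ i2,
    ← integral_sub (ContinuousLinearMap.integrable_comp _ i1)
      (ContinuousLinearMap.integrable_comp _ i2), ← integral_smul]
  refine integral_congr_ae (Eventually.of_forall fun y => ?_)
  have hx0 : (ρ x : ℂ) ≠ 0 := by exact_mod_cast (h.pos x).ne'
  simp only [matL_apply]
  ext i
  fin_cases i
  · simp [excess, dotProduct, Fin.sum_univ_two]
    field_simp
  · simp [excess, dotProduct, Fin.sum_univ_two]
    field_simp

theorem jostOp_apply (h : IsWeighted X ρ δ) (h' : IsWeighted X ρ fun x => conj (δ x))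
    (hl : 0 ≤ (lamOf q₀ z).im) (n : ℝ →ᵇ (Fin 2 → ℂ)) {x : ℝ} (hx : x ≤ X) :
    h.jostOp h' q₀ a z n x = ((ρ x : ℂ))⁻¹ •
      ((∫ y in Set.Iic x, excess δ (fun y => (ρ y : ℂ) • n y) y)
        + (bgMat q₀ a z).mulVec (∫ y in Set.Iic x, (((x - y : ℝ) : ℂ)
          * phi (2 * Complex.I * lamOf q₀ z * ((x - y : ℝ) : ℂ)))
          • excess δ (fun y => (ρ y : ℂ) • n y) y)) := by
  have h1 := liftB_op_apply h h' (k := fun _ => 1) continuous_const (B := 1)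
    (fun s _ => by rw [norm_one, one_mul]; linarith [sq_nonneg s]) n hx
  have h2 := liftB_op_apply h h' (continuous_phi_mul (lamOf q₀ z))
    (fun _ hs => norm_phi_mul_le hl hs) n hx
  rw [← h.gOp_of_nonneg hl, ← h'.gOp_of_nonneg hl] at h2
  have e : h.jostOp h' q₀ a z n x =
      ((liftB !![0, 1; 0, 0]).comp h.sOp n x - (liftB !![0, 0; 1, 0]).comp h'.sOp n x)
      + (bgMat q₀ a z).mulVec ((liftB !![0, 1; 0, 0]).comp (h.gOp (Fin 2 → ℂ) (lamOf q₀ z)) n x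
        - (liftB !![0, 0; 1, 0]).comp (h'.gOp (Fin 2 → ℂ) (lamOf q₀ z)) n x) := by
    set v := (liftB !![0, 1; 0, 0]).comp (h.gOp (Fin 2 → ℂ) (lamOf q₀ z)) n x
        - (liftB !![0, 0; 1, 0]).comp (h'.gOp (Fin 2 → ℂ) (lamOf q₀ z)) n x with hv
    have e2 : (bgMat q₀ a z).mulVec v = (Complex.I * (q₀ : ℂ) ^ 2 / z) • (!![1, 0; 0, 0] :
          Matrix (Fin 2) (Fin 2) ℂ).mulVec v
        + (Complex.I * z) • (!![0, 0; 0, 1] : Matrix (Fin 2) (Fin 2) ℂ).mulVec v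
        + (!![0, a; -conj a, 0] : Matrix (Fin 2) (Fin 2) ℂ).mulVec v := by
      rw [← Matrix.smul_mulVec, ← Matrix.smul_mulVec, ← Matrix.add_mulVec, ← Matrix.add_mulVec]
      congr 1
      ext i j
      fin_cases i <;> fin_cases j <;> simp [bgMat]
    rw [e2]
    rfl
  rw [e, sOp, sOp, h1, h2, Matrix.mulVec_smul, ← smul_add]
  simp only [one_smul]

end IsWeighted

theorem bgMat_mulVec_E (ha : a * conj a = (q₀ : ℂ) ^ 2) (hz : z ≠ 0) :
    (IsWeighted.bgMat q₀ a z).mulVec (fun i => E a z i 0) = 0 := by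
  have hI := Complex.I_mul_I
  ext i
  fin_cases i
  · simp only [IsWeighted.bgMat, E, Matrix.mulVec, dotProduct, Fin.sum_univ_two]
    simp
    rw [← ha]
    ring
  · simp only [IsWeighted.bgMat, E, Matrix.mulVec, dotProduct, Fin.sum_univ_two]
    simp
    field_simp
    linear_combination (-conj a) * hI

theorem bgMat_mul_self (ha : a * conj a = (q₀ : ℂ) ^ 2) (hz : z ≠ 0) (v : Fin 2 → ℂ) :
    (IsWeighted.bgMat q₀ a z).mulVec ((IsWeighted.bgMat q₀ a z).mulVec v)
      = (2 * Complex.I * lamOf q₀ z) • (IsWeighted.bgMat q₀ a z).mulVec v := by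
  have hI := Complex.I_mul_I
  rw [Matrix.mulVec_mulVec, ← Matrix.smul_mulVec]
  congr 1
  ext i j
  fin_cases i <;> fin_cases j <;> simp [IsWeighted.bgMat, lamOf, Matrix.mul_apply, Fin.sum_univ_two]
  · field_simp
    linear_combination (-z ^ 2) * ha - z ^ 2 * (q₀ : ℂ) ^ 2 * hI
  · field_simp
    ring
  · field_simp
    ring
  · field_simp
    linear_combination (-1) * ha - (q₀ : ℂ) ^ 2 * hI

/-- A continuous solution of the Volterra equation solves the differential equation and has the
prescribed limit. -/
theorem volterra_solution (hδ : Continuous δ)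
    (hint : ∀ x, IntegrableOn (fun y => (1 + (X - y) ^ 2) * ‖δ y‖) (Set.Iic x))
    (ha : a * conj a = (q₀ : ℂ) ^ 2) (hz : z ≠ 0) (hl : 0 ≤ (lamOf q₀ z).im)
    {m : ℝ → Fin 2 → ℂ} (hm : Continuous m) {B : ℝ} (hB : ∀ y ≤ X, ‖m y‖ ≤ B)
    (heq : ∀ x ≤ X, m x = (fun i => E a z i 0) + ((∫ y in Set.Iic x, excess δ m y)
        + (IsWeighted.bgMat q₀ a z).mulVec (∫ y in Set.Iic x, (((x - y : ℝ) : ℂ)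
          * phi (2 * Complex.I * lamOf q₀ z * ((x - y : ℝ) : ℂ))) • excess δ m y))) :
    Tendsto m atBot (𝓝 fun i => E a z i 0) ∧ (lamOf q₀ z ≠ 0 → ∀ x < X,
      HasDerivAt m ((IsWeighted.bgMat q₀ a z).mulVec (m x) + excess δ m x) x) := by
  set f := excess δ m with hf
  have hfc : Continuous f := continuous_excess hδ hm
  have hfX : ∀ y ≤ X, (1 + (X - y) ^ 2) * ‖f y‖ ≤ B * ((1 + (X - y) ^ 2) * ‖δ y‖) := fun y hy => by
    have h1 := norm_excess_le δ m y
    have h2 := mul_le_mul_of_nonneg_left (hB y hy) (norm_nonneg (δ y))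
    rw [mul_left_comm]
    gcongr
    exact (h1.trans h2).trans_eq (mul_comm _ _)
  have hgi : ∀ x, IntegrableOn (fun y => (1 + (X - y) ^ 2) * ‖f y‖) (Set.Iic x) := fun x => by
    refine integrableOn_Iic_of_continuous (by fun_prop) (a := X) ?_ x
    refine Integrable.mono' ((hint X).const_mul B)
      (by fun_prop : Continuous fun y => (1 + (X - y) ^ 2) * ‖f y‖).aestronglyMeasurable ?_
    filter_upwards [ae_restrict_mem measurableSet_Iic] with y hy
    rw [Real.norm_of_nonneg (by positivity)]
    exact hfX y hy
  have hfi : ∀ x, IntegrableOn f (Set.Iic x) := fun x => by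
    refine Integrable.mono' (hgi x) hfc.aestronglyMeasurable (Eventually.of_forall fun y => ?_)
    nlinarith [norm_nonneg (f y), sq_nonneg (X - y), mul_nonneg (sq_nonneg (X - y)) (norm_nonneg (f y))]
  have hI0 := tendsto_integral_Iic_atBot hfi
  set J := fun x => ∫ y in Set.Iic x, (((x - y : ℝ) : ℂ)
          * phi (2 * Complex.I * lamOf q₀ z * ((x - y : ℝ) : ℂ))) • f y with hJ
  have hJ0 : Tendsto J atBot (𝓝 0) := by
    refine squeeze_zero_norm' ?_ (tendsto_integral_Iic_atBot hgi)
    filter_upwards [eventually_le_atBot X] with x hx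
    refine norm_integral_le_of_norm_le (hgi x) ?_
    filter_upwards [ae_restrict_mem measurableSet_Iic] with y hy
    have h0 : 0 ≤ x - y := sub_nonneg.2 hy
    have h1 := IsWeighted.norm_phi_mul_le hl h0
    rw [norm_smul]
    gcongr
    refine h1.trans ?_
    rw [one_mul]
    gcongr
  have hmJ : ∀ x ≤ X, m x = (fun i => E a z i 0) + ((∫ y in Set.Iic x, f y)
        + (IsWeighted.bgMat q₀ a z).mulVec (J x)) := heq
  refine ⟨?_, fun hl0 x hx => ?_⟩
  · have h1 := (hI0.add (((matL (IsWeighted.bgMat q₀ a z)).continuous.tendsto 0).comp hJ0)).const_add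
      (fun i => E a z i 0)
    rw [map_zero, add_zero, add_zero] at h1
    refine h1.congr' ?_
    filter_upwards [eventually_le_atBot X] with x hx
    exact (hmJ x hx).symm
  · have d1 := hasDerivAt_integral_Iic hfc hfi x
    have d2 := hasDerivAt_integral_phi_smul hl hl0 hfc hfi x
    have d3 := ((matL (IsWeighted.bgMat q₀ a z)).restrictScalars ℝ).hasFDerivAt.comp_hasDerivAt x d2
    have d4 := (d1.add d3).const_add (fun i => E a z i 0)
    refine (d4.congr_of_eventuallyEq ?_).congr_deriv ?_
    · filter_upwards [Iio_mem_nhds hx] with y hy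
      exact hmJ y (le_of_lt hy)
    · rw [hmJ x hx.le]
      change f x + (IsWeighted.bgMat q₀ a z).mulVec (_ + _ • J x) = _
      rw [Matrix.mulVec_add, Matrix.mulVec_add, Matrix.mulVec_add, bgMat_mulVec_E ha hz,
        bgMat_mul_self ha hz, Matrix.mulVec_smul]
      abel

end VolterraSolution

/-! ### Existence and analyticity of the Jost solutions -/

/-- The region `Im λ ≥ 0`, the closure of `D⁺` in the punctured plane. -/
def Splus (q₀ : ℝ) : Set ℂ := {z | z ≠ 0 ∧ 0 ≤ (lamOf q₀ z).im}

/-- A fixed-point equation `n = e + T n` whose data depend differentiably on a parameter. -/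
theorem exists_fixedPoint {W : Type*} [NormedAddCommGroup W] [NormedSpace ℂ W] [CompleteSpace W]
    {S : Set ℂ} {z₀ : ℂ} {T : ℂ → W →L[ℂ] W} {e : ℂ → W}
    (hT : DifferentiableWithinAt ℂ T S z₀) (he : DifferentiableWithinAt ℂ e S z₀)
    (h1 : ‖T z₀‖ < 1) : ∃ n : ℂ → W, DifferentiableWithinAt ℂ n S z₀ ∧
      ∀ᶠ z in 𝓝[S] z₀, n z = e z + T z (n z) := by
  have hu : ∀ {t : W →L[ℂ] W}, ‖t‖ < 1 → IsUnit (1 - t) := fun ht => isUnit_one_sub_of_norm_lt_one ht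
  refine ⟨fun z => Ring.inverse (1 - T z) (e z), ?_, ?_⟩
  · have h2 : DifferentiableAt ℂ Ring.inverse (1 - T z₀) := differentiableAt_inverse (hu h1)
    have h3 : DifferentiableWithinAt ℂ (fun z => 1 - T z) S z₀ := hT.const_sub 1
    exact (h2.comp_differentiableWithinAt z₀ h3).clm_apply he
  · have h2 : ∀ᶠ z in 𝓝[S] z₀, ‖T z‖ < 1 :=
      hT.continuousWithinAt.norm.eventually (gt_mem_nhds h1)
    filter_upwards [h2] with z hz
    have h3 : (1 - T z) * Ring.inverse (1 - T z) = 1 := Ring.mul_inverse_cancel _ (hu hz)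
    have h4 := congrArg (fun A : W →L[ℂ] W => A (e z)) h3
    have h5 : Ring.inverse (1 - T z) (e z) - T z (Ring.inverse (1 - T z) (e z)) = e z := h4
    exact (sub_eq_iff_eq_add.1 h5).trans (by abel)

theorem differentiableWithinAt_affine {W : Type*} [NormedAddCommGroup W] [NormedSpace ℂ W] {f : ℂ → ℂ}
    {S : Set ℂ} {z : ℂ} (hf : DifferentiableWithinAt ℂ f S z) (A B : W) :
    DifferentiableWithinAt ℂ (fun z => A + f z • B) S z :=
  (hf.smul_const B).const_add A

theorem norm_comb_le {W : Type*} [NormedAddCommGroup W] [NormedSpace ℂ W]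
    (A B N S S' G G' : W →L[ℂ] W) {r : ℝ} (hS : ‖S‖ ≤ r) (hS' : ‖S'‖ ≤ r) (hG : ‖G‖ ≤ r)
    (hG' : ‖G'‖ ≤ r) : ‖(A.comp S - B.comp S') + N.comp (A.comp G - B.comp G')‖
      ≤ (‖A‖ + ‖B‖) * (1 + ‖N‖) * r := by
  have h : ∀ {S S' : W →L[ℂ] W}, ‖S‖ ≤ r → ‖S'‖ ≤ r →
      ‖A.comp S - B.comp S'‖ ≤ (‖A‖ + ‖B‖) * r := fun hS hS' => by
    refine (norm_sub_le _ _).trans ?_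
    rw [add_mul]
    exact add_le_add ((ContinuousLinearMap.opNorm_comp_le _ _).trans (by gcongr))
      ((ContinuousLinearMap.opNorm_comp_le _ _).trans (by gcongr))
  refine (norm_add_le _ _).trans ?_
  have h2 := (ContinuousLinearMap.opNorm_comp_le N (A.comp G - B.comp G')).trans
    (mul_le_mul_of_nonneg_left (h hG hG') (norm_nonneg N))
  refine (add_le_add (h hS hS') h2).trans_eq ?_
  ring

section

open BoundedContinuousFunction

variable {X q₀ : ℝ} {δ : ℝ → ℂ} {a z₀ : ℂ}

theorem norm_sOp_le {κ : ℝ} {c : ℝ → ℂ} (hδ : Continuous δ)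
    (hint : ∀ x, IntegrableOn (fun y => (1 + (X - y) ^ 2) * ‖δ y‖) (Set.Iic x)) (hκ : 0 < κ)
    (h : IsWeighted X (potWeight X κ δ) c) (hc : ∀ y, ‖c y‖ = ‖δ y‖) : ‖h.sOp‖ ≤ κ⁻¹ := by
  rw [IsWeighted.sOp]
  exact norm_op_le_inv hδ hint hκ h hc continuous_const
    fun s _ => by rw [norm_one, one_mul]; linarith [sq_nonneg s]

theorem norm_gOp_le {κ : ℝ} {c : ℝ → ℂ} (hδ : Continuous δ)
    (hint : ∀ x, IntegrableOn (fun y => (1 + (X - y) ^ 2) * ‖δ y‖) (Set.Iic x)) (hκ : 0 < κ)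
    (h : IsWeighted X (potWeight X κ δ) c) (hc : ∀ y, ‖c y‖ = ‖δ y‖) {l : ℂ} (hl : 0 ≤ l.im) :
    ‖h.gOp (Fin 2 → ℂ) l‖ ≤ κ⁻¹ := by
  rw [h.gOp_of_nonneg hl]
  exact norm_op_le_inv hδ hint hκ h hc (IsWeighted.continuous_phi_mul l)
    fun _ hs => IsWeighted.norm_phi_mul_le hl hs

/-- Near each point of `Im λ ≥ 0`, including the branch points, the Volterra equation has a solution
depending differentiably on `z`. -/
theorem exists_volterra_solution (hδ : Continuous δ)
    (hint : ∀ x, IntegrableOn (fun y => (1 + (X - y) ^ 2) * ‖δ y‖) (Set.Iic x))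
    (ha : a * conj a = (q₀ : ℂ) ^ 2) (hz₀ : z₀ ∈ Splus q₀) :
    ∃ m : ℂ → ℝ → Fin 2 → ℂ,
      (∀ x, DifferentiableWithinAt ℂ (fun z => m z x) (Splus q₀) z₀) ∧
      ∀ᶠ z in 𝓝[Splus q₀] z₀, Tendsto (m z) atBot (𝓝 fun i => E a z i 0) ∧
        (lamOf q₀ z ≠ 0 → ∀ x < X,
          HasDerivAt (m z) ((IsWeighted.bgMat q₀ a z).mulVec (m z x) + excess δ (m z) x) x) := by
  obtain ⟨L, hL⟩ : ∃ L, L = (‖liftB !![0, 1; 0, 0]‖ + ‖liftB !![0, 0; 1, 0]‖) * (1 +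
    ‖(Complex.I * (q₀ : ℂ) ^ 2 / z₀) • liftB !![1, 0; 0, 0]
      + (Complex.I * z₀) • liftB !![0, 0; 0, 1] + liftB !![0, a; -conj a, 0]‖) := ⟨_, rfl⟩
  have hL0 : 0 ≤ L := by rw [hL]; positivity
  obtain ⟨κ, hκ⟩ : ∃ κ, κ = L + 1 := ⟨_, rfl⟩
  have hκ0 : 0 < κ := by rw [hκ]; positivity
  have h : IsWeighted X (potWeight X κ δ) δ := isWeighted_potWeight hδ hint hκ0.le hδ fun _ => rfl
  have h' : IsWeighted X (potWeight X κ δ) fun x => conj (δ x) :=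
    isWeighted_potWeight hδ hint hκ0.le (Complex.continuous_conj.comp hδ) fun _ => RCLike.norm_conj _
  have hT1 : ‖h.jostOp h' q₀ a z₀‖ < 1 := by
    have n1 := norm_sOp_le hδ hint hκ0 h fun _ => rfl
    have n2 := norm_sOp_le hδ hint hκ0 h' fun _ => RCLike.norm_conj _
    have n3 := norm_gOp_le hδ hint hκ0 h (fun _ => rfl) hz₀.2
    have n4 := norm_gOp_le hδ hint hκ0 h' (fun _ => RCLike.norm_conj _) hz₀.2
    have hb := norm_comb_le (liftB !![0, 1; 0, 0]) (liftB !![0, 0; 1, 0])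
      ((Complex.I * (q₀ : ℂ) ^ 2 / z₀) • liftB !![1, 0; 0, 0]
        + (Complex.I * z₀) • liftB !![0, 0; 0, 1] + liftB !![0, a; -conj a, 0]) _ _ _ _ n1 n2 n3 n4
    rw [← hL] at hb
    rw [IsWeighted.jostOp]
    refine lt_of_le_of_lt hb ?_
    rw [← div_eq_mul_inv, div_lt_one hκ0]
    linarith
  have hρ1 := one_le_potWeight (X := X) (δ := δ) hκ0.le
  generalize potWeight X κ δ = ρ at h h' hT1 hρ1
  have hρ0 : ∀ x, (ρ x : ℂ) ≠ 0 := fun x => by exact_mod_cast (h.pos x).ne'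
  let b : (Fin 2 → ℂ) → (ℝ →ᵇ (Fin 2 → ℂ)) := fun v =>
    BoundedContinuousFunction.ofNormedAddCommGroup (fun x => ((ρ x : ℂ))⁻¹ • v)
      (((Complex.continuous_ofReal.comp h.cont_weight).inv₀ hρ0).smul continuous_const) ‖v‖ fun x => by
        rw [norm_smul, norm_inv, Complex.norm_real, Real.norm_of_nonneg (h.pos x).le]
        exact mul_le_of_le_one_left (norm_nonneg v) (inv_le_one_of_one_le₀ (hρ1 x))
  obtain ⟨n, hn, hn'⟩ := exists_fixedPoint
    (h.differentiableOn_jostOp h' (a := a) (q₀ := q₀) z₀ hz₀)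
    (differentiableWithinAt_affine (f := fun z => z⁻¹)
      (differentiableAt_inv hz₀.1).differentiableWithinAt (b ![1, 0]) (b ![0, -(Complex.I * conj a)]))
    hT1
  refine ⟨fun z x => (ρ x : ℂ) • n z x, fun x => ?_, ?_⟩
  · have h1 := (BoundedContinuousFunction.evalCLM ℂ x :
      (ℝ →ᵇ (Fin 2 → ℂ)) →L[ℂ] _).differentiableAt.comp_differentiableWithinAt z₀ hn
    exact h1.const_smul (ρ x : ℂ)
  · filter_upwards [hn', self_mem_nhdsWithin] with z hz hzS
    have hmc : Continuous fun x => (ρ x : ℂ) • n z x :=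
      (Complex.continuous_ofReal.comp h.cont_weight).smul (n z).continuous
    refine volterra_solution hδ hint ha hzS.1 hzS.2 hmc (B := ρ X * ‖n z‖) (fun y hy => ?_)
      fun x hx => ?_
    · rw [norm_smul, Complex.norm_real, Real.norm_of_nonneg (h.pos y).le]
      exact mul_le_mul (h.mono hy) ((n z).norm_coe_le_norm y) (norm_nonneg _) (h.pos X).le
    · have h1 := congrArg (fun w : ℝ →ᵇ (Fin 2 → ℂ) => (ρ x : ℂ) • w x) hz
      have h2 := h.jostOp_apply h' (a := a) hzS.2 (n z) hx
      refine h1.trans ?_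
      change (ρ x : ℂ) • ((((ρ x : ℂ))⁻¹ • ![1, 0] + z⁻¹ • (((ρ x : ℂ))⁻¹ • ![0, -(Complex.I * conj a)]))
        + h.jostOp h' q₀ a z (n z) x) = _
      rw [h2, smul_add, smul_inv_smul₀ (hρ0 x), smul_add, smul_inv_smul₀ (hρ0 x),
        smul_comm z⁻¹, smul_inv_smul₀ (hρ0 x)]
      congr 1
      ext i
      fin_cases i
      · simp [E]
      · simp [E]
        ring

end

/-- A continuous potential which tends to `a` at `-∞` with two moments. -/
structure DecaysLeft (u : ℝ → ℂ) (a : ℂ) : Prop where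
  cont : Continuous u
  int : IntegrableOn (fun x => (1 + x ^ 2) * ‖u x - a‖) (Set.Iic 0)

section Left

variable {ε q₀ t : ℝ} {q : ℝ → ℝ → ℂ} {a z : ℂ}

theorem DecaysLeft.integrableOn (h : DecaysLeft (fun x => q x t) a) (X x : ℝ) :
    IntegrableOn (fun y => (1 + (X - y) ^ 2) * ‖q y t - a‖) (Set.Iic x) :=
  integrableOn_moment (δ := fun y => q y t - a) (h.cont.sub continuous_const) h.int X x

theorem laxU_mulVec_eq (hz : z ≠ 0) (u : ℝ → ℂ) (x : ℝ) (m : ℝ → Fin 2 → ℂ) :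
    (laxU (kOf q₀ z) (u x)).mulVec (m x) = -(Complex.I * lamOf q₀ z) • m x +
      ((IsWeighted.bgMat q₀ a z).mulVec (m x) + excess (fun y => u y - a) m x) := by
  rw [laxU_mulVec]
  ext i
  fin_cases i
  · simp [IsWeighted.bgMat, excess, dotProduct, Fin.sum_univ_two, kOf, lamOf]
    field_simp
    ring
  · simp [IsWeighted.bgMat, excess, dotProduct, Fin.sum_univ_two, kOf, lamOf]
    field_simp
    ring

theorem continuous_laxU {k : ℂ} {u : ℝ → ℂ} (hu : Continuous u) (i j : Fin 2) :
    Continuous fun x => laxU k (u x) i j := by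
  fin_cases i <;> fin_cases j
  · exact continuous_const
  · exact hu
  · exact (Complex.continuous_conj.comp hu).neg
  · exact continuous_const

/-- A solution of the Volterra equation on a half-line gives the Jost solution. -/
theorem exists_isJost_of_volterra (hu : Continuous fun x => q x t) (hz : z ≠ 0) {X : ℝ}
    {m : ℝ → Fin 2 → ℂ} (hlim : Tendsto m atBot (𝓝 fun i => E a z i 0))
    (hm : ∀ x < X, HasDerivAt m ((IsWeighted.bgMat q₀ a z).mulVec (m x)
      + excess (fun y => q y t - a) m x) x) :
    ∃ φ, IsJost ε q₀ q a atBot 0 t z φ ∧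
      ∀ x < X, φ x = Complex.exp (-(Complex.I * theta ε q₀ x t z)) • m x := by
  obtain ⟨φ, hφ, hφm⟩ := exists_extension_mulVec (X := X)
    (A := fun x => laxU (kOf q₀ z) (q x t)) (continuous_laxU hu)
    (φ := fun x => Complex.exp (-(Complex.I * theta ε q₀ x t z)) • m x) fun x hx => by
      have h1 := ((hasDerivAt_theta_x ε q₀ x t z).const_mul
        Complex.I).fun_neg.cexp.smul (hm x hx)
      refine h1.congr_deriv ?_
      rw [Matrix.mulVec_smul, laxU_mulVec_eq (a := a) hz (fun y => q y t) x m,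
        smul_add _ (-(Complex.I * lamOf q₀ z) • m x), smul_smul, add_comm]
  refine ⟨φ, ⟨hφ, hlim.congr' ?_⟩, hφm⟩
  filter_upwards [eventually_lt_atBot X] with x hx
  rw [hφm x hx, smul_smul, ← Complex.exp_add]
  simp

theorem eventually_lamOf_ne (q₀ : ℝ) (z₀ : ℂ) :
    ∀ᶠ z in 𝓝 z₀, z = z₀ ∨ z = 0 ∨ lamOf q₀ z ≠ 0 := by
  have hfin : ({Complex.I * q₀, -(Complex.I * q₀)} \ {z₀} : Set ℂ).Finite :=
    (Set.toFinite _).subset Set.sdiff_subset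
  have hmem : z₀ ∉ ({Complex.I * q₀, -(Complex.I * q₀)} \ {z₀} : Set ℂ) := fun h => h.2 rfl
  filter_upwards [hfin.isClosed.isOpen_compl.mem_nhds hmem] with z hz
  by_contra! h
  refine hz ⟨?_, h.1⟩
  have h1 := h.2.2
  rw [lamOf] at h1
  have h2 : (z - Complex.I * q₀) * (z + Complex.I * q₀) = 0 := by
    have h3 := h.2.1
    field_simp at h1
    linear_combination h1 - (q₀ : ℂ) ^ 2 * Complex.I_mul_I
  rcases mul_eq_zero.1 h2 with h3 | h3
  · exact Or.inl (sub_eq_zero.1 h3)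
  · exact Or.inr (eq_neg_of_add_eq_zero_left h3)

/-- Existence of the left Jost solution for `Im λ ≥ 0`, away from the branch points. -/
theorem DecaysLeft.exists_isJost (h : DecaysLeft (fun x => q x t) a) (ε : ℝ)
    (ha : a * conj a = (q₀ : ℂ) ^ 2) (hz : z ∈ Splus q₀) (hl : lamOf q₀ z ≠ 0) :
    ∃ φ, IsJost ε q₀ q a atBot 0 t z φ := by
  obtain ⟨m, -, hm⟩ := exists_volterra_solution (X := 0) (δ := fun y => q y t - a)
    (h.cont.sub continuous_const) (h.integrableOn 0) ha hz
  obtain ⟨h1, h2⟩ := hm.self_of_nhdsWithin hz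
  obtain ⟨φ, hφ, -⟩ := exists_isJost_of_volterra (ε := ε) h.cont hz.1 h1 (h2 hl)
  exact ⟨φ, hφ⟩

theorem differentiableAt_theta (x : ℝ) (hz : z ≠ 0) :
    DifferentiableAt ℂ (theta ε q₀ x t) z := by
  unfold theta lamOf kOf
  fun_prop (disch := assumption)

/-- At each `x`, the left Jost solution is holomorphic for `Im λ > 0`, differentiable up to the
boundary, and extends to the branch points. -/
theorem DecaysLeft.exists_differentiableOn (h : DecaysLeft (fun x => q x t) a) (ε : ℝ)
    (hq : q₀ ≠ 0) (ha : a * conj a = (q₀ : ℂ) ^ 2) (x : ℝ) :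
    ∃ F : ℂ → Fin 2 → ℂ, DifferentiableOn ℂ F (Splus q₀) ∧
      ∀ z ∈ Splus q₀, lamOf q₀ z ≠ 0 → jost ε q₀ q a atBot 0 t z x = F z := by
  classical
  have key : ∀ z₀ : ℂ, ∃ m : ℂ → Fin 2 → ℂ, z₀ ∈ Splus q₀ →
      DifferentiableWithinAt ℂ m (Splus q₀) z₀ ∧ ∀ᶠ z in 𝓝[Splus q₀] z₀, lamOf q₀ z ≠ 0 →
        jost ε q₀ q a atBot 0 t z x = m z := fun z₀ => by
    by_cases hz₀ : z₀ ∈ Splus q₀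
    · obtain ⟨m, hmd, hm⟩ := exists_volterra_solution (X := x + 1) (δ := fun y => q y t - a)
        (h.cont.sub continuous_const) (h.integrableOn _) ha hz₀
      refine ⟨fun z => Complex.exp (-(Complex.I * theta ε q₀ x t z)) • m z x, fun _ => ⟨?_, ?_⟩⟩
      · exact (((differentiableAt_theta x hz₀.1).const_mul Complex.I).neg.cexp
          ).differentiableWithinAt.smul (hmd x)
      · filter_upwards [hm, self_mem_nhdsWithin] with z hz hzS hl
        obtain ⟨φ, hφ, hφm⟩ := exists_isJost_of_volterra (ε := ε) h.cont hzS.1 hz.1 (hz.2 hl)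
        rw [hφ.jost_eq h.cont (jostRange_atBot_zero hzS.2), hφm x (lt_add_one x)]
    · exact ⟨0, fun h => absurd h hz₀⟩
  choose m hm using key
  refine ⟨fun z => if lamOf q₀ z = 0 then m z z else jost ε q₀ q a atBot 0 t z x,
    fun z₀ hz₀ => ?_, fun z _ hl => (if_neg hl).symm⟩
  obtain ⟨h1, h2⟩ := hm z₀ hz₀
  refine h1.congr_of_eventuallyEq_of_mem ?_ hz₀
  filter_upwards [h2, self_mem_nhdsWithin, nhdsWithin_le_nhds (eventually_lamOf_ne q₀ z₀)]
    with z hz hzS hor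
  by_cases hl : lamOf q₀ z = 0
  · rw [if_pos hl]
    rcases hor with rfl | h0 | h0
    · rfl
    · exact absurd h0 hzS.1
    · exact absurd hl h0
  · rw [if_neg hl]
    exact hz hl

end Left

section Right

variable {ε q₀ t : ℝ} {q : ℝ → ℝ → ℂ} {a z : ℂ} {φ : ℝ → Fin 2 → ℂ}

/-- The reflection `q ↦ -q*(-x, -t)` exchanges the Jost solutions `φ_{-,1}` and `φ_{+,2}`. -/
theorem IsJost.reflect
    (h : IsJost ε q₀ (fun x t => -conj (q (-x) (-t))) (-conj a) atBot 0 (-t) z φ) :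
    IsJost ε q₀ q a atTop 1 t z fun x => ![-φ (-x) 1, φ (-x) 0] := by
  refine ⟨?_, ?_⟩
  · have h1 := isLax_iff.1 h.isLax
    refine isLax_iff.2 fun x => ?_
    obtain ⟨h2, h3⟩ := h1 (-x)
    have hn : HasDerivAt (fun x : ℝ => -x) (-1) x := hasDerivAt_neg x
    have h4 := h2.scomp x hn
    have h5 := (h3.scomp x hn).neg
    refine ⟨h5.congr_deriv ?_, h4.congr_deriv ?_⟩
    · simp
    · simp
      ring
  · have h1 := h.2.comp tendsto_neg_atTop_atBot
    rw [tendsto_pi_nhds] at h1 ⊢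
    have e : ∀ x : ℝ, theta ε q₀ (-x) (-t) z = -theta ε q₀ x t z := fun x => by
      simp only [theta]; push_cast; ring
    intro i
    fin_cases i
    · have h2 := (h1 1).neg
      simp only [Function.comp_def, e] at h2
      refine (h2.congr fun x => ?_).trans_eq ?_
      · simp
      · simp [E, neg_div]
    · have h2 := h1 0
      simp only [Function.comp_def, e] at h2
      refine (h2.congr fun x => ?_).trans_eq ?_
      · simp
      · simp [E]

/-- A continuous potential which tends to `a` at `∞` with two moments. -/
structure DecaysRight (u : ℝ → ℂ) (a : ℂ) : Prop where
  cont : Continuous u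
  int : IntegrableOn (fun x => (1 + x ^ 2) * ‖u x - a‖) (Set.Ici 0)

theorem DecaysRight.reflect (h : DecaysRight (fun x => q x t) a) :
    DecaysLeft (fun x => -conj (q (-x) t)) (-conj a) where
  cont := (Complex.continuous_conj.comp (h.cont.comp continuous_neg)).neg
  int := by
    have h1 : IntegrableOn (fun x => (1 + (-x) ^ 2) * ‖q (-x) t - a‖) (Set.Iic 0) :=
      (by simpa using h.int : IntegrableOn (fun x => (1 + x ^ 2) * ‖q x t - a‖)
        (Set.Ici (-0))).comp_neg_Iic
    refine h1.congr_fun (fun x _ => ?_) measurableSet_Iic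
    have : -conj (q (-x) t) - -conj a = -conj (q (-x) t - a) := by rw [map_sub]; ring
    simp only [this, norm_neg, RCLike.norm_conj, neg_sq]

theorem DecaysRight.exists_isJost (h : DecaysRight (fun x => q x t) a) (ε : ℝ)
    (ha : a * conj a = (q₀ : ℂ) ^ 2) (hz : z ∈ Splus q₀) (hl : lamOf q₀ z ≠ 0) :
    ∃ φ, IsJost ε q₀ q a atTop 1 t z φ := by
  have h' : DecaysLeft (fun x => (fun x t => -conj (q (-x) (-t))) x (-t)) (-conj a) := by
    simpa using h.reflect
  obtain ⟨φ, hφ⟩ := DecaysLeft.exists_isJost (q := fun x t => -conj (q (-x) (-t))) h' ε (by simpa [mul_comm] using ha) hz hl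
  exact ⟨_, hφ.reflect⟩

theorem DecaysRight.exists_differentiableOn (h : DecaysRight (fun x => q x t) a) (ε : ℝ)
    (hq : q₀ ≠ 0) (ha : a * conj a = (q₀ : ℂ) ^ 2) (x : ℝ) :
    ∃ F : ℂ → Fin 2 → ℂ, DifferentiableOn ℂ F (Splus q₀) ∧
      ∀ z ∈ Splus q₀, lamOf q₀ z ≠ 0 → jost ε q₀ q a atTop 1 t z x = F z := by
  have h' : DecaysLeft (fun x => (fun x t => -conj (q (-x) (-t))) x (-t)) (-conj a) := by
    simpa using h.reflect
  have ha' : -conj a * conj (-conj a) = (q₀ : ℂ) ^ 2 := by simpa [mul_comm] using ha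
  obtain ⟨F, hF, hF'⟩ := DecaysLeft.exists_differentiableOn
    (q := fun x t => -conj (q (-x) (-t))) h' ε hq ha' (-x)
  rw [differentiableOn_pi] at hF
  refine ⟨fun z => ![-F z 1, F z 0], differentiableOn_pi.2 fun i => ?_, fun z hz hl => ?_⟩
  · fin_cases i
    · exact (hF 1).neg
    · exact hF 0
  · obtain ⟨φ, hφ⟩ := DecaysLeft.exists_isJost (q := fun x t => -conj (q (-x) (-t))) h' ε ha' hz hl
    rw [hφ.reflect.jost_eq h.cont (jostRange_atTop_one hz.2)]
    simp only
    rw [← hF' z hz hl, hφ.jost_eq h'.cont (jostRange_atBot_zero hz.2)]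

end Right

/-! ### The evolution of the Jost solutions in time -/

section Gronwall

theorem gronwallBound_one_le {d K e : ℝ} (hK : 0 ≤ K) (he : 0 ≤ e) :
    gronwallBound d K e 1 ≤ (d + e) * Real.exp K := by
  rcases hK.eq_or_lt with rfl | hK
  · simp [gronwallBound_K0]
  · rw [gronwallBound_of_K_ne_0 hK.ne']
    simp only [mul_one]
    rw [add_mul]
    refine add_le_add le_rfl ?_
    have h1 : Real.exp K - 1 ≤ K * Real.exp K := by
      have h2 := Real.add_one_le_exp (-K)
      have h3 : Real.exp (-K) * Real.exp K = 1 := by rw [← Real.exp_add]; simp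
      nlinarith [Real.exp_pos K]
    rw [div_mul_eq_mul_div, div_le_iff₀ hK]
    nlinarith

/-- Grönwall's inequality on a segment of either orientation. -/
theorem norm_le_of_norm_deriv_le {V : Type*} [NormedAddCommGroup V] [NormedSpace ℝ V]
    {f f' : ℝ → V} {T K e : ℝ} (hK : 0 ≤ K) (he : 0 ≤ e)
    (hf : ∀ s ∈ Set.uIcc 0 T, HasDerivAt f (f' s) s)
    (hb : ∀ s ∈ Set.uIcc 0 T, ‖f' s‖ ≤ K * ‖f s‖ + e) :
    ‖f T‖ ≤ (‖f 0‖ + |T| * e) * Real.exp (|T| * K) := by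
  have hmem : ∀ r ∈ Set.Icc (0 : ℝ) 1, r * T ∈ Set.uIcc 0 T := fun r hr => by
    rcases le_total 0 T with h | h
    · rw [Set.uIcc_of_le h]
      exact ⟨mul_nonneg hr.1 h, mul_le_of_le_one_left h hr.2⟩
    · rw [Set.uIcc_of_ge h]
      exact ⟨by nlinarith [hr.1, hr.2], mul_nonpos_of_nonneg_of_nonpos hr.1 h⟩
  have hd : ∀ r ∈ Set.Icc (0 : ℝ) 1, HasDerivAt (fun r => f (r * T)) (T • f' (r * T)) r :=
    fun r hr => by
      have h1 : HasDerivAt (fun r : ℝ => r * T) T r := by simpa using (hasDerivAt_id r).mul_const T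
      exact (hf _ (hmem r hr)).scomp r h1
  have h := norm_le_gronwallBound_of_norm_deriv_right_le (f := fun r => f (r * T))
    (f' := fun r => T • f' (r * T)) (δ := ‖f 0‖) (K := |T| * K) (ε := |T| * e) (a := 0) (b := 1)
    (fun r hr => (hd r hr).continuousAt.continuousWithinAt)
    (fun r hr => (hd r (Set.Ico_subset_Icc_self hr)).hasDerivWithinAt) (by simp)
    (fun r hr => by
      rw [norm_smul, Real.norm_eq_abs, mul_assoc, ← mul_add]
      gcongr
      exact hb _ (hmem r (Set.Ico_subset_Icc_self hr))) 1 (by simp)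
  rw [one_mul, sub_zero] at h
  exact h.trans (gronwallBound_one_le (by positivity) (by positivity))

end Gronwall

section Smooth

variable {q : ℝ → ℝ → ℂ}

theorem contDiff_dx {n : ℕ} (j : ℕ) (hq : ContDiff ℝ ((n + j : ℕ) : WithTop ℕ∞) (Function.uncurry q)) :
    ContDiff ℝ n (Function.uncurry (dx j q)) := by
  induction j generalizing n with
  | zero => simpa [dx, Function.uncurry_def] using hq
  | succ j ih =>
    have h1 : ContDiff ℝ ((n + 1 : ℕ) : WithTop ℕ∞) (Function.uncurry (dx j q)) :=
      ih (by rwa [show n + 1 + j = n + (j + 1) by ring])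
    have h2 : Function.uncurry (dx (j + 1) q)
        = fun w => fderiv ℝ (Function.uncurry (dx j q)) w (1, 0) := by
      funext w
      have h3 : HasDerivAt (fun y : ℝ => (y, w.2)) (1, 0) w.1 :=
        (hasDerivAt_id w.1).prodMk (hasDerivAt_const _ _)
      have h4 := (((h1.differentiable (by simp)) (w.1, w.2)).hasFDerivAt).comp_hasDerivAt w.1 h3
      simp only [Function.uncurry_def, dx, iteratedDeriv_succ]
      exact h4.deriv
    rw [h2]
    exact (h1.fderiv_right (by norm_cast)).clm_apply contDiff_const

theorem continuous_dx (hq : ContDiff ℝ 5 (Function.uncurry q)) {j : ℕ} (hj : j ≤ 5) :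
    Continuous (Function.uncurry (dx j q)) :=
  (contDiff_dx (n := 0) j (hq.of_le (by exact_mod_cast by omega))).continuous

theorem hasDerivAt_time (hq : ContDiff ℝ 5 (Function.uncurry q)) (x t : ℝ) :
    HasDerivAt (fun s => q x s) (deriv (fun s => q x s) t) t :=
  (((hq.differentiable (by simp)) (x, t)).comp t
    ((differentiableAt_const x).prodMk differentiableAt_id)).hasDerivAt

theorem continuous_deriv_time (hq : ContDiff ℝ 5 (Function.uncurry q)) :
    Continuous fun w : ℝ × ℝ => deriv (fun s => q w.1 s) w.2 := by
  have h2 : (fun w : ℝ × ℝ => deriv (fun s => q w.1 s) w.2)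
      = fun w => fderiv ℝ (Function.uncurry q) w (0, 1) := by
    funext w
    have h3 : HasDerivAt (fun y : ℝ => (w.1, y)) (0, 1) w.2 :=
      (hasDerivAt_const _ _).prodMk (hasDerivAt_id w.2)
    exact ((((hq.differentiable (by simp)) (w.1, w.2)).hasFDerivAt).comp_hasDerivAt w.2 h3).deriv
  rw [h2]
  exact (hq.continuous_fderiv (by simp)).clm_apply continuous_const

/-- The difference quotients in time converge uniformly on compact sets in space. -/
theorem eventually_norm_sub_le (hq : ContDiff ℝ 5 (Function.uncurry q)) (R t : ℝ) {η : ℝ}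
    (hη : 0 < η) : ∀ᶠ h in 𝓝 (0 : ℝ), ∀ y ∈ Set.Icc (-R) R,
      ‖q y (t + h) - q y t - h * deriv (fun s => q y s) t‖ ≤ η * |h| := by
  have hc := continuous_deriv_time hq
  have h1 : ∀ᶠ s in 𝓝 t, ∀ y ∈ Set.Icc (-R) R,
      ‖deriv (fun s => q y s) s - deriv (fun s => q y s) t‖ < η := by
    have hU : IsOpen {w : ℝ × ℝ | ‖deriv (fun s => q w.2 s) w.1 - deriv (fun s => q w.2 s) t‖ < η} :=
      isOpen_lt ((hc.comp continuous_swap).sub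
        (hc.comp (continuous_snd.prodMk continuous_const))).norm continuous_const
    have h2 := isCompact_Icc.eventually_forall_of_forall_eventually (x₀ := t) (K := Set.Icc (-R) R)
      (P := fun s y => ‖deriv (fun s => q y s) s - deriv (fun s => q y s) t‖ < η)
      (fun y _ => hU.mem_nhds (by simpa using hη))
    exact h2
  obtain ⟨r, hr, hr'⟩ := Metric.eventually_nhds_iff.1 h1
  refine Metric.eventually_nhds_iff.2 ⟨r, hr, fun h hh y hy => ?_⟩
  have hh' : |h| < r := by simpa using hh
  have hd : ∀ s, HasDerivAt (fun s => q y s - s * deriv (fun s => q y s) t)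
      (deriv (fun s => q y s) s - deriv (fun s => q y s) t) s := fun s => by
    have h3 : HasDerivAt (fun s : ℝ => (s : ℂ)) 1 s := Complex.ofRealCLM.hasDerivAt
    simpa using (hasDerivAt_time hq y s).fun_sub (h3.mul_const (deriv (fun s => q y s) t))
  have h4 := (convex_ball t r).norm_image_sub_le_of_norm_hasDerivWithin_le
    (fun s _ => (hd s).hasDerivWithinAt) (C := η) (fun s hs => (hr' hs y hy).le)
    (Metric.mem_ball_self hr) (y := t + h) (Metric.mem_ball.2 (by simpa using hh'))
  simp only [add_sub_cancel_left, Real.norm_eq_abs] at h4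
  refine le_of_eq_of_le (congrArg _ ?_) h4
  push_cast
  ring

end Smooth

section TimeMatrix

/-- The matrix `V` of the time evolution `φ_t = V φ`, `J j` being the `j`-th derivative of the
potential. -/
def timeV (ε c : ℝ) (k : ℂ) (J : ℕ → ℂ) : Matrix (Fin 2) (Fin 2) ℂ :=
  let P : ℂ := 16 * k ^ 4 * ε - 8 * k ^ 2 * c * ε + 2 * k + 6 * c ^ 2 * ε + 1
  let α : ℂ := -(Complex.I * k) * P - Complex.I / 2 * (16 * ε * (polA0 c J * k ^ 3 + polA1 J * k ^ 2
    + polA2 c J * k + polA3 c J) - 8 * c * ε * (polA0 c J * k + polA1 J) + 2 * polA0 c J)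
  !![α, J 0 * P + Complex.I / 2 * (16 * ε * (J 1 * k ^ 3 + polB1 c J * k ^ 2 + polB2 c J * k
      + polB3 c J) - 8 * c * ε * (J 1 * k + polB1 c J) + 2 * J 1);
    -conj (J 0) * P + Complex.I / 2 * (16 * ε * (conj (J 1) * k ^ 3 + conj (polB1 c J) * k ^ 2
      + conj (polB2 c J) * k + conj (polB3 c J)) - 8 * c * ε * (conj (J 1) * k + conj (polB1 c J))
      + 2 * conj (J 1)), -α]

variable {ε c : ℝ} {k : ℂ} {J : ℝ → ℕ → ℂ} {x : ℝ}

theorem conj_polA (K : ℕ → ℂ) : conj (polA0 c K) = polA0 c K ∧ conj (polA1 K) = polA1 K ∧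
    conj (polA2 c K) = polA2 c K ∧ conj (polA3 c K) = polA3 c K := by
  refine ⟨?_, ?_, ?_, ?_⟩ <;>
  · simp only [polA0, polA1, polA2, polA3, map_mul, map_div₀, map_sub, map_add, map_pow, map_one,
      map_ofNat, Complex.conj_I, Complex.conj_conj, Complex.conj_ofReal]
    ring

/-- The zero-curvature relation `U_t + U V = V_x + V U`. -/
theorem hasDerivAt_timeV (hJ : ∀ j ≤ 4, HasDerivAt (fun y => J y j) (J x (j + 1)) x) (i j : Fin 2) :
    HasDerivAt (fun y => timeV ε c k (J y) i j)
      ((!![0, flow ε c (J x); -conj (flow ε c (J x)), 0] + laxU k (J x 0) * timeV ε c k (J x)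
        - timeV ε c k (J x) * laxU k (J x 0)) i j) x := by
  have h0 := hJ 0 (by norm_num)
  have a0 := hasDerivAt_polA0 (c := c) hJ
  have a1 := hasDerivAt_polA1 (c := c) hJ
  have a2 := hasDerivAt_polA2 (c := c) hJ
  have a3 := hasDerivAt_polA3 (c := c) hJ
  have b0 := hasDerivAt_polB0 (c := c) hJ
  have b1 := hasDerivAt_polB1 (c := c) hJ
  have b2 := hasDerivAt_polB2 (c := c) hJ
  have b3 := hasDerivAt_polB3 (c := c) hJ
  have A := ((((((a0.mul_const (k ^ 3)).add (a1.mul_const (k ^ 2))).add (a2.mul_const k)).add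
    a3).const_mul (16 * (ε : ℂ))).sub (((a0.mul_const k).add a1).const_mul (8 * (c : ℂ) * ε))).add
    (a0.const_mul 2)
  have B := ((((((b0.mul_const (k ^ 3)).add (b1.mul_const (k ^ 2))).add (b2.mul_const k)).add
    b3).const_mul (16 * (ε : ℂ))).sub (((b0.mul_const k).add b1).const_mul (8 * (c : ℂ) * ε))).add
    (b0.const_mul 2)
  have c0 := hasDerivAt_conj b0
  have c1 := hasDerivAt_conj b1
  have c2 := hasDerivAt_conj b2
  have c3 := hasDerivAt_conj b3
  have B' := ((((((c0.mul_const (k ^ 3)).add (c1.mul_const (k ^ 2))).add (c2.mul_const k)).add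
    c3).const_mul (16 * (ε : ℂ))).sub (((c0.mul_const k).add c1).const_mul (8 * (c : ℂ) * ε))).add
    (c0.const_mul 2)
  have hI := Complex.I_sq
  obtain ⟨r0, r1, r2, r3⟩ := conj_polA (c := c) (J x)
  obtain ⟨P, hP⟩ : ∃ P : ℂ, P = 16 * k ^ 4 * ε - 8 * k ^ 2 * c * ε + 2 * k + 6 * c ^ 2 * ε + 1 :=
    ⟨_, rfl⟩
  have D := (B.const_mul (Complex.I / 2))
  have D' := (B'.const_mul (Complex.I / 2))
  have E0 := h0.mul_const P
  have E0' := (hasDerivAt_conj h0).neg.mul_const P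
  have A' := (A.const_mul (Complex.I / 2)).const_sub (-(Complex.I * k) * P)
  rw [hP] at E0 E0' A'
  fin_cases i <;> fin_cases j
  · refine A'.congr_deriv ?_
    simp [timeV, laxU]
    ring
  · refine (E0.add D).congr_deriv ?_
    simp [timeV, laxU, flow]
    ring_nf
    simp only [hI]
    ring
  · refine (E0'.add D').congr_deriv ?_
    have e2 : conj (2 : ℂ) = 2 := map_ofNat _ 2
    have e6 : conj (6 : ℂ) = 6 := map_ofNat _ 6
    have e8 : conj (8 : ℂ) = 8 := map_ofNat _ 8
    have e16 : conj (16 : ℂ) = 16 := map_ofNat _ 16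
    simp [timeV, laxU, flow, r0, r1, r2, r3, e2, e6, e8, e16]
    ring_nf
    simp only [hI]
    ring
  · refine A'.neg.congr_deriv ?_
    simp [timeV, laxU]
    ring

end TimeMatrix

section TimeMatrix

variable {ε c : ℝ} {k : ℂ}

theorem continuous_timeV (i j : Fin 2) : Continuous fun J : ℕ → ℂ => timeV ε c k J i j := by
  have h : ∀ j, Continuous fun J : ℕ → ℂ => J j := fun j => continuous_apply j
  have h' : ∀ j, Continuous fun J : ℕ → ℂ => conj (J j) := fun j => Complex.continuous_conj.comp (h j)
  have a0 : Continuous fun J : ℕ → ℂ => polA0 c J := by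
    have := h 0; have := h' 0; unfold polA0; fun_prop
  have a1 : Continuous fun J : ℕ → ℂ => polA1 J := by
    have := h 0; have := h' 0; have := h 1; have := h' 1; unfold polA1; fun_prop
  have a2 : Continuous fun J : ℕ → ℂ => polA2 c J := by
    have := h 0; have := h' 0; have := h 1; have := h' 1; have := h 2; have := h' 2
    unfold polA2; fun_prop
  have a3 : Continuous fun J : ℕ → ℂ => polA3 c J := by
    have := h 0; have := h' 0; have := h 1; have := h' 1; have := h 2; have := h' 2
    have := h 3; have := h' 3
    unfold polA3; fun_prop
  have b1 : Continuous fun J : ℕ → ℂ => polB1 c J := by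
    have := h 0; have := h' 0; have := h 2; unfold polB1; fun_prop
  have b2 : Continuous fun J : ℕ → ℂ => polB2 c J := by
    have := h 0; have := h' 0; have := h 1; have := h 3; unfold polB2; fun_prop
  have b3 : Continuous fun J : ℕ → ℂ => polB3 c J := by
    have := h 0; have := h' 0; have := h 1; have := h' 1; have := h 2; have := h' 2; have := h 4
    unfold polB3; fun_prop
  have b1' := Complex.continuous_conj.comp b1
  have b2' := Complex.continuous_conj.comp b2
  have b3' := Complex.continuous_conj.comp b3
  simp only [Function.comp_def] at b1' b2' b3'
  have h0 := h 0; have h0' := h' 0; have h1 := h 1; have h1' := h' 1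
  fin_cases i <;> fin_cases j <;> (simp [timeV]; fun_prop)

theorem timeV_congr {J K : ℕ → ℂ} (h : ∀ j ≤ 4, J j = K j) : timeV ε c k J = timeV ε c k K := by
  simp only [timeV, polA0, polA1, polA2, polA3, polB1, polB2, polB3, h 0 (by norm_num),
    h 1 (by norm_num), h 2 (by norm_num), h 3 (by norm_num), h 4 (by norm_num)]

theorem tendsto_timeV {α : Type*} {l : Filter α} {J : α → ℕ → ℂ} {K : ℕ → ℂ}
    (h : ∀ j ≤ 4, Tendsto (fun y => J y j) l (𝓝 (K j))) (i j : Fin 2) :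
    Tendsto (fun y => timeV ε c k (J y) i j) l (𝓝 (timeV ε c k K i j)) := by
  have h1 : Tendsto (fun y j => if j ≤ 4 then J y j else 0) l (𝓝 fun j => if j ≤ 4 then K j else 0) := by
    rw [tendsto_pi_nhds]
    intro j
    by_cases hj : j ≤ 4
    · simpa [hj] using h j hj
    · simpa [hj] using tendsto_const_nhds
  have h2 := ((continuous_timeV (ε := ε) (c := c) (k := k) i j).tendsto _).comp h1
  rw [timeV_congr (J := fun j => if j ≤ 4 then K j else 0) (K := K) fun j hj => if_pos hj] at h2
  refine h2.congr fun y => ?_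
  simp only [Function.comp_def]
  rw [timeV_congr fun j hj => if_pos hj]

/-- On the background, `V` is a multiple of `U`. -/
theorem timeV_const {a : ℂ} (ha : a * conj a = c) :
    timeV ε c k (fun j => if j = 0 then a else 0)
      = (16 * k ^ 4 * ε - 8 * k ^ 2 * c * ε + 2 * k + 6 * c ^ 2 * ε + 1) • laxU k a := by
  have h1 : polB1 c (fun j => if j = 0 then a else 0) = 0 := by
    simp [polB1]; linear_combination 2 * a * ha
  have h2 : polB2 c (fun j => if j = 0 then a else 0) = 0 := by simp [polB2]
  have h3 : polB3 c (fun j => if j = 0 then a else 0) = 0 := by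
    simp [polB3]
    linear_combination (-3 / 4 * a ^ 2 * conj a - 1 / 4 * a * c) * ha
  have h4 : polA0 c (fun j => if j = 0 then a else 0) = 0 := by
    simp [polA0]; linear_combination -ha
  have h5 : polA1 (fun j => if j = 0 then a else 0) = 0 := by simp [polA1]
  have h6 : polA2 c (fun j => if j = 0 then a else 0) = 0 := by
    simp [polA2]; linear_combination (3 / 4 * (a * conj a) + c / 4) * ha
  have h7 : polA3 c (fun j => if j = 0 then a else 0) = 0 := by simp [polA3]
  rw [timeV, h1, h2, h3, h4, h5, h6, h7]
  ext i j
  fin_cases i <;> fin_cases j <;> simp [laxU] <;> ring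

end TimeMatrix

section Transport

theorem norm_mulVec_le (M : Matrix (Fin 2) (Fin 2) ℂ) {B : ℝ} (hB : ∀ i, ‖M i 0‖ + ‖M i 1‖ ≤ B)
    (v : Fin 2 → ℂ) : ‖M.mulVec v‖ ≤ B * ‖v‖ := by
  have hB0 : 0 ≤ B := (by positivity : 0 ≤ ‖M 0 0‖ + ‖M 0 1‖).trans (hB 0)
  refine (pi_norm_le_iff_of_nonneg (by positivity)).2 fun i => ?_
  simp only [Matrix.mulVec, dotProduct, Fin.sum_univ_two]
  refine (norm_add_le _ _).trans ?_
  rw [norm_mul, norm_mul]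
  have h0 := norm_le_pi_norm v 0
  have h1 := norm_le_pi_norm v 1
  calc ‖M i 0‖ * ‖v 0‖ + ‖M i 1‖ * ‖v 1‖ ≤ ‖M i 0‖ * ‖v‖ + ‖M i 1‖ * ‖v‖ := by gcongr
    _ = (‖M i 0‖ + ‖M i 1‖) * ‖v‖ := by ring
    _ ≤ B * ‖v‖ := by gcongr; exact hB i

theorem hasDerivAt_mulVec {A : ℝ → Matrix (Fin 2) (Fin 2) ℂ} {A' : Matrix (Fin 2) (Fin 2) ℂ}
    {v : ℝ → Fin 2 → ℂ} {v' : Fin 2 → ℂ} {x : ℝ}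
    (hA : ∀ i j, HasDerivAt (fun y => A y i j) (A' i j) x) (hv : HasDerivAt v v' x) :
    HasDerivAt (fun y => (A y).mulVec (v y)) (A'.mulVec (v x) + (A x).mulVec v') x := by
  rw [hasDerivAt_pi] at hv ⊢
  intro i
  simp only [Matrix.mulVec, dotProduct, Fin.sum_univ_two]
  refine (((hA i 0).mul (hv 0)).add ((hA i 1).mul (hv 1))).congr_deriv ?_
  simp only [Matrix.mulVec, dotProduct, Fin.sum_univ_two, Pi.add_apply]
  ring

/-- The off-diagonal matrix `U₀(b)`. -/
def offDiag (b : ℂ) : Matrix (Fin 2) (Fin 2) ℂ := !![0, b; -conj b, 0]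

theorem norm_offDiag_mulVec_le (b : ℂ) (v : Fin 2 → ℂ) : ‖(offDiag b).mulVec v‖ ≤ ‖b‖ * ‖v‖ :=
  norm_mulVec_le _ (fun i => by fin_cases i <;> simp [offDiag]) v

theorem norm_laxU_mulVec_le (k a : ℂ) (v : Fin 2 → ℂ) :
    ‖(laxU k a).mulVec v‖ ≤ (‖k‖ + ‖a‖) * ‖v‖ :=
  norm_mulVec_le _ (fun i => by fin_cases i <;> simp [laxU, add_comm]) v

variable {ε c : ℝ} {q : ℝ → ℝ → ℂ} {k : ℂ} {χ : ℝ → ℝ → Fin 2 → ℂ}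

/-- A family of solutions of the scattering problem which evolves by `φ_t = V φ` at `x = 0` does so
at every `x`. -/
theorem hasDerivAt_transport (hq : ContDiff ℝ 5 (Function.uncurry q))
    (hflow : ∀ x t, deriv (fun s => q x s) t = flow ε c fun j => dx j q x t)
    (hχ : ∀ x t, HasDerivAt (fun y => χ y t) ((laxU k (q x t)).mulVec (χ x t)) x)
    (h0 : ∀ t, HasDerivAt (fun s => χ 0 s) ((timeV ε c k fun j => dx j q 0 t).mulVec (χ 0 t)) t)
    (x t : ℝ) :
    HasDerivAt (fun s => χ x s) ((timeV ε c k fun j => dx j q x t).mulVec (χ x t)) t := by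
  set v := fun y => (timeV ε c k fun j => dx j q y t).mulVec (χ y t) with hv
  have hqx : ContDiff ℝ 5 (fun y => q y t) := hq.comp (contDiff_id.prodMk contDiff_const)
  have dv : ∀ y, HasDerivAt v ((offDiag (deriv (fun s => q y s) t)).mulVec (χ y t)
      + (laxU k (q y t)).mulVec (v y)) y := fun y => by
    have h1 := hasDerivAt_mulVec (fun i j => hasDerivAt_timeV (ε := ε) (c := c) (k := k)
      (J := fun y j => dx j q y t) (hasDerivAt_dx hqx y) i j) (hχ y t)
    refine h1.congr_deriv ?_
    simp only [hv]
    have e0 : dx 0 q y t = q y t := by simp [dx]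
    rw [Matrix.sub_mulVec, Matrix.add_mulVec, Matrix.mulVec_mulVec, Matrix.mulVec_mulVec, e0, hflow,
      offDiag]
    abel
  have cv : Continuous v := continuous_iff_continuousAt.2 fun y => (dv y).continuousAt
  have cχ : Continuous fun y => χ y t := continuous_iff_continuousAt.2 fun y => (hχ y t).continuousAt
  set R := |x| with hR
  have hR0 : 0 ≤ R := abs_nonneg x
  have hseg : ∀ y ∈ Set.uIcc 0 x, y ∈ Set.Icc (-R) R := fun y hy => by
    have := Set.abs_sub_left_of_mem_uIcc hy
    simp only [sub_zero] at this
    exact abs_le.1 this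
  obtain ⟨C₁, hC₁⟩ := isCompact_Icc.exists_bound_of_continuousOn (s := Set.Icc (-R) R) cχ.continuousOn
  obtain ⟨C₂, hC₂⟩ := isCompact_Icc.exists_bound_of_continuousOn (s := Set.Icc (-R) R) cv.continuousOn
  have cd : Continuous fun y => deriv (fun s => q y s) t :=
    (continuous_deriv_time hq).comp (continuous_id.prodMk continuous_const)
  obtain ⟨D, hD⟩ := isCompact_Icc.exists_bound_of_continuousOn (s := Set.Icc (-R) R) cd.continuousOn
  obtain ⟨B, hB⟩ := (isCompact_Icc.prod isCompact_Icc).exists_bound_of_continuousOn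
    (s := Set.Icc (-R) R ×ˢ Set.Icc (t - 1) (t + 1)) hq.continuous.continuousOn
  have hmem0 : (0 : ℝ) ∈ Set.Icc (-R) R := ⟨by linarith, hR0⟩
  have hC₁0 : 0 ≤ C₁ := (norm_nonneg _).trans (hC₁ 0 hmem0)
  have hC₂0 : 0 ≤ C₂ := (norm_nonneg _).trans (hC₂ 0 hmem0)
  have hD0 : 0 ≤ D := (norm_nonneg _).trans (hD 0 hmem0)
  have hB0 : 0 ≤ B := (norm_nonneg _).trans (hB (0, t) ⟨hmem0, by simp, by simp⟩)
  set K := ‖k‖ + B with hK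
  have hK0 : 0 ≤ K := by positivity
  set L := (1 + R * (C₁ + C₂)) * Real.exp (R * K) with hL
  have hL0 : 0 < L := by positivity
  rw [hasDerivAt_iff_isLittleO_nhds_zero, Asymptotics.isLittleO_iff]
  intro r hr
  set η := min 1 (r / L) with hη
  have hη0 : 0 < η := by positivity
  have hηr : η * L ≤ r := by
    rw [← le_div_iff₀ hL0]
    exact min_le_right _ _
  have ev0 : ∀ᶠ h in 𝓝 (0 : ℝ), ‖χ 0 (t + h) - χ 0 t - h • v 0‖ ≤ η * ‖h‖ :=
    Asymptotics.isLittleO_iff.1 (hasDerivAt_iff_isLittleO_nhds_zero.1 (h0 t)) hη0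
  have ev1 : ∀ᶠ h in 𝓝 (0 : ℝ), |h| < min 1 (η / (D + 1)) := by
    have : Tendsto (fun h : ℝ => |h|) (𝓝 0) (𝓝 0) := by simpa using (continuous_abs.tendsto (0 : ℝ))
    exact this.eventually (gt_mem_nhds (by positivity))
  filter_upwards [ev0, ev1, eventually_norm_sub_le hq R t hη0] with h hh0 hh1 hh2
  have hle1 : |h| ≤ 1 := hh1.le.trans (min_le_left _ _)
  have hle2 : |h| * (D + 1) ≤ η := by
    rw [← le_div_iff₀ (by positivity)]
    exact hh1.le.trans (min_le_right _ _)
  have hts : t + h ∈ Set.Icc (t - 1) (t + 1) := by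
    have := abs_le.1 hle1
    exact ⟨by linarith, by linarith⟩
  have hΔ : ∀ y ∈ Set.Icc (-R) R, ‖q y (t + h) - q y t‖ ≤ η := fun y hy => by
    have h1 := hh2 y hy
    have h2 := norm_add_le (q y (t + h) - q y t - h * deriv (fun s => q y s) t)
      (h * deriv (fun s => q y s) t)
    rw [sub_add_cancel, norm_mul, Complex.norm_real, Real.norm_eq_abs] at h2
    have h3 := mul_le_mul_of_nonneg_left (hD y hy) (abs_nonneg h)
    have h4 : η * |h| ≤ 1 * |h| := by gcongr; exact min_le_left _ _
    linarith
  have hd : ∀ y ∈ Set.uIcc 0 x, HasDerivAt (fun y => χ y (t + h) - χ y t - h • v y)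
      ((laxU k (q y (t + h))).mulVec (χ y (t + h)) - (laxU k (q y t)).mulVec (χ y t)
        - h • ((offDiag (deriv (fun s => q y s) t)).mulVec (χ y t)
          + (laxU k (q y t)).mulVec (v y))) y := fun y _ =>
    ((hχ y (t + h)).sub (hχ y t)).sub ((dv y).const_smul h)
  have hmain := norm_le_of_norm_deriv_le (K := K) (e := |h| * (η * (C₁ + C₂))) hK0 (by positivity) hd
    fun y hy => by
      have hy' := hseg y hy
      have e : (laxU k (q y (t + h))).mulVec (χ y (t + h)) - (laxU k (q y t)).mulVec (χ y t)
          - h • ((offDiag (deriv (fun s => q y s) t)).mulVec (χ y t) + (laxU k (q y t)).mulVec (v y))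
          = (laxU k (q y (t + h))).mulVec (χ y (t + h) - χ y t - h • v y)
            + ((offDiag (q y (t + h) - q y t - h * deriv (fun s => q y s) t)).mulVec (χ y t)
              + h • (offDiag (q y (t + h) - q y t)).mulVec (v y)) := by
        ext i
        fin_cases i
        · simp [laxU, offDiag, dotProduct, Fin.sum_univ_two]
          ring
        · simp [laxU, offDiag, dotProduct, Fin.sum_univ_two]
          ring
      rw [e]
      have n1 : ‖(laxU k (q y (t + h))).mulVec (χ y (t + h) - χ y t - h • v y)‖
          ≤ K * ‖χ y (t + h) - χ y t - h • v y‖ := by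
        refine (norm_laxU_mulVec_le _ _ _).trans ?_
        gcongr
        rw [hK]
        gcongr
        exact hB (y, t + h) ⟨hy', hts⟩
      have n2 : ‖(offDiag (q y (t + h) - q y t - h * deriv (fun s => q y s) t)).mulVec (χ y t)‖
          ≤ (η * |h|) * C₁ := (norm_offDiag_mulVec_le _ _).trans
        (mul_le_mul (hh2 y hy') (hC₁ y hy') (norm_nonneg _) (by positivity))
      have n3 : ‖h • (offDiag (q y (t + h) - q y t)).mulVec (v y)‖ ≤ |h| * (η * C₂) := by
        rw [norm_smul, Real.norm_eq_abs]
        gcongr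
        exact (norm_offDiag_mulVec_le _ _).trans
          (mul_le_mul (hΔ y hy') (hC₂ y hy') (norm_nonneg _) hη0.le)
      refine (norm_add_le _ _).trans (add_le_add n1 ((norm_add_le _ _).trans ?_))
      linarith
  refine hmain.trans ?_
  rw [← hR]
  calc _ ≤ (η * |h| + R * (|h| * (η * (C₁ + C₂)))) * Real.exp (R * K) := by gcongr; exact hh0
    _ = (η * L) * |h| := by rw [hL]; ring
    _ ≤ r * ‖h‖ := by rw [Real.norm_eq_abs]; gcongr

end Transport

section TransportLimit

variable {ε q₀ : ℝ} {q : ℝ → ℝ → ℂ} {a qm qp z : ℂ} {l : Filter ℝ}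

theorem eventually_forall_uIcc {f : ℝ × ℝ → ℂ} {b : ℂ}
    (h : ∀ t₀, Tendsto f (l ×ˢ 𝓝 t₀) (𝓝 b)) (t : ℝ) {e : ℝ} (he : 0 < e) :
    ∀ᶠ x in l, ∀ s ∈ Set.uIcc 0 t, ‖f (x, s) - b‖ ≤ e := by
  have h1 : ∀ s ∈ Set.uIcc 0 t, {w | ‖f w - b‖ ≤ e} ∈ l ×ˢ 𝓝 s := fun s _ => by
    filter_upwards [Metric.tendsto_nhds.1 (h s) e he] with w hw
    rw [← dist_eq_norm]
    exact hw.le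
  have h2 : ∀ᶠ w in l ×ˢ 𝓝ˢ (Set.uIcc 0 t), ‖f w - b‖ ≤ e :=
    isCompact_uIcc.mem_prod_nhdsSet_of_forall h1
  filter_upwards [h2.curry] with x hx s hs
  exact hx.self_of_nhdsSet s hs

theorem laxU_mulVec_E (ha : a * conj a = (q₀ : ℂ) ^ 2) (hz : z ≠ 0) (j : Fin 2) :
    (laxU (kOf q₀ z) a).mulVec (fun i => E a z i j)
      = (-((![1, -1] : Fin 2 → ℂ) j * (Complex.I * lamOf q₀ z))) • fun i => E a z i j := by
  have hI := Complex.I_sq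
  rw [laxU_mulVec]
  ext i
  fin_cases i <;> fin_cases j
  · simp [E, kOf, lamOf]
    field_simp
    linear_combination (-2) * ha
  · simp [E, kOf, lamOf]
    field_simp
    linear_combination (2 * z ^ 2) * a * hI
  · simp [E, kOf, lamOf]
    field_simp
    linear_combination (-2 * z ^ 2) * conj a * hI
  · simp [E, kOf, lamOf]
    field_simp
    linear_combination (2 : ℂ) * ha

/-- The normalization of a Jost solution is preserved by the evolution `φ_t = V φ`. -/
theorem tendsto_transport (ha : a * conj a = (q₀ : ℂ) ^ 2) (hz : z ≠ 0)
    (hl : ∀ j ≤ 4, ∀ t₀, Tendsto (fun w : ℝ × ℝ => dx j q w.1 w.2) (l ×ˢ 𝓝 t₀)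
      (𝓝 (if j = 0 then a else 0)))
    {χ : ℝ → ℝ → Fin 2 → ℂ} (hχ : ∀ x t, HasDerivAt (fun s => χ x s)
      ((timeV ε (q₀ ^ 2) (kOf q₀ z) fun j => dx j q x t).mulVec (χ x t)) t) {j : Fin 2}
    (h0 : Tendsto (fun x => Complex.exp ((![1, -1] : Fin 2 → ℂ) j
      * (Complex.I * theta ε q₀ x 0 z)) • χ x 0) l (𝓝 fun i => E a z i j)) (t : ℝ) :
    Tendsto (fun x => Complex.exp ((![1, -1] : Fin 2 → ℂ) j
      * (Complex.I * theta ε q₀ x t z)) • χ x t) l (𝓝 fun i => E a z i j) := by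
  set s₀ : ℂ := (![1, -1] : Fin 2 → ℂ) j with hs₀
  set k := kOf q₀ z with hk
  set P : ℂ := 16 * k ^ 4 * ε - 8 * k ^ 2 * ((q₀ ^ 2 : ℝ) : ℂ) * ε + 2 * k
    + 6 * ((q₀ ^ 2 : ℝ) : ℂ) ^ 2 * ε + 1 with hP
  set κ : ℂ := s₀ * (Complex.I * (lamOf q₀ z * P)) with hκ
  set Ej : Fin 2 → ℂ := fun i => E a z i j with hEj
  set V := fun x t => timeV ε (q₀ ^ 2) k fun j => dx j q x t with hV
  have hV0 : ∀ i i', ∀ t₀, Tendsto (fun w : ℝ × ℝ => V w.1 w.2 i i') (l ×ˢ 𝓝 t₀)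
      (𝓝 ((P • laxU k a) i i')) := fun i i' t₀ => by
    have h1 := tendsto_timeV (ε := ε) (c := q₀ ^ 2) (k := k) (l := l ×ˢ 𝓝 t₀)
      (J := fun w j => dx j q w.1 w.2) (K := fun j => if j = 0 then a else 0)
      (fun j hj => hl j hj t₀) i i'
    rwa [timeV_const (by rw [ha]; push_cast; rfl)] at h1
  have hker : (P • laxU k a).mulVec Ej + κ • Ej = 0 := by
    rw [Matrix.smul_mulVec, hEj, hk, laxU_mulVec_E ha hz, smul_smul, ← add_smul, hκ, hs₀]
    rw [show ∀ u v w : ℂ, u * -(v * (Complex.I * w)) + v * (Complex.I * (w * u)) = 0 by intros; ring,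
      zero_smul]
  have dg : ∀ x s, HasDerivAt (fun s => Complex.exp (s₀ * (Complex.I * theta ε q₀ x s z)) • χ x s - Ej)
      ((V x s).mulVec (Complex.exp (s₀ * (Complex.I * theta ε q₀ x s z)) • χ x s)
        + κ • (Complex.exp (s₀ * (Complex.I * theta ε q₀ x s z)) • χ x s)) s := fun x s => by
    have h1 : HasDerivAt (fun s : ℝ => s₀ * (Complex.I * theta ε q₀ x s z)) κ s := by
      have h2 : HasDerivAt (fun s : ℝ => (s : ℂ)) 1 s := Complex.ofRealCLM.hasDerivAt
      have h3 := ((((h2.const_mul P).const_add (x : ℂ)).const_mul (lamOf q₀ z)).const_mul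
        Complex.I).const_mul s₀
      refine (h3.congr_of_eventuallyEq (Eventually.of_forall fun s => ?_)).congr_deriv ?_
      · simp only [theta, hP]
        push_cast
        ring
      · rw [hκ]; ring
    refine ((h1.cexp.smul (hχ x s)).sub_const Ej).congr_deriv ?_
    rw [Matrix.mulVec_smul, smul_smul, mul_comm κ]
  set B := ∑ i, ∑ i', ‖(P • laxU k a) i i'‖ with hB
  have hB0 : 0 ≤ B := by positivity
  have hBi : ∀ i, ‖(P • laxU k a) i 0‖ + ‖(P • laxU k a) i 1‖ ≤ B := fun i => by
    rw [hB, ← Fin.sum_univ_two (fun i' => ‖(P • laxU k a) i i'‖)]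
    exact Finset.single_le_sum (f := fun i => ∑ i', ‖(P • laxU k a) i i'‖)
      (fun i _ => by positivity) (Finset.mem_univ i)
  set K := B + 2 + ‖κ‖ with hK
  set L := (1 + |t| * (2 * ‖Ej‖)) * Real.exp (|t| * K) with hL
  have hL0 : 0 < L := by positivity
  rw [tendsto_iff_norm_sub_tendsto_zero, Metric.tendsto_nhds]
  rw [tendsto_iff_norm_sub_tendsto_zero] at h0
  intro r hr
  set e := min 1 (r / (2 * L)) with he
  have he0 : 0 < e := by positivity
  have heL : e * L < r := by
    have h1 : e * (2 * L) ≤ r := by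
      rw [← le_div_iff₀ (by positivity)]
      exact min_le_right _ _
    nlinarith [mul_pos he0 hL0]
  have ev : ∀ᶠ x in l, ∀ i i', ∀ s ∈ Set.uIcc 0 t, ‖V x s i i' - (P • laxU k a) i i'‖ ≤ e := by
    rw [eventually_all]
    intro i
    rw [eventually_all]
    exact fun i' => eventually_forall_uIcc (hV0 i i') t he0
  filter_upwards [ev, Metric.tendsto_nhds.1 h0 e he0] with x hx hx0
  rw [Real.dist_eq, sub_zero, abs_norm] at hx0 ⊢
  have hdiff : ∀ s ∈ Set.uIcc 0 t, ∀ v : Fin 2 → ℂ,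
      ‖(V x s - P • laxU k a).mulVec v‖ ≤ (2 * e) * ‖v‖ := fun s hs v =>
    norm_mulVec_le _ (fun i => by
      have h1 := hx i 0 s hs
      have h2 := hx i 1 s hs
      simp only [Matrix.sub_apply]
      linarith) v
  have h1 := norm_le_of_norm_deriv_le (f := fun s =>
      Complex.exp (s₀ * (Complex.I * theta ε q₀ x s z)) • χ x s - Ej) (T := t) (K := K)
    (e := 2 * e * ‖Ej‖) (by positivity) (by positivity) (fun s _ => dg x s) fun s hs => by
      set g := Complex.exp (s₀ * (Complex.I * theta ε q₀ x s z)) • χ x s with hg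
      have e1 : (V x s).mulVec g + κ • g = (V x s - P • laxU k a).mulVec (g - Ej)
          + (P • laxU k a).mulVec (g - Ej) + κ • (g - Ej) + (V x s - P • laxU k a).mulVec Ej := by
        have e2 : κ • Ej = -((P • laxU k a).mulVec Ej) := eq_neg_of_add_eq_zero_right hker
        rw [Matrix.sub_mulVec, Matrix.sub_mulVec, Matrix.mulVec_sub, Matrix.mulVec_sub, smul_sub, e2]
        abel
      have n1 := hdiff s hs (g - Ej)
      have n2 := norm_mulVec_le (P • laxU k a) hBi (g - Ej)
      have n3 : ‖κ • (g - Ej)‖ = ‖κ‖ * ‖g - Ej‖ := norm_smul _ _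
      have n4 := hdiff s hs Ej
      have n5 : 2 * e * ‖g - Ej‖ ≤ 2 * ‖g - Ej‖ := by
        have : e ≤ 1 := min_le_left _ _
        nlinarith [norm_nonneg (g - Ej)]
      rw [e1]
      refine (norm_add_le _ _).trans ?_
      refine (add_le_add ((norm_add_le _ _).trans (add_le_add (norm_add_le _ _) le_rfl)) le_rfl).trans ?_
      rw [n3, hK]
      linarith
  refine lt_of_le_of_lt h1 (lt_of_le_of_lt ?_ heL)
  calc _ ≤ (e + |t| * (2 * e * ‖Ej‖)) * Real.exp (|t| * K) := by gcongr
    _ = e * L := by rw [hL]; ring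

end TransportLimit

section Transport

variable {ε q₀ : ℝ} {q : ℝ → ℝ → ℂ} {a qm qp z : ℂ}

theorem IsSolution.flow_eq {c : ℝ} (h : IsSolution ε c q) (x t : ℝ) :
    deriv (fun s => q x s) t = flow ε c fun j => dx j q x t := by
  have h1 := equation_eq_flow (ε := ε) (c := c) (q := q) (t := t)
    (h.1.comp (contDiff_id.prodMk contDiff_const)) x (deriv (fun s => q x s) t)
  have h2 := h1.symm.trans (h.2 x t)
  exact sub_eq_zero.1 ((mul_eq_zero.1 h2).resolve_left Complex.I_ne_zero)

theorem wr_mulVec (M : Matrix (Fin 2) (Fin 2) ℂ) (u v : Fin 2 → ℂ) :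
    wr (M.mulVec u) (M.mulVec v) = M.det * wr u v := by
  simp only [wr, Matrix.mulVec, dotProduct, Fin.sum_univ_two, Matrix.det_fin_two]
  ring

/-- The end at which a Jost solution is normalized, with its boundary value. -/
def IsEnd (qm qp a : ℂ) (l : Filter ℝ) : Prop := (a = qm ∧ l = atBot) ∨ (a = qp ∧ l = atTop)

theorem BoundaryConditions.tendsto_dx (h : BoundaryConditions qm qp q) {l : Filter ℝ}
    (he : IsEnd qm qp a l) (j : ℕ) (hj : j ≤ 4) (t₀ : ℝ) :
    Tendsto (fun w : ℝ × ℝ => dx j q w.1 w.2) (l ×ˢ 𝓝 t₀) (𝓝 (if j = 0 then a else 0)) := by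
  rcases Nat.eq_zero_or_pos j with rfl | hj0
  · simp only [dx, iteratedDeriv_zero, if_true]
    rcases he with ⟨rfl, rfl⟩ | ⟨rfl, rfl⟩
    exacts [h.lim_left t₀, h.lim_right t₀]
  · rw [if_neg hj0.ne']
    rcases he with ⟨rfl, rfl⟩ | ⟨rfl, rfl⟩
    exacts [h.deriv_left j (Finset.mem_Icc.2 ⟨hj0, hj⟩) t₀,
      h.deriv_right j (Finset.mem_Icc.2 ⟨hj0, hj⟩) t₀]

/-- The Jost solutions at time `t` are obtained from those at time `0` by a unimodular matrix, which
does not depend on their normalization. -/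
theorem exists_transport (hs : IsSolution ε (q₀ ^ 2) q) (hbc : BoundaryConditions qm qp q)
    (hz : z ≠ 0) (t : ℝ) : ∃ M : Matrix (Fin 2) (Fin 2) ℂ, M.det = 1 ∧
      ∀ {a : ℂ} {l : Filter ℝ} {j : Fin 2} {φ : ℝ → Fin 2 → ℂ}, a * conj a = (q₀ : ℂ) ^ 2 →
        IsEnd qm qp a l → IsJost ε q₀ q a l j 0 z φ →
        ∃ ψ, IsJost ε q₀ q a l j t z ψ ∧ ψ 0 = M.mulVec (φ 0) := by
  set A := fun s => timeV ε (q₀ ^ 2) (kOf q₀ z) fun j => dx j q 0 s with hA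
  have hAc : ∀ i j, Continuous fun s => A s i j := fun i j => by
    refine continuous_iff_continuousAt.2 fun s => tendsto_timeV (fun j hj => ?_) i j
    exact ((continuous_dx hs.1 (by omega)).comp (continuous_const.prodMk continuous_id)).tendsto s
  have hAtr : ∀ s, A s 1 1 = -A s 0 0 := fun s => by simp [hA, timeV]
  obtain ⟨w₀, hw₀, dw₀⟩ := exists_hasDerivAt_mulVec hAc ![1, 0]
  obtain ⟨w₁, hw₁, dw₁⟩ := exists_hasDerivAt_mulVec hAc ![0, 1]
  set M := fun s => !![w₀ s 0, w₁ s 0; w₀ s 1, w₁ s 1] with hM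
  have hMv : ∀ s v, (M s).mulVec v = v 0 • w₀ s + v 1 • w₁ s := fun s v => by
    ext i
    fin_cases i <;> (simp [hM, Matrix.mulVec, dotProduct, Fin.sum_univ_two]; ring)
  have hM0 : ∀ v, (M 0).mulVec v = v := fun v => by
    rw [hMv, hw₀, hw₁]
    ext i
    fin_cases i <;> simp
  have hMd : ∀ v s, HasDerivAt (fun s => (M s).mulVec v) ((A s).mulVec ((M s).mulVec v)) s :=
    fun v s => by
      simp only [hMv]
      refine (((dw₀ s).const_smul (v 0)).add ((dw₁ s).const_smul (v 1))).congr_deriv ?_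
      rw [Matrix.mulVec_add, Matrix.mulVec_smul, Matrix.mulVec_smul]
  have hdet : ∀ s, (M s).det = 1 := by
    have hd : ∀ s, HasDerivAt (fun s => (M s).det) 0 s := fun s => by
      have p := hasDerivAt_pi.1 (dw₀ s)
      have p' := hasDerivAt_pi.1 (dw₁ s)
      have h1 := ((p 0).mul (p' 1)).sub ((p' 0).mul (p 1))
      simp only [hM, Matrix.det_fin_two_of]
      refine h1.congr_deriv ?_
      simp only [Matrix.mulVec, dotProduct, Fin.sum_univ_two, hAtr]
      ring
    intro s
    have h1 := is_const_of_deriv_eq_zero (fun s => (hd s).differentiableAt) (fun s => (hd s).deriv) s 0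
    rw [h1]
    simp [hM, hw₀, hw₁]
  refine ⟨M t, hdet t, fun {a l j φ} ha he hφ => ?_⟩
  have hqc : ∀ s, Continuous fun y => q y s := fun s =>
    hs.1.continuous.comp (continuous_id.prodMk continuous_const)
  have hex := fun s => exists_hasDerivAt_mulVec (A := fun y => laxU (kOf q₀ z) (q y s))
    (continuous_laxU (hqc s)) ((M s).mulVec (φ 0))
  choose y hy0 hy using hex
  have hinit : y 0 = φ := by
    funext x
    have h1 : IsLax (kOf q₀ z) (fun x => q x 0) (fun x => y 0 x - φ x) :=
      IsLax.sub (hy 0) hφ.isLax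
    have h2 := h1.eq_zero (hqc 0) (x₀ := 0) (by rw [hy0, hM0, sub_self]) x
    exact sub_eq_zero.1 h2
  have htr := hasDerivAt_transport (χ := fun x s => y s x) hs.1 hs.flow_eq (fun x s => hy s x)
    (fun s => by
      simp only [hy0]
      exact hMd (φ 0) s)
  refine ⟨y t, ⟨hy t, ?_⟩, hy0 t⟩
  refine tendsto_transport (χ := fun x s => y s x) ha hz (hbc.tendsto_dx he) htr ?_ t
  simp only [hinit]
  exact hφ.2

end Transport

/-! ### Conservation of the scattering data -/

section Data

variable {ε q₀ : ℝ} {q : ℝ → ℝ → ℂ} {qm qp z : ℂ}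

theorem lamOf_eq_mul_gam (hz : z ≠ 0) : lamOf q₀ z = z / 2 * gam q₀ z := by
  unfold lamOf gam
  field_simp

theorem neg_div_mem_Splus (hq : (q₀ : ℂ) ≠ 0) (hz : z ≠ 0) (hl : (lamOf q₀ z).im ≤ 0) :
    -(q₀ : ℂ) ^ 2 / z ∈ Splus q₀ :=
  ⟨neg_div_ne_zero hq hz, by rw [lamOf_neg_div hq hz]; simpa using hl⟩

theorem BoundaryConditions.decaysLeft (h : BoundaryConditions qm qp q)
    (hs : Continuous (Function.uncurry q)) (t : ℝ) : DecaysLeft (fun x => q x t) qm :=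
  ⟨hs.comp (continuous_id.prodMk continuous_const), h.moment_left t⟩

theorem BoundaryConditions.decaysRight (h : BoundaryConditions qm qp q)
    (hs : Continuous (Function.uncurry q)) (t : ℝ) : DecaysRight (fun x => q x t) qp :=
  ⟨hs.comp (continuous_id.prodMk continuous_const), h.moment_right t⟩

/-- A potential with the boundary values `q_±` of modulus `q₀`, at a fixed time. -/
structure IsPotential (q₀ : ℝ) (qm qp : ℂ) (q : ℝ → ℝ → ℂ) (t : ℝ) : Prop where
  pos : 0 < q₀
  qm_mul : qm * conj qm = (q₀ : ℂ) ^ 2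
  qp_mul : qp * conj qp = (q₀ : ℂ) ^ 2
  left : DecaysLeft (fun x => q x t) qm
  right : DecaysRight (fun x => q x t) qp

namespace IsPotential

variable {t : ℝ} (h : IsPotential q₀ qm qp q t)

theorem ne_zero (h : IsPotential q₀ qm qp q t) : (q₀ : ℂ) ≠ 0 := by exact_mod_cast h.pos.ne'

theorem qm_ne (h : IsPotential q₀ qm qp q t) : qm ≠ 0 := fun h0 => by
  have := h.qm_mul
  rw [h0, zero_mul] at this
  exact pow_ne_zero 2 h.ne_zero this.symm

theorem qp_ne (h : IsPotential q₀ qm qp q t) : qp ≠ 0 := fun h0 => by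
  have := h.qp_mul
  rw [h0, zero_mul] at this
  exact pow_ne_zero 2 h.ne_zero this.symm

/-! The four Jost solutions, in the regions where they are determined by their normalization. -/

theorem isJost_left_zero (h : IsPotential q₀ qm qp q t) (ε : ℝ) (hz : z ∈ Splus q₀) (hl : lamOf q₀ z ≠ 0) :
    IsJost ε q₀ q qm atBot 0 t z (jostM ε q₀ qm q 0 t z) :=
  isJost_jost (h.left.exists_isJost ε h.qm_mul hz hl)

theorem isJost_right_one (h : IsPotential q₀ qm qp q t) (ε : ℝ) (hz : z ∈ Splus q₀) (hl : lamOf q₀ z ≠ 0) :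
    IsJost ε q₀ q qp atTop 1 t z (jostP ε q₀ qp q 1 t z) :=
  isJost_jost (h.right.exists_isJost ε h.qp_mul hz hl)

theorem jostM_one_eq (h : IsPotential q₀ qm qp q t) (ε : ℝ) (hz : z ≠ 0) (hi : (lamOf q₀ z).im ≤ 0)
    (hl : lamOf q₀ z ≠ 0) :
    IsJost ε q₀ q qm atBot 1 t z (jostM ε q₀ qm q 1 t z) ∧ jostM ε q₀ qm q 1 t z =
      fun x => (-(Complex.I * qm / z)) • jostM ε q₀ qm q 0 t (-(q₀ : ℂ) ^ 2 / z) x := by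
  have h1 := (h.isJost_left_zero ε (neg_div_mem_Splus h.ne_zero hz hi)
    (by rwa [lamOf_neg_div h.ne_zero hz, neg_ne_zero])).col_one h.ne_zero hz h.qm_mul
  exact ⟨isJost_jost ⟨_, h1⟩, h1.jost_eq h.left.cont (jostRange_atBot_one hi)⟩

theorem jostP_zero_eq (h : IsPotential q₀ qm qp q t) (ε : ℝ) (hz : z ≠ 0) (hi : (lamOf q₀ z).im ≤ 0)
    (hl : lamOf q₀ z ≠ 0) :
    IsJost ε q₀ q qp atTop 0 t z (jostP ε q₀ qp q 0 t z) ∧ jostP ε q₀ qp q 0 t z =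
      fun x => (-(Complex.I * conj qp / z)) • jostP ε q₀ qp q 1 t (-(q₀ : ℂ) ^ 2 / z) x := by
  have h1 := (h.isJost_right_one ε (neg_div_mem_Splus h.ne_zero hz hi)
    (by rwa [lamOf_neg_div h.ne_zero hz, neg_ne_zero])).col_zero h.ne_zero hz h.qp_mul
  exact ⟨isJost_jost ⟨_, h1⟩, h1.jost_eq h.right.cont (jostRange_atTop_zero hi)⟩

end IsPotential

theorem gam_ne_zero_iff (hz : z ≠ 0) : lamOf q₀ z ≠ 0 ↔ gam q₀ z ≠ 0 := by
  rw [lamOf_eq_mul_gam hz]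
  simp [hz]

theorem mem_Splus_of_mem_Sigma (hz : z ∈ Sigma₁ q₀) : z ∈ Splus q₀ :=
  ⟨hz.2.1, (im_lamOf_of_mem_Sigma hz).ge⟩

theorem lamOf_ne_zero_of_mem_Sigma (hz : z ∈ Sigma₁ q₀) : lamOf q₀ z ≠ 0 :=
  (gam_ne_zero_iff hz.2.1).2 (gam_ne_zero_of_ne hz.2.1 hz.2.2.1 hz.2.2.2)

theorem mem_Splus_of_mem_Dplus (hz : z ∈ Dplus q₀) : z ∈ Splus q₀ :=
  ⟨ne_zero_of_mem_Dplus hz, ((mem_Dplus_iff (ne_zero_of_mem_Dplus hz)).1 hz).le⟩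

theorem lamOf_ne_zero_of_mem_Dplus (hz : z ∈ Dplus q₀) : lamOf q₀ z ≠ 0 := fun h0 => by
  have := (mem_Dplus_iff (ne_zero_of_mem_Dplus hz)).1 hz
  simp [h0] at this

theorem lamOf_ne_zero_of_mem_Dminus (hz : z ∈ Dminus q₀) : lamOf q₀ z ≠ 0 := fun h0 => by
  have := (mem_Dminus_iff (ne_zero_of_mem_Dminus hz)).1 hz
  simp [h0] at this

/-- Reflectionless data at time `0` persist. -/
theorem ReflectionlessSimple.at_time {N : ℕ} {y : Fin N → ℂ} {C : Fin N ⊕ Fin N → ℂ}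
    (hs : IsSolution ε (q₀ ^ 2) q) (hbc : BoundaryConditions qm qp q)
    (hp : ∀ t, IsPotential q₀ qm qp q t) (hη : ∀ n, eta q₀ y n ∈ Dminus q₀)
    (hh : ∀ n, etaHat q₀ y n ∈ Dplus q₀) (h : ReflectionlessSimple ε q₀ qm qp y C q 0) (t : ℝ) :
    ReflectionlessSimple ε q₀ qm qp y C q t := by
  have hL : IsEnd qm qp qm atBot := Or.inl ⟨rfl, rfl⟩
  have hR : IsEnd qm qp qp atTop := Or.inr ⟨rfl, rfl⟩
  -- each Jost solution is transported by the same unimodular matrix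
  have key : ∀ z : ℂ, z ≠ 0 → lamOf q₀ z ≠ 0 → ∃ M : Matrix (Fin 2) (Fin 2) ℂ, M.det = 1 ∧
      (0 ≤ (lamOf q₀ z).im → jostM ε q₀ qm q 0 t z 0 = M.mulVec (jostM ε q₀ qm q 0 0 z 0) ∧
        jostP ε q₀ qp q 1 t z 0 = M.mulVec (jostP ε q₀ qp q 1 0 z 0)) ∧
      ((lamOf q₀ z).im ≤ 0 → jostM ε q₀ qm q 1 t z 0 = M.mulVec (jostM ε q₀ qm q 1 0 z 0) ∧
        jostP ε q₀ qp q 0 t z 0 = M.mulVec (jostP ε q₀ qp q 0 0 z 0)) := fun z hz hl => by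
    obtain ⟨M, hM, hMt⟩ := exists_transport (z := z) hs hbc hz t
    refine ⟨M, hM, fun hi => ⟨?_, ?_⟩, fun hi => ⟨?_, ?_⟩⟩
    · obtain ⟨ψ, h1, h2⟩ := hMt (hp 0).qm_mul hL ((hp 0).isJost_left_zero ε ⟨hz, hi⟩ hl)
      rw [← h2, jostM, h1.jost_eq (hp t).left.cont (jostRange_atBot_zero hi)]
    · obtain ⟨ψ, h1, h2⟩ := hMt (hp 0).qp_mul hR ((hp 0).isJost_right_one ε ⟨hz, hi⟩ hl)
      rw [← h2, jostP, h1.jost_eq (hp t).left.cont (jostRange_atTop_one hi)]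
    · obtain ⟨ψ, h1, h2⟩ := hMt (hp 0).qm_mul hL ((hp 0).jostM_one_eq ε hz hi hl).1
      rw [← h2, jostM, h1.jost_eq (hp t).left.cont (jostRange_atBot_one hi)]
    · obtain ⟨ψ, h1, h2⟩ := hMt (hp 0).qp_mul hR ((hp 0).jostP_zero_eq ε hz hi hl).1
      rw [← h2, jostP, h1.jost_eq (hp t).left.cont (jostRange_atTop_zero hi)]
  have e11 : ∀ z ∈ Dminus q₀, s11 ε q₀ qm qp q t z = s11 ε q₀ qm qp q 0 z := fun z hz => by
    obtain ⟨M, hM, -, h2⟩ := key z (ne_zero_of_mem_Dminus hz) (lamOf_ne_zero_of_mem_Dminus hz)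
    obtain ⟨h3, h4⟩ := h2 ((mem_Dminus_iff (ne_zero_of_mem_Dminus hz)).1 hz).le
    rw [s11, s11, h3, h4, wr_mulVec, hM, one_mul]
  have e22 : ∀ z ∈ Dplus q₀, s22 ε q₀ qm qp q t z = s22 ε q₀ qm qp q 0 z := fun z hz => by
    obtain ⟨M, hM, h2, -⟩ := key z (ne_zero_of_mem_Dplus hz) (lamOf_ne_zero_of_mem_Dplus hz)
    obtain ⟨h3, h4⟩ := h2 (mem_Splus_of_mem_Dplus hz).2
    rw [s22, s22, h3, h4, wr_mulVec, hM, one_mul]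
  have d11 : ∀ z ∈ Dminus q₀, deriv (s11 ε q₀ qm qp q t) z = deriv (s11 ε q₀ qm qp q 0) z :=
    fun z hz => Filter.EventuallyEq.deriv_eq (by
      filter_upwards [isOpen_Dminus.mem_nhds hz] with w hw using e11 w hw)
  have d22 : ∀ z ∈ Dplus q₀, deriv (s22 ε q₀ qm qp q t) z = deriv (s22 ε q₀ qm qp q 0) z :=
    fun z hz => Filter.EventuallyEq.deriv_eq (by
      filter_upwards [isOpen_Dplus.mem_nhds hz] with w hw using e22 w hw)
  refine ⟨fun z hz => ?_, fun z hz => ?_, fun z hz => ?_, fun z hz => ?_, fun n => ?_, fun n => ?_,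
    fun n => ?_⟩
  · obtain ⟨M, hM, h1, h2⟩ := key z hz.2.1 (lamOf_ne_zero_of_mem_Sigma hz)
    have hi := im_lamOf_of_mem_Sigma hz
    rw [s12, (h1 hi.ge).2, (h2 hi.le).1, wr_mulVec, hM, one_mul]
    exact h.s12_eq_zero z hz
  · obtain ⟨M, hM, h1, h2⟩ := key z hz.2.1 (lamOf_ne_zero_of_mem_Sigma hz)
    have hi := im_lamOf_of_mem_Sigma hz
    rw [s21, (h1 hi.ge).1, (h2 hi.le).2, wr_mulVec, hM, one_mul]
    exact h.s21_eq_zero z hz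
  · rw [e11 z hz]
    exact h.s11_zeros z hz
  · rw [e22 z hz]
    exact h.s22_zeros z hz
  · rw [d11 _ (hη n)]
    exact h.s11_simple n
  · rw [d22 _ (hh n)]
    exact h.s22_simple n
  · obtain ⟨b, hb, hC⟩ := h.norming n
    have hz := hh n
    have hl := lamOf_ne_zero_of_mem_Dplus hz
    refine ⟨b, fun x => ?_, by rw [d22 _ hz]; exact hC⟩
    obtain ⟨M, hM, h1, -⟩ := key _ (ne_zero_of_mem_Dplus hz) hl
    obtain ⟨h3, h4⟩ := h1 (mem_Splus_of_mem_Dplus hz).2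
    have l1 := ((hp t).isJost_right_one ε (mem_Splus_of_mem_Dplus hz) hl).isLax
    have l2 := ((hp t).isJost_left_zero ε (mem_Splus_of_mem_Dplus hz) hl).isLax
    have h5 := (l1.sub (l2.smul b)).eq_zero (hp t).left.cont (x₀ := 0)
      (by rw [h3, h4, hb, Matrix.mulVec_smul, sub_self]) x
    exact sub_eq_zero.1 h5

end Data

/-! ### The Jost solutions for large `z` -/

section Asymptotics

/-- The functions `m₀`, `m₁` are the components of the modified Jost solution `e^{iθ} φ_{-,1}` for
the potential `u` with limit `a` at `-∞`. In the coordinate `z` the equations read as stated, since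
`λ - k = q₀² / z` and `λ + k = z`. -/
structure IsNormalized (u : ℝ → ℂ) (a : ℂ) (q₀ : ℝ) (z : ℂ) (m₀ m₁ : ℝ → ℂ) : Prop where
  deriv_zero : ∀ x, HasDerivAt m₀ (Complex.I * (q₀ : ℂ) ^ 2 / z * m₀ x + u x * m₁ x) x
  deriv_one : ∀ x, HasDerivAt m₁ (-conj (u x) * m₀ x + Complex.I * z * m₁ x) x
  lim_zero : Tendsto m₀ atBot (𝓝 1)
  lim_one : Tendsto m₁ atBot (𝓝 (-(Complex.I * conj a / z)))

variable {u : ℝ → ℂ} {a z : ℂ} {q₀ : ℝ} {m₀ m₁ : ℝ → ℂ}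

theorem energy_ineq {s s0 s1 e D : ℝ} (he : 0 ≤ e) (hs : s = s0 + s1)
    (hD : D = s0 ^ 2 + s1 ^ 2) : 2 * (s * (2 * e * (1 + s))) ≤ 2 * e * (1 + 6 * D) := by
  have h2 : s ^ 2 ≤ 2 * D := by rw [hs, hD]; nlinarith [sq_nonneg (s0 - s1)]
  have h3 : 2 * (s * (1 + s)) ≤ 1 + 6 * D := by nlinarith [sq_nonneg (s - 1)]
  nlinarith [mul_le_mul_of_nonneg_left h3 he]

theorem inner_mul_self_nonpos {l d : ℂ} (hl : 0 ≤ l.im) :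
    inner ℝ d (2 * Complex.I * l * d) ≤ (0 : ℝ) := by
  have h1 : inner ℝ d (2 * Complex.I * l * d) = -(2 * l.im * (d.re ^ 2 + d.im ^ 2)) := by
    rw [Complex.inner]
    simp
    ring
  rw [h1]
  have : 0 ≤ 2 * l.im * (d.re ^ 2 + d.im ^ 2) := by positivity
  linarith

/-- Energy estimate for the Jost solution, uniform in `z`. -/
theorem IsNormalized.norm_sq_le (h : IsNormalized u a q₀ z m₀ m₁) (ha : a * conj a = (q₀ : ℂ) ^ 2)
    (hq : 0 < q₀) (hz : 2 * q₀ ≤ ‖z‖) (hl : 0 ≤ (lamOf q₀ z).im) (hu : Continuous u)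
    (hint : ∀ x, IntegrableOn (fun y => ‖u y - a‖) (Set.Iic x)) (x : ℝ) :
    ‖m₀ x - 1‖ ^ 2 ≤ Real.exp (12 * ∫ y in Set.Iic x, ‖u y - a‖) - 1 ∧
    ‖m₁ x + Complex.I * conj a / z‖ ^ 2 ≤ Real.exp (12 * ∫ y in Set.Iic x, ‖u y - a‖) - 1 := by
  have hz0 : z ≠ 0 := norm_pos_iff.1 (by linarith)
  have hna : ‖a‖ = q₀ := by
    have h1 := congrArg norm ha
    rw [norm_mul, RCLike.norm_conj, norm_pow, Complex.norm_real, Real.norm_of_nonneg hq.le] at h1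
    nlinarith [norm_nonneg a]
  have hq2 : (q₀ : ℂ) ^ 2 = a * conj a := ha.symm
  set g := gam q₀ z with hg
  have hqz : ‖(q₀ : ℂ) ^ 2 / z ^ 2‖ ≤ 1 / 4 := by
    rw [norm_div, norm_pow, norm_pow, Complex.norm_real, Real.norm_of_nonneg hq.le,
      div_le_iff₀ (by positivity)]
    nlinarith
  have hgn : 3 / 4 ≤ ‖g‖ := by
    have h1 := norm_sub_norm_le (1 : ℂ) (-((q₀ : ℂ) ^ 2 / z ^ 2))
    rw [norm_one, norm_neg, sub_neg_eq_add] at h1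
    rw [hg, gam]
    linarith
  have hg0 : g ≠ 0 := norm_pos_iff.1 (by linarith)
  set α := Complex.I * a / z with hα
  set β := Complex.I * conj a / z with hβ
  have hαn : ‖α‖ ≤ 1 / 2 := by
    rw [hα, norm_div, norm_mul, Complex.norm_I, one_mul, hna, div_le_iff₀ (by linarith)]
    linarith
  have hβn : ‖β‖ ≤ 1 / 2 := by
    rw [hβ, norm_div, norm_mul, Complex.norm_I, one_mul, RCLike.norm_conj, hna,
      div_le_iff₀ (by linarith)]
    linarith
  have hI := Complex.I_sq
  have hgαβ : g = 1 - α * β := by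
    rw [hg, gam, hα, hβ, hq2]
    field_simp
    rw [hI]
    ring
  -- the coordinates with respect to the columns of `E`
  set d₀ := fun x => (m₀ x + α * m₁ x) / g - 1 with hd₀
  set d₁ := fun x => (β * m₀ x + m₁ x) / g with hd₁
  set r₀ := fun x => ((u x - a) * m₁ x - α * (conj (u x - a) * m₀ x)) / g with hr₀
  set r₁ := fun x => (β * ((u x - a) * m₁ x) - conj (u x - a) * m₀ x) / g with hr₁
  have dd₀ : ∀ x, HasDerivAt d₀ (r₀ x) x := fun x => by
    refine ((((h.deriv_zero x).add ((h.deriv_one x).const_mul α)).div_const g).sub_const 1).congr_deriv ?_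
    simp only [hr₀, hα, map_sub]
    rw [hq2]
    field_simp
    linear_combination (a * z * m₁ x) * hI
  have dd₁ : ∀ x, HasDerivAt d₁ (2 * Complex.I * lamOf q₀ z * d₁ x + r₁ x) x := fun x => by
    refine ((((h.deriv_zero x).const_mul β).add (h.deriv_one x)).div_const g).congr_deriv ?_
    simp only [hr₁, hd₁, hβ, map_sub, lamOf]
    rw [hq2]
    field_simp
    linear_combination (-conj a * z ^ 2 * m₀ x) * hI
  have hm₀ : ∀ x, m₀ x = 1 + d₀ x - α * d₁ x := fun x => by
    simp only [hd₀, hd₁]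
    field_simp
    rw [hgαβ]
    ring
  have hm₁ : ∀ x, m₁ x = d₁ x - β * (1 + d₀ x) := fun x => by
    simp only [hd₀, hd₁]
    field_simp
    rw [hgαβ]
    ring
  have hs : ∀ x, ‖m₀ x‖ ≤ 1 + (‖d₀ x‖ + ‖d₁ x‖) ∧ ‖m₁ x‖ ≤ 1 + (‖d₀ x‖ + ‖d₁ x‖) := fun x => by
    have n1 : ‖1 + d₀ x‖ ≤ 1 + ‖d₀ x‖ := by
      have := norm_add_le (1 : ℂ) (d₀ x); rwa [norm_one] at this
    have n2 : ‖α * d₁ x‖ ≤ 1 / 2 * ‖d₁ x‖ := by rw [norm_mul]; gcongr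
    have n3 : ‖β * (1 + d₀ x)‖ ≤ 1 / 2 * (1 + ‖d₀ x‖) := by rw [norm_mul]; gcongr
    constructor
    · rw [hm₀]
      refine (norm_sub_le _ _).trans ?_
      linarith [norm_nonneg (d₁ x)]
    · rw [hm₁]
      refine (norm_sub_le _ _).trans ?_
      linarith [norm_nonneg (d₀ x)]
  have hrb : ∀ x, ‖r₀ x‖ ≤ 2 * ‖u x - a‖ * (1 + (‖d₀ x‖ + ‖d₁ x‖)) ∧
      ‖r₁ x‖ ≤ 2 * ‖u x - a‖ * (1 + (‖d₀ x‖ + ‖d₁ x‖)) := fun x => by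
    obtain ⟨s0, s1⟩ := hs x
    set s := 1 + (‖d₀ x‖ + ‖d₁ x‖) with hss
    have hs0 : 0 ≤ s := by positivity
    have n1 : ‖(u x - a) * m₁ x‖ ≤ ‖u x - a‖ * s := by rw [norm_mul]; gcongr
    have n2 : ‖conj (u x - a) * m₀ x‖ ≤ ‖u x - a‖ * s := by
      rw [norm_mul, RCLike.norm_conj]; gcongr
    have hw : 0 ≤ ‖u x - a‖ * s := by positivity
    constructor
    · simp only [hr₀]
      rw [norm_div, div_le_iff₀ (by linarith)]
      have n3 : ‖α * (conj (u x - a) * m₀ x)‖ ≤ 1 / 2 * (‖u x - a‖ * s) := by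
        rw [norm_mul]; gcongr
      refine (norm_sub_le _ _).trans ?_
      nlinarith
    · simp only [hr₁]
      rw [norm_div, div_le_iff₀ (by linarith)]
      have n3 : ‖β * ((u x - a) * m₁ x)‖ ≤ 1 / 2 * (‖u x - a‖ * s) := by
        rw [norm_mul]; gcongr
      refine (norm_sub_le _ _).trans ?_
      nlinarith
  set D := fun x => ‖d₀ x‖ ^ 2 + ‖d₁ x‖ ^ 2 with hD
  set T := fun x => ∫ y in Set.Iic x, ‖u y - a‖ with hT
  have dT : ∀ x, HasDerivAt T ‖u x - a‖ x := hasDerivAt_integral_Iic (by fun_prop) hint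
  have dG : ∀ x, HasDerivAt (fun x => (1 + 6 * D x) * Real.exp (-(12 * T x)))
      ((6 * (2 * inner ℝ (d₀ x) (r₀ x) + 2 * inner ℝ (d₁ x) (2 * Complex.I * lamOf q₀ z * d₁ x + r₁ x))
        - 12 * ‖u x - a‖ * (1 + 6 * D x)) * Real.exp (-(12 * T x))) x := fun x => by
    have h1 := (((dd₀ x).norm_sq.add (dd₁ x).norm_sq).const_mul 6).const_add 1
    have h2 := ((dT x).const_mul 12).neg.exp
    refine (h1.mul h2).congr_deriv ?_
    simp only [hD, Pi.add_apply, Pi.neg_apply]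
    ring
  have hanti : Antitone fun x => (1 + 6 * D x) * Real.exp (-(12 * T x)) := by
    refine antitone_of_hasDerivAt_nonpos dG fun x => ?_
    refine mul_nonpos_of_nonpos_of_nonneg ?_ (Real.exp_pos _).le
    obtain ⟨b0, b1⟩ := hrb x
    have i0 : inner ℝ (d₀ x) (r₀ x) ≤ ‖d₀ x‖ * ‖r₀ x‖ := real_inner_le_norm _ _
    have i1 : inner ℝ (d₁ x) (r₁ x) ≤ ‖d₁ x‖ * ‖r₁ x‖ := real_inner_le_norm _ _
    have i2 : inner ℝ (d₁ x) (2 * Complex.I * lamOf q₀ z * d₁ x) ≤ 0 := inner_mul_self_nonpos hl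
    rw [inner_add_right]
    have j0 := mul_le_mul_of_nonneg_left b0 (norm_nonneg (d₀ x))
    have j1 := mul_le_mul_of_nonneg_left b1 (norm_nonneg (d₁ x))
    have k0 := energy_ineq (D := D x) (norm_nonneg (u x - a)) rfl rfl
    nlinarith
  have hT0 : Tendsto T atBot (𝓝 0) := tendsto_integral_Iic_atBot hint
  have hd₀l : Tendsto d₀ atBot (𝓝 0) := by
    have h1 := ((h.lim_zero.add (h.lim_one.const_mul α)).div_const g).sub_const 1
    refine h1.trans_eq ?_
    congr 1
    rw [← hβ, mul_neg, ← sub_eq_add_neg, ← hgαβ, div_self hg0, sub_self]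
  have hd₁l : Tendsto d₁ atBot (𝓝 0) := by
    have h1 := ((h.lim_zero.const_mul β).add h.lim_one).div_const g
    refine h1.trans_eq ?_
    congr 1
    rw [← hβ, mul_one, add_neg_cancel, zero_div]
  have hlim : Tendsto (fun x => (1 + 6 * D x) * Real.exp (-(12 * T x))) atBot (𝓝 1) := by
    have h1 := ((((hd₀l.norm.pow 2).add (hd₁l.norm.pow 2)).const_mul 6).const_add 1).mul
      ((hT0.const_mul 12).neg.rexp)
    simpa using h1
  have hmain : 1 + 6 * D x ≤ Real.exp (12 * T x) := by
    have h1 : (1 + 6 * D x) * Real.exp (-(12 * T x)) ≤ 1 := by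
      refine ge_of_tendsto hlim ?_
      filter_upwards [eventually_le_atBot x] with y hy
      exact hanti hy
    rw [Real.exp_neg, ← div_eq_mul_inv, div_le_one (Real.exp_pos _)] at h1
    exact h1
  have hDx : D x = ‖d₀ x‖ ^ 2 + ‖d₁ x‖ ^ 2 := rfl
  constructor
  · have e1 : m₀ x - 1 = d₀ x - α * d₁ x := by rw [hm₀]; ring
    have n2 : ‖α * d₁ x‖ ≤ ‖d₁ x‖ := by
      rw [norm_mul]
      exact mul_le_of_le_one_left (norm_nonneg _) (by linarith)
    have n3 : ‖m₀ x - 1‖ ≤ ‖d₀ x‖ + ‖d₁ x‖ := by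
      rw [e1]; exact (norm_sub_le _ _).trans (by linarith)
    have n4 : ‖m₀ x - 1‖ ^ 2 ≤ (‖d₀ x‖ + ‖d₁ x‖) ^ 2 := by gcongr
    nlinarith [sq_nonneg (‖d₀ x‖ - ‖d₁ x‖), sq_nonneg ‖d₀ x‖, sq_nonneg ‖d₁ x‖]
  · have e1 : m₁ x + β = d₁ x - β * d₀ x := by rw [hm₁]; ring
    have n2 : ‖β * d₀ x‖ ≤ ‖d₀ x‖ := by
      rw [norm_mul]
      exact mul_le_of_le_one_left (norm_nonneg _) (by linarith)
    have n3 : ‖m₁ x + β‖ ≤ ‖d₀ x‖ + ‖d₁ x‖ := by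
      rw [e1]; exact (norm_sub_le _ _).trans (by linarith)
    have n4 : ‖m₁ x + β‖ ^ 2 ≤ (‖d₀ x‖ + ‖d₁ x‖) ^ 2 := by gcongr
    nlinarith [sq_nonneg (‖d₀ x‖ - ‖d₁ x‖), sq_nonneg ‖d₀ x‖, sq_nonneg ‖d₁ x‖]

theorem im_nonneg_of_lamOf (hq : 0 < q₀) (hz : 2 * q₀ ≤ ‖z‖) (hl : 0 ≤ (lamOf q₀ z).im) :
    0 ≤ z.im := by
  have hz0 : z ≠ 0 := norm_pos_iff.1 (by linarith)
  have hn : 0 < 2 * ‖z‖ ^ 2 := by have := norm_pos_iff.2 hz0; positivity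
  rw [im_lamOf q₀ hz0, le_div_iff₀ hn, zero_mul] at hl
  exact nonneg_of_mul_nonneg_right hl (by nlinarith)

/-- The asymptotics of the Jost solution for `z → ∞`. The oscillating terms are absorbed by passing
to `m₀ + i u m₁ / z` and `m₁ + i u* m₀ / z`, whose equations are perturbed by `O(1 / z)` only. -/
theorem exists_normalized_near (ha : a * conj a = (q₀ : ℂ) ^ 2)
    (hq : 0 < q₀) (hu : ContDiff ℝ 1 u)
    (hint : ∀ x, IntegrableOn (fun y => ‖u y - a‖) (Set.Iic x)) (x : ℝ) {r : ℝ} (hr : 0 < r) :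
    ∃ K : ℝ, ∀ z m₀ m₁, K ≤ ‖z‖ → 0 ≤ (lamOf q₀ z).im → IsNormalized u a q₀ z m₀ m₁ →
      ‖m₀ x - 1‖ ≤ r ∧ ‖m₁ x‖ ≤ r := by
  have hna : ‖a‖ = q₀ := by
    have h1 := congrArg norm ha
    rw [norm_mul, RCLike.norm_conj, norm_pow, Complex.norm_real, Real.norm_of_nonneg hq.le] at h1
    nlinarith [norm_nonneg a]
  set T := fun x => Real.exp (12 * ∫ y in Set.Iic x, ‖u y - a‖) with hT
  obtain ⟨b, hb, hbx⟩ : ∃ b, T b - 1 ≤ (r / 2) ^ 2 ∧ b ≤ x := by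
    have h1 : Tendsto (fun x => T x - 1) atBot (𝓝 0) := by
      simpa using (((tendsto_integral_Iic_atBot hint).const_mul 12).rexp).sub_const 1
    exact ((h1.eventually_le_const (by positivity : (0 : ℝ) < (r / 2) ^ 2)).and
      (eventually_le_atBot x)).exists
  obtain ⟨U, hU⟩ := isCompact_Icc.exists_bound_of_continuousOn (s := Set.Icc b x)
    hu.continuous.continuousOn
  obtain ⟨V, hV⟩ := isCompact_Icc.exists_bound_of_continuousOn (s := Set.Icc b x)
    (hu.continuous_deriv le_rfl).continuousOn
  have hU0 : 0 ≤ U := (norm_nonneg _).trans (hU b ⟨le_rfl, hbx⟩)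
  have hV0 : 0 ≤ V := (norm_nonneg _).trans (hV b ⟨le_rfl, hbx⟩)
  set C := 1 + T x with hC
  have hC1 : 1 ≤ C := by have := Real.exp_pos (12 * ∫ y in Set.Iic x, ‖u y - a‖); linarith
  set L := (q₀ ^ 2 + V + U ^ 2 + U * q₀) * C * (x - b) + 2 * U * C + q₀ with hL
  have hxb : 0 ≤ x - b := sub_nonneg.2 hbx
  refine ⟨max (2 * q₀) (2 * L / r), fun z m₀ m₁ hz hl h => ?_⟩
  obtain ⟨hz2, hzL⟩ := max_le_iff.1 hz
  have hzp : 0 < ‖z‖ := by linarith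
  have hz0 : z ≠ 0 := norm_pos_iff.1 hzp
  have hzi := im_nonneg_of_lamOf hq hz2 hl
  have hLr : L / ‖z‖ ≤ r / 2 := by
    rw [div_le_iff₀ hr] at hzL
    rw [div_le_iff₀ hzp]
    linarith
  have hen := h.norm_sq_le ha hq hz2 hl hu.continuous hint
  have hqz : ‖Complex.I * conj a / z‖ = q₀ / ‖z‖ := by
    rw [norm_div, norm_mul, Complex.norm_I, one_mul, RCLike.norm_conj, hna]
  have hbd : ∀ y ∈ Set.Icc b x, ‖m₀ y‖ ≤ C ∧ ‖m₁ y‖ ≤ C := fun y hy => by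
    have hT1 : T y ≤ T x := Real.exp_le_exp.2 (mul_le_mul_of_nonneg_left
      (setIntegral_mono_set (hint x) (Eventually.of_forall fun _ => norm_nonneg _)
        (Set.Iic_subset_Iic.2 hy.2).eventuallyLE) (by norm_num))
    have hT0 : 1 ≤ T y := Real.one_le_exp
      (mul_nonneg (by norm_num) (integral_nonneg fun _ => norm_nonneg _))
    have hle : ∀ s : ℝ, s ^ 2 ≤ T y - 1 → s ≤ T y - 1 / 2 := fun s hs => by
      nlinarith [sq_nonneg (s - 1)]
    have h0 := hle _ (hen y).1
    have h1 := hle _ (hen y).2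
    constructor
    · have := norm_add_le (m₀ y - 1) 1
      rw [sub_add_cancel, norm_one] at this
      linarith
    · have := norm_sub_le (m₁ y + Complex.I * conj a / z) (Complex.I * conj a / z)
      rw [add_sub_cancel_right, hqz] at this
      have h2 : q₀ / ‖z‖ ≤ 1 / 2 := by rw [div_le_iff₀ hzp]; linarith
      linarith
  have hb0 : ‖m₀ b - 1‖ ≤ r / 2 := abs_le_of_sq_le_sq' ((hen b).1.trans hb) (by positivity) |>.2
  have hb1 : ‖m₁ b + Complex.I * conj a / z‖ ≤ r / 2 :=
    abs_le_of_sq_le_sq' ((hen b).2.trans hb) (by positivity) |>.2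
  have hdu : ∀ y, HasDerivAt u (deriv u y) y := fun y =>
    (hu.differentiable one_ne_zero y).hasDerivAt
  have hmb : b ∈ Set.Icc b x := ⟨le_rfl, hbx⟩
  have hmx : x ∈ Set.Icc b x := ⟨hbx, le_rfl⟩
  have hum : ∀ y ∈ Set.Icc b x, ‖Complex.I / z * (u y * m₁ y)‖ ≤ U * C / ‖z‖ ∧
      ‖Complex.I / z * (conj (u y) * m₀ y)‖ ≤ U * C / ‖z‖ := fun y hy => by
    obtain ⟨h0, h1⟩ := hbd y hy
    have h2 := hU y hy
    simp only [norm_mul, norm_div, Complex.norm_I, RCLike.norm_conj]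
    constructor <;> rw [one_div, inv_mul_eq_div] <;> gcongr
  constructor
  · have dQ : ∀ y, HasDerivAt (fun y => m₀ y + Complex.I / z * (u y * m₁ y))
        (Complex.I / z * ((q₀ : ℂ) ^ 2 * m₀ y + deriv u y * m₁ y - u y * (conj (u y) * m₀ y))) y :=
      fun y => by
        refine ((h.deriv_zero y).add (((hdu y).mul (h.deriv_one y)).const_mul
          (Complex.I / z))).congr_deriv ?_
        field_simp
        linear_combination (z * u y * m₁ y) * Complex.I_sq
    have hQ := Convex.norm_image_sub_le_of_norm_hasDerivWithin_le (s := Set.Icc b x)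
      (C := (q₀ ^ 2 + V + U ^ 2) * C / ‖z‖) (fun y _ => (dQ y).hasDerivWithinAt) (fun y hy => by
        obtain ⟨h0, h1⟩ := hbd y hy
        have h2 := hU y hy
        have h3 := hV y hy
        rw [norm_mul, norm_div, Complex.norm_I, one_div, inv_mul_eq_div]
        gcongr
        calc _ ≤ ‖(q₀ : ℂ) ^ 2 * m₀ y‖ + ‖deriv u y * m₁ y‖ + ‖u y * (conj (u y) * m₀ y)‖ :=
              (norm_sub_le _ _).trans (by gcongr; exact norm_add_le _ _)
          _ ≤ q₀ ^ 2 * C + V * C + U * (U * C) := by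
              simp only [norm_mul, norm_pow, RCLike.norm_conj, Complex.norm_real,
                Real.norm_of_nonneg hq.le]
              gcongr
          _ = _ := by ring) (convex_Icc b x) hmb hmx
    rw [Real.norm_of_nonneg hxb] at hQ
    have e : m₀ x - 1 = (m₀ b - 1) + (m₀ x + Complex.I / z * (u x * m₁ x) -
        (m₀ b + Complex.I / z * (u b * m₁ b))) + Complex.I / z * (u b * m₁ b)
        - Complex.I / z * (u x * m₁ x) := by ring
    rw [e]
    refine (norm_sub_le _ _).trans ?_
    refine (add_le_add ((norm_add_le _ _).trans (add_le_add ((norm_add_le _ _).trans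
      (add_le_add hb0 hQ)) (hum b hmb).1)) (hum x hmx).1).trans ?_
    refine le_trans ?_ (add_le_add_right hLr (r / 2) |>.trans_eq (add_halves r))
    have : 0 ≤ U * q₀ * C * (x - b) / ‖z‖ + q₀ / ‖z‖ := by positivity
    rw [hL]
    linear_combination this
  · have dP : ∀ y : ℝ, HasDerivAt (fun y : ℝ => Complex.exp (Complex.I * z * (x - y)) *
        (m₁ y + Complex.I / z * (conj (u y) * m₀ y)))
        (Complex.exp (Complex.I * z * (x - y)) * (Complex.I / z * (conj (deriv u y) * m₀ y
          + conj (u y) * (Complex.I * (q₀ : ℂ) ^ 2 / z * m₀ y + u y * m₁ y)))) y := fun y => by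
        have h1 : HasDerivAt (fun y : ℝ => Complex.I * z * ((x : ℂ) - y)) (-(Complex.I * z)) y := by
          simpa using (((Complex.ofRealCLM.hasDerivAt (x := y)).const_sub (x : ℂ)).const_mul
            (Complex.I * z))
        refine (h1.cexp.mul ((h.deriv_one y).add (((hasDerivAt_conj (hdu y)).mul
          (h.deriv_zero y)).const_mul (Complex.I / z)))).congr_deriv ?_
        simp only [Pi.add_apply, Pi.mul_apply]
        field_simp
        linear_combination (-conj (u y) * m₀ y * z ^ 2) * Complex.I_sq
    have hP := Convex.norm_image_sub_le_of_norm_hasDerivWithin_le (s := Set.Icc b x)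
      (C := (V + U * q₀ + U ^ 2) * C / ‖z‖) (fun y _ => (dP y).hasDerivWithinAt) (fun y hy => by
        obtain ⟨h0, h1⟩ := hbd y hy
        have h2 := hU y hy
        have h3 := hV y hy
        have h4 : ‖Complex.exp (Complex.I * z * (x - y))‖ ≤ 1 := by
          rw [Complex.norm_exp, Real.exp_le_one_iff]
          have : (Complex.I * z * (x - y)).re = -(z.im * (x - y)) := by simp
          rw [this]
          exact neg_nonpos.2 (mul_nonneg hzi (sub_nonneg.2 hy.2))
        have h5 : q₀ ^ 2 / ‖z‖ ≤ q₀ := by rw [div_le_iff₀ hzp]; nlinarith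
        rw [norm_mul]
        refine (mul_le_of_le_one_left (norm_nonneg _) h4).trans ?_
        rw [norm_mul, norm_div, Complex.norm_I, one_div, inv_mul_eq_div]
        gcongr
        calc _ ≤ ‖conj (deriv u y) * m₀ y‖ + ‖conj (u y)‖ *
                (‖Complex.I * (q₀ : ℂ) ^ 2 / z * m₀ y‖ + ‖u y * m₁ y‖) :=
              (norm_add_le _ _).trans (by rw [norm_mul (conj (u y))]; gcongr; exact norm_add_le _ _)
          _ ≤ V * C + U * (q₀ * C + U * C) := by
              simp only [norm_mul, norm_pow, norm_div, RCLike.norm_conj, Complex.norm_real,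
                Real.norm_of_nonneg hq.le, Complex.norm_I, one_mul]
              gcongr
          _ = _ := by ring) (convex_Icc b x) hmb hmx
    rw [Real.norm_of_nonneg hxb, sub_self, mul_zero, Complex.exp_zero, one_mul] at hP
    have h4 : ‖Complex.exp (Complex.I * z * (x - b)) *
        (m₁ b + Complex.I / z * (conj (u b) * m₀ b))‖ ≤ r / 2 + q₀ / ‖z‖ + U * C / ‖z‖ := by
      have h4 : ‖Complex.exp (Complex.I * z * (x - b))‖ ≤ 1 := by
        rw [Complex.norm_exp, Real.exp_le_one_iff]
        have : (Complex.I * z * (x - b)).re = -(z.im * (x - b)) := by simp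
        rw [this]
        exact neg_nonpos.2 (mul_nonneg hzi hxb)
      rw [norm_mul]
      refine (mul_le_of_le_one_left (norm_nonneg _) h4).trans ?_
      refine (norm_add_le _ _).trans (add_le_add ?_ (hum b hmb).2)
      have := norm_sub_le (m₁ b + Complex.I * conj a / z) (Complex.I * conj a / z)
      rw [add_sub_cancel_right, hqz] at this
      linarith
    set P := Complex.exp (Complex.I * z * (x - b)) *
        (m₁ b + Complex.I / z * (conj (u b) * m₀ b)) with hPd
    have e : m₁ x = P + (m₁ x + Complex.I / z * (conj (u x) * m₀ x) - P)
        - Complex.I / z * (conj (u x) * m₀ x) := by ring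
    rw [e]
    refine (norm_sub_le _ _).trans ?_
    refine (add_le_add ((norm_add_le _ _).trans (add_le_add h4 hP)) (hum x hmx).2).trans ?_
    refine le_trans ?_ (add_le_add_right hLr (r / 2) |>.trans_eq (add_halves r))
    have : 0 ≤ q₀ ^ 2 * C * (x - b) / ‖z‖ := by positivity
    rw [hL]
    linear_combination this

end Asymptotics

section Limits

variable {ε q₀ t : ℝ} {q : ℝ → ℝ → ℂ} {a z : ℂ} {φ : ℝ → Fin 2 → ℂ}

theorem hasDerivAt_normFactor_zero (x : ℝ) : HasDerivAt (normFactor ε q₀ 0 t z)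
    (normFactor ε q₀ 0 t z x * (Complex.I * lamOf q₀ z)) x := by
  have h1 := ((hasDerivAt_theta_x ε q₀ x t z).const_mul Complex.I).cexp
  have e : normFactor ε q₀ 0 t z = fun x => Complex.exp (Complex.I * theta ε q₀ x t z) :=
    funext fun x => by simp [normFactor]
  rw [e]
  exact h1

theorem IsJost.isNormalized (h : IsJost ε q₀ q a atBot 0 t z φ) (hz : z ≠ 0) :
    IsNormalized (fun x => q x t) a q₀ z (fun x => (normFactor ε q₀ 0 t z x • φ x) 0)
      (fun x => (normFactor ε q₀ 0 t z x • φ x) 1) := by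
  have h1 := isLax_iff.1 h.isLax
  have h2 := tendsto_pi_nhds.1 h.tendsto
  refine ⟨fun x => ?_, fun x => ?_, (h2 0).trans_eq (by simp [E]), (h2 1).trans_eq (by simp [E])⟩
  · refine ((hasDerivAt_normFactor_zero x).mul (h1 x).1).congr_deriv ?_
    simp only [Pi.smul_apply, smul_eq_mul, lamOf, kOf]
    field_simp
    ring
  · refine ((hasDerivAt_normFactor_zero x).mul (h1 x).2).congr_deriv ?_
    simp only [Pi.smul_apply, smul_eq_mul, lamOf, kOf]
    field_simp
    ring

theorem DecaysLeft.integrableOn_norm (h : DecaysLeft (fun x => q x t) a) (x : ℝ) :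
    IntegrableOn (fun y => ‖q y t - a‖) (Set.Iic x) :=
  (h.integrableOn 0 x).mono' (h.cont.sub continuous_const).norm.aestronglyMeasurable
    (Eventually.of_forall fun y => by
      rw [norm_norm]
      exact le_mul_of_one_le_left (norm_nonneg _) (by nlinarith [sq_nonneg (0 - y)]))

/-- For large `z` in the closed region `Im λ ≥ 0`. -/
def largePlus (q₀ : ℝ) : Filter ℂ := cocompact ℂ ⊓ 𝓟 (Splus q₀)

theorem eventually_largePlus (hq : 0 < q₀) (K : ℝ) :
    ∀ᶠ z in largePlus q₀, z ∈ Splus q₀ ∧ lamOf q₀ z ≠ 0 ∧ K ≤ ‖z‖ := by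
  have h1 : ∀ᶠ z : ℂ in cocompact ℂ, max K (2 * q₀) ≤ ‖z‖ :=
    tendsto_norm_cocompact_atTop.eventually_ge_atTop _
  rw [largePlus, eventually_inf_principal]
  filter_upwards [h1] with z hz hzS
  obtain ⟨hz1, hz2⟩ := max_le_iff.1 hz
  refine ⟨hzS, fun h0 => ?_, hz1⟩
  rw [lamOf, div_eq_zero_iff, or_iff_left two_ne_zero, ← eq_neg_iff_add_eq_zero] at h0
  have h3 := congrArg norm h0
  rw [norm_neg, norm_div, norm_pow, Complex.norm_real, Real.norm_of_nonneg hq.le,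
    eq_div_iff (by linarith)] at h3
  nlinarith

theorem tendsto_jost_atBot (h : DecaysLeft (fun x => q x t) a) (ε : ℝ) (hq : 0 < q₀)
    (ha : a * conj a = (q₀ : ℂ) ^ 2) (hu : ContDiff ℝ 1 fun x => q x t) (x : ℝ) :
    Tendsto (fun z => normFactor ε q₀ 0 t z x • jost ε q₀ q a atBot 0 t z x)
      (largePlus q₀) (𝓝 ![1, 0]) := by
  rw [Metric.tendsto_nhds]
  intro r hr
  obtain ⟨K, hK⟩ := exists_normalized_near ha hq hu h.integrableOn_norm x (half_pos hr)
  filter_upwards [eventually_largePlus hq K] with z ⟨hzS, hl, hz⟩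
  obtain ⟨h2, h3⟩ := hK z _ _ hz hzS.2
    ((isJost_jost (h.exists_isJost ε ha hzS hl)).isNormalized hzS.1)
  rw [dist_pi_lt_iff hr]
  intro i
  rw [dist_eq_norm]
  fin_cases i
  · exact h2.trans_lt (half_lt_self hr)
  · simpa using h3.trans_lt (half_lt_self hr)

theorem tendsto_jost_atTop (h : DecaysRight (fun x => q x t) a) (ε : ℝ) (hq : 0 < q₀)
    (ha : a * conj a = (q₀ : ℂ) ^ 2) (hu : ContDiff ℝ 1 fun x => q x t) (x : ℝ) :
    Tendsto (fun z => normFactor ε q₀ 1 t z x • jost ε q₀ q a atTop 1 t z x)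
      (largePlus q₀) (𝓝 ![0, 1]) := by
  have h' : DecaysLeft (fun x => (fun x t => -conj (q (-x) (-t))) x (-t)) (-conj a) := by
    simpa using h.reflect
  have ha' : -conj a * conj (-conj a) = (q₀ : ℂ) ^ 2 := by simpa [mul_comm] using ha
  have hu' : ContDiff ℝ 1 fun x => (fun x t => -conj (q (-x) (-t))) x (-t) := by
    have := (Complex.conjCLE.contDiff.comp (hu.comp contDiff_neg)).neg
    simpa [Function.comp_def] using this
  have h1 := tendsto_pi_nhds.1 (tendsto_jost_atBot
    (q := fun x t => -conj (q (-x) (-t))) h' ε hq ha' hu' (-x))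
  refine tendsto_pi_nhds.2 fun i => ?_
  have key : ∀ᶠ z in largePlus q₀, normFactor ε q₀ 1 t z x • jost ε q₀ q a atTop 1 t z x =
      normFactor ε q₀ 0 (-t) z (-x) •
        ![-jost ε q₀ (fun x t => -conj (q (-x) (-t))) (-conj a) atBot 0 (-t) z (-x) 1,
          jost ε q₀ (fun x t => -conj (q (-x) (-t))) (-conj a) atBot 0 (-t) z (-x) 0] := by
    filter_upwards [eventually_largePlus hq 0] with z ⟨hzS, hl, _⟩
    have h2 := (isJost_jost (DecaysLeft.exists_isJost (q := fun x t => -conj (q (-x) (-t)))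
      h' ε ha' hzS hl)).reflect
    rw [h2.jost_eq h.cont (jostRange_atTop_one hzS.2)]
    congr 1
    have e : theta ε q₀ (-x) (-t) z = -theta ε q₀ x t z := by
      simp only [theta]; push_cast; ring
    simp [normFactor, e]
  fin_cases i
  · refine ((h1 1).neg.congr' ?_).trans_eq (by simp)
    filter_upwards [key] with z hz
    simpa using (congrFun hz 0).symm
  · refine ((h1 0).congr' ?_).trans_eq (by simp)
    filter_upwards [key] with z hz
    simpa using (congrFun hz 1).symm

end Limits

/-! ### Gluing holomorphic functions, and Liouville's theorem with simple poles -/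

section ComplexAnalysis

variable {F : Type*} [NormedAddCommGroup F] [NormedSpace ℂ F]

/-- A function differentiable within each of two sets that cover a neighbourhood of `z` and meet
along a set accumulating at `z` is differentiable at `z`: both derivatives are determined by the
difference quotients on the intersection. -/
theorem differentiableAt_of_differentiableWithinAt {f : ℂ → F} {S T : Set ℂ} {z : ℂ}
    (hS : DifferentiableWithinAt ℂ f S z) (hT : DifferentiableWithinAt ℂ f T z)
    (hST : S ∪ T ∈ 𝓝 z) (hacc : ∃ᶠ w in 𝓝[≠] z, w ∈ S ∩ T) : DifferentiableAt ℂ f z := by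
  have h1 := hasDerivWithinAt_iff_tendsto_slope.1 hS.hasDerivWithinAt
  have h2 := hasDerivWithinAt_iff_tendsto_slope.1 hT.hasDerivWithinAt
  have : (𝓝[(S ∩ T) \ {z}] z).NeBot := by
    have := accPt_iff_frequently_nhdsNE.2 hacc
    rwa [accPt_principal_iff_nhdsWithin] at this
  have e := tendsto_nhds_unique
    (h1.mono_left (nhdsWithin_mono z (Set.sdiff_subset_sdiff_left Set.inter_subset_left)))
    (h2.mono_left (nhdsWithin_mono z (Set.sdiff_subset_sdiff_left Set.inter_subset_right)))
  have h3 := hT.hasDerivWithinAt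
  rw [← e] at h3
  exact ((hS.hasDerivWithinAt.union h3).hasDerivAt hST).differentiableAt

variable [CompleteSpace F]

/-- Liouville's theorem for a function with removable singularities. -/
theorem eq_zero_of_tendsto_cocompact {g : ℂ → F} (B : Finset ℂ)
    (hd : ∀ z ∉ B, DifferentiableAt ℂ g z)
    (hB : ∀ c ∈ B, Tendsto (fun z => (z - c) • g z) (𝓝[≠] c) (𝓝 0))
    (h0 : Tendsto g (cocompact ℂ) (𝓝 0)) {z : ℂ} (hz : z ∉ B) : g z = 0 := by
  classical
  set G : ℂ → F := fun z => if z ∈ B then limUnder (𝓝[≠] z) g else g z with hG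
  have hnear : ∀ c, ((B.erase c : Finset ℂ) : Set ℂ)ᶜ ∈ 𝓝 c := fun c =>
    (B.erase c).finite_toSet.isClosed.isOpen_compl.mem_nhds (by simp)
  have hGd : Differentiable ℂ G := fun c => by
    by_cases hc : c ∈ B
    · have ho : (fun z => g z - g c) =o[𝓝[≠] c] fun z => (z - c)⁻¹ := by
        have h1 : Tendsto (fun z => (z - c) • (g z - g c)) (𝓝[≠] c) (𝓝 0) := by
          have h2 : Tendsto (fun z : ℂ => (z - c) • g c) (𝓝[≠] c) (𝓝 0) := by
            have : ContinuousAt (fun z : ℂ => (z - c) • g c) c := by fun_prop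
            simpa using this.tendsto.mono_left (nhdsWithin_le_nhds (s := {c}ᶜ))
          simpa [smul_sub] using (hB c hc).sub h2
        have h3 := (Asymptotics.isBigO_refl (fun z : ℂ => (z - c)⁻¹) (𝓝[≠] c)).smul_isLittleO
          ((Asymptotics.isLittleO_one_iff ℂ).2 h1)
        refine h3.congr' ?_ (Eventually.of_forall fun z => by simp)
        filter_upwards [self_mem_nhdsWithin] with z hz
        exact inv_smul_smul₀ (sub_ne_zero.2 hz) _
      have h2 := Complex.differentiableOn_update_limUnder_of_isLittleO (hnear c) (fun z hz => by
        refine (hd z fun hzB => hz.1 ?_).differentiableWithinAt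
        simpa using ⟨hzB, hz.2⟩) ho
      refine (h2.differentiableAt (hnear c)).congr_of_eventuallyEq ?_
      filter_upwards [hnear c] with z hz
      rcases eq_or_ne z c with rfl | hzc
      · simp [hG, hc]
      · have : z ∉ B := fun hzB => hz (by simpa using ⟨hzB, hzc⟩)
        simp [hG, this, hzc]
    · refine (hd c hc).congr_of_eventuallyEq ?_
      filter_upwards [B.finite_toSet.isClosed.isOpen_compl.mem_nhds hc] with z hz
      exact if_neg hz
  have hG0 : Tendsto G (cocompact ℂ) (𝓝 0) := by
    refine h0.congr' ?_
    filter_upwards [B.finite_toSet.isCompact.compl_mem_cocompact] with z hz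
    exact (if_neg hz).symm
  have := hGd.apply_eq_of_tendsto_cocompact z hG0
  simpa only [hG, if_neg hz] using this

/-- A function with simple poles and a limit at `∞` is the sum of its principal parts and of this
limit. -/
theorem eq_add_sum_of_tendsto {f : ℂ → F} {B : Finset ℂ} {r : ℂ → F} {A : F}
    (hd : ∀ z ∉ B, DifferentiableAt ℂ f z)
    (hr : ∀ c ∈ B, Tendsto (fun z => (z - c) • f z) (𝓝[≠] c) (𝓝 (r c)))
    (hA : Tendsto f (cocompact ℂ) (𝓝 A)) {z : ℂ} (hz : z ∉ B) :
    f z = A + ∑ c ∈ B, (z - c)⁻¹ • r c := by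
  classical
  have hinv : ∀ c : ℂ, ∀ w, w ≠ c → DifferentiableAt ℂ (fun z => (z - c)⁻¹ • r c) w :=
    fun c w hw => ((differentiableAt_id.sub_const c).inv (sub_ne_zero.2 hw)).smul_const _
  have key := eq_zero_of_tendsto_cocompact (g := fun z => f z - (A + ∑ c ∈ B, (z - c)⁻¹ • r c)) B
    (fun w hw => (hd w hw).sub (DifferentiableAt.const_add _ (DifferentiableAt.fun_sum fun c hc =>
      hinv c w fun h => hw (h ▸ hc)))) (fun c hc => ?_) ?_ hz
  · exact sub_eq_zero.1 key
  · have h1 : Tendsto (fun z => (z - c) • (A + ∑ c' ∈ B.erase c, (z - c')⁻¹ • r c')) (𝓝[≠] c)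
        (𝓝 0) := by
      have : ContinuousAt (fun z => (z - c) • (A + ∑ c' ∈ B.erase c, (z - c')⁻¹ • r c')) c := by
        refine ContinuousAt.smul (by fun_prop) ((continuousAt_const).add ?_)
        exact tendsto_finsetSum _ fun c' hc' => (hinv c' c (Finset.ne_of_mem_erase hc').symm).continuousAt
      simpa using this.tendsto.mono_left (nhdsWithin_le_nhds (s := {c}ᶜ))
    have h2 := ((hr c hc).sub_const (r c)).sub h1
    rw [sub_self, sub_zero] at h2
    refine h2.congr' ?_
    filter_upwards [self_mem_nhdsWithin] with w hw
    rw [← Finset.add_sum_erase B _ hc]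
    simp only [smul_sub, smul_add]
    rw [smul_inv_smul₀ (sub_ne_zero.2 hw)]
    abel
  · have h1 : Tendsto (fun z => A + ∑ c ∈ B, (z - c)⁻¹ • r c) (cocompact ℂ)
        (𝓝 (A + ∑ c ∈ B, (0 : ℂ) • r c)) := by
      refine tendsto_const_nhds.add (tendsto_finsetSum _ fun c _ => Tendsto.smul_const ?_ _)
      refine tendsto_inv₀_cobounded.comp ?_
      rw [← Metric.cobounded_eq_cocompact]
      simp
    simpa using hA.sub h1

end ComplexAnalysis

/-! ### The Wronskian `γ s₂₂` -/

section Flip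

variable {ε q₀ t : ℝ} {q : ℝ → ℝ → ℂ} {qm qp a z : ℂ} {φ : ℝ → Fin 2 → ℂ}

/-- The antilinear map `v ↦ (-v₁*, v₀*)`, which implements the symmetry `z ↦ z*`. -/
def flipConj (v : Fin 2 → ℂ) : Fin 2 → ℂ := ![-conj (v 1), conj (v 0)]

theorem flipConj_smul (c : ℂ) (v : Fin 2 → ℂ) : flipConj (c • v) = conj c • flipConj v := by
  funext i
  fin_cases i <;> simp [flipConj]

theorem wr_flipConj (u v : Fin 2 → ℂ) : wr (flipConj u) (flipConj v) = conj (wr u v) := by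
  simp [wr, flipConj]
  ring

theorem continuous_flipConj : Continuous flipConj := by
  refine continuous_pi fun i => ?_
  fin_cases i
  · exact (Complex.continuous_conj.comp (continuous_apply 1)).neg
  · exact Complex.continuous_conj.comp (continuous_apply 0)

theorem conj_neg_div : conj (-(q₀ : ℂ) ^ 2 / z) = -(q₀ : ℂ) ^ 2 / conj z := by simp

theorem lamOf_flip (hq : (q₀ : ℂ) ≠ 0) (hz : z ≠ 0) :
    lamOf q₀ (-(q₀ : ℂ) ^ 2 / conj z) = -conj (lamOf q₀ z) := by
  rw [← conj_neg_div, lamOf_conj, lamOf_neg_div hq hz, map_neg]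

theorem flip_mem_Splus (hq : (q₀ : ℂ) ≠ 0) (hz : z ∈ Splus q₀) :
    -(q₀ : ℂ) ^ 2 / conj z ∈ Splus q₀ :=
  ⟨neg_div_ne_zero hq ((map_ne_zero _).2 hz.1), by rw [lamOf_flip hq hz.1]; simpa using hz.2⟩

namespace IsPotential

theorem jostM_zero_flip (h : IsPotential q₀ qm qp q t) (ε : ℝ) (hz : z ∈ Splus q₀)
    (hl : lamOf q₀ z ≠ 0) : jostM ε q₀ qm q 0 t z = fun x =>
      (-(Complex.I * conj qm / z)) • flipConj (jostM ε q₀ qm q 0 t (-(q₀ : ℂ) ^ 2 / conj z) x) := by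
  have h1 := h.isJost_left_zero ε (flip_mem_Splus h.ne_zero hz)
    (by rwa [lamOf_flip h.ne_zero hz.1, neg_ne_zero, map_ne_zero])
  rw [← conj_neg_div] at h1 ⊢
  exact (h1.conj_zero.col_zero h.ne_zero hz.1 h.qm_mul).jost_eq h.left.cont
    (jostRange_atBot_zero hz.2)

theorem jostP_one_flip (h : IsPotential q₀ qm qp q t) (ε : ℝ) (hz : z ∈ Splus q₀)
    (hl : lamOf q₀ z ≠ 0) : jostP ε q₀ qp q 1 t z = fun x =>
      (Complex.I * qp / z) • flipConj (jostP ε q₀ qp q 1 t (-(q₀ : ℂ) ^ 2 / conj z) x) := by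
  have h1 := h.isJost_right_one ε (flip_mem_Splus h.ne_zero hz)
    (by rwa [lamOf_flip h.ne_zero hz.1, neg_ne_zero, map_ne_zero])
  have h2 := (h1.col_zero h.ne_zero ((map_ne_zero _).2 hz.1) h.qp_mul).conj_zero
  rw [jostP, h2.jost_eq h.right.cont (jostRange_atTop_one hz.2)]
  funext x
  refine (flipConj_smul _ _).trans ?_
  simp [neg_div]

/-- The second column from the first one, for `Im λ ≤ 0`. -/
theorem jostM_one_conj (h : IsPotential q₀ qm qp q t) (ε : ℝ) (hz : z ≠ 0)
    (hi : (lamOf q₀ z).im ≤ 0) (hl : lamOf q₀ z ≠ 0) : jostM ε q₀ qm q 1 t z = fun x =>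
      flipConj (jostM ε q₀ qm q 0 t (conj z) x) := by
  have h1 := h.isJost_left_zero (z := conj z) ε
    ⟨(map_ne_zero _).2 hz, by rw [lamOf_conj]; simpa using hi⟩ (by rwa [lamOf_conj, map_ne_zero])
  exact h1.conj_zero.jost_eq h.left.cont (jostRange_atBot_one hi)

end IsPotential

/-- The Wronskian `Wr(φ_{-,1}, φ_{+,2}) = γ s₂₂`. -/
def wrOf (ε q₀ : ℝ) (qm qp : ℂ) (q : ℝ → ℝ → ℂ) (t : ℝ) (z : ℂ) : ℂ :=
  wr (jostM ε q₀ qm q 0 t z 0) (jostP ε q₀ qp q 1 t z 0)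

namespace IsPotential

theorem exists_wrOf_eq (h : IsPotential q₀ qm qp q t) (ε : ℝ) :
    ∃ w : ℂ → ℂ, DifferentiableOn ℂ w (Splus q₀) ∧
      ∀ z ∈ Splus q₀, lamOf q₀ z ≠ 0 → wrOf ε q₀ qm qp q t z = w z := by
  obtain ⟨F, hF, hF'⟩ := h.left.exists_differentiableOn ε h.pos.ne' h.qm_mul 0
  obtain ⟨G, hG, hG'⟩ := h.right.exists_differentiableOn ε h.pos.ne' h.qp_mul 0
  rw [differentiableOn_pi] at hF hG
  refine ⟨fun z => wr (F z) (G z), ((hF 0).mul (hG 1)).sub ((hF 1).mul (hG 0)), fun z hz hl => ?_⟩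
  rw [wrOf, jostM, jostP, hF' z hz hl, hG' z hz hl]

theorem wrOf_flip (h : IsPotential q₀ qm qp q t) (ε : ℝ) (hz : z ∈ Splus q₀)
    (hl : lamOf q₀ z ≠ 0) : wrOf ε q₀ qm qp q t z =
      conj qm * qp / z ^ 2 * conj (wrOf ε q₀ qm qp q t (-(q₀ : ℂ) ^ 2 / conj z)) := by
  rw [wrOf, wrOf, h.jostM_zero_flip ε hz hl, h.jostP_one_flip ε hz hl, wr_smul_left, wr_smul_right,
    wr_flipConj]
  generalize conj (wr _ _) = y
  have := hz.1
  field_simp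
  linear_combination (-qp * conj qm * y) * Complex.I_sq

theorem tendsto_wrOf (h : IsPotential q₀ qm qp q t) (ε : ℝ) (hu : ContDiff ℝ 1 fun x => q x t) :
    Tendsto (wrOf ε q₀ qm qp q t) (largePlus q₀) (𝓝 1) := by
  have h1 := tendsto_pi_nhds.1 (tendsto_jost_atBot h.left ε h.pos h.qm_mul hu 0)
  have h2 := tendsto_pi_nhds.1 (tendsto_jost_atTop h.right ε h.pos h.qp_mul hu 0)
  refine ((((h1 0).mul (h2 1)).sub ((h1 1).mul (h2 0))).congr fun z => ?_).trans_eq (by simp)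
  have e : normFactor ε q₀ 0 t z 0 * normFactor ε q₀ 1 t z 0 = 1 := by
    rw [normFactor, normFactor, ← Complex.exp_add]
    simp
  simp only [Pi.smul_apply, smul_eq_mul, wrOf, wr, jostM, jostP]
  linear_combination (jost ε q₀ q qm atBot 0 t z 0 0 * jost ε q₀ q qp atTop 1 t z 0 1 -
    jost ε q₀ q qm atBot 0 t z 0 1 * jost ε q₀ q qp atTop 1 t z 0 0) * e

/-- Where `s₁₂ = 0`, `φ_{-,2}` is a multiple of `φ_{+,2}`. -/
theorem jostM_one_eq_smul (h : IsPotential q₀ qm qp q t) (hz : z ∈ Sigma₁ q₀)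
    (hs : s12 ε q₀ qm qp q t z = 0) : wrOf ε q₀ qm qp q t z ≠ 0 ∧ ∀ x,
      jostM ε q₀ qm q 1 t z x =
        (gam q₀ z / wrOf ε q₀ qm qp q t z) • jostP ε q₀ qp q 1 t z x := by
  have hi := im_lamOf_of_mem_Sigma hz
  have hl := lamOf_ne_zero_of_mem_Sigma hz
  have hS := mem_Splus_of_mem_Sigma hz
  have hg := (gam_ne_zero_iff hz.2.1).1 hl
  have hR := h.isJost_right_one ε hS hl
  have hL := h.isJost_left_zero ε hS hl
  have hM := (h.jostM_one_eq ε hz.2.1 hi.le hl).1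
  have h0 : jostP ε q₀ qp q 1 t z 0 ≠ 0 := fun h0 => by
    have h1 := hR.tendsto
    simp only [hR.isLax.eq_zero h.right.cont h0, smul_zero] at h1
    exact E_col_ne_zero qp z 1 (tendsto_nhds_unique h1 tendsto_const_nhds)
  rw [s12, div_eq_zero_iff, or_iff_left hg] at hs
  obtain ⟨c, hc⟩ := hR.isLax.exists_eq_smul h.right.cont hM.isLax h0 hs
  have h1 := wr_jost_jost h.qm_mul hz.2.1 hL hM 0
  rw [hc, wr_smul_right] at h1
  change c * wrOf ε q₀ qm qp q t z = _ at h1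
  have hw : wrOf ε q₀ qm qp q t z ≠ 0 := fun h2 => hg (by rw [← h1, h2, mul_zero])
  exact ⟨hw, fun x => by rw [hc, ← h1, mul_div_cancel_right₀ _ hw]⟩

theorem wrOf_mul_wrOf (h : IsPotential q₀ qm qp q t) (hz : z ∈ Sigma₁ q₀)
    (hs : s12 ε q₀ qm qp q t z = 0) : conj qp * qm / z ^ 2 *
      (wrOf ε q₀ qm qp q t z * wrOf ε q₀ qm qp q t (-(q₀ : ℂ) ^ 2 / z)) = gam q₀ z ^ 2 := by
  have hi := im_lamOf_of_mem_Sigma hz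
  have hl := lamOf_ne_zero_of_mem_Sigma hz
  have hS := mem_Splus_of_mem_Sigma hz
  have hR := h.isJost_right_one ε hS hl
  obtain ⟨hw, hc⟩ := h.jostM_one_eq_smul hz hs
  obtain ⟨hM, hM'⟩ := h.jostM_one_eq ε hz.2.1 hi.le hl
  obtain ⟨hP, hP'⟩ := h.jostP_zero_eq ε hz.2.1 hi.le hl
  have h1 := wr_jost_jost h.qp_mul hz.2.1 hP hR 0
  have h2 := congrArg (wr (jostP ε q₀ qp q 0 t z 0)) (hc 0)
  rw [wr_smul_right, h1, hM', hP', wr_smul_left, wr_smul_right, wr_swap] at h2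
  change _ * (_ * -wrOf ε q₀ qm qp q t (-(q₀ : ℂ) ^ 2 / z)) = _ at h2
  have h3 : gam q₀ z / wrOf ε q₀ qm qp q t z * gam q₀ z * wrOf ε q₀ qm qp q t z = gam q₀ z ^ 2 := by
    field_simp
  rw [← h3, ← h2]
  generalize wrOf ε q₀ qm qp q t (-(q₀ : ℂ) ^ 2 / z) = y
  have := hz.2.1
  field_simp
  linear_combination (qm * conj qp * y) * Complex.I_sq

end IsPotential

/-- The set `Im λ = 0` has no isolated points. -/
theorem frequently_im_lamOf_eq_zero (hz : z ≠ 0) (hi : (lamOf q₀ z).im = 0) :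
    ∃ᶠ w in 𝓝[≠] z, w ≠ 0 ∧ (lamOf q₀ w).im = 0 := by
  have key : ∀ γ : ℝ → ℂ, ∀ d : ℂ, γ 0 = z → HasDerivAt γ d 0 → d ≠ 0 →
      (∀ s, γ s ≠ 0 → (‖γ s‖ ^ 2 - q₀ ^ 2) * (γ s).im = 0) →
      ∃ᶠ w in 𝓝[≠] z, w ≠ 0 ∧ (lamOf q₀ w).im = 0 := fun γ d h0 hd hd0 h => by
    have h1 := hd.tendsto_nhdsNE hd0
    rw [h0] at h1
    have h2 : ∀ᶠ s in 𝓝[≠] (0 : ℝ), γ s ≠ 0 :=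
      nhdsWithin_le_nhds (hd.continuousAt.eventually_ne (h0 ▸ hz))
    refine h1.frequently (h2.mono fun s hs => ⟨hs, ?_⟩).frequently
    rw [im_lamOf q₀ hs, h s hs, zero_div]
  rw [im_lamOf q₀ hz, div_eq_zero_iff, or_iff_left (by have := norm_pos_iff.2 hz; positivity),
    mul_eq_zero] at hi
  rcases hi with hi | hi
  · refine key (fun s => z * Complex.exp (Complex.I * s)) (z * Complex.I) (by simp) ?_
      (mul_ne_zero hz Complex.I_ne_zero) fun s _ => ?_
    · simpa using ((Complex.ofRealCLM.hasDerivAt (x := (0 : ℝ))).const_mul Complex.I).cexp.const_mul z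
    · rw [norm_mul, mul_comm Complex.I, Complex.norm_exp_ofReal_mul_I, mul_one, hi, zero_mul]
  · refine key (fun s => z + s) 1 (by simp) ?_ one_ne_zero fun s _ => by simp [hi]
    exact (Complex.ofRealCLM.hasDerivAt (x := (0 : ℝ))).const_add z

theorem mem_Sigma_of_im_eq_zero (hq : 0 < q₀) (hz : z ≠ 0) (hi : (lamOf q₀ z).im = 0) (hl : lamOf q₀ z ≠ 0) :
    z ∈ Sigma₁ q₀ := by
  have hg := (gam_ne_zero_iff hz).1 hl
  have h1 : ∀ c : ℂ, c ^ 2 = -(q₀ : ℂ) ^ 2 → z ≠ c := fun c hc e => hg (by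
    rw [gam, e, hc, div_neg, div_self, add_neg_cancel]
    rw [← neg_ne_zero, ← hc, ← e]
    exact pow_ne_zero 2 hz)
  refine ⟨?_, hz, h1 _ (by rw [mul_pow, Complex.I_sq]; ring),
    h1 _ (by rw [neg_sq, mul_pow, Complex.I_sq]; ring)⟩
  rw [im_lamOf q₀ hz, div_eq_zero_iff, or_iff_left (by have := norm_pos_iff.2 hz; positivity),
    mul_eq_zero] at hi
  exact hi.symm.imp_right fun hi => (sq_eq_sq₀ (norm_nonneg z) hq.le).1 (sub_eq_zero.1 hi)

/-- At a branch point, `γ s₂₂` vanishes at most to first order. -/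
theorem isBigO_of_branch {w : ℂ → ℂ} {c κ : ℂ} (hq : 0 < q₀) (hc : c ^ 2 = -(q₀ : ℂ) ^ 2)
    (hw : DifferentiableWithinAt ℂ w (Splus q₀) c)
    (hww : ∀ z ∈ Sigma₁ q₀, κ / z ^ 2 * (w z * w (-(q₀ : ℂ) ^ 2 / z)) = gam q₀ z ^ 2) :
    (fun z => z - c) =O[𝓝[Splus q₀] c] w := by
  have hc0 : c ≠ 0 := fun h0 => by
    rw [h0] at hc
    simp [hq.ne'] at hc
  have hlc : lamOf q₀ c = 0 := by
    rw [lamOf]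
    field_simp
    rw [hc]
    simp
  by_cases hwc : w c = 0
  swap
  · have h1 : ∀ᶠ z in 𝓝[Splus q₀] c, ‖w c‖ / 2 < ‖w z‖ :=
      hw.continuousWithinAt.norm.eventually_const_lt (half_lt_self (norm_pos_iff.2 hwc))
    have h2 : ∀ᶠ z in 𝓝[Splus q₀] c, ‖z - c‖ < 1 := nhdsWithin_le_nhds (by
      filter_upwards [Metric.ball_mem_nhds c one_pos] with z hz
      rwa [← dist_eq_norm])
    refine Asymptotics.IsBigO.of_bound (2 / ‖w c‖) ?_
    filter_upwards [h1, h2] with z h3 h4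
    have := norm_pos_iff.2 hwc
    rw [div_mul_eq_mul_div, le_div_iff₀ this]
    nlinarith
  have hd := hw.hasDerivWithinAt
  set d := derivWithin w (Splus q₀) c with hdd
  by_cases hd0 : d = 0
  swap
  · have := (HasDerivAtFilter.isTheta_sub hd hd0).isBigO_symm
    simpa [hwc, Function.comp_def] using this
  exfalso
  have h1 : w =o[𝓝[Splus q₀] c] fun z => z - c := by
    have := hasDerivWithinAt_iff_isLittleO.1 hd
    simpa [hwc, hd0] using this
  have hne : (𝓝[Sigma₁ q₀] c).NeBot := by
    rw [← mem_closure_iff_nhdsWithin_neBot, mem_closure_iff_frequently]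
    have h2 := frequently_im_lamOf_eq_zero (q₀ := q₀) hc0 (by rw [hlc, Complex.zero_im])
    have h3 : ∀ᶠ z in 𝓝[≠] c, z ≠ c ∧ (z = c ∨ z = 0 ∨ lamOf q₀ z ≠ 0) := by
      filter_upwards [self_mem_nhdsWithin, nhdsWithin_le_nhds (eventually_lamOf_ne q₀ c)]
        with z h4 h5 using ⟨h4, h5⟩
    refine ((h2.and_eventually h3).filter_mono nhdsWithin_le_nhds).mono fun z hz => ?_
    obtain ⟨⟨hz0, hzi⟩, hzc, hor⟩ := hz
    exact mem_Sigma_of_im_eq_zero hq hz0 hzi ((hor.resolve_left hzc).resolve_left hz0)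
  have hsub : 𝓝[Sigma₁ q₀] c ≤ 𝓝[Splus q₀] c :=
    nhdsWithin_mono c fun z => mem_Splus_of_mem_Sigma
  have hσc : ContinuousAt (fun z => -(q₀ : ℂ) ^ 2 / z) c := by fun_prop (disch := assumption)
  have hσ : Tendsto (fun z => -(q₀ : ℂ) ^ 2 / z) (𝓝[Sigma₁ q₀] c) (𝓝[Splus q₀] c) := by
    refine tendsto_nhdsWithin_iff.2 ⟨?_, ?_⟩
    · have h2 := hσc.tendsto.mono_left (nhdsWithin_le_nhds (s := Sigma₁ q₀))
      have e : -(q₀ : ℂ) ^ 2 / c = c := by rw [← hc, sq, mul_div_cancel_right₀ _ hc0]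
      rwa [e] at h2
    · filter_upwards [self_mem_nhdsWithin] with z hz
      exact neg_div_mem_Splus (by exact_mod_cast hq.ne') hz.2.1 (im_lamOf_of_mem_Sigma hz).le
  have h2 : (fun z => w (-(q₀ : ℂ) ^ 2 / z)) =o[𝓝[Sigma₁ q₀] c] fun z => z - c := by
    refine (h1.comp_tendsto hσ).trans_isBigO ?_
    have h3 : (fun z => -c / z) =O[𝓝[Sigma₁ q₀] c] fun _ => (1 : ℂ) :=
      (((by fun_prop (disch := assumption) : ContinuousAt (fun z => -c / z) c)).tendsto.mono_left
        nhdsWithin_le_nhds).isBigO_one ℂ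
    refine (h3.mul (Asymptotics.isBigO_refl (fun z => z - c) _)).congr' ?_ ?_
    · filter_upwards [self_mem_nhdsWithin] with z hz
      have := hz.2.1
      simp only [Function.comp]
      rw [← hc]
      field_simp
      ring
    · exact Eventually.of_forall fun z => one_mul _
  have h3 : (fun z => κ / z ^ 2) =O[𝓝[Sigma₁ q₀] c] fun _ => (1 : ℂ) := by
    have hc2 := pow_ne_zero 2 hc0
    exact ((by fun_prop (disch := assumption) : ContinuousAt (fun z => κ / z ^ 2) c).tendsto.mono_left
        nhdsWithin_le_nhds).isBigO_one ℂ
  have h4 := (h3.mul_isLittleO ((h1.mono hsub).mul h2)).tendsto_div_nhds_zero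
  have hc2 : c ^ 2 ≠ 0 := pow_ne_zero 2 hc0
  have h5 : Tendsto (fun z => ((z + c) / z ^ 2) ^ 2) (𝓝[Sigma₁ q₀] c) (𝓝 (((c + c) / c ^ 2) ^ 2)) :=
    (by fun_prop (disch := assumption) : ContinuousAt (fun z => ((z + c) / z ^ 2) ^ 2) c).tendsto.mono_left
      nhdsWithin_le_nhds
  have h6 := tendsto_nhds_unique (h4.congr' ?_) h5
  · rw [eq_comm, sq_eq_zero_iff, div_eq_zero_iff, or_iff_left hc2] at h6
    exact hc0 (by linear_combination h6 / 2)
  · filter_upwards [self_mem_nhdsWithin] with z hz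
    have hz0 := hz.2.1
    have hzc : z - c ≠ 0 := fun h => by
      have := lamOf_ne_zero_of_mem_Sigma hz
      rw [sub_eq_zero.1 h] at this
      exact this hlc
    rw [hww z hz, gam]
    have e : (q₀ : ℂ) ^ 2 = -c ^ 2 := by rw [hc, neg_neg]
    rw [e]
    field_simp
    ring

end Flip

/-! ### The Riemann–Hilbert problem -/

section RiemannHilbert

variable {ε q₀ t : ℝ} {q : ℝ → ℝ → ℂ} {qm qp z : ℂ}

/-- The closed region `Im λ ≤ 0`. -/
def Sminus (q₀ : ℝ) : Set ℂ := {z | z ≠ 0 ∧ (lamOf q₀ z).im ≤ 0}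

/-- The second column of the sectionally meromorphic matrix: `φ_{-,2} e^{-iθ}` for `Im λ ≤ 0` and
`φ_{+,2} e^{-iθ} / s₂₂` for `Im λ > 0`. -/
def rhCol (ε q₀ : ℝ) (qm qp : ℂ) (q : ℝ → ℝ → ℂ) (t x : ℝ) (z : ℂ) : Fin 2 → ℂ :=
  if 0 < (lamOf q₀ z).im then
    normFactor ε q₀ 1 t z x • ((gam q₀ z / wrOf ε q₀ qm qp q t z) • jostP ε q₀ qp q 1 t z x)
  else normFactor ε q₀ 1 t z x • jostM ε q₀ qm q 1 t z x

theorem tendsto_of_sides {F : Type*} {f : ℂ → F} {l : Filter ℂ} {y : Filter F}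
    (h0 : ∀ᶠ z in l, z ≠ 0) (hp : Tendsto f (l ⊓ 𝓟 (Splus q₀)) y)
    (hm : Tendsto f (l ⊓ 𝓟 (Sminus q₀)) y) : Tendsto f l y := by
  refine (tendsto_sup.2 ⟨hp, hm⟩).mono_left ?_
  rw [← inf_sup_left, sup_principal, le_inf_iff]
  refine ⟨le_rfl, le_principal_iff.2 ?_⟩
  filter_upwards [h0] with z hz
  exact (le_total 0 (lamOf q₀ z).im).imp (fun h => ⟨hz, h⟩) fun h => ⟨hz, h⟩

theorem differentiableAt_normFactor (j : Fin 2) (x : ℝ) (hz : z ≠ 0) :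
    DifferentiableAt ℂ (fun z => normFactor ε q₀ j t z x) z :=
  (((differentiableAt_theta x hz).const_mul Complex.I).const_mul _).cexp

theorem differentiableAt_gam (hz : z ≠ 0) : DifferentiableAt ℂ (gam q₀) z := by
  unfold gam
  have := pow_ne_zero 2 hz
  fun_prop (disch := assumption)

theorem rhCol_of_nonpos (x : ℝ) (hz : (lamOf q₀ z).im ≤ 0) : rhCol ε q₀ qm qp q t x z =
    normFactor ε q₀ 1 t z x • jostM ε q₀ qm q 1 t z x := if_neg hz.not_gt

namespace IsPotential

theorem rhCol_of_nonneg (h : IsPotential q₀ qm qp q t)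
    (hs : ∀ z ∈ Sigma₁ q₀, s12 ε q₀ qm qp q t z = 0) (x : ℝ) (hz : z ∈ Splus q₀)
    (hl : lamOf q₀ z ≠ 0) : rhCol ε q₀ qm qp q t x z = normFactor ε q₀ 1 t z x •
      ((gam q₀ z / wrOf ε q₀ qm qp q t z) • jostP ε q₀ qp q 1 t z x) := by
  rcases hz.2.lt_or_eq with hi | hi
  · exact if_pos hi
  · have h1 := mem_Sigma_of_im_eq_zero h.pos hz.1 hi.symm hl
    rw [rhCol_of_nonpos x hi.ge, (h.jostM_one_eq_smul h1 (hs z h1)).2 x]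

/-- The boundary values of `rhCol` from both sides are differentiable. -/
theorem exists_sides (h : IsPotential q₀ qm qp q t)
    (hs : ∀ z ∈ Sigma₁ q₀, s12 ε q₀ qm qp q t z = 0) (x : ℝ) :
    ∃ w : ℂ → ℂ, ∃ G N : ℂ → Fin 2 → ℂ, DifferentiableOn ℂ w (Splus q₀) ∧
      DifferentiableOn ℂ G (Splus q₀) ∧ DifferentiableOn ℂ N (Sminus q₀) ∧
      (∀ z ∈ Splus q₀, lamOf q₀ z ≠ 0 → wrOf ε q₀ qm qp q t z = w z ∧
        rhCol ε q₀ qm qp q t x z = (gam q₀ z / w z) • G z) ∧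
      ∀ z ∈ Sminus q₀, lamOf q₀ z ≠ 0 → rhCol ε q₀ qm qp q t x z = N z := by
  obtain ⟨w, hw, hw'⟩ := h.exists_wrOf_eq ε
  obtain ⟨F, hF, hF'⟩ := h.left.exists_differentiableOn ε h.pos.ne' h.qm_mul x
  obtain ⟨G, hG, hG'⟩ := h.right.exists_differentiableOn ε h.pos.ne' h.qp_mul x
  refine ⟨w, fun z => normFactor ε q₀ 1 t z x • G z, fun z => normFactor ε q₀ 1 t z x •
    (-(Complex.I * qm / z)) • F (-(q₀ : ℂ) ^ 2 / z), hw, fun z hz =>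
      (differentiableAt_normFactor 1 x hz.1).differentiableWithinAt.smul (hG z hz), fun z hz => ?_,
      fun z hz hl => ⟨hw' z hz hl, ?_⟩, fun z hz hl => ?_⟩
  · have h1 : DifferentiableWithinAt ℂ (fun z => F (-(q₀ : ℂ) ^ 2 / z)) (Sminus q₀) z := by
      refine (hF _ (neg_div_mem_Splus h.ne_zero hz.1 hz.2)).comp z
        (((differentiableAt_const _).div differentiableAt_id hz.1).differentiableWithinAt)
        fun y hy => neg_div_mem_Splus h.ne_zero hy.1 hy.2
    have h0 := hz.1
    have h2 : DifferentiableAt ℂ (fun z => -(Complex.I * qm / z)) z := by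
      fun_prop (disch := assumption)
    exact (differentiableAt_normFactor 1 x hz.1).differentiableWithinAt.smul
      (h2.differentiableWithinAt.smul h1)
  · rw [h.rhCol_of_nonneg hs x hz hl, hw' z hz hl, jostP, hG' z hz hl, smul_comm]
  · rw [rhCol_of_nonpos x hz.2, (h.jostM_one_eq ε hz.1 hz.2 hl).2]
    simp only [jostM]
    rw [hF' _ (neg_div_mem_Splus h.ne_zero hz.1 hz.2) (by rwa [lamOf_neg_div h.ne_zero hz.1, neg_ne_zero])]

theorem differentiableAt_rhCol (h : IsPotential q₀ qm qp q t)
    (hs : ∀ z ∈ Sigma₁ q₀, s12 ε q₀ qm qp q t z = 0) (x : ℝ) (hz : z ≠ 0) (hl : lamOf q₀ z ≠ 0)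
    (hw : 0 < (lamOf q₀ z).im → wrOf ε q₀ qm qp q t z ≠ 0) :
    DifferentiableAt ℂ (rhCol ε q₀ qm qp q t x) z := by
  obtain ⟨w, G, N, hwd, hG, hN, hp, hm⟩ := h.exists_sides hs x
  have hlc : ContinuousAt (lamOf q₀) z := (IsWeighted.differentiableAt_lamOf hz).continuousAt
  have hne : ∀ᶠ y in 𝓝 z, lamOf q₀ y ≠ 0 := hlc.eventually_ne hl
  have hP : z ∈ Splus q₀ → DifferentiableWithinAt ℂ (rhCol ε q₀ qm qp q t x) (Splus q₀) z :=
    fun hS => by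
      have hw0 : w z ≠ 0 := by
        rw [← (hp z hS hl).1]
        rcases hS.2.lt_or_eq with hi | hi
        · exact hw hi
        · have h1 := mem_Sigma_of_im_eq_zero h.pos hz hi.symm hl
          exact (h.jostM_one_eq_smul h1 (hs z h1)).1
      refine DifferentiableWithinAt.congr_of_eventuallyEq_of_mem
        (((differentiableAt_gam (q₀ := q₀) hz).differentiableWithinAt.div (hwd z hS) hw0).smul (hG z hS)) ?_ hS
      filter_upwards [self_mem_nhdsWithin, nhdsWithin_le_nhds hne] with y hy hly
      exact (hp y hy hly).2
  have hM : z ∈ Sminus q₀ → DifferentiableWithinAt ℂ (rhCol ε q₀ qm qp q t x) (Sminus q₀) z :=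
    fun hS => by
      refine (hN z hS).congr_of_eventuallyEq_of_mem ?_ hS
      filter_upwards [self_mem_nhdsWithin, nhdsWithin_le_nhds hne] with y hy hly
      exact hm y hy hly
  have h0 : ∀ᶠ y in 𝓝 z, y ≠ 0 := isOpen_ne.mem_nhds hz
  rcases lt_trichotomy (lamOf q₀ z).im 0 with hi | hi | hi
  · refine (hM ⟨hz, hi.le⟩).differentiableAt ?_
    filter_upwards [h0, (Complex.continuous_im.continuousAt.comp hlc).eventually_lt_const hi]
      with y hy hyi using ⟨hy, hyi.le⟩
  · refine differentiableAt_of_differentiableWithinAt (hP ⟨hz, hi.ge⟩) (hM ⟨hz, hi.le⟩) ?_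
      ((frequently_im_lamOf_eq_zero hz hi).mono fun y hy => ⟨⟨hy.1, hy.2.ge⟩, hy.1, hy.2.le⟩)
    filter_upwards [h0] with y hy
    exact (le_total 0 (lamOf q₀ y).im).imp (fun h => ⟨hy, h⟩) fun h => ⟨hy, h⟩
  · refine (hP ⟨hz, hi.le⟩).differentiableAt ?_
    filter_upwards [h0, (Complex.continuous_im.continuousAt.comp hlc).eventually_const_lt hi]
      with y hy hyi using ⟨hy, hyi.le⟩

theorem tendsto_rhCol_branch (h : IsPotential q₀ qm qp q t)
    (hs : ∀ z ∈ Sigma₁ q₀, s12 ε q₀ qm qp q t z = 0) (x : ℝ) {c : ℂ} (hc : c ^ 2 = -(q₀ : ℂ) ^ 2) :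
    Tendsto (fun z => (z - c) • rhCol ε q₀ qm qp q t x z) (𝓝[≠] c) (𝓝 0) := by
  obtain ⟨w, G, N, hwd, hG, hN, hp, hm⟩ := h.exists_sides hs x
  have hc0 : c ≠ 0 := fun h0 => by
    rw [h0] at hc
    simp [h.ne_zero] at hc
  have hgc : gam q₀ c = 0 := by
    rw [gam, hc, div_neg, div_self (pow_ne_zero 2 h.ne_zero), add_neg_cancel]
  have hlc : lamOf q₀ c = 0 := by rw [lamOf_eq_mul_gam hc0, hgc, mul_zero]
  have hne : ∀ᶠ z in 𝓝[≠] c, z ≠ 0 ∧ lamOf q₀ z ≠ 0 := by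
    filter_upwards [self_mem_nhdsWithin, nhdsWithin_le_nhds (eventually_lamOf_ne q₀ c),
      nhdsWithin_le_nhds (isOpen_ne.mem_nhds hc0)] with z h1 h2 h3
    exact ⟨h3, (h2.resolve_left h1).resolve_left h3⟩
  have hcS : c ∈ Splus q₀ := ⟨hc0, by rw [hlc, Complex.zero_im]⟩
  have hcM : c ∈ Sminus q₀ := ⟨hc0, by rw [hlc, Complex.zero_im]⟩
  have hle : ∀ S : Set ℂ, 𝓝[≠] c ⊓ 𝓟 S ≤ 𝓝[S] c := fun S => inf_le_inf_right _ inf_le_left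
  have hzc : Tendsto (fun z => z - c) (𝓝 c) (𝓝 0) := by
    simpa using (by fun_prop : ContinuousAt (fun z => z - c) c).tendsto
  refine tendsto_of_sides (q₀ := q₀) (hne.mono fun z hz => hz.1) ?_ ?_
  · have hO := isBigO_of_branch (κ := conj qp * qm) h.pos hc (hwd c hcS) fun z hz => by
      have hl := lamOf_ne_zero_of_mem_Sigma hz
      have hi := im_lamOf_of_mem_Sigma hz
      rw [← (hp z (mem_Splus_of_mem_Sigma hz) hl).1,
        ← (hp _ (neg_div_mem_Splus h.ne_zero hz.2.1 hi.le)
          (by rwa [lamOf_neg_div h.ne_zero hz.2.1, neg_ne_zero])).1]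
      exact h.wrOf_mul_wrOf hz (hs z hz)
    have h1 : Tendsto (fun z => (z - c) / w z * gam q₀ z) (𝓝[≠] c ⊓ 𝓟 (Splus q₀)) (𝓝 0) := by
      have h2 : (fun z => (z - c) / w z) =O[𝓝[≠] c ⊓ 𝓟 (Splus q₀)] fun _ => (1 : ℂ) := by
        have := (hO.mono (hle _)).mul (Asymptotics.isBigO_refl (fun z => (w z)⁻¹) _)
        simp only [← div_eq_mul_inv] at this
        refine this.trans (Asymptotics.IsBigO.of_bound 1 (Eventually.of_forall fun z => ?_))
        rw [one_mul, norm_one, norm_div]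
        exact div_self_le_one _
      have h3 : Tendsto (gam q₀) (𝓝[≠] c ⊓ 𝓟 (Splus q₀)) (𝓝 0) := by
        rw [← hgc]
        exact (differentiableAt_gam hc0).continuousAt.tendsto.mono_left
          (inf_le_left.trans inf_le_left)
      have h4 := h2.mul_isLittleO ((Asymptotics.isLittleO_one_iff ℂ).2 h3)
      simp only [mul_one] at h4
      exact (Asymptotics.isLittleO_one_iff ℂ).1 h4
    have h2 := h1.smul ((hG c hcS).continuousWithinAt.tendsto.mono_left (hle _))
    rw [zero_smul] at h2
    refine h2.congr' ?_
    filter_upwards [hne.filter_mono inf_le_left, mem_inf_of_right (mem_principal_self _)]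
      with z hz hzS
    rw [(hp z hzS hz.2).2, smul_smul]
    congr 1
    ring
  · have h2 := (hzc.mono_left (inf_le_left.trans inf_le_left : 𝓝[≠] c ⊓ 𝓟 (Sminus q₀) ≤ _)).smul
      ((hN c hcM).continuousWithinAt.tendsto.mono_left (hle _))
    rw [zero_smul] at h2
    refine h2.congr' ?_
    filter_upwards [hne.filter_mono inf_le_left, mem_inf_of_right (mem_principal_self _)]
      with z hz hzS
    rw [hm z hzS hz.2]

theorem tendsto_gam_cocompact : Tendsto (gam q₀) (cocompact ℂ) (𝓝 1) := by
  have h1 : Tendsto (fun z : ℂ => z⁻¹) (cocompact ℂ) (𝓝 0) := by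
    rw [← Metric.cobounded_eq_cocompact]
    exact tendsto_inv₀_cobounded
  have h2 := ((h1.pow 2).const_mul ((q₀ : ℂ) ^ 2)).const_add 1
  refine (h2.congr fun z => ?_).trans_eq (by simp)
  rw [gam, inv_pow, div_eq_mul_inv]

theorem tendsto_rhCol_cocompact (h : IsPotential q₀ qm qp q t)
    (hs : ∀ z ∈ Sigma₁ q₀, s12 ε q₀ qm qp q t z = 0) (hu : ContDiff ℝ 1 fun x => q x t) (x : ℝ) :
    Tendsto (rhCol ε q₀ qm qp q t x) (cocompact ℂ) (𝓝 ![0, 1]) := by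
  have h0 : ∀ᶠ z : ℂ in cocompact ℂ, z ≠ 0 :=
    (isCompact_singleton (x := (0 : ℂ))).compl_mem_cocompact
  refine tendsto_of_sides (q₀ := q₀) h0 ?_ ?_
  · have h1 := ((tendsto_gam_cocompact (q₀ := q₀)).mono_left inf_le_left).div
      (h.tendsto_wrOf ε hu) one_ne_zero |>.smul (tendsto_jost_atTop h.right ε h.pos h.qp_mul hu x)
    refine (h1.congr' ?_).trans_eq (by simp)
    filter_upwards [eventually_largePlus h.pos 0] with z hz
    rw [h.rhCol_of_nonneg hs x hz.1 hz.2.1, smul_comm]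
    rfl
  · have hc : Tendsto conj (cocompact ℂ ⊓ 𝓟 (Sminus q₀)) (largePlus q₀) := by
      refine tendsto_inf.2 ⟨?_, ?_⟩
      · exact Complex.conjCLE.toHomeomorph.isClosedEmbedding.tendsto_cocompact.mono_left inf_le_left
      · refine (tendsto_principal_principal.2 fun z hz => ?_).mono_left inf_le_right
        exact ⟨(map_ne_zero _).2 hz.1, by rw [lamOf_conj]; simpa using hz.2⟩
    have h1 := (continuous_flipConj.tendsto _).comp
      ((tendsto_jost_atBot h.left ε h.pos h.qm_mul hu x).comp hc)
    refine (h1.congr' ?_).trans_eq (by simp [flipConj])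
    filter_upwards [hc.eventually (eventually_largePlus h.pos 0),
      mem_inf_of_right (mem_principal_self _)] with z hz hzM
    have hl : lamOf q₀ z ≠ 0 := by simpa [lamOf_conj] using hz.2.1
    rw [rhCol_of_nonpos x hzM.2, h.jostM_one_conj ε hzM.1 hzM.2 hl]
    simp only [Function.comp]
    rw [flipConj_smul, conj_normFactor, sub_zero, jostM]

theorem tendsto_rhCol_zero (h : IsPotential q₀ qm qp q t)
    (hs : ∀ z ∈ Sigma₁ q₀, s12 ε q₀ qm qp q t z = 0) (hu : ContDiff ℝ 1 fun x => q x t) (x : ℝ) :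
    Tendsto (fun z => z • rhCol ε q₀ qm qp q t x z) (𝓝[≠] 0) (𝓝 ![-(Complex.I * qm), 0]) := by
  have h0 : ∀ᶠ z : ℂ in 𝓝[≠] 0, z ≠ 0 := self_mem_nhdsWithin
  have hσ : Tendsto (fun z => -(q₀ : ℂ) ^ 2 / z) (𝓝[≠] 0) (cocompact ℂ) := by
    rw [← Metric.cobounded_eq_cocompact]
    simp only [div_eq_mul_inv]
    exact (tendsto_mul_left_cobounded (neg_ne_zero.2 (pow_ne_zero 2 h.ne_zero))).comp
      tendsto_inv₀_nhdsNE_zero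
  refine tendsto_of_sides (q₀ := q₀) h0 ?_ ?_
  · have hτ : Tendsto (fun z => -(q₀ : ℂ) ^ 2 / conj z) (𝓝[≠] 0 ⊓ 𝓟 (Splus q₀)) (largePlus q₀) := by
      refine tendsto_inf.2 ⟨?_, ?_⟩
      · have h2 := Complex.conjCLE.toHomeomorph.isClosedEmbedding.tendsto_cocompact.comp hσ
        exact (h2.congr fun z => conj_neg_div).mono_left inf_le_left
      · exact (tendsto_principal_principal.2 fun z hz =>
          flip_mem_Splus h.ne_zero hz).mono_left inf_le_right
    have h1 := (continuous_flipConj.tendsto _).comp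
      ((tendsto_jost_atTop h.right ε h.pos h.qp_mul hu x).comp hτ)
    have h2 := (Complex.continuous_conj.tendsto _).comp ((h.tendsto_wrOf ε hu).comp hτ)
    have h3 : Tendsto (fun z : ℂ => (z ^ 2 + (q₀ : ℂ) ^ 2) * Complex.I / conj qm)
        (𝓝[≠] 0 ⊓ 𝓟 (Splus q₀)) (𝓝 (((0 : ℂ) ^ 2 + (q₀ : ℂ) ^ 2) * Complex.I / conj qm)) :=
      (by fun_prop : ContinuousAt (fun z : ℂ => (z ^ 2 + (q₀ : ℂ) ^ 2) * Complex.I / conj qm)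
        0).tendsto.mono_left (inf_le_left.trans inf_le_left)
    have hqm : conj qm ≠ 0 := (map_ne_zero _).2 h.qm_ne
    refine (((h3.div h2 (by simp)).smul h1).congr' ?_).trans_eq ?_
    · filter_upwards [hτ.eventually (eventually_largePlus h.pos 0),
        mem_inf_of_right (mem_principal_self _)] with z hz hzS
      have hz0 := hzS.1
      have hl : lamOf q₀ z ≠ 0 := by simpa [lamOf_flip h.ne_zero hz0] using hz.2.1
      have e : normFactor ε q₀ 1 t z x = conj (normFactor ε q₀ 1 t (-(q₀ : ℂ) ^ 2 / conj z) x) := by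
        rw [normFactor_neg_div h.ne_zero ((map_ne_zero _).2 hz0), sub_self, conj_normFactor, sub_zero]
      rw [h.rhCol_of_nonneg hs x hzS hl, h.wrOf_flip ε hzS hl, h.jostP_one_flip ε hzS hl]
      simp only [Function.comp, flipConj_smul, smul_smul, jostP, Pi.div_apply]
      rw [e]
      congr 1
      have := h.qp_ne
      rw [gam]
      generalize conj (wrOf ε q₀ qm qp q t (-(q₀ : ℂ) ^ 2 / conj z)) = y
      generalize conj (normFactor ε q₀ 1 t (-(q₀ : ℂ) ^ 2 / conj z) x) = y'
      rcases eq_or_ne y 0 with rfl | hy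
      · simp
      · field_simp
    · have e : (q₀ : ℂ) ^ 2 * Complex.I / conj qm = Complex.I * qm := by
        rw [← h.qm_mul]
        field_simp
      rw [map_one, div_one, zero_pow two_ne_zero, zero_add, e]
      congr 1
      funext i
      fin_cases i <;> simp [flipConj]
  · have hσ' : Tendsto (fun z => -(q₀ : ℂ) ^ 2 / z) (𝓝[≠] 0 ⊓ 𝓟 (Sminus q₀)) (largePlus q₀) :=
      tendsto_inf.2 ⟨hσ.mono_left inf_le_left, (tendsto_principal_principal.2 fun z hz =>
        neg_div_mem_Splus h.ne_zero hz.1 hz.2).mono_left inf_le_right⟩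
    have h1 := ((tendsto_jost_atBot h.left ε h.pos h.qm_mul hu x).comp hσ').const_smul
      (-(Complex.I * qm))
    refine (h1.congr' ?_).trans_eq ?_
    · filter_upwards [hσ'.eventually (eventually_largePlus h.pos 0),
        mem_inf_of_right (mem_principal_self _)] with z hz hzM
      have hz0 := hzM.1
      have hl : lamOf q₀ z ≠ 0 := by simpa [lamOf_neg_div h.ne_zero hz0] using hz.2.1
      rw [rhCol_of_nonpos x hzM.2, (h.jostM_one_eq ε hz0 hzM.2 hl).2]
      simp only [Function.comp, smul_smul, jostM]
      rw [normFactor_neg_div h.ne_zero hz0, sub_zero]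
      congr 1
      field_simp
    · congr 1
      funext i
      fin_cases i <;> simp

end IsPotential

end RiemannHilbert

/-! ### Reconstruction of a reflectionless potential -/

section Reconstruction

variable {ε q₀ t : ℝ} {q : ℝ → ℝ → ℂ} {qm qp z : ℂ} {N : ℕ} {y : Fin N → ℂ}
  {C : Fin N ⊕ Fin N → ℂ}

/-- The value of `φ_{-,1} e^{iθ}` at `η̂_n`. -/
def boundVec (ε q₀ : ℝ) (qm : ℂ) (q : ℝ → ℝ → ℂ) (t : ℝ) (y : Fin N → ℂ) (n : Fin N ⊕ Fin N)
    (x : ℝ) : Fin 2 → ℂ :=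
  normFactor ε q₀ 0 t (etaHat q₀ y n) x • jostM ε q₀ qm q 0 t (etaHat q₀ y n) x

theorem s22_eq : s22 ε q₀ qm qp q t z = wrOf ε q₀ qm qp q t z / gam q₀ z := rfl

namespace IsPotential

theorem tendsto_rhCol_etaHat (h : IsPotential q₀ qm qp q t)
    (hsp : IsSpectrum q₀ qm (eta q₀ y) Sum.swap) (hr : ReflectionlessSimple ε q₀ qm qp y C q t)
    (n : Fin N ⊕ Fin N) (x : ℝ) :
    Tendsto (fun z => (z - etaHat q₀ y n) • rhCol ε q₀ qm qp q t x z) (𝓝[≠] etaHat q₀ y n)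
      (𝓝 (expVec ε q₀ (eta q₀ y) C x t n • boundVec ε q₀ qm q t y n x)) := by
  set a := etaHat q₀ y n with ha
  have haD : a ∈ Dplus q₀ := hsp.hat_mem n
  have ha0 := ne_zero_of_mem_Dplus haD
  obtain ⟨b, hb, hC⟩ := hr.norming n
  have hd := hr.s22_simple n
  rw [← ha] at hb hC hd
  have h0 : s22 ε q₀ qm qp q t a = 0 := (hr.s22_zeros a haD).2 ⟨n, rfl⟩
  have hslope := hasDerivAt_iff_tendsto_slope.1 (differentiableAt_of_deriv_ne_zero hd).hasDerivAt
  obtain ⟨G, hG, hG'⟩ := h.right.exists_differentiableOn ε h.pos.ne' h.qp_mul x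
  have hD : ∀ᶠ z in 𝓝 a, z ∈ Dplus q₀ := isOpen_Dplus.mem_nhds haD
  have hGa : Tendsto G (𝓝[≠] a) (𝓝 (b • jostM ε q₀ qm q 0 t a x)) := by
    rw [← hb, jostP, hG' a (mem_Splus_of_mem_Dplus haD) (lamOf_ne_zero_of_mem_Dplus haD)]
    refine ((hG a (mem_Splus_of_mem_Dplus haD)).differentiableAt
      ?_).continuousAt.tendsto.mono_left nhdsWithin_le_nhds
    filter_upwards [hD] with z hz using mem_Splus_of_mem_Dplus hz
  have hn := (differentiableAt_normFactor (ε := ε) (q₀ := q₀) (t := t) 1 x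
    ha0).continuousAt.tendsto.mono_left (nhdsWithin_le_nhds (s := {a}ᶜ))
  refine ((hn.smul ((hslope.inv₀ hd).smul hGa)).congr' ?_).trans_eq ?_
  · filter_upwards [self_mem_nhdsWithin, nhdsWithin_le_nhds hD] with z hza hz
    have hzS := mem_Splus_of_mem_Dplus hz
    have hl := lamOf_ne_zero_of_mem_Dplus hz
    have hsub : z - a ≠ 0 := sub_ne_zero.2 hza
    rw [h.rhCol_of_nonneg hr.s12_eq_zero x hzS hl, jostP, hG' z hzS hl, slope_def_module, h0,
      sub_zero, smul_eq_mul, mul_inv, inv_inv, s22_eq, inv_div, smul_comm (z - a), mul_smul]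
  · congr 1
    rw [boundVec, ← ha, expVec, hC]
    change _ = (_ * Complex.exp (-2 * Complex.I * theta ε q₀ x t a)) • _
    have e : -2 * Complex.I * theta ε q₀ x t a = -(Complex.I * theta ε q₀ x t a) +
      -(Complex.I * theta ε q₀ x t a) := by ring
    rw [e, Complex.exp_add]
    simp only [normFactor, smul_smul, Matrix.cons_val_zero, Matrix.cons_val_one, one_mul,
      neg_one_mul, Complex.exp_neg]
    congr 1
    field_simp

/-- The solution of the Riemann–Hilbert problem is a rational function. -/
theorem rhCol_eq (h : IsPotential q₀ qm qp q t) (hsp : IsSpectrum q₀ qm (eta q₀ y) Sum.swap)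
    (hu : ContDiff ℝ 1 fun x => q x t) (hr : ReflectionlessSimple ε q₀ qm qp y C q t) (x : ℝ)
    (hz : z ≠ 0) (hl : lamOf q₀ z ≠ 0) (hzn : ∀ n, z ≠ etaHat q₀ y n) :
    rhCol ε q₀ qm qp q t x z = ![0, 1] + z⁻¹ • ![-(Complex.I * qm), 0] +
      ∑ n, (z - etaHat q₀ y n)⁻¹ •
        expVec ε q₀ (eta q₀ y) C x t n • boundVec ε q₀ qm q t y n x := by
  classical
  set c := Complex.I * (q₀ : ℂ) with hc
  have hc2 : c ^ 2 = -(q₀ : ℂ) ^ 2 := by rw [hc, mul_pow, Complex.I_sq]; ring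
  have hc2' : (-c) ^ 2 = -(q₀ : ℂ) ^ 2 := by rw [neg_sq, hc2]
  have hc0 : c ≠ 0 := mul_ne_zero Complex.I_ne_zero h.ne_zero
  have hlc : ∀ d : ℂ, d ^ 2 = -(q₀ : ℂ) ^ 2 → lamOf q₀ d = 0 := fun d hd => by
    have e : (q₀ : ℂ) ^ 2 = -d ^ 2 := by rw [hd, neg_neg]
    rw [lamOf, e, neg_div, sq, mul_self_div_self, add_neg_cancel, zero_div]
  have hhat : ∀ n, lamOf q₀ (etaHat q₀ y n) ≠ 0 := fun n => lamOf_ne_zero_of_mem_Dplus (hsp.hat_mem n)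
  have hhat0 : ∀ n, etaHat q₀ y n ≠ 0 := hsp.hat_ne
  have hinj : Function.Injective (etaHat q₀ y) := hsp.hat_inj
  set r : ℂ → Fin 2 → ℂ := fun d => limUnder (𝓝[≠] d) fun z => (z - d) • rhCol ε q₀ qm qp q t x z
  have hr0 : Tendsto (fun z => (z - 0) • rhCol ε q₀ qm qp q t x z) (𝓝[≠] 0)
      (𝓝 ![-(Complex.I * qm), 0]) := by
    simpa only [sub_zero] using h.tendsto_rhCol_zero hr.s12_eq_zero hu x
  have hrc := h.tendsto_rhCol_branch hr.s12_eq_zero x hc2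
  have hrc' := h.tendsto_rhCol_branch hr.s12_eq_zero x hc2'
  have hrn := fun n => h.tendsto_rhCol_etaHat hsp hr n x
  have m1 : -c ∉ Finset.univ.image (etaHat q₀ y) := fun hm => by
    obtain ⟨n, -, hn⟩ := Finset.mem_image.1 hm
    exact hhat n (by rw [hn, hlc _ hc2'])
  have m2 : c ∉ insert (-c) (Finset.univ.image (etaHat q₀ y)) := fun hm => by
    rcases Finset.mem_insert.1 hm with h1 | h1
    · exact hc0 (by linear_combination h1 / 2)
    · obtain ⟨n, -, hn⟩ := Finset.mem_image.1 h1
      exact hhat n (by rw [hn, hlc _ hc2])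
  have m3 : (0 : ℂ) ∉ insert c (insert (-c) (Finset.univ.image (etaHat q₀ y))) := fun hm => by
    simp only [Finset.mem_insert, Finset.mem_image, Finset.mem_univ, true_and, zero_eq_neg] at hm
    rcases hm with h1 | h1 | ⟨n, h1⟩
    · exact hc0 h1.symm
    · exact hc0 h1
    · exact hhat0 n h1
  have key := eq_add_sum_of_tendsto (r := r) (z := z)
    (B := insert 0 (insert c (insert (-c) (Finset.univ.image (etaHat q₀ y)))))
    (f := rhCol ε q₀ qm qp q t x) (fun w hw => ?_) (fun d hd => ?_)
    (h.tendsto_rhCol_cocompact hr.s12_eq_zero hu x) ?_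
  · rw [Finset.sum_insert m3, Finset.sum_insert m2, Finset.sum_insert m1,
      Finset.sum_image fun i _ j _ hij => hinj hij] at key
    simp only [r, hr0.limUnder_eq, hrc.limUnder_eq, hrc'.limUnder_eq, (hrn _).limUnder_eq] at key
    rw [key]
    simp only [smul_zero, zero_add, sub_zero, add_assoc]
  · simp only [Finset.mem_insert, Finset.mem_image, Finset.mem_univ, true_and, not_or,
      not_exists] at hw
    obtain ⟨w0, w1, w2, w3⟩ := hw
    have hlw : lamOf q₀ w ≠ 0 := (gam_ne_zero_iff w0).2 (gam_ne_zero_of_ne w0 w1 w2)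
    refine h.differentiableAt_rhCol hr.s12_eq_zero x w0 hlw fun hi hw0 => ?_
    obtain ⟨n, hn⟩ := (hr.s22_zeros w ((mem_Dplus_iff w0).2 hi)).1 (by rw [s22_eq, hw0, zero_div])
    exact w3 n hn.symm
  · refine tendsto_nhds_limUnder ?_
    simp only [Finset.mem_insert, Finset.mem_image, Finset.mem_univ, true_and] at hd
    rcases hd with rfl | rfl | rfl | ⟨n, rfl⟩
    exacts [⟨_, hr0⟩, ⟨_, hrc⟩, ⟨_, hrc'⟩, ⟨_, hrn n⟩]
  · simp only [Finset.mem_insert, Finset.mem_image, Finset.mem_univ, true_and, not_or, not_exists]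
    exact ⟨hz, fun e => hl (by rw [e, hlc _ hc2]), fun e => hl (by rw [e, hlc _ hc2']),
      fun n e => hzn n e.symm⟩

/-- The values at the points `η_s` give the linear system with the matrix `G`. -/
theorem cmat_mulVec_boundVec (h : IsPotential q₀ qm qp q t)
    (hsp : IsSpectrum q₀ qm (eta q₀ y) Sum.swap) (hu : ContDiff ℝ 1 fun x => q x t)
    (hr : ReflectionlessSimple ε q₀ qm qp y C q t) (x : ℝ) :
    (cmat q₀ qm (eta q₀ y) (expVec ε q₀ (eta q₀ y) C x t)).mulVec
      (fun n => boundVec ε q₀ qm q t y n x 0) = fun s => Complex.I * qm / eta q₀ y s := by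
  funext s
  have hs0 := hsp.eta_ne s
  have hi := ((mem_Dminus_iff hs0).1 (hsp.mem s)).le
  have hl := lamOf_ne_zero_of_mem_Dminus (hsp.mem s)
  have h1 := congrFun (h.rhCol_eq hsp hu hr x hs0 hl (hsp.eta_ne_hat s)) 0
  rw [rhCol_of_nonpos x hi, (h.jostM_one_eq ε hs0 hi hl).2] at h1
  have h2 : boundVec ε q₀ qm q t y s x 0 = normFactor ε q₀ 1 t (eta q₀ y s) x *
      jostM ε q₀ qm q 0 t (-(q₀ : ℂ) ^ 2 / eta q₀ y s) x 0 := by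
    rw [boundVec, etaHat, normFactor_neg_div h.ne_zero hs0, sub_zero]
    rfl
  simp only [Pi.smul_apply, Pi.add_apply, Finset.sum_apply, smul_eq_mul, Matrix.cons_val_zero,
    zero_add] at h1
  rw [cmat_mulVec]
  have h3 : ∀ n, expVec ε q₀ (eta q₀ y) C x t n * boundVec ε q₀ qm q t y n x 0 /
      (eta q₀ y s - hat q₀ (eta q₀ y) n) = (eta q₀ y s - etaHat q₀ y n)⁻¹ *
      (expVec ε q₀ (eta q₀ y) C x t n * boundVec ε q₀ qm q t y n x 0) := fun n => by
    rw [div_eq_inv_mul]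
    rfl
  simp only [h3]
  rw [h2, div_eq_mul_inv]
  linear_combination -h1

/-- The potential is read off from the expansion of the equation at `z = ∞`. -/
theorem eq_add_sum_boundVec (h : IsPotential q₀ qm qp q t)
    (hsp : IsSpectrum q₀ qm (eta q₀ y) Sum.swap) (hu : ContDiff ℝ 1 fun x => q x t)
    (hr : ReflectionlessSimple ε q₀ qm qp y C q t) (x : ℝ) :
    q x t = qm + Complex.I * ∑ n, expVec ε q₀ (eta q₀ y) C x t n *
      boundVec ε q₀ qm q t y n x 0 := by
  have hhat : ∀ n, etaHat q₀ y n ∈ Splus q₀ ∧ lamOf q₀ (etaHat q₀ y n) ≠ 0 := fun n =>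
    ⟨mem_Splus_of_mem_Dplus (hsp.hat_mem n), lamOf_ne_zero_of_mem_Dplus (hsp.hat_mem n)⟩
  have hP : ∀ n, ∃ d, HasDerivAt (fun x => expVec ε q₀ (eta q₀ y) C x t n *
      boundVec ε q₀ qm q t y n x 0) d x := fun n =>
    ⟨_, (hsp.hasDerivAt_expVec_x x t n).mul
      (((h.isJost_left_zero ε (hhat n).1 (hhat n).2).isNormalized (hhat n).1.1).deriv_zero x)⟩
  choose d hd using hP
  set P := fun n => expVec ε q₀ (eta q₀ y) C x t n * boundVec ε q₀ qm q t y n x 0 with hPd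
  set Q := fun n => expVec ε q₀ (eta q₀ y) C x t n * boundVec ε q₀ qm q t y n x 1 with hQd
  have hinv : ∀ c : ℂ, Tendsto (fun R : ℝ => ((R : ℂ) - c)⁻¹) atTop (𝓝 0) := fun c => by
    refine tendsto_inv₀_cobounded.comp ?_
    have h1 : Tendsto (fun R : ℝ => (R : ℂ)) atTop (Bornology.cobounded ℂ) :=
      tendsto_norm_atTop_iff_cobounded.1 (by simpa using tendsto_abs_atTop_atTop)
    simpa [sub_eq_add_neg, Function.comp_def] using (tendsto_add_const_cobounded (-c)).comp h1
  have hone : ∀ c : ℂ, Tendsto (fun R : ℝ => (R : ℂ) * ((R : ℂ) - c)⁻¹) atTop (𝓝 1) := fun c => by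
    have h1 := ((hinv c).const_mul c).const_add 1
    rw [mul_zero, add_zero] at h1
    refine h1.congr' ?_
    filter_upwards [eventually_gt_atTop c.re] with R hR
    have : (R : ℂ) - c ≠ 0 := fun h0 => by
      have := congrArg Complex.re h0
      simp at this
      linarith
    field_simp
    ring
  have hev : ∀ᶠ R : ℝ in atTop, ∑ n, ((R : ℂ) - etaHat q₀ y n)⁻¹ * d n =
      -(Complex.I * ((R : ℂ) * ((R : ℂ) - 0)⁻¹ * -(Complex.I * qm) +
        ∑ n, (R : ℂ) * ((R : ℂ) - etaHat q₀ y n)⁻¹ * P n)) +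
        q x t * (1 + ∑ n, ((R : ℂ) - etaHat q₀ y n)⁻¹ * Q n) := by
    filter_upwards [eventually_gt_atTop 0] with R hR
    have hR0 : (R : ℂ) ≠ 0 := by exact_mod_cast hR.ne'
    have e : lamOf q₀ R = ((R + q₀ ^ 2 / R) / 2 : ℝ) := by rw [lamOf]; push_cast; ring
    have hi : (lamOf q₀ R).im = 0 := by rw [e, Complex.ofReal_im]
    have hl : lamOf q₀ R ≠ 0 := by
      rw [e]
      exact_mod_cast (by positivity : (R + q₀ ^ 2 / R) / 2 ≠ 0)
    have hne : ∀ n, (R : ℂ) ≠ etaHat q₀ y n := fun n hn => by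
      have := (mem_Dplus_iff (hsp.hat_ne n)).1 (hsp.hat_mem n)
      rw [hn] at hi
      exact this.ne' hi
    have hcol : ∀ x, normFactor ε q₀ 1 t R x • jostM ε q₀ qm q 1 t R x = _ := fun x =>
      (rhCol_of_nonpos x hi.le).symm.trans (h.rhCol_eq hsp hu hr x hR0 hl hne)
    have hL := isLax_iff.1 (h.jostM_one_eq ε hR0 hi.le hl).1.isLax x
    have hnf : HasDerivAt (normFactor ε q₀ 1 t R)
        (normFactor ε q₀ 1 t R x * -(Complex.I * lamOf q₀ R)) x := by
      have h1 := ((hasDerivAt_theta_x ε q₀ x t R).const_mul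
        Complex.I).fun_neg.cexp
      have e : normFactor ε q₀ 1 t R = fun x => Complex.exp (-(Complex.I * theta ε q₀ x t R)) :=
        funext fun x => by simp [normFactor]
      rw [e]
      exact h1
    have h1 := hnf.mul hL.1
    have h2 : HasDerivAt (fun x => (normFactor ε q₀ 1 t R x • jostM ε q₀ qm q 1 t R x) 0)
        (∑ n, ((R : ℂ) - etaHat q₀ y n)⁻¹ * d n) x := by
      have h3 := (HasDerivAt.fun_sum fun n (_ : n ∈ Finset.univ) =>
        (hd n).const_mul ((R : ℂ) - etaHat q₀ y n)⁻¹).const_add ((R : ℂ)⁻¹ * -(Complex.I * qm))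
      refine h3.congr_of_eventuallyEq (Eventually.of_forall fun x => ?_)
      refine (congrFun (hcol x) 0).trans ?_
      simp only [Pi.smul_apply, Pi.add_apply, Finset.sum_apply, smul_eq_mul, Matrix.cons_val_zero,
        zero_add]
    have c0 := congrFun (hcol x) 0
    have c1 := congrFun (hcol x) 1
    simp only [Pi.smul_apply, Pi.add_apply, Finset.sum_apply, smul_eq_mul, Matrix.cons_val_zero,
      Matrix.cons_val_one, zero_add, mul_zero, add_zero] at c0 c1
    rw [h2.unique h1]
    simp only [hPd, hQd, sub_zero, mul_assoc, ← Finset.mul_sum]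
    rw [← mul_add (R : ℂ), ← c0, ← c1]
    simp only [lamOf, kOf]
    field_simp
    ring
  have hl1 : Tendsto (fun R : ℝ => ∑ n, ((R : ℂ) - etaHat q₀ y n)⁻¹ * d n) atTop
      (𝓝 (∑ n, 0 * d n)) := tendsto_finsetSum _ fun n _ => (hinv _).mul_const _
  have hl2 := ((((hone 0).mul_const (-(Complex.I * qm))).add (tendsto_finsetSum Finset.univ fun n _ =>
    (hone (etaHat q₀ y n)).mul_const (P n))).const_mul Complex.I).neg.add
    (((tendsto_finsetSum Finset.univ fun n _ =>
      (hinv (etaHat q₀ y n)).mul_const (Q n)).const_add 1).const_mul (q x t))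
  have h3 := tendsto_nhds_unique (hl1.congr' hev) hl2
  simp only [zero_mul, Finset.sum_const_zero, one_mul, add_zero, mul_one] at h3
  linear_combination -h3 - qm * Complex.I_sq

end IsPotential

end Reconstruction

/-! ### The symmetry of the norming constants, and uniqueness -/

section Uniqueness

variable {ε q₀ t : ℝ} {q : ℝ → ℝ → ℂ} {qm qp z : ℂ} {N : ℕ} {y : Fin N → ℂ}
  {C : Fin N ⊕ Fin N → ℂ}

theorem flipConj_ne_zero {v : Fin 2 → ℂ} (hv : v ≠ 0) : flipConj v ≠ 0 := fun h0 => hv (by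
  have h1 := congrFun h0 0
  have h2 := congrFun h0 1
  simp only [flipConj, Matrix.cons_val_zero, Matrix.cons_val_one, Pi.zero_apply, neg_eq_zero,
    map_eq_zero] at h1 h2
  funext i
  fin_cases i
  exacts [h2, h1])

theorem IsJost.ne_zero {a : ℂ} {l : Filter ℝ} [l.NeBot] {j : Fin 2} {φ : ℝ → Fin 2 → ℂ}
    (h : IsJost ε q₀ q a l j t z φ) (hq : Continuous fun x => q x t) (x : ℝ) : φ x ≠ 0 := fun h0 => by
  have h1 := h.tendsto
  simp only [h.isLax.eq_zero hq h0, smul_zero] at h1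
  exact E_col_ne_zero a z j (tendsto_nhds_unique h1 tendsto_const_nhds)

namespace IsPotential

/-- The symmetry `z ↦ -q₀² / z*` of `s₂₂`. -/
theorem s22_flip (h : IsPotential q₀ qm qp q t) (ε : ℝ) (hz : z ∈ Dplus q₀) :
    s22 ε q₀ qm qp q t z =
      conj qm * qp / (q₀ : ℂ) ^ 2 * conj (s22 ε q₀ qm qp q t (-(q₀ : ℂ) ^ 2 / conj z)) := by
  have hz0 := ne_zero_of_mem_Dplus hz
  have hl := lamOf_ne_zero_of_mem_Dplus hz
  have hg := (gam_ne_zero_iff hz0).1 hl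
  have hc : conj (gam q₀ (conj z)) = gam q₀ z := by simp [gam]
  rw [s22_eq, s22_eq, h.wrOf_flip ε (mem_Splus_of_mem_Dplus hz) hl,
    gam_neg_div h.ne_zero ((map_ne_zero _).2 hz0), map_div₀, map_mul, hc]
  have := h.ne_zero
  simp only [map_div₀, map_pow, Complex.conj_conj, Complex.conj_ofReal]
  field_simp

theorem flip_etaHat (hsp : IsSpectrum q₀ qm (eta q₀ y) Sum.swap) (n : Fin N ⊕ Fin N) :
    -(q₀ : ℂ) ^ 2 / conj (etaHat q₀ y n) = etaHat q₀ y n.swap := by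
  have h1 : conj (etaHat q₀ y n) = eta q₀ y n.swap := hsp.conj_hat n
  rw [h1, etaHat]

theorem deriv_s22_flip (h : IsPotential q₀ qm qp q t)
    (hsp : IsSpectrum q₀ qm (eta q₀ y) Sum.swap) (hr : ReflectionlessSimple ε q₀ qm qp y C q t)
    (n : Fin N ⊕ Fin N) : deriv (s22 ε q₀ qm qp q t) (etaHat q₀ y n) =
      conj qm * qp / etaHat q₀ y n ^ 2 * conj (deriv (s22 ε q₀ qm qp q t) (etaHat q₀ y n.swap)) := by
  set a := etaHat q₀ y n with ha
  have haD : a ∈ Dplus q₀ := hsp.hat_mem n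
  have ha0 : conj a ≠ 0 := (map_ne_zero _).2 (ne_zero_of_mem_Dplus haD)
  have h1 := (differentiableAt_of_deriv_ne_zero (hr.s22_simple n.swap)).hasDerivAt
  rw [← flip_etaHat hsp n, ← ha] at h1
  have h2 : HasDerivAt (fun w => -(q₀ : ℂ) ^ 2 / w) ((q₀ : ℂ) ^ 2 / conj a ^ 2) (conj a) := by
    refine (((hasDerivAt_inv ha0).const_mul (-(q₀ : ℂ) ^ 2)).congr_deriv ?_).congr_of_eventuallyEq
      (Eventually.of_forall fun w => div_eq_mul_inv _ _)
    field_simp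
  have h3 := ((h1.comp (conj a) h2).conj_conj).const_mul (conj qm * qp / (q₀ : ℂ) ^ 2)
  rw [Complex.conj_conj] at h3
  have h4 : s22 ε q₀ qm qp q t =ᶠ[𝓝 a] fun z => conj qm * qp / (q₀ : ℂ) ^ 2 *
      (conj ∘ (s22 ε q₀ qm qp q t ∘ fun w => -(q₀ : ℂ) ^ 2 / w) ∘ conj) z := by
    filter_upwards [isOpen_Dplus.mem_nhds haD] with z hz using h.s22_flip ε hz
  rw [(h3.congr_of_eventuallyEq h4).deriv, ← flip_etaHat hsp n, ← ha]
  have := h.ne_zero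
  simp only [map_mul, map_div₀, map_pow, Complex.conj_conj, Complex.conj_ofReal]
  field_simp

theorem norming_eq (h : IsPotential q₀ qm qp q t)
    (hsp : IsSpectrum q₀ qm (eta q₀ y) Sum.swap) (hr : ReflectionlessSimple ε q₀ qm qp y C q t)
    (n : Fin N ⊕ Fin N) :
    C n ≠ 0 ∧ C n = -(qm ^ 2 / eta q₀ y n ^ 2) * conj (C n.swap) := by
  obtain ⟨b, hb, hC⟩ := hr.norming n
  obtain ⟨b', hb', hC'⟩ := hr.norming n.swap
  set a := etaHat q₀ y n with ha
  have haD : a ∈ Dplus q₀ := hsp.hat_mem n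
  have haD' : etaHat q₀ y n.swap ∈ Dplus q₀ := hsp.hat_mem n.swap
  have ha0 := ne_zero_of_mem_Dplus haD
  have haS := mem_Splus_of_mem_Dplus haD
  have hal := lamOf_ne_zero_of_mem_Dplus haD
  have hd := hr.s22_simple n
  have hb0 : b ≠ 0 := fun h0 => by
    have h1 := hb 0
    rw [h0, zero_smul] at h1
    exact (h.isJost_right_one ε haS hal).ne_zero h.right.cont 0 h1
  refine ⟨by rw [hC]; exact div_ne_zero hb0 hd, ?_⟩
  set v := flipConj (jostM ε q₀ qm q 0 t (etaHat q₀ y n.swap) 0) with hv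
  have hv0 : v ≠ 0 := flipConj_ne_zero
    ((h.isJost_left_zero ε (mem_Splus_of_mem_Dplus haD')
      (lamOf_ne_zero_of_mem_Dplus haD')).ne_zero h.left.cont 0)
  have h1 := hb 0
  rw [h.jostP_one_flip ε haS hal, h.jostM_zero_flip ε haS hal] at h1
  simp only [ha, flip_etaHat hsp n, hb' 0, flipConj_smul, smul_smul] at h1
  rw [← ha, ← hv] at h1
  have h2 := smul_left_injective ℂ hv0 h1
  have hqm := (map_ne_zero (starRingEnd ℂ)).2 h.qm_ne
  have h3 : b = -(qp * conj b' / conj qm) := by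
    have hI := Complex.I_ne_zero
    field_simp at h2 ⊢
    linear_combination h2
  have hda := h.deriv_s22_flip hsp hr n
  rw [← ha] at hda
  have hd' : conj (deriv (s22 ε q₀ qm qp q t) (etaHat q₀ y n.swap)) ≠ 0 :=
    (map_ne_zero _).2 (hr.s22_simple n.swap)
  have hqp := h.qp_ne
  have hη : eta q₀ y n = -(qm * conj qm) / a := by
    rw [eq_div_iff ha0, h.qm_mul, mul_comm]
    exact hsp.hat_mul_eta n
  rw [hC, hda, hC', h3, hη, map_div₀]
  have hqm' := h.qm_ne
  field_simp

/-- A reflectionless potential is determined by its data. -/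
theorem eq_soliton (h : IsPotential q₀ qm qp q t)
    (hsp : IsSpectrum q₀ qm (eta q₀ y) Sum.swap) (hu : ContDiff ℝ 1 fun x => q x t)
    (hr : ReflectionlessSimple ε q₀ qm qp y C q t) (x : ℝ) :
    (gMat ε q₀ qm y C x t).det ≠ 0 ∧ q x t = soliton ε q₀ qm y C x t := by
  have hA : Admissible qm (eta q₀ y) Sum.swap C :=
    admissible_of_symmetry (fun n => hsp.eta_ne (Sum.inl n)) h.qm_ne h.qm_mul
      (fun n => (h.norming_eq hsp hr (Sum.inl n)).2) fun n => (h.norming_eq hsp hr n).1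
  have hdet := hsp.det_cmat_ne_zero (hsp.admissible_expVec (ε := ε) hA x t)
  refine ⟨hdet, ?_⟩
  rw [soliton_eq_sol hsp hA, sol, potential, h.eq_add_sum_boundVec hsp hu hr x]
  have h1 := h.cmat_mulVec_boundVec hsp hu hr x
  have h2 : sol₁ q₀ qm (eta q₀ y) (expVec ε q₀ (eta q₀ y) C x t) =
      fun n => boundVec ε q₀ qm q t y n x 0 := by
    rw [sol₁, ← h1, Matrix.mulVec_mulVec, Matrix.nonsing_inv_mul _ (isUnit_iff_ne_zero.2 hdet),
      Matrix.one_mulVec]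
  rw [h2]

end IsPotential

end Uniqueness

end IfoNLS

end

theorem theorem1p1 (ε q₀ : ℝ) (hq₀ : 0 < q₀) (qm : ℂ) (hqm : ‖qm‖ = q₀)
    (N : ℕ) (z : Fin N → ℂ) (hz : Function.Injective z)
    (hz_out : ∀ n, q₀ < ‖z n‖) (hz_im : ∀ n, (z n).im < 0)
    (C : Fin N ⊕ Fin N → ℂ) :
    -- every solution with these scattering data at time `0` is given by the formula
    (∀ (qp : ℂ) (q : ℝ → ℝ → ℂ), ‖qp‖ = q₀ →
      IfoNLS.IsSolution ε (q₀ ^ 2) q → IfoNLS.BoundaryConditions qm qp q →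
      IfoNLS.ReflectionlessSimple ε q₀ qm qp z C q 0 →
      ∀ x t : ℝ, (IfoNLS.gMat ε q₀ qm z C x t).det ≠ 0 ∧
        q x t = IfoNLS.soliton ε q₀ qm z C x t) ∧
    -- for all admissible data the formula defines such a solution
    (IfoNLS.NormingSymmetry qm z C → (∀ n, C n ≠ 0) →
      (∀ x t : ℝ, (IfoNLS.gMat ε q₀ qm z C x t).det ≠ 0) ∧
      IfoNLS.IsSolution ε (q₀ ^ 2) (IfoNLS.soliton ε q₀ qm z C) ∧
      IfoNLS.IsSolution ε 0 (fun x t =>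
        IfoNLS.soliton ε q₀ qm z C x t * Complex.exp (2 * Complex.I * (q₀ : ℂ) ^ 2 * t)) ∧
      ∃ qp : ℂ, ‖qp‖ = q₀ ∧
        IfoNLS.BoundaryConditions qm qp (IfoNLS.soliton ε q₀ qm z C) ∧
        ∀ t : ℝ, IfoNLS.ReflectionlessSimple ε q₀ qm qp z C (IfoNLS.soliton ε q₀ qm z C) t) := by
  have h := IfoNLS.isSpectrum_eta (qm := qm) hq₀ hqm hz hz_out hz_im
  have h0 : ∀ n, z n ≠ 0 := fun n => norm_pos_iff.1 (hq₀.trans (hz_out n))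
  refine ⟨fun qp q hqp hq hb hr x t => ?_, fun hC hC0 => ?_⟩
  · have hc := hq.1.continuous
    have hp : ∀ t, IfoNLS.IsPotential q₀ qm qp q t := fun t =>
      ⟨hq₀, h.qm_mul_conj, by rw [Complex.mul_conj', hqp], hb.decaysLeft hc t, hb.decaysRight hc t⟩
    refine (hp t).eq_soliton h ?_ (hr.at_time hq hb hp h.mem h.hat_mem t) x
    exact (hq.1.comp (contDiff_id.prodMk contDiff_const)).of_le (by norm_num)
  · have hA := IfoNLS.admissible_of_symmetry h0 h.qm_ne h.qm_mul_conj hC hC0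
    have hu := IfoNLS.soliton_eq_sol (ε := ε) h hA
    have hs := h.isSolution_sol (ε := ε) hA
    rw [hu]
    refine ⟨fun x t => h.det_cmat_ne_zero (h.admissible_expVec (ε := ε) hA x t), hs, ?_,
      IfoNLS.qPlus q₀ qm (IfoNLS.eta q₀ z), h.norm_qPlus hA, h.boundaryConditions_sol hA,
      fun t => IfoNLS.reflectionlessSimple_sol h hA t⟩
    have := hs.mul_exp
    push_cast at this
    exact this
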